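/- **Setting.** Let $\tau>0$. Let $V:[0,\infty)\to\mathbb R$ be $C^1$ on $[0,\infty)$ and $C^2$ on $(0,\infty)$, with $V'$ positive and bounded on $(0,\infty)$, $V'(u)\to0$ as $u\to\infty$, and such that $V'$ has a global maximum point $U_M\in(0,\infty)$ which is the unique zero of $V''$ in $(0,\infty)$. Let $\kappa\in C^1((0,\infty))$ be positive. For $K>0$, $c,\mu\in\mathbb R$ put $$f(u)=\frac{Ku-V(u)-c}{K},\quad h(u,\mu)=f'(u)+\mu,\quad g_1(u)=\frac1{\tau\kappa(u^{-1})},\quad g_2(u)=\frac{u}{2\tau\kappa(u^{-1})},$$ and consider solutions on $\mathbb R$ with $u>0$ of $$u_z=w,\qquad w_z=g_1(u)f(u)+g_2(u)h(u,\mu)w.\tag{1}$$ Let $K_0=V'(0)$, $K_M=V'(U_M)$. Let $u_M(K)\in(0,U_M)$ be the local maximum point (for $K_0<K<K_M$) and $u_m(K)\in(U_M,\infty)$ the local minimum point (for $0<K<K_M$) of $u\mapsto Ku-V(u)$. Put $c_M=Ku_M-V(u_M)$, $c_m=Ku_m-V(u_m)$, $c_0=-V(0)$, $c_1=\max\{c_0,c_m\}$.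 Let $K_1\in(K_0,K_M)$ be the number such that $c_m(K)$ is less than, equal to, or greater than $c_0$ according as $0<K<K_1$, $K=K_1$, or $K_1<K<K_M$. Let $$\mathcal D_1=\{K_0<K<K_M,\ c_1<c<c_M\},\qquad \mathcal D_2=\{K_0<K<K_1,\ c=c_0\}\cup\{0<K<K_1,\ c_m<c<c_0\}.$$ On $\mathcal D_1$ the function $f$ has three positive zeros $u_1<u_0<u_2$, and on $\mathcal D_2$ it has two, $u_0<u_2$. Assume $$\text{(C)}\qquad K\in(K_1,K_M),\quad\text{or}\quad \int_1^\infty\frac{d\rho}{\rho^3\kappa(\rho)}=\infty\ \text{ and }\ K\in(K_0,K_1].$$ **Statement.** The following objects are well defined (the parameter values exist and are unique, and the solutions exist and have a unique orbit). * For $(K,c)\in\mathcal D_1$: the value $\mu_b(K,c)$ (resp. $\mu_f(K,c)$) of $\mu$ for which (1) has a heteroclinic solution from $(u_1,0)$ to $(u_2,0)$ with $w>0$ (resp. from $(u_2,0)$ to $(u_1,0)$ with $w<0$), and the orbit of that solution. * The number $c_*=c_*(K)\in(c_1,c_M)$ with $\mu_b(K,c_*)=\mu_f(K,c_*)=:\mu_*$.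 Let $\mathcal O_*$ be the heteroclinic cycle, the union of the two heteroclinic orbits at $(c,\mu)=(c_*,\mu_*)$. * For $(K,c)\in\mathcal D_1$ with $c_*<c<c_M$: the value $\mu^1_{pul}(K,c)$ of $\mu$ for which (1) has a nonconstant solution tending to $(u_1,0)$ as $z\to\pm\infty$, and the orbit $\mathcal O^1_{pul}(K,c)\subset\mathbb R^2$ of that solution. * For $(K,c)\in\mathcal D_2$, or $(K,c)\in\mathcal D_1$ with $c_1<c<c_*$: likewise $\mu^2_{pul}(K,c)$ and $\mathcal O^2_{pul}(K,c)$, with $u_2$ in place of $u_1$. Moreover, with convergence of sets in the sense of the Hausdorff distance in $\mathbb R^2$ and $K$ fixed: $$\mu^j_{pul}(K,c)\to\mu_*,\quad \mathcal O^j_{pul}(K,c)\to\mathcal O_*\quad\text{as } c\to c_*\qquad(j=1,2),$$ $$\mu^1_{pul}(K,c)\to0,\quad \mathcal O^1_{pul}(K,c)\to\{(u_M,0)\}\quad\text{as } c\to c_M,$$ $$\mu^2_{pul}(K,c)\to0,\quad \mathcal O^2_{pul}(K,c)\to\{(u_m,0)\}\quad\text{as } c\to c_m.$$ Here $c$ ranges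 over $(c_*,c_M)$ for $j=1$ and over $(c_m,c_*)$ for $j=2$, the sets on which these quantities are defined. -/

import Mathlib

open Set Filter Topology MeasureTheory

/-- The data of the traffic flow model (optimal velocity function `V`, viscosity coefficient `κ`,
relaxation time `τ`) together with its standing assumptions: `V` is `C¹` on `[0,∞)` and `C²` on
`(0,∞)`; `V'` is positive and bounded on `(0,∞)`, tends to `0` at infinity, attains its global
maximum at `UM > 0`, and `UM` is the unique zero of `V''` in `(0,∞)`; `κ` is `C¹` and positive on
`(0,∞)`. The values of `V` on `(-∞,0)` and of `κ` on `(-∞,0]` are irrelevant. -/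
structure TrafficModel where
  V : ℝ → ℝ
  κ : ℝ → ℝ
  τ : ℝ
  UM : ℝ
  τ_pos : 0 < τ
  V_contDiffOn_one : ContDiffOn ℝ 1 V (Ici 0)
  V_contDiffOn_two : ContDiffOn ℝ 2 V (Ioi 0)
  deriv_V_pos : ∀ u : ℝ, 0 < u → 0 < deriv V u
  deriv_V_bounded : ∃ B : ℝ, ∀ u : ℝ, 0 < u → deriv V u ≤ B
  deriv_V_tendsto : Tendsto (deriv V) atTop (𝓝 0)
  UM_pos : 0 < UM
  deriv_V_le : ∀ u : ℝ, 0 < u → deriv V u ≤ deriv V UM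
  deriv2_V_eq_zero_iff : ∀ u : ℝ, 0 < u → (deriv (deriv V) u = 0 ↔ u = UM)
  κ_contDiffOn : ContDiffOn ℝ 1 κ (Ioi 0)
  κ_pos : ∀ ρ : ℝ, 0 < ρ → 0 < κ ρ

namespace TrafficModel

noncomputable section

variable (m : TrafficModel)

/-- The condition `∫₁^∞ dρ / (ρ³ κ(ρ)) = ∞`. -/
def ConditionH : Prop :=
  ∫⁻ ρ in Ioi (1 : ℝ), ENNReal.ofReal (1 / (ρ ^ 3 * m.κ ρ)) = ⊤

/-! ### The dynamical system -/

def f (K c u : ℝ) : ℝ := (K * u - m.V u - c) / K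

def h (K c u μ : ℝ) : ℝ := deriv (m.f K c) u + μ

def g₁ (u : ℝ) : ℝ := 1 / (m.τ * m.κ u⁻¹)

def g₂ (u : ℝ) : ℝ := u / (2 * m.τ * m.κ u⁻¹)

/-- `(u, w)` is a positive (`u > 0`) entire solution of
`u_z = w`, `w_z = g₁(u) f(u) + g₂(u) h(u, μ) w`. -/
def IsSolution (K c μ : ℝ) (u w : ℝ → ℝ) : Prop :=
  ∀ z : ℝ, 0 < u z ∧ HasDerivAt u (w z) z ∧
    HasDerivAt w (m.g₁ (u z) * m.f K c (u z) + m.g₂ (u z) * m.h K c (u z) μ * w z) z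

/-! ### Parameter regions -/

/-- `K₀ = V'(0)` (one-sided derivative). -/
def K₀ : ℝ := derivWithin m.V (Ici 0) 0

/-- `K_M = V'(U_M)`. -/
def KM : ℝ := deriv m.V m.UM

/-- `u` is a local maximum point of `K u - V(u)` in `(0, U_M)`. -/
def IsMaxPoint (K u : ℝ) : Prop :=
  u ∈ Ioo 0 m.UM ∧ IsLocalMax (fun s => K * s - m.V s) u

/-- `u` is a local minimum point of `K u - V(u)` in `(U_M, ∞)`. -/
def IsMinPoint (K u : ℝ) : Prop :=
  u ∈ Ioi m.UM ∧ IsLocalMin (fun s => K * s - m.V s) u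

/-- `u_M(K)`, for `K₀ < K < K_M`; see `existsUnique_isMaxPoint`. -/
def uM (K : ℝ) : ℝ := Classical.epsilon (m.IsMaxPoint K)

/-- `u_m(K)`, for `0 < K < K_M`; see `existsUnique_isMinPoint`. -/
def um (K : ℝ) : ℝ := Classical.epsilon (m.IsMinPoint K)

def c₀ : ℝ := -m.V 0

def cM (K : ℝ) : ℝ := K * m.uM K - m.V (m.uM K)

def cm (K : ℝ) : ℝ := K * m.um K - m.V (m.um K)

def c₁ (K : ℝ) : ℝ := max m.c₀ (m.cm K)

/-- The defining property of `K₁ ∈ (K₀, K_M)`: `c_m(K)` is less than, equal to, greater than `c₀`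
according as `K < K₁`, `K = K₁`, `K > K₁`. -/
def IsK₁ (k : ℝ) : Prop :=
  k ∈ Ioo m.K₀ m.KM ∧ (∀ K ∈ Ioo 0 k, m.cm K < m.c₀) ∧ m.cm k = m.c₀ ∧
    ∀ K ∈ Ioo k m.KM, m.c₀ < m.cm K

/-- `K₁`; see `existsUnique_isK₁`. -/
def K₁ : ℝ := Classical.epsilon m.IsK₁

/-- Condition (C): `K ∈ (K₁, K_M)`, or (H) holds and `K ∈ (K₀, K₁]`. -/
def ConditionC (K : ℝ) : Prop :=
  K ∈ Ioo m.K₁ m.KM ∨ (m.ConditionH ∧ K ∈ Ioc m.K₀ m.K₁)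

/-- The region `𝒟₁` of pairs `(K, c)`. -/
def D₁ : Set (ℝ × ℝ) :=
  {p | m.K₀ < p.1 ∧ p.1 < m.KM ∧ m.c₁ p.1 < p.2 ∧ p.2 < m.cM p.1}

/-- The region `𝒟₂` of pairs `(K, c)`. -/
def D₂ : Set (ℝ × ℝ) :=
  {p | m.K₀ < p.1 ∧ p.1 < m.K₁ ∧ p.2 = m.c₀} ∪
    {p | 0 < p.1 ∧ p.1 < m.K₁ ∧ m.cm p.1 < p.2 ∧ p.2 < m.c₀}

/-- The positive zeros of `f`: three of them, `u₁ < u₀ < u₂`, if `(K, c) ∈ 𝒟₁`, and two,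
`u₀ < u₂`, if `(K, c) ∈ 𝒟₂`. -/
def zeros (K c : ℝ) : Set ℝ := {u | 0 < u ∧ m.f K c u = 0}

/-- `u₁(K, c)`, for `(K, c) ∈ 𝒟₁`: the smallest positive zero of `f`. -/
def u₁ (K c : ℝ) : ℝ := sInf (m.zeros K c)

/-- `u₂(K, c)`, for `(K, c) ∈ 𝒟₁ ∪ 𝒟₂`: the largest positive zero of `f`. -/
def u₂ (K c : ℝ) : ℝ := sSup (m.zeros K c)

/-! ### Heteroclinic orbits -/

/-- `(u, w)` is a traveling back solution: a heteroclinic orbit from `(u₁, 0)` to `(u₂, 0)`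
with `w > 0`. -/
def IsBack (K c μ : ℝ) (u w : ℝ → ℝ) : Prop :=
  m.IsSolution K c μ u w ∧
    Tendsto u atBot (𝓝 (m.u₁ K c)) ∧ Tendsto u atTop (𝓝 (m.u₂ K c)) ∧
    Tendsto w atBot (𝓝 0) ∧ Tendsto w atTop (𝓝 0) ∧ ∀ z, 0 < w z

/-- `(u, w)` is a traveling front solution: a heteroclinic orbit from `(u₂, 0)` to `(u₁, 0)`
with `w < 0`. -/
def IsFront (K c μ : ℝ) (u w : ℝ → ℝ) : Prop :=
  m.IsSolution K c μ u w ∧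
    Tendsto u atBot (𝓝 (m.u₂ K c)) ∧ Tendsto u atTop (𝓝 (m.u₁ K c)) ∧
    Tendsto w atBot (𝓝 0) ∧ Tendsto w atTop (𝓝 0) ∧ ∀ z, w z < 0

def HasBack (K c μ : ℝ) : Prop := ∃ u w : ℝ → ℝ, m.IsBack K c μ u w

def HasFront (K c μ : ℝ) : Prop := ∃ u w : ℝ → ℝ, m.IsFront K c μ u w

/-- `μ_b(K, c)`: the value of `μ` for which there is a traveling back solution. -/
def μb (K c : ℝ) : ℝ := Classical.epsilon (m.HasBack K c)

/-- `μ_f(K, c)`: the value of `μ` for which there is a traveling front solution. -/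
def μf (K c : ℝ) : ℝ := Classical.epsilon (m.HasFront K c)

/-- The defining property of `c_*(K)`. -/
def IsCStar (K c : ℝ) : Prop := c ∈ Ioo (m.c₁ K) (m.cM K) ∧ m.μb K c = m.μf K c

def cStar (K : ℝ) : ℝ := Classical.epsilon (m.IsCStar K)

def μStar (K : ℝ) : ℝ := m.μb K (m.cStar K)

/-- The part `c_* < c < c_M` of `𝒟₁`. -/
def D₁₁ : Set (ℝ × ℝ) := {p ∈ m.D₁ | m.cStar p.1 < p.2 ∧ p.2 < m.cM p.1}

/-- The part `c₁ < c < c_*` of `𝒟₁`. -/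
def D₁₂ : Set (ℝ × ℝ) := {p ∈ m.D₁ | m.c₁ p.1 < p.2 ∧ p.2 < m.cStar p.1}

/-! ### Homoclinic orbits -/

/-- `(u, w)` is a traveling pulse solution: a nonconstant solution homoclinic to `(a, 0)`. -/
def IsPulse (K c μ a : ℝ) (u w : ℝ → ℝ) : Prop :=
  m.IsSolution K c μ u w ∧
    Tendsto u atBot (𝓝 a) ∧ Tendsto u atTop (𝓝 a) ∧
    Tendsto w atBot (𝓝 0) ∧ Tendsto w atTop (𝓝 0) ∧ ¬ ∀ z, u z = a ∧ w z = 0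

def HasPulse (K c μ a : ℝ) : Prop := ∃ u w : ℝ → ℝ, m.IsPulse K c μ a u w

/-- `μ¹_pul(K, c)`: the value of `μ` for which there is a pulse homoclinic to `(u₁, 0)`. -/
def μPul₁ (K c : ℝ) : ℝ := Classical.epsilon fun μ => m.HasPulse K c μ (m.u₁ K c)

/-- `μ²_pul(K, c)`: the value of `μ` for which there is a pulse homoclinic to `(u₂, 0)`. -/
def μPul₂ (K c : ℝ) : ℝ := Classical.epsilon fun μ => m.HasPulse K c μ (m.u₂ K c)

/-! ### Orbits in the phase plane -/

/-- The orbit `{(u(z), w(z)) | z ∈ ℝ}` in the Euclidean plane. -/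
def orbit (s : (ℝ → ℝ) × (ℝ → ℝ)) : Set (EuclideanSpace ℝ (Fin 2)) :=
  range fun z : ℝ => !₂[s.1 z, s.2 z]

/-- All solutions in the class `P` have one and the same orbit. -/
def OrbitUnique (P : (ℝ → ℝ) → (ℝ → ℝ) → Prop) : Prop :=
  ∀ u w u' w' : ℝ → ℝ, P u w → P u' w' → orbit (u, w) = orbit (u', w')

/-- `𝒪¹_pul(K, c)`: the orbit of a pulse homoclinic to `(u₁, 0)` for `μ = μ¹_pul`. -/
def orbitPul₁ (K c : ℝ) : Set (EuclideanSpace ℝ (Fin 2)) :=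
  orbit (Classical.epsilon fun s => m.IsPulse K c (m.μPul₁ K c) (m.u₁ K c) s.1 s.2)

/-- `𝒪²_pul(K, c)`: the orbit of a pulse homoclinic to `(u₂, 0)` for `μ = μ²_pul`. -/
def orbitPul₂ (K c : ℝ) : Set (EuclideanSpace ℝ (Fin 2)) :=
  orbit (Classical.epsilon fun s => m.IsPulse K c (m.μPul₂ K c) (m.u₂ K c) s.1 s.2)

/-- `𝒪_*(K)`: the union of the two heteroclinic orbits at `(c, μ) = (c_*, μ_*)`. (Adding the two
equilibria, which lie in its closure, does not change any Hausdorff distance.) -/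
def orbitStar (K : ℝ) : Set (EuclideanSpace ℝ (Fin 2)) :=
  orbit (Classical.epsilon fun s => m.IsBack K (m.cStar K) (m.μStar K) s.1 s.2) ∪
    orbit (Classical.epsilon fun s => m.IsFront K (m.cStar K) (m.μStar K) s.1 s.2)

/-- Convergence of sets in the plane with respect to the Hausdorff distance. -/
def SetTendsto (A : ℝ → Set (EuclideanSpace ℝ (Fin 2))) (l : Filter ℝ)
    (B : Set (EuclideanSpace ℝ (Fin 2))) : Prop :=
  Tendsto (fun c => Metric.hausdorffEDist (A c) B) l (𝓝 0)

/-! ### `u_M`, `u_m` and `K₁` are well defined -/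

theorem hasDerivAt_V {u : ℝ} (hu : 0 < u) : HasDerivAt m.V (deriv m.V u) u :=
  ((m.V_contDiffOn_two.differentiableOn (by norm_num)).differentiableAt
    (Ioi_mem_nhds hu)).hasDerivAt

theorem continuousOn_V : ContinuousOn m.V (Ici 0) := m.V_contDiffOn_one.continuousOn

theorem hasDerivAt_deriv_V {u : ℝ} (hu : 0 < u) :
    HasDerivAt (deriv m.V) (deriv (deriv m.V) u) u := by
  have h : ContDiffOn ℝ 1 (deriv m.V) (Ioi 0) :=
    m.V_contDiffOn_two.deriv_of_isOpen isOpen_Ioi (by norm_num)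
  exact ((h.differentiableOn (by norm_num)).differentiableAt (Ioi_mem_nhds hu)).hasDerivAt

theorem strictMonoOn_deriv_V : StrictMonoOn (deriv m.V) (Ioc 0 m.UM) := by
  have hc : ContinuousOn (deriv m.V) (Ioc 0 m.UM) := fun u hu =>
    (m.hasDerivAt_deriv_V hu.1).continuousAt.continuousWithinAt
  have hd : ∀ u ∈ Ioo 0 m.UM, deriv (deriv m.V) u ≠ 0 := fun u hu h =>
    hu.2.ne ((m.deriv2_V_eq_zero_iff u hu.1).1 h)
  rcases hasDerivWithinAt_forall_lt_or_forall_gt_of_forall_ne (convex_Ioo 0 m.UM)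
    (fun u hu => (m.hasDerivAt_deriv_V hu.1).hasDerivWithinAt) hd with h | h
  · have ha : StrictAntiOn (deriv m.V) (Ioc 0 m.UM) :=
      strictAntiOn_of_deriv_neg (convex_Ioc 0 m.UM) hc (by rwa [interior_Ioc])
    have hU := m.UM_pos
    have := ha ⟨half_pos hU, by linarith⟩ ⟨hU, le_rfl⟩ (by linarith)
    exact absurd (m.deriv_V_le _ (half_pos hU)) (not_le.2 this)
  · exact strictMonoOn_of_deriv_pos (convex_Ioc 0 m.UM) hc (by rwa [interior_Ioc])

theorem strictAntiOn_deriv_V : StrictAntiOn (deriv m.V) (Ici m.UM) := by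
  have hU := m.UM_pos
  have hc : ContinuousOn (deriv m.V) (Ici m.UM) := fun u hu =>
    (m.hasDerivAt_deriv_V (hU.trans_le hu)).continuousAt.continuousWithinAt
  have hd : ∀ u ∈ Ioi m.UM, deriv (deriv m.V) u ≠ 0 := fun u hu h =>
    (ne_of_gt hu) ((m.deriv2_V_eq_zero_iff u (hU.trans hu)).1 h)
  rcases hasDerivWithinAt_forall_lt_or_forall_gt_of_forall_ne (convex_Ioi m.UM)
    (fun u hu => (m.hasDerivAt_deriv_V (hU.trans hu)).hasDerivWithinAt) hd with h | h
  · exact strictAntiOn_of_deriv_neg (convex_Ici m.UM) hc (by rwa [interior_Ici])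
  · have ha : StrictMonoOn (deriv m.V) (Ici m.UM) :=
      strictMonoOn_of_deriv_pos (convex_Ici m.UM) hc (by rwa [interior_Ici])
    have := ha self_mem_Ici (show m.UM ≤ m.UM + 1 by linarith) (by linarith)
    exact absurd (m.deriv_V_le (m.UM + 1) (by linarith)) (not_le.2 this)

theorem hasDerivAt_aux (K : ℝ) {u : ℝ} (hu : 0 < u) :
    HasDerivAt (fun s => K * s - m.V s) (K - deriv m.V u) u := by
  have h1 : HasDerivAt (fun s : ℝ => K * s) K u := by simpa using (hasDerivAt_id u).const_mul K
  exact h1.sub (m.hasDerivAt_V hu)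

theorem K₀_nonneg : 0 ≤ m.K₀ := by
  have hc : ContinuousWithinAt (derivWithin m.V (Ici 0)) (Ioi 0) 0 :=
    ((m.V_contDiffOn_one.continuousOn_derivWithin (uniqueDiffOn_Ici 0) le_rfl) 0
      self_mem_Ici).mono Ioi_subset_Ici_self
  refine ge_of_tendsto hc ?_
  filter_upwards [self_mem_nhdsWithin] with u hu
  rw [derivWithin_of_mem_nhds (Ici_mem_nhds hu)]
  exact (m.deriv_V_pos u hu).le

theorem existsUnique_isMaxPoint {K : ℝ} (hK : K ∈ Ioo m.K₀ m.KM) : ∃! u, m.IsMaxPoint K u := by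
  have hU := m.UM_pos
  have hc : ContinuousOn (derivWithin m.V (Ici 0)) (Icc 0 m.UM) :=
    (m.V_contDiffOn_one.continuousOn_derivWithin (uniqueDiffOn_Ici 0) le_rfl).mono
      Icc_subset_Ici_self
  have he : ∀ u, 0 < u → derivWithin m.V (Ici 0) u = deriv m.V u := fun u hu =>
    derivWithin_of_mem_nhds (Ici_mem_nhds hu)
  have hK' : K ∈ Ioo (derivWithin m.V (Ici 0) 0) (derivWithin m.V (Ici 0) m.UM) := by
    rw [he _ hU]; exact hK
  obtain ⟨u, hu, huK⟩ := intermediate_value_Ioo hU.le hc hK'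
  rw [he u hu.1] at huK
  refine ⟨u, ⟨hu, ?_⟩, ?_⟩
  · refine isLocalMax_of_deriv_Ioo hu.1 hu.2 (m.hasDerivAt_aux K hu.1).continuousAt
      (fun s hs => (m.hasDerivAt_aux K hs.1).differentiableAt.differentiableWithinAt)
      (fun s hs => (m.hasDerivAt_aux K (hu.1.trans hs.1)).differentiableAt.differentiableWithinAt)
      (fun s hs => ?_) (fun s hs => ?_)
    · rw [(m.hasDerivAt_aux K hs.1).deriv]
      have := m.strictMonoOn_deriv_V ⟨hs.1, (hs.2.trans hu.2).le⟩ ⟨hu.1, hu.2.le⟩ hs.2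
      linarith
    · rw [(m.hasDerivAt_aux K (hu.1.trans hs.1)).deriv]
      have := m.strictMonoOn_deriv_V ⟨hu.1, hu.2.le⟩ ⟨hu.1.trans hs.1, hs.2.le⟩ hs.1
      linarith
  · rintro v ⟨hv, hmax⟩
    have h0 := hmax.hasDerivAt_eq_zero (m.hasDerivAt_aux K hv.1)
    exact m.strictMonoOn_deriv_V.injOn ⟨hv.1, hv.2.le⟩ ⟨hu.1, hu.2.le⟩ (by linarith)

theorem existsUnique_isMinPoint {K : ℝ} (hK : K ∈ Ioo 0 m.KM) : ∃! u, m.IsMinPoint K u := by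
  have hU := m.UM_pos
  obtain ⟨b, hbK, hb⟩ := ((m.deriv_V_tendsto.eventually (gt_mem_nhds hK.1)).and
    (eventually_gt_atTop m.UM)).exists
  have hc : ContinuousOn (deriv m.V) (Icc m.UM b) := fun u hu =>
    (m.hasDerivAt_deriv_V (hU.trans_le hu.1)).continuousAt.continuousWithinAt
  obtain ⟨u, hu, huK⟩ := intermediate_value_Ioo' hb.le hc ⟨hbK, hK.2⟩
  have hu0 := hU.trans hu.1
  refine ⟨u, ⟨hu.1, ?_⟩, ?_⟩
  · refine isLocalMin_of_deriv_Ioo hu.1 hu.2 (m.hasDerivAt_aux K hu0).continuousAt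
      (fun s hs => (m.hasDerivAt_aux K
        (hU.trans hs.1)).differentiableAt.differentiableWithinAt)
      (fun s hs => (m.hasDerivAt_aux K (hu0.trans hs.1)).differentiableAt.differentiableWithinAt)
      (fun s hs => ?_) (fun s hs => ?_)
    · rw [(m.hasDerivAt_aux K (hU.trans hs.1)).deriv]
      have := m.strictAntiOn_deriv_V (mem_Ici.2 hs.1.le) (mem_Ici.2 hu.1.le) hs.2
      linarith
    · rw [(m.hasDerivAt_aux K (hu0.trans hs.1)).deriv]
      have := m.strictAntiOn_deriv_V (mem_Ici.2 hu.1.le) (mem_Ici.2 (hu.1.trans hs.1).le) hs.1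
      linarith
  · rintro v ⟨hv, hmin⟩
    have h0 := hmin.hasDerivAt_eq_zero (m.hasDerivAt_aux K (hU.trans hv))
    exact m.strictAntiOn_deriv_V.injOn (mem_Ici.2 (le_of_lt hv)) (mem_Ici.2 hu.1.le) (by linarith)

theorem isMaxPoint_uM {K : ℝ} (hK : K ∈ Ioo m.K₀ m.KM) : m.IsMaxPoint K (m.uM K) :=
  Classical.epsilon_spec (m.existsUnique_isMaxPoint hK).exists

theorem isMinPoint_um {K : ℝ} (hK : K ∈ Ioo 0 m.KM) : m.IsMinPoint K (m.um K) :=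
  Classical.epsilon_spec (m.existsUnique_isMinPoint hK).exists

theorem deriv_V_um {K : ℝ} (hK : K ∈ Ioo 0 m.KM) : deriv m.V (m.um K) = K := by
  have h := m.isMinPoint_um hK
  have := h.2.hasDerivAt_eq_zero (m.hasDerivAt_aux K (m.UM_pos.trans h.1))
  linarith

theorem cm_le {K : ℝ} (hK : K ∈ Ioo 0 m.KM) {u : ℝ} (hu : m.UM ≤ u) :
    m.cm K ≤ K * u - m.V u := by
  have hU := m.UM_pos
  have hm := (m.isMinPoint_um hK).1
  have hd := m.deriv_V_um hK
  rcases le_total u (m.um K) with h | h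
  · have : AntitoneOn (fun s => K * s - m.V s) (Icc m.UM (m.um K)) := by
      refine antitoneOn_of_deriv_nonpos (convex_Icc _ _) (fun s hs =>
        (m.hasDerivAt_aux K (hU.trans_le hs.1)).continuousAt.continuousWithinAt)
        (fun s hs => ?_) (fun s hs => ?_) <;> rw [interior_Icc] at hs
      · exact (m.hasDerivAt_aux K (hU.trans hs.1)).differentiableAt.differentiableWithinAt
      · rw [(m.hasDerivAt_aux K (hU.trans hs.1)).deriv]
        have := m.strictAntiOn_deriv_V (mem_Ici.2 hs.1.le) (mem_Ici.2 (le_of_lt hm)) hs.2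
        linarith
    exact this ⟨hu, h⟩ ⟨le_of_lt hm, le_rfl⟩ h
  · have : MonotoneOn (fun s => K * s - m.V s) (Ici (m.um K)) := by
      refine monotoneOn_of_deriv_nonneg (convex_Ici _) (fun s hs =>
        (m.hasDerivAt_aux K (hU.trans (lt_of_lt_of_le hm hs))).continuousAt.continuousWithinAt)
        (fun s hs => ?_) (fun s hs => ?_) <;> rw [interior_Ici] at hs
      · exact (m.hasDerivAt_aux K
          (hU.trans (lt_trans hm hs))).differentiableAt.differentiableWithinAt
      · rw [(m.hasDerivAt_aux K (hU.trans (lt_trans hm hs))).deriv]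
        have := m.strictAntiOn_deriv_V (mem_Ici.2 (le_of_lt hm))
          (mem_Ici.2 (le_of_lt (lt_trans hm hs))) hs
        linarith
    exact this self_mem_Ici h h

/-- For `K, L` in `(0, K_M)`, the increment of `c_m` is squeezed by `u_m`. -/
theorem cm_sub_le {K L : ℝ} (hK : K ∈ Ioo 0 m.KM) (hL : L ∈ Ioo 0 m.KM) :
    m.cm K - m.cm L ≤ (K - L) * m.um L := by
  have := m.cm_le hK (le_of_lt (m.isMinPoint_um hL).1)
  have h2 : m.cm L = L * m.um L - m.V (m.um L) := rfl
  linarith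

theorem strictMonoOn_cm : StrictMonoOn m.cm (Ioo 0 m.KM) := by
  intro K hK L hL h
  have h1 := m.cm_sub_le hK hL
  have h2 : 0 < m.um L := m.UM_pos.trans (m.isMinPoint_um hL).1
  nlinarith

theorem continuousOn_cm : ContinuousOn m.cm (Ioo 0 m.KM) := by
  intro K hK
  refine ContinuousAt.continuousWithinAt ?_
  -- `u_m` is decreasing, so `c_m` is Lipschitz to the right of `K / 2`
  have hh : K / 2 ∈ Ioo 0 m.KM := ⟨by linarith [hK.1], by linarith [hK.1, hK.2]⟩
  have hbd : ∀ L ∈ Ioo (K / 2) m.KM, m.um L ≤ m.um (K / 2) := by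
    intro L hL
    by_contra hlt
    have hL' : L ∈ Ioo 0 m.KM := ⟨hh.1.trans hL.1, hL.2⟩
    have := m.strictAntiOn_deriv_V (mem_Ici.2 (le_of_lt (m.isMinPoint_um hh).1))
      (mem_Ici.2 (le_of_lt (m.isMinPoint_um hL').1)) (not_le.1 hlt)
    rw [m.deriv_V_um hh, m.deriv_V_um hL'] at this
    linarith [hL.1]
  have hpos : ∀ L ∈ Ioo (K / 2) m.KM, 0 < m.um L := fun L hL =>
    m.UM_pos.trans (m.isMinPoint_um ⟨hh.1.trans hL.1, hL.2⟩).1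
  refine continuousAt_of_locally_lipschitz (x := K)
    (r := min (K / 2) (m.KM - K)) (lt_min hh.1 (by linarith [hK.2])) (m.um (K / 2)) ?_
  intro L hL
  rw [Real.dist_eq] at hL
  obtain ⟨ha, hb⟩ := abs_lt.1 hL
  have h1 : L ∈ Ioo (K / 2) m.KM :=
    ⟨by linarith [min_le_left (K / 2) (m.KM - K)], by linarith [min_le_right (K / 2) (m.KM - K)]⟩
  have h2 : K ∈ Ioo (K / 2) m.KM := ⟨by linarith [hK.1], hK.2⟩
  have e1 := m.cm_sub_le hK ⟨hh.1.trans h1.1, h1.2⟩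
  have e2 := m.cm_sub_le ⟨hh.1.trans h1.1, h1.2⟩ hK
  have b1 := hbd L h1
  have b2 := hbd K h2
  have p1 := hpos L h1
  have p2 := hpos K h2
  rw [Real.dist_eq, Real.dist_eq]
  have key : ∀ x y : ℝ, 0 < y → y ≤ m.um (K / 2) → x * y ≤ m.um (K / 2) * |x| := by
    intro x y hy hy'
    nlinarith [le_abs_self x, abs_nonneg x]
  refine abs_le.2 ⟨?_, ?_⟩
  · have := key (K - L) _ p1 b1
    rw [abs_sub_comm] at this
    linarith
  · have := key (L - K) _ p2 b2
    linarith

theorem K₀_lt_KM : m.K₀ < m.KM := by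
  have hU := m.UM_pos
  have hc : ContinuousWithinAt (derivWithin m.V (Ici 0)) (Ioi 0) 0 :=
    ((m.V_contDiffOn_one.continuousOn_derivWithin (uniqueDiffOn_Ici 0) le_rfl) 0
      self_mem_Ici).mono Ioi_subset_Ici_self
  have hle : m.K₀ ≤ deriv m.V (m.UM / 2) := by
    refine le_of_tendsto hc ?_
    filter_upwards [Ioo_mem_nhdsGT (half_pos hU)] with u hu
    rw [derivWithin_of_mem_nhds (Ici_mem_nhds hu.1)]
    exact (m.strictMonoOn_deriv_V ⟨hu.1, by linarith [hu.2]⟩ ⟨half_pos hU, by linarith⟩ hu.2).le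
  exact hle.trans_lt (m.strictMonoOn_deriv_V ⟨half_pos hU, by linarith⟩ ⟨hU, le_rfl⟩
    (by linarith))

/-- A mean value theorem for `V` between `0` and `u`. -/
theorem exists_deriv_V_eq {u : ℝ} (hu : 0 < u) :
    ∃ s ∈ Ioo 0 u, m.V u - m.V 0 = deriv m.V s * u := by
  obtain ⟨s, hs, h⟩ := exists_hasDerivAt_eq_slope m.V (deriv m.V) hu
    (m.continuousOn_V.mono Icc_subset_Ici_self) (fun s hs => m.hasDerivAt_V hs.1)
  refine ⟨s, hs, ?_⟩
  rw [h, sub_zero, div_mul_cancel₀ _ hu.ne']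

theorem existsUnique_isK₁ : ∃! k, m.IsK₁ k := by
  have hU := m.UM_pos
  have h0 := m.K₀_nonneg
  have hKM : 0 < m.KM := m.deriv_V_pos _ hU
  -- somewhere in `(K₀, K_M)` one has `c_m < c₀`
  have hlow : ∃ a ∈ Ioo m.K₀ m.KM, m.cm a < m.c₀ := by
    obtain ⟨s, hs, hsV⟩ := m.exists_deriv_V_eq hU
    have hsK : m.K₀ < deriv m.V s := by
      have hc : ContinuousWithinAt (derivWithin m.V (Ici 0)) (Ioi 0) 0 :=
        ((m.V_contDiffOn_one.continuousOn_derivWithin (uniqueDiffOn_Ici 0) le_rfl) 0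
          self_mem_Ici).mono Ioi_subset_Ici_self
      have hs2 := half_pos hs.1
      have hle : m.K₀ ≤ deriv m.V (s / 2) := by
        refine le_of_tendsto hc ?_
        filter_upwards [Ioo_mem_nhdsGT hs2] with u hu
        rw [derivWithin_of_mem_nhds (Ici_mem_nhds hu.1)]
        exact (m.strictMonoOn_deriv_V ⟨hu.1, by linarith [hu.2, hs.2]⟩
          ⟨hs2, by linarith [hs.2]⟩ hu.2).le
      exact hle.trans_lt (m.strictMonoOn_deriv_V ⟨hs2, by linarith [hs.2]⟩ ⟨hs.1, hs.2.le⟩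
        (by linarith))
    obtain ⟨a, ha0, ha⟩ := exists_between (lt_min hsK m.K₀_lt_KM)
    have ha1 := lt_of_lt_of_le ha (min_le_left _ _)
    have ha2 := lt_of_lt_of_le ha (min_le_right _ _)
    refine ⟨a, ⟨ha0, ha2⟩, ?_⟩
    have := m.cm_le ⟨h0.trans_lt ha0, ha2⟩ (le_refl m.UM)
    have e : m.c₀ = -m.V 0 := rfl
    nlinarith
  -- somewhere in `(K₀, K_M)` one has `c_m > c₀`
  have hhigh : ∃ b ∈ Ioo m.K₀ m.KM, m.c₀ < m.cm b := by
    have hstrict : m.V m.UM - m.V 0 < m.KM * m.UM := by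
      obtain ⟨s, hs, hsV⟩ := m.exists_deriv_V_eq hU
      have : deriv m.V s < m.KM :=
        m.strictMonoOn_deriv_V ⟨hs.1, hs.2.le⟩ ⟨hU, le_rfl⟩ hs.2
      nlinarith
    -- a point `v > U_M` and `K = V'(v)`, so that `u_m(K) = v`
    have hcont : Tendsto (fun v => deriv m.V v * v - m.V v) (𝓝[>] m.UM)
        (𝓝 (deriv m.V m.UM * m.UM - m.V m.UM)) :=
      (((m.hasDerivAt_deriv_V hU).continuousAt.mul continuousAt_id).sub
        (m.hasDerivAt_V hU).continuousAt).tendsto.mono_left nhdsWithin_le_nhds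
    have hcont2 : Tendsto (deriv m.V) (𝓝[>] m.UM) (𝓝 m.KM) :=
      (m.hasDerivAt_deriv_V hU).continuousAt.tendsto.mono_left nhdsWithin_le_nhds
    have e : m.c₀ = -m.V 0 := rfl
    have hgt : m.c₀ < deriv m.V m.UM * m.UM - m.V m.UM := by
      have : deriv m.V m.UM = m.KM := rfl
      rw [this, e]; linarith
    obtain ⟨v, ⟨hv1, hv2⟩, hv3⟩ := (((hcont.eventually (lt_mem_nhds hgt)).and
      (hcont2.eventually (lt_mem_nhds m.K₀_lt_KM))).and self_mem_nhdsWithin).exists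
    have hvK : deriv m.V v < m.KM :=
      m.strictAntiOn_deriv_V self_mem_Ici (mem_Ici.2 (le_of_lt hv3)) hv3
    refine ⟨deriv m.V v, ⟨hv2, hvK⟩, ?_⟩
    have hK : deriv m.V v ∈ Ioo 0 m.KM := ⟨h0.trans_lt hv2, hvK⟩
    have huv : m.um (deriv m.V v) = v :=
      m.strictAntiOn_deriv_V.injOn (mem_Ici.2 (le_of_lt (m.isMinPoint_um hK).1))
        (mem_Ici.2 (le_of_lt hv3)) (m.deriv_V_um hK)
    rw [cm, huv]
    exact hv1
  obtain ⟨a, ha, hac⟩ := hlow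
  obtain ⟨b, hb, hbc⟩ := hhigh
  have ha' : a ∈ Ioo 0 m.KM := ⟨h0.trans_lt ha.1, ha.2⟩
  have hb' : b ∈ Ioo 0 m.KM := ⟨h0.trans_lt hb.1, hb.2⟩
  have hab : a ≤ b := by
    by_contra hlt
    linarith [m.strictMonoOn_cm hb' ha' (not_le.1 hlt)]
  obtain ⟨k, hk, hkc⟩ := intermediate_value_Icc hab
    (m.continuousOn_cm.mono fun x hx => ⟨ha'.1.trans_le hx.1, hx.2.trans_lt hb'.2⟩)
    ⟨hac.le, hbc.le⟩
  have hk0 : m.K₀ < k := ha.1.trans_le hk.1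
  have hk1 : k < m.KM := hk.2.trans_lt hb.2
  have hk' : k ∈ Ioo 0 m.KM := ⟨h0.trans_lt hk0, hk1⟩
  refine ⟨k, ⟨⟨hk0, hk1⟩, fun K hK => ?_, hkc, fun K hK => ?_⟩, ?_⟩
  · rw [← hkc]
    exact m.strictMonoOn_cm ⟨hK.1, hK.2.trans hk1⟩ hk' hK.2
  · rw [← hkc]
    exact m.strictMonoOn_cm hk' ⟨hk'.1.trans hK.1, hK.2⟩ hK.1
  · rintro l ⟨hl, -, hlc, -⟩
    exact m.strictMonoOn_cm.injOn ⟨h0.trans_lt hl.1, hl.2⟩ hk' (hlc.trans hkc.symm)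

theorem isK₁_K₁ : m.IsK₁ m.K₁ := Classical.epsilon_spec m.existsUnique_isK₁.exists

end

end TrafficModel

/-! Where `w > 0`, an orbit is a graph over `u`, and its energy `Y = w² / 2` satisfies the scalar
equation `Y' = G + H √(2 Y)` with `G = g₁ f` and `H = g₂ h`. The unstable manifold of a saddle `a`
is the maximal solution with `Y a = 0`, and it is the only solution that is positive near `a`. Once
`Y` reaches zero to the right of the middle root it continues with negative values and `Y' = G < 0`.
Its value at a right end `β` is therefore a signed quantity: zero means that the orbit ends at `β`,
and a negative value means that it turned back earlier. Orbits with `w < 0` are described by an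
energy `Z` for `-H`, by time reversal, and the reflection `(u, w) ↦ (-u, -w)` exchanges the two
saddles.

Backs and fronts: the value of `Y` at the right saddle depends continuously on `μ`, takes both signs
and crosses zero only once. This gives `μ_b`, and the same for `Z` gives `μ_f`. Raising `c` lowers
`G` and moves the saddles to the right, so `μ_b` increases and `μ_f` decreases with `c`.

Pulses: a homoclinic orbit at `a` consists of the graphs of `√(2 Y)` and `-√(2 Z)` up to a common
first zero. Both energies have slope `G` after their zeros, so this amounts to `Y β = Z β < 0`. Some
`μ` bounded by `sup |f'|` always gives `Y β = Z β` (`Adm.exists_common`); what has to be excluded is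
a nonnegative common value. Uniqueness holds because the first zero of `Y` moves to the right with
`μ` and that of `Z` to the left (`Adm.common_unique`). For `c > c_*` a nonnegative common value
would need `μ_b ≤ μ ≤ μ_f`, which is false there; for `c < c_*` the mirrored argument applies.

The crossing `c_*` exists by a collapse estimate (`Hump.sq_sum_le`, `exists_collapse`). If `Y` and
`Z` both stay positive beyond the middle root `m`, then the area of `-G` there is bounded by the
energies at `m`, which are `O(m - a)`. Near `c_M` the roots `a` and `m` merge while the area does
not shrink. Near `c_m` the same happens in the mirror. If instead `c_m < c₀`, the area near `u = 0`
is infinite by condition (H), through `u = 1 / ρ`; this also yields the pulses for `c_m < c ≤ c₀`.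

Limits: energies depend continuously on all parameters, because limits of equi-Lipschitz energies
are energies and uniqueness identifies them. At `c_*` the value of `μ_pul` is squeezed between `μ_f`
and `μ_b`, and the graphs converge uniformly. At `c_M` the collapse estimate forces the turning
point to `u_M`, so the orbit shrinks; `f' (u_M) = 0` then forces `μ → 0`, since any `μ` bounded away
from zero carries one of the two energies past the turning point. The limit at `c_m` is the mirror
image. -/

namespace TravelingWave

/-! ### The energy equation: regularization, compactness and maximal solutions. -/

/-- `Y` solves the energy equation `Y' = G + H √(2 Y)` on `[a, b]` with `Y a = 0`. Where `Y > 0`,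
the function `w = √(2 Y)` satisfies `w w' = G + H w`. -/
structure IsEnergy (G H : ℝ → ℝ) (a b : ℝ) (Y : ℝ → ℝ) : Prop where
  init : Y a = 0
  deriv : ∀ u ∈ Icc a b, HasDerivWithinAt Y (G u + H u * √(2 * Y u)) (Icc a b) u

/-- The maximal solution of the energy equation: it dominates all subsolutions. -/
structure IsMaxEnergy (G H : ℝ → ℝ) (a b : ℝ) (Y : ℝ → ℝ) : Prop extends IsEnergy G H a b Y where
  max : ∀ a' ∈ Icc a b, ∀ b' ≤ b, ∀ Z z' : ℝ → ℝ, ContinuousOn Z (Icc a' b') →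
    (∀ u ∈ Ico a' b', HasDerivWithinAt Z (z' u) (Ici u) u) → Z a' ≤ Y a' →
    (∀ u ∈ Ico a' b', z' u ≤ G u + H u * √(2 * Z u)) → ∀ u ∈ Icc a' b', Z u ≤ Y u

/-- Conversion of derivatives within a closed interval to right derivatives. -/
theorem hasDerivWithinAt_Ici_of_Icc {Y : ℝ → ℝ} {y a b u : ℝ} (hu : u ∈ Ico a b)
    (h : HasDerivWithinAt Y y (Icc a b) u) : HasDerivWithinAt Y y (Ici u) u :=
  h.mono_of_mem_nhdsWithin (mem_nhdsWithin.2 ⟨Iio b, isOpen_Iio, hu.2, fun _ hx =>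
    ⟨hu.1.trans hx.2, (le_of_lt hx.1)⟩⟩)

/-- The root is Hölder continuous of exponent 1/2. The equation has no better regularity in `Y` near
zero, but this suffices to pass to uniform limits under the root. -/
theorem abs_sqrt_sub_sqrt_le (x y : ℝ) : |√x - √y| ≤ √|x - y| := by
  wlog h : y ≤ x generalizing x y
  · rw [abs_sub_comm, abs_sub_comm x]; exact this y x (not_le.1 h).le
  rw [abs_of_nonneg (sub_nonneg.2 (Real.sqrt_le_sqrt h)), abs_of_nonneg (sub_nonneg.2 h)]
  rcases le_total y 0 with hy | hy
  · rw [Real.sqrt_eq_zero_of_nonpos hy, sub_zero]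
    exact Real.sqrt_le_sqrt (by linarith)
  · rw [sub_le_iff_le_add]
    refine Real.sqrt_le_iff.2 ⟨by positivity, ?_⟩
    have h1 := Real.sq_sqrt (sub_nonneg.2 h)
    have h2 := Real.sq_sqrt hy
    nlinarith [Real.sqrt_nonneg (x - y), Real.sqrt_nonneg y,
      mul_nonneg (Real.sqrt_nonneg (x - y)) (Real.sqrt_nonneg y)]

theorem sqrt_two_mul_max (y : ℝ) : √(2 * max y 0) = √(2 * y) := by
  rcases le_total y 0 with hy | hy
  · rw [max_eq_right hy, Real.sqrt_eq_zero_of_nonpos (by linarith : 2 * y ≤ 0)]; simp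
  · rw [max_eq_left hy]

/-- The regularized root stays above `ε`, so dividing the difference of squares by the sum of roots
costs only `1 / ε`. This makes Picard–Lindelöf available. -/
theorem sqrt_regular_lipschitz {ε : ℝ} (hε : 0 < ε) (x y : ℝ) :
    |√(2 * max x 0 + ε ^ 2) - √(2 * max y 0 + ε ^ 2)| ≤ ε⁻¹ * |x - y| := by
  set A := 2 * max x 0 + ε ^ 2
  set B := 2 * max y 0 + ε ^ 2
  have hA : ε ^ 2 ≤ A := by have := le_max_right x 0; simp only [A]; linarith
  have hB : ε ^ 2 ≤ B := by have := le_max_right y 0; simp only [B]; linarith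
  have h1 : ε ≤ √A := Real.le_sqrt_of_sq_le hA
  have h2 : ε ≤ √B := Real.le_sqrt_of_sq_le hB
  have hAB : |A - B| ≤ 2 * |x - y| := by
    have : A - B = 2 * (max x 0 - max y 0) := by simp only [A, B]; ring
    rw [this, abs_mul, abs_two]
    have := abs_max_sub_max_le_abs x y 0
    linarith
  have e1 := Real.sq_sqrt ((sq_nonneg ε).trans hA)
  have e2 := Real.sq_sqrt ((sq_nonneg ε).trans hB)
  have h3 : |√A - √B| * (√A + √B) = |A - B| := by
    have e3 : (√A - √B) * (√A + √B) = A - B := by nlinarith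
    rw [← e3, abs_mul, abs_of_pos (show 0 < √A + √B by linarith)]
  rw [inv_mul_eq_div, le_div_iff₀ hε]
  nlinarith [abs_nonneg (√A - √B), mul_le_mul_of_nonneg_left (add_le_add h1 h2) (abs_nonneg (√A - √B))]

theorem sqrt_regular_close {ε : ℝ} (hε : 0 ≤ ε) (y : ℝ) :
    √(2 * y) ≤ √(2 * max y 0 + ε ^ 2) ∧ √(2 * max y 0 + ε ^ 2) ≤ √(2 * y) + ε := by
  rw [← sqrt_two_mul_max y]
  have h0 : 0 ≤ 2 * max y 0 := by positivity
  refine ⟨Real.sqrt_le_sqrt (by nlinarith), Real.sqrt_le_iff.2 ⟨by positivity, ?_⟩⟩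
  have := Real.sq_sqrt h0
  nlinarith [mul_nonneg (Real.sqrt_nonneg (2 * max y 0)) hε]

/-- Global solutions of the regularized energy equation. -/
theorem exists_regularized {G H : ℝ → ℝ} {a b C₀ C₁ ε : ℝ} (hab : a ≤ b)
    (hG : ContinuousOn G (Icc a b)) (hH : ContinuousOn H (Icc a b))
    (hGb : ∀ u ∈ Icc a b, |G u| ≤ C₀) (hHb : ∀ u ∈ Icc a b, |H u| ≤ C₁) (hε : 0 < ε) :
    ∃ Y : ℝ → ℝ, Y a = ε ∧ ∀ u ∈ Icc a b, HasDerivWithinAt Y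
      ((G u + ε * (C₁ + 1)) + H u * √(2 * max (Y u) 0 + ε ^ 2)) (Icc a b) u := by
  have hC₀ : 0 ≤ C₀ := (abs_nonneg _).trans (hGb a ⟨le_rfl, hab⟩)
  have hC₁ : 0 ≤ C₁ := (abs_nonneg _).trans (hHb a ⟨le_rfl, hab⟩)
  have hT : 0 ≤ b - a := by linarith
  -- Existence on all of `[a, b]` needs a radius `A` that is at least `b - a` times the bound of the
  -- field on the ball. The field grows only like `√A`, so a large `A` works; Young's inequality
  -- gives an explicit one.
  obtain ⟨A, hA0, hA⟩ : ∃ A : ℝ, 0 ≤ A ∧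
      (C₀ + ε * (C₁ + 1) + C₁ * √(2 * (ε + A) + ε ^ 2)) * (b - a) ≤ A := by
    have hε' := hε.le
    have ht : 0 ≤ C₁ * (b - a) := by positivity
    set s := C₁ * (b - a)
    set r := (C₀ + ε * (C₁ + 1)) * (b - a)
    have hr : 0 ≤ r := by positivity
    refine ⟨2 * r + 2 * s ^ 2 + 2 * ε + ε ^ 2, by positivity, ?_⟩
    set A := 2 * r + 2 * s ^ 2 + 2 * ε + ε ^ 2
    have hAp : 0 ≤ A := by positivity
    have h1 : s * √(2 * (ε + A) + ε ^ 2) ≤ s ^ 2 + (2 * (ε + A) + ε ^ 2) / 4 := by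
      have := Real.sq_sqrt (show 0 ≤ 2 * (ε + A) + ε ^ 2 by positivity)
      nlinarith [sq_nonneg (s - √(2 * (ε + A) + ε ^ 2) / 2)]
    have : (C₀ + ε * (C₁ + 1) + C₁ * √(2 * (ε + A) + ε ^ 2)) * (b - a)
        = r + s * √(2 * (ε + A) + ε ^ 2) := by simp only [r, s]; ring
    rw [this]
    simp only [A] at h1 ⊢
    nlinarith [sq_nonneg s, sq_nonneg ε]
  set L := C₀ + ε * (C₁ + 1) + C₁ * √(2 * (ε + A) + ε ^ 2)
  have hL : 0 ≤ L := by positivity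
  obtain ⟨A', hA'⟩ : ∃ A' : NNReal, (A' : ℝ) = A := ⟨⟨A, hA0⟩, rfl⟩
  obtain ⟨L', hL'⟩ : ∃ L' : NNReal, (L' : ℝ) = L := ⟨⟨L, hL⟩, rfl⟩
  obtain ⟨K', hK'⟩ : ∃ K' : NNReal, (K' : ℝ) = C₁ * ε⁻¹ := ⟨⟨C₁ * ε⁻¹, by positivity⟩, rfl⟩
  let f : ℝ → ℝ → ℝ := fun u y => (G u + ε * (C₁ + 1)) + H u * √(2 * max y 0 + ε ^ 2)
  have hpl : IsPicardLindelof f (tmin := a) (tmax := b) ⟨a, le_rfl, hab⟩ ε A' 0 L' K' := by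
    refine ⟨fun u hu => ?_, fun y _ => ?_, fun u hu y hy => ?_, ?_⟩
    · refine LipschitzWith.lipschitzOnWith (LipschitzWith.of_dist_le_mul fun x y => ?_)
      simp only [f, Real.dist_eq, hK']
      rw [add_sub_add_left_eq_sub, ← mul_sub, abs_mul, mul_assoc]
      exact mul_le_mul (hHb u hu) (sqrt_regular_lipschitz hε x y) (abs_nonneg _) hC₁
    · exact (hG.add continuousOn_const).add (hH.mul continuousOn_const)
    · simp only [f, Real.norm_eq_abs, hL']
      have hy' : y ≤ ε + A := by
        rw [Metric.mem_closedBall, Real.dist_eq, hA'] at hy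
        have := (abs_le.1 hy).2
        linarith
      have h1 : √(2 * max y 0 + ε ^ 2) ≤ √(2 * (ε + A) + ε ^ 2) := by
        apply Real.sqrt_le_sqrt
        have := max_le hy' (show 0 ≤ ε + A by linarith)
        linarith
      calc |(G u + ε * (C₁ + 1)) + H u * √(2 * max y 0 + ε ^ 2)|
          ≤ |G u| + |ε * (C₁ + 1)| + |H u| * |√(2 * max y 0 + ε ^ 2)| := by
            rw [← abs_mul]; exact (abs_add_le _ _).trans (by gcongr; exact abs_add_le _ _)
        _ ≤ L := by
            rw [abs_of_nonneg (show 0 ≤ ε * (C₁ + 1) by positivity),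
              abs_of_nonneg (Real.sqrt_nonneg _)]
            simp only [L]
            have := mul_le_mul (hHb u hu) h1 (Real.sqrt_nonneg _) hC₁
            linarith [hGb u hu]
    · simp only [hA', hL', sub_self, NNReal.coe_zero, sub_zero]
      rw [max_eq_left hT]; exact hA
  obtain ⟨Y, hY0, hY⟩ := hpl.exists_eq_forall_mem_Icc_hasDerivWithinAt₀
  exact ⟨Y, hY0, hY⟩

theorem IsEnergy.continuousOn {G H : ℝ → ℝ} {a b : ℝ} {Y : ℝ → ℝ} (h : IsEnergy G H a b Y) :
    ContinuousOn Y (Icc a b) := fun u hu => (h.deriv u hu).continuousWithinAt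

/-- Comparison with the regularized equation. -/
theorem le_regularized {G H : ℝ → ℝ} {a b C₁ ε a' b' : ℝ}
    (hHb : ∀ u ∈ Icc a b, |H u| ≤ C₁) (hε : 0 < ε) {Y : ℝ → ℝ}
    (hY : ∀ u ∈ Icc a b, HasDerivWithinAt Y
      ((G u + ε * (C₁ + 1)) + H u * √(2 * max (Y u) 0 + ε ^ 2)) (Icc a b) u)
    (ha : a' ∈ Icc a b) (hb : b' ≤ b) {Z z' : ℝ → ℝ} (hZ : ContinuousOn Z (Icc a' b'))
    (hZ' : ∀ u ∈ Ico a' b', HasDerivWithinAt Z (z' u) (Ici u) u) (hZa : Z a' ≤ Y a')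
    (hz : ∀ u ∈ Ico a' b', z' u ≤ G u + H u * √(2 * Z u)) : ∀ u ∈ Icc a' b', Z u ≤ Y u := by
  intro u hu
  refine image_le_of_deriv_right_lt_deriv_boundary' hZ hZ' hZa
    (fun x hx => ((hY x ⟨ha.1.trans hx.1, hx.2.trans hb⟩).continuousWithinAt).mono
      (Icc_subset_Icc ha.1 hb))
    (fun x hx => hasDerivWithinAt_Ici_of_Icc ⟨ha.1.trans hx.1, hx.2.trans_le hb⟩
      (hY x ⟨ha.1.trans hx.1, hx.2.le.trans hb⟩)) (fun x hx hxe => ?_) hu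
  refine (hz x hx).trans_lt ?_
  rw [hxe]
  -- At a contact point the regularized field exceeds the original one by `ε (C₁ + 1)` plus `H`
  -- times an excess in `[0, ε]`, hence by at least `ε`.
  obtain ⟨h1, h2⟩ := sqrt_regular_close hε.le (Y x)
  obtain ⟨h3, h4⟩ := abs_le.1 (hHb x ⟨ha.1.trans hx.1, hx.2.le.trans hb⟩)
  nlinarith

/-- Along an ultrafilter, equibounded equi-Lipschitz functions converge uniformly. -/
theorem exists_tendstoUniformlyOn_of_lipschitz {ι : Type*} (U : Ultrafilter ι) {Y : ι → ℝ → ℝ}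
    {a b B L : ℝ} (hB : ∀ᶠ i in (U : Filter ι), ∀ u ∈ Icc a b, |Y i u| ≤ B)
    (hL : ∀ᶠ i in (U : Filter ι), ∀ u ∈ Icc a b, ∀ v ∈ Icc a b, |Y i u - Y i v| ≤ L * |u - v|) :
    ∃ Z : ℝ → ℝ, TendstoUniformlyOn Y Z (U : Filter ι) (Icc a b) := by
  have hlim : ∀ u : ℝ, ∃ z : ℝ, u ∈ Icc a b → Tendsto (fun i => Y i u) U (𝓝 z) := by
    intro u
    by_cases hu : u ∈ Icc a b
    · have : Icc (-B) B ∈ U.map (fun i => Y i u) :=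
        hB.mono fun i hi => abs_le.1 (hi u hu)
      obtain ⟨z, -, hz⟩ := isCompact_Icc.ultrafilter_le_nhds _ (le_principal_iff.2 this)
      exact ⟨z, fun _ => hz⟩
    · exact ⟨0, fun h => absurd h hu⟩
  choose Z hZ using hlim
  refine ⟨Z, ?_⟩
  have hZL : ∀ u ∈ Icc a b, ∀ v ∈ Icc a b, |Z u - Z v| ≤ L * |u - v| := fun u hu v hv =>
    le_of_tendsto ((hZ u hu).sub (hZ v hv)).abs (hL.mono fun i hi => hi u hu v hv)
  rw [Metric.tendstoUniformlyOn_iff]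
  intro ε hε
  have hLp : 0 < |L| + 1 := by positivity
  set δ := ε / (4 * (|L| + 1))
  have hδ : 0 < δ := by positivity
  obtain ⟨t, hts, htf, ht⟩ := (isCompact_Icc (a := a) (b := b)).finite_cover_balls hδ
  have hev : ∀ᶠ i in (U : Filter ι), ∀ x ∈ t, |Y i x - Z x| < ε / 4 := by
    rw [htf.eventually_all]
    intro x hx
    have := (hZ x (hts hx)).eventually (Metric.ball_mem_nhds _ (show 0 < ε / 4 by linarith))
    simpa [Real.dist_eq] using this
  filter_upwards [hev, hL] with i h1 h2 u hu
  obtain ⟨x, hx, hux⟩ := mem_iUnion₂.1 (ht hu)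
  rw [Metric.mem_ball, Real.dist_eq] at hux
  have hLδ : L * |u - x| ≤ ε / 4 := by
    calc L * |u - x| ≤ (|L| + 1) * δ := by
          refine mul_le_mul (by linarith [le_abs_self L]) hux.le (abs_nonneg _) hLp.le
      _ = ε / 4 := by simp only [δ]; field_simp
  have a1 := h1 x hx
  have a2 := (h2 u hu x (hts hx)).trans hLδ
  have a3 := (hZL u hu x (hts hx)).trans hLδ
  rw [Real.dist_eq]
  rw [abs_lt] at a1 ⊢
  rw [abs_le] at a2 a3
  constructor <;> linarith [a1.1, a1.2, a2.1, a2.2, a3.1, a3.2]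

/-- Uniform limits of solutions of perturbed energy equations solve the energy equation. -/
theorem hasDerivWithinAt_of_tendstoUniformlyOn {ι : Type*} {l : Filter ι} [l.NeBot]
    {Y y : ι → ℝ → ℝ} {Z z : ℝ → ℝ} {a b : ℝ}
    (hY : ∀ᶠ i in l, ∀ u ∈ Icc a b, HasDerivWithinAt (Y i) (y i u) (Icc a b) u)
    (hyc : ∀ᶠ i in l, ContinuousOn (y i) (Icc a b))
    (hy : TendstoUniformlyOn y z l (Icc a b))
    (hZ : ∀ u ∈ Icc a b, Tendsto (fun i => Y i u) l (𝓝 (Z u))) :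
    ∀ u ∈ Icc a b, HasDerivWithinAt Z (z u) (Icc a b) u := by
  intro u hu
  have hab : a ≤ b := hu.1.trans hu.2
  have hz : ContinuousOn z (Icc a b) := hy.continuousOn hyc.frequently
  -- The limit is taken in the integral form of the equation; differentiating the identity obtained
  -- gives the derivative back.
  have key : ∀ v ∈ Icc a b, Z v = Z a + ∫ s in a..v, z s := by
    intro v hv
    have hsub : Icc a v ⊆ Icc a b := Icc_subset_Icc_right hv.2
    have h1 : Tendsto (fun i => ∫ s in a..v, y i s) l (𝓝 (∫ s in a..v, z s)) := by
      rw [Metric.tendsto_nhds]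
      intro ε hε
      rw [Metric.tendstoUniformlyOn_iff] at hy
      have hδ : 0 < ε / (v - a + 1) := div_pos hε (by linarith [hv.1])
      filter_upwards [hy _ hδ, hyc] with i h1 h2
      rw [Real.dist_eq, ← intervalIntegral.integral_sub]
      · have := intervalIntegral.norm_integral_le_of_norm_le_const (a := a) (b := v)
          (f := fun s => y i s - z s) (C := ε / (v - a + 1)) (fun s hs => by
            rw [uIoc_of_le hv.1] at hs
            have := h1 s ⟨hs.1.le, hs.2.trans hv.2⟩
            rw [dist_comm, Real.dist_eq] at this
            exact this.le)
        rw [abs_of_nonneg (sub_nonneg.2 hv.1), Real.norm_eq_abs] at this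
        refine this.trans_lt ?_
        rw [div_mul_eq_mul_div, div_lt_iff₀ (by linarith [hv.1])]
        nlinarith [hv.1]
      · exact (h2.mono hsub).intervalIntegrable_of_Icc hv.1
      · exact (hz.mono hsub).intervalIntegrable_of_Icc hv.1
    have h2 : Tendsto (fun i => Y i v) l (𝓝 (Z a + ∫ s in a..v, z s)) := by
      refine ((hZ a ⟨le_rfl, hab⟩).add h1).congr' ?_
      filter_upwards [hY, hyc] with i h3 h4
      rw [intervalIntegral.integral_eq_sub_of_hasDeriv_right_of_le hv.1 (f := Y i)]
      · ring
      · exact fun x hx => ((h3 x (hsub hx)).continuousWithinAt).mono hsub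
      · intro x hx
        exact (hasDerivWithinAt_Ici_of_Icc ⟨hx.1.le, hx.2.trans_le hv.2⟩
          (h3 x ⟨hx.1.le, hx.2.le.trans hv.2⟩)).mono Ioi_subset_Ici_self
      · exact (h4.mono hsub).intervalIntegrable_of_Icc hv.1
    exact tendsto_nhds_unique (hZ v hv) h2
  -- The `FTCFilter` instance for `𝓝[Icc a b] u` takes the membership of `u` as a `Fact`.
  have : Fact (u ∈ Icc a b) := ⟨hu⟩
  have hd : HasDerivWithinAt (fun v => Z a + ∫ s in a..v, z s) (z u) (Icc a b) u := by
    refine HasDerivWithinAt.const_add _ ?_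
    refine intervalIntegral.integral_hasDerivWithinAt_right ?_
      (hz.stronglyMeasurableAtFilter_nhdsWithin measurableSet_Icc u) (hz u hu)
    exact (hz.mono (Icc_subset_Icc_right hu.2)).intervalIntegrable_of_Icc hu.1
  exact hd.congr key (key u hu)

/-- A priori bounds for a perturbed energy equation. -/
theorem abs_le_of_energy {y Y : ℝ → ℝ} {a b C₀ C₁ : ℝ} (hC₀ : 0 ≤ C₀) (hC₁ : 0 ≤ C₁)
    (hY : ∀ u ∈ Icc a b, HasDerivWithinAt Y (y u) (Icc a b) u) (hYa : |Y a| ≤ 1 / 2)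
    (hy : ∀ u ∈ Icc a b, |y u| ≤ C₀ + C₁ * √(2 * Y u)) :
    ∀ u ∈ Icc a b, |Y u| ≤ ((C₀ + C₁ + 1) * (u - a) + 1) ^ 2 / 2 := by
  intro u hu
  have hab : a ≤ b := hu.1.trans hu.2
  set κ := C₀ + C₁ + 1
  have hκ : 0 < κ := by simp only [κ]; linarith
  have hc : ContinuousOn Y (Icc a b) := fun x hx => (hY x hx).continuousWithinAt
  -- The majorant is `q² / 2` with `q = κ (x - a) + 1`: its root is `√(2 · q² / 2) = q`, its slope
  -- is `κ q`, and `q ≥ 1` gives `C₀ + C₁ q < κ q`.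
  have hB : ∀ x, HasDerivAt (fun x => (κ * (x - a) + 1) ^ 2 / 2) (κ * (κ * (x - a) + 1)) x := by
    intro x
    refine ((((((hasDerivAt_id' x).sub_const a).const_mul κ).add_const 1).pow 2).div_const
      2).congr_deriv ?_
    norm_num
    ring
  have hs : ∀ x ∈ Ico a b, Y x ≤ (κ * (x - a) + 1) ^ 2 / 2 →
      C₀ + C₁ * √(2 * Y x) < κ * (κ * (x - a) + 1) := by
    intro x hx hle
    have h0 : 0 ≤ κ * (x - a) := mul_nonneg hκ.le (by linarith [hx.1])
    have : √(2 * Y x) ≤ κ * (x - a) + 1 := Real.sqrt_le_iff.2 ⟨by linarith, by linarith⟩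
    have h2 : C₁ * √(2 * Y x) ≤ C₁ * (κ * (x - a) + 1) := mul_le_mul_of_nonneg_left this hC₁
    set q := κ * (x - a) + 1
    have hq : 1 ≤ q := by simp only [q]; linarith
    have : C₀ ≤ C₀ * q := le_mul_of_one_le_right hC₀ hq
    simp only [κ]
    linarith
  have hd := fun x (hx : x ∈ Ico a b) => hasDerivWithinAt_Ici_of_Icc hx (hY x ⟨hx.1, hx.2.le⟩)
  rw [abs_le]
  constructor
  · have := image_le_of_deriv_right_lt_deriv_boundary hc.neg (fun x hx => (hd x hx).neg)
      (B := fun x => (κ * (x - a) + 1) ^ 2 / 2)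
      (by simp only [Pi.neg_apply, sub_self]; linarith [(abs_le.1 hYa).1]) hB (fun x hx he => ?_) hu
    · simp only [Pi.neg_apply] at this; linarith
    · have h1 := (abs_le.1 (hy x ⟨hx.1, hx.2.le⟩)).1
      have h2 := hs x hx (by simp only [Pi.neg_apply] at he; nlinarith [sq_nonneg (κ * (x - a) + 1)])
      linarith
  · refine image_le_of_deriv_right_lt_deriv_boundary hc hd
      (B := fun x => (κ * (x - a) + 1) ^ 2 / 2)
      (by simp only [sub_self]; linarith [(abs_le.1 hYa).2]) hB (fun x hx he => ?_) hu
    have h1 := (abs_le.1 (hy x ⟨hx.1, hx.2.le⟩)).2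
    exact h1.trans_lt (hs x hx he.le)

/-- The Lipschitz constant of solutions of the energy equation. -/
noncomputable def energyLip (C₀ C₁ T : ℝ) : ℝ := C₀ + C₁ * ((C₀ + C₁ + 1) * T + 1)

/-- The quadratic a priori bound makes `√(2 Y)` at most linear, hence bounds `Y'`. The constant
depends only on bounds of the coefficients, which is what yields compactness of families of
energies. -/
theorem lipschitz_of_energy {y Y : ℝ → ℝ} {a b C₀ C₁ T : ℝ} (hC₀ : 0 ≤ C₀) (hC₁ : 0 ≤ C₁)
    (hT : b - a ≤ T)
    (hY : ∀ u ∈ Icc a b, HasDerivWithinAt Y (y u) (Icc a b) u) (hYa : |Y a| ≤ 1 / 2)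
    (hy : ∀ u ∈ Icc a b, |y u| ≤ C₀ + C₁ * √(2 * Y u)) :
    ∀ u ∈ Icc a b, ∀ v ∈ Icc a b, |Y u - Y v| ≤ energyLip C₀ C₁ T * |u - v| := by
  intro u hu v hv
  refine (convex_Icc a b).norm_image_sub_le_of_norm_hasDerivWithin_le hY (fun x hx => ?_) hv hu
  refine (hy x hx).trans ?_
  have hb := abs_le_of_energy hC₀ hC₁ hY hYa hy x hx
  have h1 : √(2 * Y x) ≤ (C₀ + C₁ + 1) * (x - a) + 1 :=
    Real.sqrt_le_iff.2 ⟨by nlinarith [hx.1], by linarith [le_abs_self (Y x)]⟩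
  have h2 : (C₀ + C₁ + 1) * (x - a) ≤ (C₀ + C₁ + 1) * T :=
    mul_le_mul_of_nonneg_left (by linarith [hx.2]) (by linarith)
  simp only [energyLip]
  have := mul_le_mul_of_nonneg_left (h1.trans (add_le_add_left h2 1)) hC₁
  linarith

/-- Existence of the maximal solution of the energy equation. -/
theorem exists_isMaxEnergy {G H : ℝ → ℝ} {a b : ℝ} (hab : a ≤ b)
    (hG : ContinuousOn G (Icc a b)) (hH : ContinuousOn H (Icc a b)) :
    ∃ Y, IsMaxEnergy G H a b Y := by
  obtain ⟨C₀, hGb⟩ := isCompact_Icc.exists_bound_of_continuousOn hG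
  obtain ⟨C₁, hHb⟩ := isCompact_Icc.exists_bound_of_continuousOn hH
  simp only [Real.norm_eq_abs] at hGb hHb
  have hC₀ : 0 ≤ C₀ := (abs_nonneg _).trans (hGb a ⟨le_rfl, hab⟩)
  have hC₁ : 0 ≤ C₁ := (abs_nonneg _).trans (hHb a ⟨le_rfl, hab⟩)
  have hex : ∀ ε : ℝ, ∃ Y : ℝ → ℝ, 0 < ε → Y a = ε ∧ ∀ u ∈ Icc a b, HasDerivWithinAt Y
      ((G u + ε * (C₁ + 1)) + H u * √(2 * max (Y u) 0 + ε ^ 2)) (Icc a b) u := by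
    intro ε
    by_cases hε : 0 < ε
    · obtain ⟨Y, hY⟩ := exists_regularized hab hG hH hGb hHb hε
      exact ⟨Y, fun _ => hY⟩
    · exact ⟨0, fun h => absurd h hε⟩
  choose Y hY using hex
  set y : ℝ → ℝ → ℝ := fun ε u =>
    (G u + ε * (C₁ + 1)) + H u * √(2 * max (Y ε u) 0 + ε ^ 2) with hy
  -- An ultrafilter finer than `ε → 0+` takes the place of extracting a convergent subsequence.
  let U : Ultrafilter ℝ := Ultrafilter.of (𝓝[>] 0)
  have hU : (U : Filter ℝ) ≤ 𝓝[>] 0 := Ultrafilter.of_le _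
  have hev : ∀ᶠ ε in (U : Filter ℝ), ε ∈ Ioo (0 : ℝ) (1 / 2) :=
    hU (Ioo_mem_nhdsGT (by norm_num))
  have hU0 : Tendsto (fun ε : ℝ => ε) U (𝓝 0) := (hU.trans nhdsWithin_le_nhds)
  have hbd : ∀ ε ∈ Ioo (0 : ℝ) (1 / 2), ∀ u ∈ Icc a b,
      |y ε u| ≤ (C₀ + 2 * C₁ + 1) + C₁ * √(2 * Y ε u) := by
    intro ε hε u hu
    obtain ⟨h1, h2⟩ := sqrt_regular_close hε.1.le (Y ε u)
    calc |y ε u| ≤ |G u| + |ε * (C₁ + 1)| + |H u| * |√(2 * max (Y ε u) 0 + ε ^ 2)| := by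
          rw [← abs_mul]; exact (abs_add_le _ _).trans (by gcongr; exact abs_add_le _ _)
      _ ≤ _ := by
          rw [abs_of_nonneg (Real.sqrt_nonneg _),
            abs_of_nonneg (mul_nonneg hε.1.le (by linarith : 0 ≤ C₁ + 1))]
          have h3 := mul_le_mul (hHb u hu) h2 (Real.sqrt_nonneg _) hC₁
          nlinarith [hGb u hu, hε.1, hε.2]
  have hYa : ∀ ε ∈ Ioo (0 : ℝ) (1 / 2), |Y ε a| ≤ 1 / 2 := fun ε hε => by
    rw [(hY ε hε.1).1, abs_of_pos hε.1]; exact hε.2.le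
  have hlip : ∀ᶠ ε in (U : Filter ℝ), ∀ u ∈ Icc a b, ∀ v ∈ Icc a b,
      |Y ε u - Y ε v| ≤ energyLip (C₀ + 2 * C₁ + 1) C₁ (b - a) * |u - v| := by
    filter_upwards [hev] with ε hε
    exact lipschitz_of_energy (by positivity) hC₁ le_rfl (hY ε hε.1).2 (hYa ε hε) (hbd ε hε)
  set B := ((C₀ + 2 * C₁ + 1 + C₁ + 1) * (b - a) + 1) ^ 2 / 2
  have hB : ∀ᶠ ε in (U : Filter ℝ), ∀ u ∈ Icc a b, |Y ε u| ≤ B := by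
    filter_upwards [hev] with ε hε u hu
    refine (abs_le_of_energy (by positivity) hC₁ (hY ε hε.1).2 (hYa ε hε) (hbd ε hε) u hu).trans ?_
    have := hu.1
    have h1 : (C₀ + 2 * C₁ + 1 + C₁ + 1) * (u - a) ≤ (C₀ + 2 * C₁ + 1 + C₁ + 1) * (b - a) :=
      mul_le_mul_of_nonneg_left (by linarith [hu.2]) (by positivity)
    have h2 : 0 ≤ (C₀ + 2 * C₁ + 1 + C₁ + 1) * (u - a) :=
      mul_nonneg (by positivity) (by linarith)
    simp only [B]
    gcongr
  obtain ⟨Z, hZ⟩ := exists_tendstoUniformlyOn_of_lipschitz U hB hlip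
  have hZt : ∀ u ∈ Icc a b, Tendsto (fun ε => Y ε u) U (𝓝 (Z u)) := fun u hu =>
    hZ.tendsto_at hu
  have hyu : TendstoUniformlyOn y (fun u => G u + H u * √(2 * Z u)) (U : Filter ℝ) (Icc a b) := by
    rw [Metric.tendstoUniformlyOn_iff] at hZ ⊢
    intro η hη
    set δ := (η / (2 * (C₁ + 1))) ^ 2 / 2
    have hδ : 0 < δ := by positivity
    have hε1 : ∀ᶠ ε in (U : Filter ℝ), ε < η / (4 * (C₁ + 1)) :=
      hU0.eventually (gt_mem_nhds (by positivity))
    filter_upwards [hZ δ hδ, hev, hε1] with ε h1 hε h2 u hu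
    have h3 := h1 u hu
    rw [Real.dist_eq] at h3 ⊢
    obtain ⟨h4, h5⟩ := sqrt_regular_close hε.1.le (Y ε u)
    have h6 : |√(2 * Z u) - √(2 * Y ε u)| < η / (2 * (C₁ + 1)) := by
      refine (abs_sqrt_sub_sqrt_le _ _).trans_lt ?_
      rw [Real.sqrt_lt' (by positivity), ← mul_sub, abs_mul, abs_two]
      simp only [δ] at h3
      linarith
    have h7 : |√(2 * Z u) - √(2 * max (Y ε u) 0 + ε ^ 2)| < η / (2 * (C₁ + 1)) + ε := by
      rw [abs_lt] at h6 ⊢; constructor <;> linarith [h6.1, h6.2, hε.1]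
    have h8 : |G u + H u * √(2 * Z u) - y ε u| ≤
        C₁ * (η / (2 * (C₁ + 1)) + ε) + ε * (C₁ + 1) := by
      have e : G u + H u * √(2 * Z u) - y ε u =
          H u * (√(2 * Z u) - √(2 * max (Y ε u) 0 + ε ^ 2)) - ε * (C₁ + 1) := by
        simp only [hy]; ring
      rw [e]
      refine (abs_sub _ _).trans (add_le_add ?_ ?_)
      · rw [abs_mul]; exact mul_le_mul (hHb u hu) h7.le (abs_nonneg _) hC₁
      · rw [abs_of_nonneg (mul_nonneg hε.1.le (by linarith : 0 ≤ C₁ + 1))]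
    refine h8.trans_lt ?_
    have e1 : (C₁ + 1) * (η / (2 * (C₁ + 1))) = η / 2 := by field_simp
    have e2 : ε * (4 * (C₁ + 1)) < η := by rwa [lt_div_iff₀ (by positivity)] at h2
    have e3 : 0 < η / (2 * (C₁ + 1)) := by positivity
    nlinarith [hε.1]
  have hyc : ∀ᶠ ε in (U : Filter ℝ), ContinuousOn (y ε) (Icc a b) := by
    filter_upwards [hev] with ε hε
    have hYc : ContinuousOn (Y ε) (Icc a b) := fun u hu => ((hY ε hε.1).2 u hu).continuousWithinAt
    exact (hG.add continuousOn_const).add (hH.mul (((continuousOn_const.mul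
      (hYc.sup continuousOn_const)).add continuousOn_const).sqrt))
  have hZd := hasDerivWithinAt_of_tendstoUniformlyOn
    (hev.mono fun ε hε => (hY ε hε.1).2) hyc hyu hZt
  have hZa : Z a = 0 := by
    refine tendsto_nhds_unique (hZt a ⟨le_rfl, hab⟩) (hU0.congr' ?_)
    filter_upwards [hev] with ε hε using (hY ε hε.1).1.symm
  have hE : IsEnergy G H a b Z := ⟨hZa, hZd⟩
  -- The limit `Z` is itself a subsolution, hence lies below every regularized solution. A
  -- subsolution that starts below `Z` at `a'` then starts below all of them, and so stays below
  -- their limit.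
  have hle : ∀ ε ∈ Ioo (0 : ℝ) (1 / 2), ∀ u ∈ Icc a b, Z u ≤ Y ε u := fun ε hε =>
    le_regularized hHb hε.1 (hY ε hε.1).2 ⟨le_rfl, hab⟩ le_rfl hE.continuousOn
      (fun u hu => hasDerivWithinAt_Ici_of_Icc hu (hZd u ⟨hu.1, hu.2.le⟩))
      (by rw [hZa, (hY ε hε.1).1]; exact hε.1.le) (fun u _ => le_rfl)
  refine ⟨Z, hE, fun a' ha' b' hb' X x' hX hX' hXa hx' u hu => ?_⟩
  refine ge_of_tendsto (hZt u ⟨ha'.1.trans hu.1, hu.2.trans hb'⟩) ?_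
  filter_upwards [hev] with ε hε
  exact le_regularized hHb hε.1 (hY ε hε.1).2 ha' hb' hX hX' (hXa.trans (hle ε hε a' ha')) hx' u hu

theorem IsEnergy.mono_right {G H : ℝ → ℝ} {a b b' : ℝ} {Y : ℝ → ℝ} (h : IsEnergy G H a b Y)
    (hb : b' ≤ b) : IsEnergy G H a b' Y :=
  ⟨h.init, fun u hu => (h.deriv u ⟨hu.1, hu.2.trans hb⟩).mono (Icc_subset_Icc_right hb)⟩

theorem IsMaxEnergy.mono_right {G H : ℝ → ℝ} {a b b' : ℝ} {Y : ℝ → ℝ}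
    (h : IsMaxEnergy G H a b Y) (hb : b' ≤ b) : IsMaxEnergy G H a b' Y :=
  ⟨h.toIsEnergy.mono_right hb, fun a' ha' c hc => h.max a' ⟨ha'.1, ha'.2.trans hb⟩ c (hc.trans hb)⟩

theorem IsEnergy.hasDerivAt {G H : ℝ → ℝ} {a b : ℝ} {Y : ℝ → ℝ} (h : IsEnergy G H a b Y)
    {u : ℝ} (hu : u ∈ Ioo a b) : HasDerivAt Y (G u + H u * √(2 * Y u)) u :=
  (h.deriv u (Ioo_subset_Icc_self hu)).hasDerivAt (Icc_mem_nhds hu.1 hu.2)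

theorem IsEnergy.hasDerivWithinAt_Ici {G H : ℝ → ℝ} {a b : ℝ} {Y : ℝ → ℝ}
    (h : IsEnergy G H a b Y) {u : ℝ} (hu : u ∈ Ico a b) :
    HasDerivWithinAt Y (G u + H u * √(2 * Y u)) (Ici u) u :=
  hasDerivWithinAt_Ici_of_Icc hu (h.deriv u ⟨hu.1, hu.2.le⟩)

/-- The maximal solution is monotone in the coefficients and the left endpoint. -/
theorem IsMaxEnergy.le_of_le {G H G' H' : ℝ → ℝ} {a a' b : ℝ} {Y Y' : ℝ → ℝ}
    (h' : IsMaxEnergy G' H' a' b Y') (h : IsEnergy G H a b Y) (ha : a' ≤ a) (hab : a ≤ b)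
    (hYa : 0 ≤ Y' a) (hG : ∀ u ∈ Ico a b, G u ≤ G' u) (hH : ∀ u ∈ Ico a b, H u ≤ H' u) :
    ∀ u ∈ Icc a b, Y u ≤ Y' u :=
  h'.max a ⟨ha, hab⟩ b le_rfl Y _ h.continuousOn (fun _ hu => h.hasDerivWithinAt_Ici hu)
    (by rw [h.init]; exact hYa) fun u hu => add_le_add (hG u hu)
      (mul_le_mul_of_nonneg_right (hH u hu) (Real.sqrt_nonneg _))

/-- A linear lower barrier for `√(2 Y)`. -/
theorem IsMaxEnergy.barrier_le {G H : ℝ → ℝ} {a b b' k : ℝ} {Y : ℝ → ℝ}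
    (h : IsMaxEnergy G H a b Y) (hab : a ≤ b) (hb : b' ≤ b) (hk : 0 ≤ k)
    (hbar : ∀ u ∈ Ico a b', k ^ 2 * (u - a) ≤ G u + H u * (k * (u - a))) :
    ∀ u ∈ Icc a b', (k * (u - a)) ^ 2 / 2 ≤ Y u := by
  refine h.max a ⟨le_rfl, hab⟩ b' hb (fun u => (k * (u - a)) ^ 2 / 2)
    (fun u => k ^ 2 * (u - a)) (by fun_prop) (fun u _ => ?_) (by simp [h.init]) (fun u hu => ?_)
  · refine (((((hasDerivAt_id' u).sub_const a).const_mul k).pow 2).div_const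
      2).congr_deriv ?_ |>.hasDerivWithinAt
    norm_num
    ring
  · rw [show 2 * ((k * (u - a)) ^ 2 / 2) = (k * (u - a)) ^ 2 by ring,
      Real.sqrt_sq (mul_nonneg hk (by linarith [hu.1]))]
    exact hbar u hu

end TravelingWave

/-! ### Sign structure of an energy: positivity, first zero, descent after it. -/

namespace TravelingWave

theorem eventually_lt_left_of_hasDerivAt_pos {f : ℝ → ℝ} {f' x : ℝ} (h : HasDerivAt f f' x)
    (hf' : 0 < f') : ∀ᶠ y in 𝓝[<] x, f y < f x := by
  have hs := (hasDerivAt_iff_tendsto_slope.1 h).mono_left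
    (nhdsWithin_mono x (fun y (hy : y < x) => hy.ne))
  filter_upwards [hs.eventually (lt_mem_nhds hf'), self_mem_nhdsWithin] with y h1 hy
  rw [slope_def_field, div_pos_iff] at h1
  have hy' : y < x := hy
  rcases h1 with h1 | h1 <;> linarith [h1.1, h1.2]

theorem eventually_gt_right_of_hasDerivAt_pos {f : ℝ → ℝ} {f' x : ℝ} (h : HasDerivAt f f' x)
    (hf' : 0 < f') : ∀ᶠ y in 𝓝[>] x, f x < f y := by
  have hs := (hasDerivAt_iff_tendsto_slope.1 h).mono_left
    (nhdsWithin_mono x (fun y (hy : x < y) => hy.ne'))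
  filter_upwards [hs.eventually (lt_mem_nhds hf'), self_mem_nhdsWithin] with y h1 hy
  rw [slope_def_field, div_pos_iff] at h1
  have hy' : x < y := hy
  rcases h1 with h1 | h1 <;> linarith [h1.1, h1.2]

/-- The sign structure of the energy equation near a saddle `a`, a center-like equilibrium `m`,
and up to a right end `b`. -/
structure Hump (G H : ℝ → ℝ) (a m b : ℝ) : Prop where
  left_lt : a < m
  lt_right : m < b
  contG : ContinuousOn G (Icc a b)
  contH : ContinuousOn H (Icc a b)
  pos : ∀ u ∈ Ioo a m, 0 < G u
  neg : ∀ u ∈ Ioo m b, G u < 0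
  lin : ∃ γ > 0, ∃ δ > 0, ∀ u ∈ Ico a (a + δ), γ * (u - a) ≤ G u
  node : 0 ≤ H m → ∃ C γ : ℝ, 0 < γ ∧ ∀ᶠ u in 𝓝[<] m, γ * (m - u) ≤ G u ∧ -C * (m - u) ≤ H u

variable {G H H' : ℝ → ℝ} {a m b p x : ℝ} {Y Z : ℝ → ℝ}

/-- This is `w w' = G + H w` divided by `w = √(2 Y)`, which is legitimate only where `Y > 0`. -/
theorem IsEnergy.hasDerivAt_sqrt (hY : IsEnergy G H a b Y) {u : ℝ} (hu : u ∈ Ioo a b)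
    (hpos : 0 < Y u) : HasDerivAt (fun u => √(2 * Y u)) (G u / √(2 * Y u) + H u) u := by
  have h1 := ((hY.hasDerivAt hu).const_mul 2).sqrt (by linarith : 2 * Y u ≠ 0)
  refine h1.congr_deriv ?_
  have : 0 < √(2 * Y u) := Real.sqrt_pos.2 (by linarith)
  field_simp

namespace Hump

theorem le_right (h : Hump G H a m b) : a ≤ b := (h.left_lt.trans h.lt_right).le

/-- Since `G ≥ γ (u - a)` near `a`, the line `k (u - a)` is a subsolution for `√(2 Y)` as soon as
`k² + C k ≤ γ`, with `C` a bound of `|H|`. Maximality keeps the energy above it. -/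
theorem eventually_pos (h : Hump G H a m b) (hY : IsMaxEnergy G H a b Y) :
    ∀ᶠ u in 𝓝[>] a, 0 < Y u := by
  obtain ⟨γ, hγ, δ, hδ, hl⟩ := h.lin
  obtain ⟨C, hC⟩ := isCompact_Icc.exists_bound_of_continuousOn h.contH
  simp only [Real.norm_eq_abs] at hC
  have hC0 : 0 ≤ C := (abs_nonneg _).trans (hC a ⟨le_rfl, h.le_right⟩)
  obtain ⟨k, hk0, hk⟩ : ∃ k : ℝ, 0 < k ∧ k ^ 2 + C * k ≤ γ := by
    refine ⟨min 1 (γ / (1 + C)), by positivity, ?_⟩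
    have h1 := min_le_left 1 (γ / (1 + C))
    have h2 := min_le_right 1 (γ / (1 + C))
    have h0 : 0 < min 1 (γ / (1 + C)) := by positivity
    rw [le_div_iff₀ (by linarith)] at h2
    nlinarith
  have hb := hY.barrier_le h.le_right (b' := min b (a + δ)) (min_le_left _ _) hk0.le
    (fun u hu => by
      have hu1 : u < b := hu.2.trans_le (min_le_left _ _)
      have hu2 : u < a + δ := hu.2.trans_le (min_le_right _ _)
      have h1 := hl u ⟨hu.1, hu2⟩
      have h2 := (abs_le.1 (hC u ⟨hu.1, hu1.le⟩)).1
      have h3 : 0 ≤ u - a := by linarith [hu.1]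
      have h4 : 0 ≤ (H u + C) * (k * (u - a)) := by
        apply mul_nonneg; linarith; positivity
      nlinarith [mul_le_mul_of_nonneg_right hk h3])
  have hlt : a < min b (a + δ) := lt_min (h.left_lt.trans h.lt_right) (by linarith)
  filter_upwards [Ioo_mem_nhdsGT hlt] with u hu
  refine lt_of_lt_of_le ?_ (hb u (Ioo_subset_Icc_self hu))
  have : 0 < u - a := by linarith [hu.1]
  positivity

/-- Wherever `Y` vanishes the root term drops out and `Y' = G > 0`, so `Y` cannot come down to zero
before `m`. -/
theorem pos_left (h : Hump G H a m b) (hY : IsEnergy G H a b Y)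
    (hp : ∀ᶠ u in 𝓝[>] a, 0 < Y u) : ∀ u ∈ Ioo a m, 0 < Y u := by
  have hnn : ∀ u ∈ Ioo a m, 0 ≤ Y u := by
    intro u hu
    obtain ⟨v, hv, hva, hvu⟩ := (hp.and (Ioo_mem_nhdsGT hu.1)).exists
    have hsub : Icc v u ⊆ Icc a b := Icc_subset_Icc hva.le (hu.2.trans h.lt_right).le
    have := image_le_of_deriv_right_lt_deriv_boundary (f := fun x => - Y x) (B := 0) (B' := 0)
      (hY.continuousOn.neg.mono hsub) (fun x hx => (hY.hasDerivWithinAt_Ici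
        ⟨hva.le.trans hx.1, hx.2.trans (hu.2.trans h.lt_right)⟩).neg)
      (by simp only [Pi.zero_apply]; linarith)
      (fun x => hasDerivAt_const x 0) (fun x hx he => ?_) (right_mem_Icc.2 hvu.le)
    · simp only [Pi.zero_apply] at this; linarith
    · simp only [Pi.zero_apply, neg_eq_zero] at he ⊢
      rw [he]
      have := h.pos x ⟨hva.trans_le hx.1, hx.2.trans hu.2⟩
      simpa using this
  intro u hu
  refine (hnn u hu).lt_of_ne fun h0 => ?_
  have hd := hY.hasDerivAt ⟨hu.1, hu.2.trans h.lt_right⟩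
  rw [← h0] at hd
  have hpu := h.pos u hu
  obtain ⟨v, hv, hv1, hv2⟩ := ((eventually_lt_left_of_hasDerivAt_pos hd (by simpa using hpu)).and
    (Ioo_mem_nhdsLT hu.1)).exists
  rw [← h0] at hv
  linarith [hnn v ⟨hv1, hv2.trans hu.2⟩]

theorem nonneg_mid (h : Hump G H a m b) (hY : IsEnergy G H a b Y)
    (hp : ∀ᶠ u in 𝓝[>] a, 0 < Y u) : 0 ≤ Y m := by
  have hc := (hY.hasDerivAt ⟨h.left_lt, h.lt_right⟩).continuousAt.tendsto.mono_left
    (nhdsWithin_le_nhds (s := Iio m))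
  refine ge_of_tendsto hc ?_
  filter_upwards [Ioo_mem_nhdsLT h.left_lt] with u hu using (h.pos_left hY hp u hu).le

/-- If `H m ≥ 0`, the bounds in `node` give `Y' ≥ (γ - C √(2 Y)) (m - u)` near `m`, which is
nonnegative because `√(2 Y)` is small there. Then `Y` would be nondecreasing up to `Y m = 0`,
against its positivity on the left. -/
theorem neg_of_mid_eq_zero (h : Hump G H a m b) (hY : IsEnergy G H a b Y)
    (hp : ∀ᶠ u in 𝓝[>] a, 0 < Y u) (h0 : Y m = 0) : H m < 0 := by
  by_contra hH
  obtain ⟨C, γ, hγ, hev⟩ := h.node (not_lt.1 hH)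
  have hc : Tendsto (fun u => √(2 * Y u)) (𝓝[<] m) (𝓝 0) := by
    have hc := (hY.hasDerivAt ⟨h.left_lt, h.lt_right⟩).continuousAt.tendsto.mono_left
      (nhdsWithin_le_nhds (s := Iio m))
    have := (hc.const_mul 2).sqrt
    simpa [h0] using this
  have hsm : ∀ᶠ u in 𝓝[<] m, √(2 * Y u) < γ / (|C| + 1) :=
    hc.eventually (gt_mem_nhds (by positivity))
  have hall := (hev.and hsm).and (Ioo_mem_nhdsLT h.left_lt)
  obtain ⟨l, hl, hlm⟩ := (mem_nhdsLT_iff_exists_Ioo_subset' h.left_lt).1 hall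
  have hl' : l < m := hl
  obtain ⟨v, hv1, hv2⟩ := exists_between hl'
  have hva : a < v := (hlm ⟨hv1, hv2⟩).2.1
  have hmono : MonotoneOn Y (Icc v m) := by
    refine monotoneOn_of_hasDerivWithinAt_nonneg (convex_Icc v m)
      (f' := fun u => G u + H u * √(2 * Y u))
      (hY.continuousOn.mono (Icc_subset_Icc hva.le h.lt_right.le)) (fun u hu => ?_)
      (fun u hu => ?_) <;> rw [interior_Icc] at hu
    · exact (hY.hasDerivAt ⟨hva.trans hu.1, hu.2.trans h.lt_right⟩).hasDerivWithinAt
    · obtain ⟨⟨⟨h1, h2⟩, h3⟩, -⟩ := hlm ⟨hv1.trans hu.1, hu.2⟩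
      rw [lt_div_iff₀ (by positivity)] at h3
      have h4 := Real.sqrt_nonneg (2 * Y u)
      have h5 : 0 < m - u := by linarith [hu.2]
      have h6 := mul_le_mul_of_nonneg_right h2 h4
      have h7 : C * √(2 * Y u) ≤ γ := by nlinarith [le_abs_self C]
      have h8 := mul_le_mul_of_nonneg_right h7 h5.le
      nlinarith
  have := hmono ⟨le_rfl, hv2.le⟩ ⟨hv2.le, le_rfl⟩ hv2.le
  linarith [h.pos_left hY hp v ⟨hva, hv2⟩]

/-- To the right of `m` the slope at a zero is `G < 0`, so the energy cannot rise through zero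
again. A zero at `m` itself needs a separate argument: there `H m < 0`, and both terms of `Y'` are
nonpositive just after `m`. -/
theorem nonpos_after (h : Hump G H a m b) (hY : IsEnergy G H a b Y)
    (hp : ∀ᶠ u in 𝓝[>] a, 0 < Y u) (hpm : p ∈ Icc m b) (h0 : Y p ≤ 0) :
    ∀ u ∈ Icc p b, Y u ≤ 0 := by
  have main : ∀ q, m < q → Y q ≤ 0 → ∀ u ∈ Icc q b, Y u ≤ 0 := by
    intro q hq hq0 u hu
    have haq := h.left_lt.trans hq
    refine image_le_of_deriv_right_lt_deriv_boundary (f := Y) (B := 0) (B' := 0)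
      (hY.continuousOn.mono (Icc_subset_Icc_left haq.le))
      (fun x hx => hY.hasDerivWithinAt_Ici ⟨haq.le.trans hx.1, hx.2⟩) hq0
      (fun x => hasDerivAt_const x 0) (fun x hx he => ?_) hu
    simp only [Pi.zero_apply] at he ⊢
    rw [he]
    have := h.neg x ⟨hq.trans_le hx.1, hx.2⟩
    simpa using this
  rcases hpm.1.lt_or_eq with hlt | rfl
  · exact main p hlt h0
  have h0' : Y m = 0 := le_antisymm h0 (h.nonneg_mid hY hp)
  have hH := h.neg_of_mid_eq_zero hY hp h0'
  have hHc : ∀ᶠ u in 𝓝[>] m, H u < 0 :=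
    ((h.contH.continuousAt (Icc_mem_nhds h.left_lt h.lt_right)).tendsto.eventually
      (gt_mem_nhds hH)).filter_mono nhdsWithin_le_nhds
  obtain ⟨r, hr, hrm⟩ := (mem_nhdsGT_iff_exists_Ioo_subset' h.lt_right).1
    (hHc.and (Ioo_mem_nhdsGT h.lt_right))
  have hr' : m < r := hr
  have hsmall : ∀ q ∈ Ioo m r, Y q ≤ 0 := by
    intro q hq
    have hqb := (hrm hq).2.2
    have hanti : AntitoneOn Y (Icc m q) := by
      refine antitoneOn_of_hasDerivWithinAt_nonpos (convex_Icc m q)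
        (f' := fun u => G u + H u * √(2 * Y u))
        (hY.continuousOn.mono (Icc_subset_Icc h.left_lt.le hqb.le)) (fun u hu => ?_)
        (fun u hu => ?_) <;> rw [interior_Icc] at hu
      · exact (hY.hasDerivAt ⟨h.left_lt.trans hu.1, hu.2.trans hqb⟩).hasDerivWithinAt
      · have h1 := h.neg u ⟨hu.1, hu.2.trans hqb⟩
        have h2 := (hrm ⟨hu.1, hu.2.trans hq.2⟩).1
        have h3 := Real.sqrt_nonneg (2 * Y u)
        nlinarith
    exact (hanti ⟨le_rfl, hq.1.le⟩ ⟨hq.1.le, le_rfl⟩ hq.1.le).trans h0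
  intro u hu
  rcases hu.1.lt_or_eq with hlt | rfl
  · obtain ⟨q, hq1, hq2⟩ := exists_between (lt_min hlt hr')
    exact main q hq1 (hsmall q ⟨hq1, hq2.trans_le (min_le_right _ _)⟩) u
      ⟨(hq2.trans_le (min_le_left _ _)).le, hu.2⟩
  · exact h0

/-- Where `Y ≤ 0` the root is zero and `Y' = G < 0`. Because of this, the value at `b` records the
position of the first zero. -/
theorem strictAntiOn_after (h : Hump G H a m b) (hY : IsEnergy G H a b Y)
    (hp : ∀ᶠ u in 𝓝[>] a, 0 < Y u) (hpm : p ∈ Icc m b) (h0 : Y p ≤ 0) :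
    StrictAntiOn Y (Icc p b) := by
  have hn := h.nonpos_after hY hp hpm h0
  refine strictAntiOn_of_hasDerivWithinAt_neg (convex_Icc p b)
    (f' := fun u => G u + H u * √(2 * Y u))
    (hY.continuousOn.mono (Icc_subset_Icc_left (h.left_lt.le.trans hpm.1))) (fun u hu => ?_)
    (fun u hu => ?_) <;> rw [interior_Icc] at hu
  · exact (hY.hasDerivAt ⟨(h.left_lt.trans_le hpm.1).trans hu.1, hu.2⟩).hasDerivWithinAt
  · rw [Real.sqrt_eq_zero_of_nonpos (by linarith [hn u (Ioo_subset_Icc_self hu)]), mul_zero,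
      add_zero]
    exact h.neg u ⟨hpm.1.trans_lt hu.1, hu.2⟩

/-- Either `Y` is positive up to `b`, or it has a first zero `p`. -/
theorem pos_or_crossing (h : Hump G H a m b) (hY : IsEnergy G H a b Y)
    (hp : ∀ᶠ u in 𝓝[>] a, 0 < Y u) :
    ((∀ u ∈ Ioo a b, 0 < Y u) ∧ 0 ≤ Y b) ∨
      ∃ p ∈ Ico m b, (∀ u ∈ Ioo a p, 0 < Y u) ∧ Y p = 0 ∧ Y b < 0 := by
  by_cases hall : ∀ u ∈ Ioo a b, 0 < Y u
  · refine Or.inl ⟨hall, ?_⟩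
    have hc : ContinuousWithinAt Y (Iio b) b :=
      (hY.continuousOn b ⟨h.le_right, le_rfl⟩).mono_of_mem_nhdsWithin
        (mem_of_superset (Ioo_mem_nhdsLT (h.left_lt.trans h.lt_right)) Ioo_subset_Icc_self)
    refine ge_of_tendsto hc ?_
    filter_upwards [Ioo_mem_nhdsLT (h.left_lt.trans h.lt_right)] with u hu using (hall u hu).le
  · push Not at hall
    obtain ⟨v, hv, hv0⟩ := hall
    have hmv : m ≤ v := by
      by_contra hlt
      exact absurd (h.pos_left hY hp v ⟨hv.1, not_le.1 hlt⟩) (not_lt.2 hv0)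
    have hc : ContinuousOn Y (Icc m v) :=
      hY.continuousOn.mono (Icc_subset_Icc h.left_lt.le hv.2.le)
    set S := Icc m v ∩ Y ⁻¹' Iic 0
    have hS : IsCompact S :=
      isCompact_Icc.of_isClosed_subset (hc.preimage_isClosed_of_isClosed isClosed_Icc isClosed_Iic)
        inter_subset_left
    have hne : S.Nonempty := ⟨v, ⟨hmv, le_rfl⟩, hv0⟩
    obtain ⟨p, hpS, hpmin⟩ := hS.exists_isLeast hne
    have hpb : p < b := hpS.1.2.trans_lt hv.2
    have hpos : ∀ u ∈ Ioo a p, 0 < Y u := by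
      intro u hu
      rcases lt_or_ge u m with hum | hum
      · exact h.pos_left hY hp u ⟨hu.1, hum⟩
      · by_contra hneg
        exact absurd (hpmin ⟨⟨hum, hu.2.le.trans hpS.1.2⟩, not_lt.1 hneg⟩) (not_le.2 hu.2)
    have hap := h.left_lt.trans_le hpS.1.1
    have hp0 : Y p = 0 := by
      refine le_antisymm hpS.2 ?_
      refine ge_of_tendsto ((hY.hasDerivAt ⟨hap, hpb⟩).continuousAt.tendsto.mono_left
        (nhdsWithin_le_nhds (s := Iio p))) ?_
      filter_upwards [Ioo_mem_nhdsLT hap] with u hu using (hpos u hu).le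
    refine Or.inr ⟨p, ⟨hpS.1.1, hpb⟩, hpos, hp0, ?_⟩
    have := h.strictAntiOn_after hY hp ⟨hpS.1.1, hpb.le⟩ hp0.le ⟨le_rfl, hpb.le⟩ ⟨hpb.le, le_rfl⟩ hpb
    linarith

theorem exists_crossing (h : Hump G H a m b) (hY : IsEnergy G H a b Y)
    (hp : ∀ᶠ u in 𝓝[>] a, 0 < Y u) (hb : Y b < 0) :
    ∃ p ∈ Ico m b, (∀ u ∈ Ioo a p, 0 < Y u) ∧ Y p = 0 := by
  rcases h.pos_or_crossing hY hp with h1 | ⟨p, hp1, hp2, hp3, -⟩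
  · linarith [h1.2]
  · exact ⟨p, hp1, hp2, hp3⟩

theorem pos_of_nonneg (h : Hump G H a m b) (hY : IsEnergy G H a b Y)
    (hp : ∀ᶠ u in 𝓝[>] a, 0 < Y u) (hb : 0 ≤ Y b) : ∀ u ∈ Ioo a b, 0 < Y u := by
  rcases h.pos_or_crossing hY hp with h1 | ⟨p, hp1, hp2, hp3, h4⟩
  · exact h1.1
  · linarith

end Hump

/-- Two energies that are nonpositive on `[p, b]` differ by a constant there. -/
theorem sub_eq_sub_of_nonpos (hY : IsEnergy G H a b Y) (hZ : IsEnergy G H' a b Z) (hap : a ≤ p)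
    (hYn : ∀ u ∈ Icc p b, Y u ≤ 0) (hZn : ∀ u ∈ Icc p b, Z u ≤ 0) :
    ∀ u ∈ Icc p b, Y u - Z u = Y p - Z p := by
  have hsub : Icc p b ⊆ Icc a b := Icc_subset_Icc_left hap
  refine constant_of_has_deriv_right_zero (f := fun u => Y u - Z u)
    ((hY.continuousOn.sub hZ.continuousOn).mono hsub)
    (fun u hu => ?_)
  have h1 := hY.hasDerivWithinAt_Ici ⟨hap.trans hu.1, hu.2⟩
  have h2 := hZ.hasDerivWithinAt_Ici ⟨hap.trans hu.1, hu.2⟩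
  have e1 : √(2 * Y u) = 0 := Real.sqrt_eq_zero_of_nonpos (by linarith [hYn u ⟨hu.1, hu.2.le⟩])
  have e2 : √(2 * Z u) = 0 := Real.sqrt_eq_zero_of_nonpos (by linarith [hZn u ⟨hu.1, hu.2.le⟩])
  refine (h1.sub h2).congr_deriv ?_
  rw [e1, e2]; ring

end TravelingWave

/-! ### Uniqueness and comparison of energies; the pair of energies for `±H`. -/

namespace TravelingWave

variable {G H H' : ℝ → ℝ} {a m b p x : ℝ} {Y Z : ℝ → ℝ}

theorem tendsto_sqrt_energy (hY : IsEnergy G H a b Y) (hab : a < b) :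
    Tendsto (fun u => √(2 * Y u)) (𝓝[>] a) (𝓝 0) := by
  have hc : ContinuousWithinAt Y (Ioi a) a :=
    (hY.continuousOn a ⟨le_rfl, hab.le⟩).mono_of_mem_nhdsWithin
      (mem_of_superset (Ioo_mem_nhdsGT hab) Ioo_subset_Icc_self)
  have h2 : Tendsto Y (𝓝[>] a) (𝓝 0) := by rw [← hY.init]; exact hc
  simpa using (h2.const_mul 2).sqrt

/-- Two ordered energies that are positive on `[p, x]` and agree at `p` agree on `[p, x]`. -/
theorem eq_of_pos_of_eq (hH : ContinuousOn H (Icc a b)) (hY : IsEnergy G H a b Y)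
    (hZ : IsEnergy G H a b Z)
    (hap : a ≤ p) (hxb : x ≤ b) (hle : ∀ u ∈ Icc p x, Z u ≤ Y u) (hpos : ∀ u ∈ Icc p x, 0 < Z u)
    (hp : Y p = Z p) : ∀ u ∈ Icc p x, Y u = Z u := by
  intro u hu
  have hpx : p ≤ x := hu.1.trans hu.2
  have hsub : Icc p x ⊆ Icc a b := Icc_subset_Icc hap hxb
  obtain ⟨C, hC⟩ := isCompact_Icc.exists_bound_of_continuousOn hH
  simp only [Real.norm_eq_abs] at hC
  obtain ⟨v, hv, hvmin⟩ := isCompact_Icc.exists_isMinOn ⟨p, left_mem_Icc.2 hpx⟩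
    (hZ.continuousOn.mono hsub)
  set ζ := √(2 * Z v)
  have hζ : 0 < ζ := Real.sqrt_pos.2 (by linarith [hpos v hv])
  have := eq_zero_of_abs_deriv_le_mul_abs_self_of_eq_zero_right
    (f := fun u => Y u - Z u) (K := |C| / ζ)
    (f' := fun u => (G u + H u * √(2 * Y u)) - (G u + H u * √(2 * Z u)))
    ((hY.continuousOn.sub hZ.continuousOn).mono hsub)
    (fun u hu => (hY.hasDerivWithinAt_Ici ⟨hap.trans hu.1, hu.2.trans_le hxb⟩).sub
      (hZ.hasDerivWithinAt_Ici ⟨hap.trans hu.1, hu.2.trans_le hxb⟩))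
    (by rw [hp, sub_self]) (fun u hu => ?_) u hu
  · linarith
  have hu' : u ∈ Icc p x := ⟨hu.1, hu.2.le⟩
  have h1 : ζ ≤ √(2 * Z u) := Real.sqrt_le_sqrt (by have : Z v ≤ Z u := hvmin hu'; linarith)
  have h2 : √(2 * Z u) ≤ √(2 * Y u) := Real.sqrt_le_sqrt (by linarith [hle u hu'])
  have e1 := Real.sq_sqrt (show 0 ≤ 2 * Z u by linarith [hpos u hu'])
  have e2 := Real.sq_sqrt (show 0 ≤ 2 * Y u by linarith [hpos u hu', hle u hu'])
  rw [Real.norm_eq_abs, Real.norm_eq_abs, add_sub_add_left_eq_sub, ← mul_sub, abs_mul,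
    abs_of_nonneg (sub_nonneg.2 h2), abs_of_nonneg (sub_nonneg.2 (hle u hu')),
    div_mul_eq_mul_div, le_div_iff₀ hζ, mul_assoc]
  refine mul_le_mul ((hC u (hsub hu')).trans (le_abs_self C)) ?_
    (mul_nonneg (sub_nonneg.2 h2) hζ.le) (abs_nonneg C)
  nlinarith [mul_nonneg (sub_nonneg.2 h2) (sub_nonneg.2 h1)]

namespace Hump

/-- Uniqueness of the energy that is positive near `a`. -/
theorem eqOn_of_pos (h : Hump G H a m b) (hY : IsMaxEnergy G H a b Y) (hZ : IsEnergy G H a b Z)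
    (hp : ∀ᶠ u in 𝓝[>] a, 0 < Z u) : EqOn Z Y (Icc a b) := by
  have hle : ∀ u ∈ Icc a b, Z u ≤ Y u :=
    hY.max a ⟨le_rfl, h.le_right⟩ b le_rfl Z _ hZ.continuousOn
      (fun u hu => hZ.hasDerivWithinAt_Ici hu) (by rw [hZ.init, hY.init]) fun _ _ => le_rfl
  have hpY := h.eventually_pos hY
  have hleft : ∀ u ∈ Ioo a m, Y u = Z u := by
    intro u hu
    have hd : ∀ v ∈ Ioo a m, HasDerivAt (fun u => √(2 * Y u) - √(2 * Z u))
        ((G v / √(2 * Y v) + H v) - (G v / √(2 * Z v) + H v)) v := fun v hv =>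
      (hY.hasDerivAt_sqrt ⟨hv.1, hv.2.trans h.lt_right⟩ (h.pos_left hY.toIsEnergy hpY v hv)).sub
        (hZ.hasDerivAt_sqrt ⟨hv.1, hv.2.trans h.lt_right⟩ (h.pos_left hZ hp v hv))
    -- To the left of `m`, where `G > 0`, the difference of the roots has slope `G (1 / √(2 Y) - 1 /
    -- √(2 Z)) ≤ 0`. It tends to zero at `a`, so it is nonpositive.
    have hanti : AntitoneOn (fun u => √(2 * Y u) - √(2 * Z u)) (Ioo a m) := by
      refine antitoneOn_of_hasDerivWithinAt_nonpos (convex_Ioo a m)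
        (fun v hv => (hd v hv).continuousAt.continuousWithinAt)
        (fun v hv => ?_) (fun v hv => ?_) (f' := fun v =>
          (G v / √(2 * Y v) + H v) - (G v / √(2 * Z v) + H v)) <;> rw [interior_Ioo] at hv
      · exact (hd v hv).hasDerivWithinAt
      · have h1 : 0 < √(2 * Z v) := Real.sqrt_pos.2 (by linarith [h.pos_left hZ hp v hv])
        have h2 : √(2 * Z v) ≤ √(2 * Y v) := Real.sqrt_le_sqrt
          (by linarith [hle v ⟨hv.1.le, (hv.2.trans h.lt_right).le⟩])
        have := div_le_div_of_nonneg_left (h.pos v hv).le h1 h2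
        linarith
    have hlim : Tendsto (fun u => √(2 * Y u) - √(2 * Z u)) (𝓝[>] a) (𝓝 0) := by
      have := (tendsto_sqrt_energy hY.toIsEnergy (h.left_lt.trans h.lt_right)).sub
        (tendsto_sqrt_energy hZ (h.left_lt.trans h.lt_right))
      simpa using this
    have hd0 : √(2 * Y u) - √(2 * Z u) ≤ 0 := by
      refine ge_of_tendsto hlim ?_
      filter_upwards [Ioo_mem_nhdsGT hu.1] with v hv
      exact hanti ⟨hv.1, hv.2.trans hu.2⟩ hu hv.2.le
    have hzpos := h.pos_left hZ hp u hu
    have h1 : 2 * Y u ≤ 2 * Z u :=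
      (Real.sqrt_le_sqrt_iff (by linarith)).1 (by linarith)
    linarith [hle u ⟨hu.1.le, (hu.2.trans h.lt_right).le⟩]
  have hmid : Y m = Z m := by
    have c1 := (hY.hasDerivAt ⟨h.left_lt, h.lt_right⟩).continuousAt.tendsto.mono_left
      (nhdsWithin_le_nhds (s := Iio m))
    have c2 := (hZ.hasDerivAt ⟨h.left_lt, h.lt_right⟩).continuousAt.tendsto.mono_left
      (nhdsWithin_le_nhds (s := Iio m))
    refine tendsto_nhds_unique c1 (c2.congr' ?_)
    filter_upwards [Ioo_mem_nhdsLT h.left_lt] with u hu using (hleft u hu).symm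
  -- Past `m` the sign of `G` no longer helps, but before its first zero `q` the energy is positive,
  -- and there the equation is locally Lipschitz. The point `q` itself is reached by continuity.
  have hlt : ∀ q, m < q → q ≤ b → (∀ u ∈ Ioo a q, 0 < Z u) → ∀ u ∈ Icc m q, Y u = Z u := by
    intro q hmq hqb hzp
    have hI : ∀ u ∈ Ioo m q, Y u = Z u := by
      intro u hu
      have hzm : 0 < Z m := hzp m ⟨h.left_lt, hmq⟩
      refine eq_of_pos_of_eq h.contH hY.toIsEnergy hZ h.left_lt.le (hu.2.le.trans hqb)
        (fun v hv => hle v ⟨h.left_lt.le.trans hv.1, hv.2.trans (hu.2.le.trans hqb)⟩)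
        (fun v hv => hzp v ⟨h.left_lt.trans_le hv.1, hv.2.trans_lt hu.2⟩) hmid u
        ⟨hu.1.le, le_rfl⟩
    intro u hu
    rcases hu.2.lt_or_eq with h1 | rfl
    · rcases hu.1.lt_or_eq with h2 | rfl
      · exact hI u ⟨h2, h1⟩
      · exact hmid
    · have haq := h.left_lt.trans hmq
      have hmem : Icc a b ∈ 𝓝[<] u :=
        mem_of_superset (Ioo_mem_nhdsLT haq) fun v hv => ⟨hv.1.le, hv.2.le.trans hqb⟩
      have c1 := (hY.continuousOn u ⟨haq.le, hqb⟩).mono_of_mem_nhdsWithin hmem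
      have c2 := (hZ.continuousOn u ⟨haq.le, hqb⟩).mono_of_mem_nhdsWithin hmem
      refine tendsto_nhds_unique c1.tendsto (c2.tendsto.congr' ?_)
      filter_upwards [Ioo_mem_nhdsLT hmq] with v hv using (hI v hv).symm
  have hall : ∀ u ∈ Icc m b, Y u = Z u := by
    rcases h.pos_or_crossing hZ hp with h1 | ⟨p, hpm, hp1, hp2, -⟩
    · exact hlt b h.lt_right le_rfl h1.1
    · have hYp : Y p = Z p := by
        rcases hpm.1.lt_or_eq with h1 | rfl
        · exact hlt p h1 hpm.2.le hp1 p ⟨h1.le, le_rfl⟩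
        · exact hmid
      intro u hu
      rcases le_total u p with hup | hup
      · rcases hpm.1.lt_or_eq with h1 | rfl
        · exact hlt p h1 hpm.2.le hp1 u ⟨hu.1, hup⟩
        · rw [le_antisymm hup hu.1]; exact hmid
      · have := sub_eq_sub_of_nonpos hY.toIsEnergy hZ (h.left_lt.le.trans hpm.1)
          (h.nonpos_after hY.toIsEnergy hpY ⟨hpm.1, hpm.2.le⟩ (by rw [hYp, hp2]))
          (h.nonpos_after hZ hp ⟨hpm.1, hpm.2.le⟩ hp2.le) u ⟨hup, hu.2⟩
        linarith
  intro u hu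
  rcases lt_or_ge u m with hum | hum
  · rcases hu.1.lt_or_eq with h1 | rfl
    · exact (hleft u ⟨h1, hum⟩).symm
    · rw [hZ.init, hY.init]
  · exact (hall u ⟨hum, hu.2⟩).symm

/-- Strict monotonicity in `H`, at a first zero. -/
theorem pos_of_lt (h : Hump G H a m b) (hY : IsEnergy G H a b Y)
    (hY' : IsMaxEnergy G H' a b Z) (hH : ∀ u ∈ Ico a b, H u < H' u)
    (hpm : p ∈ Ioc m b) (hpos : ∀ u ∈ Ioo a p, 0 < Y u) (hp0 : Y p = 0) : 0 < Z p := by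
  have hle : ∀ u ∈ Icc a b, Y u ≤ Z u := hY'.le_of_le hY le_rfl h.le_right
    (by rw [hY'.init]) (fun _ _ => le_rfl) fun u hu => (hH u hu).le
  obtain ⟨y, hy1, hy2⟩ := exists_between hpm.1
  have hyI : y ∈ Ioo a b := ⟨h.left_lt.trans hy1, hy2.trans_le hpm.2⟩
  have hypos := hpos y ⟨hyI.1, hy2⟩
  -- Equality at `y` would be an interior minimum of `Z - Y`, although the slope there is `(H' - H)
  -- √(2 Z) > 0`.
  have hlt : Y y < Z y := by
    refine (hle y (Ioo_subset_Icc_self hyI)).lt_of_ne fun he => ?_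
    have hd := (hY'.hasDerivAt hyI).sub (hY.hasDerivAt hyI)
    have hmin : IsLocalMin (Z - Y) y := by
      filter_upwards [Ioo_mem_nhds hyI.1 hyI.2] with u hu
      simp only [Pi.sub_apply, he, sub_self]
      linarith [hle u (Ioo_subset_Icc_self hu)]
    have h0 := hmin.hasDerivAt_eq_zero hd
    rw [he] at h0
    have := mul_lt_mul_of_pos_right (hH y ⟨hyI.1.le, hyI.2⟩)
      (Real.sqrt_pos.2 (by linarith : 0 < 2 * Z y))
    linarith
  have hap := h.left_lt.trans hpm.1
  have hsub : Icc y p ⊆ Icc a b := Icc_subset_Icc hyI.1.le hpm.2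
  -- On `[y, p]` one has `G < 0`, so a larger root has a larger slope `G / √(2 Z) + H'`. The gap
  -- present at `y` cannot close before `p`.
  have hmono : MonotoneOn (fun u => √(2 * Z u) - √(2 * Y u)) (Icc y p) := by
    refine monotoneOn_of_hasDerivWithinAt_nonneg (convex_Icc y p)
      (f' := fun v => (G v / √(2 * Z v) + H' v) - (G v / √(2 * Y v) + H v)) ?_
      (fun v hv => ?_) (fun v hv => ?_)
    · exact (((continuousOn_const.mul hY'.continuousOn).sqrt).sub
        (continuousOn_const.mul hY.continuousOn).sqrt).mono hsub
    all_goals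
      rw [interior_Icc] at hv
      have hvp := hpos v ⟨hyI.1.trans hv.1, hv.2⟩
      have hvI : v ∈ Ioo a b := ⟨hyI.1.trans hv.1, hv.2.trans_le hpm.2⟩
      have hvle := hle v (Ioo_subset_Icc_self hvI)
    · exact ((hY'.hasDerivAt_sqrt hvI (by linarith)).sub
        (hY.hasDerivAt_sqrt hvI hvp)).hasDerivWithinAt
    · have h1 : 0 < √(2 * Y v) := Real.sqrt_pos.2 (by linarith)
      have h2 : √(2 * Y v) ≤ √(2 * Z v) := Real.sqrt_le_sqrt (by linarith)
      have h3 := div_le_div_of_nonneg_left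
        (by linarith [h.neg v ⟨hy1.trans hv.1, hvI.2⟩] : 0 ≤ - G v) h1 h2
      rw [neg_div, neg_div] at h3
      linarith [hH v ⟨hvI.1.le, hvI.2⟩]
  have h1 := hmono ⟨le_rfl, hy2.le⟩ ⟨hy2.le, le_rfl⟩ hy2.le
  simp only [hp0, mul_zero, Real.sqrt_zero, sub_zero] at h1
  have h2 : √(2 * Y y) < √(2 * Z y) := Real.sqrt_lt_sqrt (by linarith) (by linarith)
  have h3 : 0 < √(2 * Z p) := by linarith
  linarith [Real.sqrt_pos.1 h3]

/-- At most one of the two energies for `±H` vanishes at `m`. -/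
theorem mid_pos (h : Hump G H a m b) (hY : IsEnergy G H a b Y)
    (h' : Hump G H' a m b) (hZ : IsEnergy G H' a b Z) (hH : ∀ u ∈ Icc a b, H' u = - H u)
    (hp : ∀ᶠ u in 𝓝[>] a, 0 < Y u) (hq : ∀ᶠ u in 𝓝[>] a, 0 < Z u) : 0 < Y m ∨ 0 < Z m := by
  have hmI : m ∈ Ioo a b := ⟨h.left_lt, h.lt_right⟩
  have h1 := h.nonneg_mid hY hp
  have h2 := h'.nonneg_mid hZ hq
  by_contra hcon
  push Not at hcon
  have e1 := h.neg_of_mid_eq_zero hY hp (le_antisymm hcon.1 h1)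
  have e2 := h'.neg_of_mid_eq_zero hZ hq (le_antisymm hcon.2 h2)
  rw [hH m (Ioo_subset_Icc_self hmI)] at e2
  linarith

/-- The two energies for `±H` cannot both stay positive when `∫ G` is very negative. -/
theorem sq_sum_le (h : Hump G H a m b) (hY : IsEnergy G H a b Y)
    (hZ : IsEnergy G H' a b Z) (hH : ∀ u ∈ Icc a b, H' u = - H u)
    (hpos : ∀ u ∈ Ioo a b, 0 < Y u) (hpos' : ∀ u ∈ Ioo a b, 0 < Z u) (hx : x ∈ Ioo m b) :
    -(8 * ∫ s in m..x, G s) ≤ (√(2 * Y m) + √(2 * Z m)) ^ 2 := by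
  set S := fun u => √(2 * Y u) + √(2 * Z u)
  have hmI : m ∈ Ioo a b := ⟨h.left_lt, h.lt_right⟩
  have hsub : Icc m x ⊆ Ioo a b := fun u hu => ⟨h.left_lt.trans_le hu.1, hu.2.trans_lt hx.2⟩
  have hGc : ContinuousOn G (Icc m x) := h.contG.mono (hsub.trans Ioo_subset_Icc_self)
  have hSd : ∀ u ∈ Ioo a b, HasDerivAt S (G u / √(2 * Y u) + G u / √(2 * Z u)) u := by
    intro u hu
    refine ((hY.hasDerivAt_sqrt hu (hpos u hu)).add
      (hZ.hasDerivAt_sqrt hu (hpos' u hu))).congr_deriv ?_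
    rw [hH u (Ioo_subset_Icc_self hu)]; ring
  have hId : ∀ u ∈ Ioo m x, HasDerivAt (fun v => ∫ s in m..v, G s) (G u) u := by
    intro u hu
    exact intervalIntegral.integral_hasDerivAt_right
      ((hGc.mono (Icc_subset_Icc_right hu.2.le)).intervalIntegrable_of_Icc hu.1.le)
      ((hGc.mono Ioo_subset_Icc_self).stronglyMeasurableAtFilter isOpen_Ioo u hu)
      (hGc.continuousAt (Icc_mem_nhds hu.1 hu.2))
  -- In `S' = G / A + G / B`, with `A`, `B` the two roots, the terms in `H` have cancelled. Since
  -- `(A + B) (1 / A + 1 / B) ≥ 4` and `G < 0`, this gives `(S²)' ≤ 8 G`.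
  have hanti : AntitoneOn (fun u => S u ^ 2 - 8 * ∫ s in m..u, G s) (Icc m x) := by
    refine antitoneOn_of_hasDerivWithinAt_nonpos (convex_Icc m x)
      (f' := fun u => 2 * S u * (G u / √(2 * Y u) + G u / √(2 * Z u)) - 8 * G u) ?_
      (fun u hu => ?_) (fun u hu => ?_)
    · refine ContinuousOn.sub (ContinuousOn.pow (fun u hu =>
        (hSd u (hsub hu)).continuousAt.continuousWithinAt) 2) (continuousOn_const.mul ?_)
      have := intervalIntegral.continuousOn_primitive_interval' (a := m) (b₁ := m) (b₂ := x)
        (f := G) (μ := volume) (hGc.intervalIntegrable_of_Icc hx.1.le) left_mem_uIcc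
      rwa [uIcc_of_le hx.1.le] at this
    all_goals rw [interior_Icc] at hu
    · refine ((((hSd u (hsub (Ioo_subset_Icc_self hu))).pow 2).sub
        ((hId u hu).const_mul 8)).congr_deriv ?_).hasDerivWithinAt
      norm_num
    · have hu' := hsub (Ioo_subset_Icc_self hu)
      have h1 : 0 < √(2 * Y u) := Real.sqrt_pos.2 (by linarith [hpos u hu'])
      have h2 : 0 < √(2 * Z u) := Real.sqrt_pos.2 (by linarith [hpos' u hu'])
      have hG := h.neg u ⟨hu.1, hu'.2⟩
      simp only [S]
      set A := √(2 * Y u)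
      set B := √(2 * Z u)
      have e : 2 * (A + B) * (G u / A + G u / B) - 8 * G u = 2 * G u * ((A - B) ^ 2 / (A * B)) := by
        field_simp; ring
      rw [e]
      have : 0 ≤ (A - B) ^ 2 / (A * B) := by positivity
      nlinarith
  have h1 := hanti ⟨le_rfl, hx.1.le⟩ ⟨hx.1.le, le_rfl⟩ hx.1.le
  simp only [intervalIntegral.integral_same, mul_zero, sub_zero] at h1
  nlinarith [sq_nonneg (S x)]

/-- If the energies for `±H` agree and are negative at `b`, their first zeros coincide. -/
theorem exists_common_crossing (h : Hump G H a m b) (hY : IsEnergy G H a b Y)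
    (h' : Hump G H' a m b) (hZ : IsEnergy G H' a b Z) (hH : ∀ u ∈ Icc a b, H' u = - H u)
    (hp : ∀ᶠ u in 𝓝[>] a, 0 < Y u) (hq : ∀ᶠ u in 𝓝[>] a, 0 < Z u) (he : Y b = Z b)
    (hb : Y b < 0) : ∃ p ∈ Ioo m b, (∀ u ∈ Ioo a p, 0 < Y u) ∧ (∀ u ∈ Ioo a p, 0 < Z u) ∧
      Y p = 0 ∧ Z p = 0 := by
  obtain ⟨p, hpm, hp1, hp2⟩ := h.exists_crossing hY hp hb
  obtain ⟨q, hqm, hq1, hq2⟩ := h'.exists_crossing hZ hq (he ▸ hb)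
  -- Where both energies are nonpositive they descend with the same slope `G`, so their equality at
  -- `b` propagates back. If one zero came first, its energy would be strictly negative at the other
  -- zero.
  have key : ∀ r ∈ Icc m b, Y r ≤ 0 → Z r ≤ 0 → Y r = Z r := by
    intro r hr h1 h2
    have := sub_eq_sub_of_nonpos hY hZ (h.left_lt.le.trans hr.1)
      (h.nonpos_after hY hp hr h1) (h'.nonpos_after hZ hq hr h2) b ⟨hr.2, le_rfl⟩
    linarith
  have hpq : p = q := by
    rcases lt_trichotomy p q with hlt | heq | hlt
    · have h1 := h.strictAntiOn_after hY hp ⟨hpm.1, hpm.2.le⟩ hp2.le ⟨le_rfl, hpm.2.le⟩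
        ⟨hlt.le, hqm.2.le⟩ hlt
      have := key q ⟨hqm.1, hqm.2.le⟩ (by linarith) hq2.le
      linarith
    · exact heq
    · have h1 := h'.strictAntiOn_after hZ hq ⟨hqm.1, hqm.2.le⟩ hq2.le ⟨le_rfl, hqm.2.le⟩
        ⟨hlt.le, hpm.2.le⟩ hlt
      have := key p ⟨hpm.1, hpm.2.le⟩ hp2.le (by linarith)
      linarith
  subst hpq
  refine ⟨p, ⟨hpm.1.lt_of_ne fun hmp => ?_, hpm.2⟩, hp1, hq1, hp2, hq2⟩
  rw [← hmp] at hp2 hq2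
  rcases h.mid_pos hY h' hZ hH hp hq with h1 | h1 <;> linarith

/-- If the energies for `±H` have a common zero then they agree and are negative at `b`. -/
theorem eq_of_common_zero (h : Hump G H a m b) (hY : IsEnergy G H a b Y)
    (h' : Hump G H' a m b) (hZ : IsEnergy G H' a b Z)
    (hp : ∀ᶠ u in 𝓝[>] a, 0 < Y u) (hq : ∀ᶠ u in 𝓝[>] a, 0 < Z u) (hpm : p ∈ Ico m b)
    (h1 : Y p = 0) (h2 : Z p = 0) : Y b = Z b ∧ Y b < 0 := by
  have hr : p ∈ Icc m b := ⟨hpm.1, hpm.2.le⟩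
  have e1 := sub_eq_sub_of_nonpos hY hZ (h.left_lt.le.trans hr.1)
      (h.nonpos_after hY hp hr h1.le) (h'.nonpos_after hZ hq hr h2.le) b ⟨hr.2, le_rfl⟩
  have e2 := h.strictAntiOn_after hY hp hr h1.le ⟨le_rfl, hr.2⟩ ⟨hr.2, le_rfl⟩ hpm.2
  constructor <;> linarith

end Hump

end TravelingWave

/-! ### The planar system: symmetries, traps, equilibria and departure from a saddle. -/

namespace TravelingWave

/-- Entire solutions, with values in `I`, of `u' = w`, `w' = G(u) + H(u) w`. -/
def IsSol (I : Set ℝ) (G H u w : ℝ → ℝ) : Prop :=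
  ∀ z : ℝ, u z ∈ I ∧ HasDerivAt u (w z) z ∧ HasDerivAt w (G (u z) + H (u z) * w z) z

variable {I : Set ℝ} {G H u w : ℝ → ℝ} {a b L z₀ : ℝ}

namespace IsSol

/-- Reversing time flips `w` and the sign of `H` but keeps `G`. Stable manifolds become unstable
ones. -/
theorem rev (h : IsSol I G H u w) :
    IsSol I G (fun x => -H x) (fun z => u (-z)) (fun z => -w (-z)) := by
  intro z
  obtain ⟨h1, h2, h3⟩ := h (-z)
  refine ⟨h1, ?_, ?_⟩
  · have := h2.comp z (hasDerivAt_neg z)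
    simpa [Function.comp_def] using this
  · have := (h3.comp z (hasDerivAt_neg z)).neg
    refine this.congr_deriv ?_
    ring

/-- The point reflection of the phase plane keeps the direction of time and turns a right saddle
into a left one. -/
theorem mirror (h : IsSol I G H u w) :
    IsSol (-I) (fun x => -G (-x)) (fun x => H (-x)) (fun z => -u z) (fun z => -w z) := by
  intro z
  obtain ⟨h1, h2, h3⟩ := h z
  refine ⟨by simpa using h1, h2.neg, h3.neg.congr_deriv ?_⟩
  simp only [neg_neg]; ring

theorem continuous_fst (h : IsSol I G H u w) : Continuous u :=
  continuous_iff_continuousAt.2 fun z => (h z).2.1.continuousAt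

theorem continuous_snd (h : IsSol I G H u w) : Continuous w :=
  continuous_iff_continuousAt.2 fun z => (h z).2.2.continuousAt

theorem strictMonoOn (h : IsSol I G H u w) {s : Set ℝ} (hs : Convex ℝ s)
    (hw : ∀ z ∈ interior s, 0 < w z) : StrictMonoOn u s :=
  strictMonoOn_of_hasDerivWithinAt_pos hs h.continuous_fst.continuousOn
    (fun z _ => (h z).2.1.hasDerivWithinAt) hw

theorem strictAntiOn (h : IsSol I G H u w) {s : Set ℝ} (hs : Convex ℝ s)
    (hw : ∀ z ∈ interior s, w z < 0) : StrictAntiOn u s :=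
  strictAntiOn_of_hasDerivWithinAt_neg hs h.continuous_fst.continuousOn
    (fun z _ => (h z).2.1.hasDerivWithinAt) hw

/-- The region `u ≥ b`, `w > 0` is a forward trap. -/
theorem trap_right (h : IsSol I G H u w) (hG : ∀ x ∈ I, b < x → 0 < G x) (hu : b ≤ u z₀)
    (hw : 0 < w z₀) (hL : Tendsto u atTop (𝓝 L)) : b < L := by
  have hpos : ∀ z, z₀ ≤ z → 0 < w z := by
    by_contra hcon
    push Not at hcon
    obtain ⟨z, hz, hwz⟩ := hcon
    have hS : IsCompact (Icc z₀ z ∩ w ⁻¹' Iic 0) :=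
      isCompact_Icc.inter_right (isClosed_Iic.preimage h.continuous_snd)
    obtain ⟨y, hy, hmin⟩ := hS.exists_isLeast ⟨z, ⟨hz, le_rfl⟩, hwz⟩
    have hy0 : z₀ < y := hy.1.1.lt_of_ne (fun he => by
      have : w y ≤ 0 := hy.2
      rw [← he] at this; linarith)
    have hbefore : ∀ x ∈ Ico z₀ y, 0 < w x := fun x hx => by
      by_contra hn
      exact absurd (hmin ⟨⟨hx.1, hx.2.le.trans hy.1.2⟩, not_lt.1 hn⟩) (not_le.2 hx.2)
    have hwy : w y = 0 := by
      refine le_antisymm hy.2 (ge_of_tendsto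
        ((h.continuous_snd.tendsto y).mono_left (nhdsWithin_le_nhds (s := Iio y))) ?_)
      filter_upwards [Ioo_mem_nhdsLT hy0] with x hx using (hbefore x ⟨hx.1.le, hx.2⟩).le
    have huy : b < u y := hu.trans_lt (h.strictMonoOn (convex_Icc z₀ y)
      (fun x hx => by rw [interior_Icc] at hx; exact hbefore x ⟨hx.1.le, hx.2⟩)
      ⟨le_rfl, hy0.le⟩ ⟨hy0.le, le_rfl⟩ hy0)
    have hd := (h y).2.2
    rw [hwy, mul_zero, add_zero] at hd
    obtain ⟨x, hx1, hx2⟩ := ((eventually_lt_left_of_hasDerivAt_pos hd (hG _ (h y).1 huy)).and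
      (Ioo_mem_nhdsLT hy0)).exists
    rw [hwy] at hx1
    linarith [hbefore x ⟨hx2.1.le, hx2.2⟩]
  have hmono : StrictMonoOn u (Ici z₀) := h.strictMonoOn (convex_Ici z₀)
    (fun x hx => by rw [interior_Ici] at hx; exact hpos x (le_of_lt hx))
  have h1 : u z₀ < u (z₀ + 1) := hmono self_mem_Ici (by simp) (by linarith)
  refine (hu.trans_lt h1).trans_le (ge_of_tendsto hL ?_)
  filter_upwards [eventually_ge_atTop (z₀ + 1)] with z hz
  exact hmono.monotoneOn (by simp) (mem_Ici.2 (by linarith)) hz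

theorem trap_left (h : IsSol I G H u w) (hG : ∀ x ∈ I, x < a → G x < 0) (hu : u z₀ ≤ a)
    (hw : w z₀ < 0) (hL : Tendsto u atTop (𝓝 L)) : L < a := by
  have := h.mirror.trap_right (b := -a) (L := -L) (z₀ := z₀) (fun x hx hxa => by
    have := hG (-x) hx (by linarith); linarith) (by linarith) (by linarith) hL.neg
  linarith

/-- The bound `G = O(x - a)` at the single point `a` suffices for a Gronwall argument against the
constant solution: `(u - a, w)` satisfies a linear differential inequality with zero initial value.
It covers forward time only; `rev` supplies the other half. -/
theorem eventually_eq_equilibrium (h : IsSol I G H u w) {C : ℝ}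
    (hG : ∀ᶠ x in 𝓝 a, |G x| ≤ C * |x - a|) (hH : ContinuousAt H a) (hu : u z₀ = a)
    (hw : w z₀ = 0) : ∀ᶠ z in 𝓝[≥] z₀, u z = a ∧ w z = 0 := by
  have hHb : ∀ᶠ x in 𝓝 a, |H x| ≤ |H a| + 1 :=
    (hH.abs.tendsto.eventually (gt_mem_nhds (lt_add_one |H a|))).mono fun _ hx => hx.le
  have hev := (h.continuous_fst.tendsto z₀).eventually (by rw [hu]; exact hG.and hHb)
  obtain ⟨δ, hδ, hδ'⟩ := Metric.eventually_nhds_iff.1 hev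
  have hz : ∀ z ∈ Icc z₀ (z₀ + δ / 2), (u z - a, w z) = ((0, 0) : ℝ × ℝ) := by
    refine eq_zero_of_abs_deriv_le_mul_abs_self_of_eq_zero_right
      (f := fun z => (u z - a, w z)) (f' := fun z => (w z, G (u z) + H (u z) * w z))
      (K := 1 + |C| + (|H a| + 1))
      ((h.continuous_fst.sub continuous_const).prodMk h.continuous_snd).continuousOn
      (fun z _ => (((h z).2.1.sub_const a).prodMk (h z).2.2).hasDerivWithinAt)
      (by rw [hu, hw]; simp) (fun z hz => ?_)
    obtain ⟨h1, h2⟩ := hδ' (show dist z z₀ < δ by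
      rw [Real.dist_eq, abs_of_nonneg (by linarith [hz.1])]; linarith [hz.2])
    set N := ‖(u z - a, w z)‖
    have n1 : |u z - a| ≤ N := norm_fst_le (u z - a, w z)
    have n2 : |w z| ≤ N := norm_snd_le (u z - a, w z)
    have n0 : 0 ≤ N := norm_nonneg _
    have c0 := abs_nonneg C
    have d0 := abs_nonneg (H a)
    rw [Prod.norm_def]
    refine max_le ?_ ?_
    · simp only [Real.norm_eq_abs]
      nlinarith [mul_nonneg c0 n0, mul_nonneg d0 n0]
    · simp only [Real.norm_eq_abs]
      have e1 : |G (u z)| ≤ |C| * N := h1.trans (mul_le_mul (le_abs_self C) n1 (abs_nonneg _) c0)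
      have e2 : |H (u z) * w z| ≤ (|H a| + 1) * N := by
        rw [abs_mul]; exact mul_le_mul h2 n2 (abs_nonneg _) (by linarith)
      have := abs_add_le (G (u z)) (H (u z) * w z)
      nlinarith
  filter_upwards [Icc_mem_nhdsGE (show z₀ < z₀ + δ / 2 by linarith)] with z hz'
  have := hz z hz'
  simp only [Prod.mk.injEq, sub_eq_zero] at this
  exact this

/-- A solution passing through an equilibrium is constant. -/
theorem eq_equilibrium (h : IsSol I G H u w) {C : ℝ}
    (hG : ∀ᶠ x in 𝓝 a, |G x| ≤ C * |x - a|) (hH : ContinuousAt H a) (hu : u z₀ = a)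
    (hw : w z₀ = 0) : ∀ z, u z = a ∧ w z = 0 := by
  have hclosed : IsClosed {z | u z = a ∧ w z = 0} :=
    (isClosed_eq h.continuous_fst continuous_const).inter
      (isClosed_eq h.continuous_snd continuous_const)
  have hopen : IsOpen {z | u z = a ∧ w z = 0} := by
    rw [isOpen_iff_mem_nhds]
    rintro z ⟨hz1, hz2⟩
    have h1 := h.eventually_eq_equilibrium hG hH hz1 hz2
    have h2 := h.rev.eventually_eq_equilibrium (z₀ := -z) hG hH.neg (by simpa using hz1)
      (by simpa using hz2)
    have h3 : ∀ᶠ y in 𝓝[≤] z, u y = a ∧ w y = 0 := by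
      have ht : Tendsto (fun y : ℝ => -y) (𝓝[≤] z) (𝓝[≥] (-z)) := by
        refine tendsto_nhdsWithin_of_tendsto_nhds_of_eventually_within _
          ((continuous_neg.tendsto z).mono_left nhdsWithin_le_nhds) ?_
        filter_upwards [self_mem_nhdsWithin] with y hy using neg_le_neg (mem_Iic.1 hy)
      filter_upwards [ht.eventually h2] with y hy
      simpa using hy
    rw [← nhdsLE_sup_nhdsGE]
    exact ⟨h3, h1⟩
  have := IsClopen.eq_univ ⟨hclosed, hopen⟩ ⟨z₀, hu, hw⟩
  intro z
  have hz : z ∈ {z | u z = a ∧ w z = 0} := this ▸ mem_univ z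
  exact hz

/-- A solution emanating from a saddle leaves along the unstable direction. -/
theorem departure (h : IsSol I G H u w) (hG : ∀ᶠ x in 𝓝 a, x ≠ a → 0 < (x - a) * G x)
    (hne : ∀ z, ¬ (u z = a ∧ w z = 0)) (hu : Tendsto u atBot (𝓝 a)) :
    ∃ z₁, (∀ z ≤ z₁, a < u z ∧ 0 < w z) ∨ (∀ z ≤ z₁, u z < a ∧ w z < 0) := by
  obtain ⟨z₁, hz₁⟩ := eventually_atBot.1 (hu.eventually hG)
  -- `P` is half the derivative of `(u - a)²`. At a zero of `P` its slope is `w² + (u - a) G > 0`,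
  -- so once nonnegative it is positive afterwards. If it were nonpositive at some time it would be
  -- negative at all earlier times; then `(u - a)²` would decrease from its limit zero at `-∞`,
  -- which is impossible.
  set P : ℝ → ℝ := fun z => (u z - a) * w z with hP
  have hPd : ∀ z, HasDerivAt P (w z * w z + (u z - a) * (G (u z) + H (u z) * w z)) z := fun z =>
    ((h z).2.1.sub_const a).mul (h z).2.2
  have hP0 : ∀ z ≤ z₁, P z = 0 → 0 < w z * w z + (u z - a) * (G (u z) + H (u z) * w z) := by
    intro z hz hPz
    have e : w z * w z + (u z - a) * (G (u z) + H (u z) * w z)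
        = w z * w z + (u z - a) * G (u z) + H (u z) * P z := by simp only [hP]; ring
    rw [e, hPz, mul_zero, add_zero]
    rcases eq_or_ne (u z) a with hua | hua
    · have hw : w z ≠ 0 := fun hw => hne z ⟨hua, hw⟩
      rw [hua, sub_self, zero_mul, add_zero]
      exact mul_self_pos.2 hw
    · have := hz₁ z hz hua
      nlinarith [mul_self_nonneg (w z)]
  have step : ∀ z ≤ z₁, ∀ y < z, 0 ≤ P y → 0 < P z := by
    intro z hz y hy hPy
    have hnn : ∀ x ∈ Icc y z, 0 ≤ P x := by
      intro x hx
      have := image_le_of_deriv_right_lt_deriv_boundary (f := fun x => - P x) (B := 0) (B' := 0)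
        (a := y) (b := z) (fun x _ => (hPd x).continuousAt.continuousWithinAt.neg)
        (fun x _ => (hPd x).hasDerivWithinAt.neg) (by simp only [Pi.zero_apply]; linarith)
        (fun x => hasDerivAt_const x 0) (fun x hx he => ?_) hx
      · simp only [Pi.zero_apply] at this; linarith
      · simp only [Pi.zero_apply, neg_eq_zero] at he ⊢
        linarith [hP0 x (hx.2.le.trans hz) he]
    refine (hnn z ⟨hy.le, le_rfl⟩).lt_of_ne fun h0 => ?_
    obtain ⟨x, hx1, hx2⟩ := ((eventually_lt_left_of_hasDerivAt_pos (hPd z)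
      (hP0 z hz h0.symm)).and (Ioo_mem_nhdsLT hy)).exists
    linarith [hnn x (Ioo_subset_Icc_self hx2)]
  have hpos : ∀ z ≤ z₁, 0 < P z := by
    by_contra hcon
    push Not at hcon
    obtain ⟨z, hz, hPz⟩ := hcon
    have hneg : ∀ y < z, P y < 0 := fun y hy => by
      by_contra hn
      linarith [step z hz y hy (not_lt.1 hn)]
    have hanti : AntitoneOn (fun y => (u y - a) ^ 2) (Iio z) := by
      refine antitoneOn_of_hasDerivWithinAt_nonpos (convex_Iio z)
        (f' := fun y => 2 * P y)
        ((h.continuous_fst.sub continuous_const).pow 2).continuousOn (fun y _ => ?_)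
        (fun y hy => ?_)
      · refine ((((h y).2.1.sub_const a).pow 2).congr_deriv ?_).hasDerivWithinAt
        simp only [hP]; norm_num; ring
      · rw [interior_Iio] at hy
        linarith [hneg y hy]
    have hlim : Tendsto (fun y => (u y - a) ^ 2) atBot (𝓝 0) := by
      simpa using (hu.sub_const a).pow 2
    have : (u (z - 1) - a) ^ 2 ≤ 0 := by
      refine ge_of_tendsto hlim ?_
      filter_upwards [eventually_le_atBot (z - 1)] with y hy
      exact hanti (show y < z by linarith) (show z - 1 < z by linarith) hy
    have h2 := hneg (z - 1) (by linarith)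
    simp only [hP] at h2
    have h3 : u (z - 1) - a = 0 := by nlinarith [sq_nonneg (u (z - 1) - a)]
    rw [h3, zero_mul] at h2
    exact lt_irrefl _ h2
  have hsign : ∀ z ≤ z₁, (a < u z ∧ 0 < w z) ∨ (u z < a ∧ w z < 0) := by
    intro z hz
    rcases mul_pos_iff.1 (hpos z hz) with h1 | h1
    · exact Or.inl ⟨by linarith [h1.1], h1.2⟩
    · exact Or.inr ⟨by linarith [h1.1], h1.2⟩
  refine ⟨z₁, ?_⟩
  rcases hsign z₁ le_rfl with h1 | h1
  · left
    intro z hz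
    rcases hsign z hz with h2 | h2
    · exact h2
    · exfalso
      obtain ⟨y, hy, hy0⟩ := intermediate_value_Icc hz h.continuous_snd.continuousOn
        ⟨h2.2.le, h1.2.le⟩
      have := hpos y hy.2
      simp only [hP, hy0, mul_zero] at this
      exact lt_irrefl _ this
  · right
    intro z hz
    rcases hsign z hz with h2 | h2
    · exfalso
      obtain ⟨y, hy, hy0⟩ := intermediate_value_Icc' hz h.continuous_snd.continuousOn
        ⟨h1.2.le, h2.2.le⟩
      have := hpos y hy.2
      simp only [hP, hy0, mul_zero] at this
      exact lt_irrefl _ this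
    · exact h2

end IsSol

end TravelingWave

/-! ### Solutions that follow the graph of an energy, and their first return to the axis. -/

namespace TravelingWave

variable {I : Set ℝ} {G H H' u w Y Z : ℝ → ℝ} {a m b p L z₀ z₁ z₂ : ℝ}

/-- The sign of a solution of a linear equation is preserved. -/
theorem neg_of_linear {d c : ℝ → ℝ} {y z : ℝ} (hyz : y ≤ z)
    (hd : ∀ x ∈ Icc y z, HasDerivAt d (c x * d x) x) (hc : ContinuousOn c (Icc y z))
    (hy : d y < 0) : d z < 0 := by
  obtain ⟨K, hK⟩ := isCompact_Icc.exists_bound_of_continuousOn hc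
  simp only [Real.norm_eq_abs] at hK
  -- At a contact with this negative barrier the slope `c d` is below `-(K + 1) d`, since `c ≥ -K`
  -- and `d < 0`.
  have hB : ∀ x, HasDerivAt (fun x => d y * Real.exp (-(K + 1) * (x - y)))
      (d y * (Real.exp (-(K + 1) * (x - y)) * (-(K + 1)))) x := by
    intro x
    have := (((hasDerivAt_id' x).sub_const y).const_mul (-(K + 1))).exp.const_mul (d y)
    simpa using this
  have := image_le_of_deriv_right_lt_deriv_boundary (f := d) (a := y) (b := z)
    (fun x hx => (hd x hx).continuousAt.continuousWithinAt)
    (fun x hx => (hd x ⟨hx.1, hx.2.le⟩).hasDerivWithinAt) (by simp) hB (fun x hx he => ?_)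
    (right_mem_Icc.2 hyz)
  · exact this.trans_lt (mul_neg_of_neg_of_pos hy (Real.exp_pos _))
  · have hneg : d x < 0 := he ▸ mul_neg_of_neg_of_pos hy (Real.exp_pos _)
    have h1 := (abs_le.1 (hK x ⟨hx.1, hx.2.le⟩)).1
    rw [← mul_assoc, ← he]
    nlinarith

namespace IsSol

/-- Along a solution, the deviation from the graph of `√(2 Y)` satisfies a linear equation. -/
theorem hasDerivAt_deviation (h : IsSol I G H u w) (hY : IsEnergy G H a b Y) {z : ℝ}
    (hu : u z ∈ Ioo a b) (hpos : 0 < Y (u z)) :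
    HasDerivAt (fun z => w z - √(2 * Y (u z)))
      (-(G (u z) / √(2 * Y (u z))) * (w z - √(2 * Y (u z)))) z := by
  have h1 := (hY.hasDerivAt_sqrt hu hpos).comp z (h z).2.1
  refine ((h z).2.2.sub h1).congr_deriv ?_
  have : 0 < √(2 * Y (u z)) := Real.sqrt_pos.2 (by linarith)
  field_simp
  ring

theorem continuousOn_coeff (h : IsSol I G H u w) (hG : ContinuousOn G (Icc a b))
    (hY : IsEnergy G H a b Y) {s : Set ℝ}
    (hs : ∀ z ∈ s, u z ∈ Ioo a b ∧ 0 < Y (u z)) :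
    ContinuousOn (fun z => -(G (u z) / √(2 * Y (u z)))) s := by
  have hm : MapsTo u s (Icc a b) := fun z hz => Ioo_subset_Icc_self (hs z hz).1
  refine ((hG.comp h.continuous_fst.continuousOn hm).div
    (continuousOn_const.mul (hY.continuousOn.comp h.continuous_fst.continuousOn hm)).sqrt
    fun z hz => ?_).neg
  exact (Real.sqrt_pos.2 (mul_pos two_pos (hs z hz).2)).ne'

/-- A solution leaving the saddle with `w > 0` follows the graph of `√(2 Y)`. -/
theorem follow (h : IsSol I G H u w) (hh : Hump G H a m b) (hY : IsEnergy G H a b Y)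
    (hua : Tendsto u atBot (𝓝 a)) (hwa : Tendsto w atBot (𝓝 0)) (hpb : p ≤ b)
    (hpos : ∀ x ∈ Ioo a p, 0 < Y x) (hz : ∀ z ≤ z₁, u z ∈ Ioo a p) :
    w z₁ = √(2 * Y (u z₁)) := by
  have hI : ∀ z ≤ z₁, u z ∈ Ioo a b := fun z hz' => ⟨(hz z hz').1, (hz z hz').2.trans_le hpb⟩
  set d : ℝ → ℝ := fun z => w z - √(2 * Y (u z)) with hdd
  set c : ℝ → ℝ := fun z => -(G (u z) / √(2 * Y (u z))) with hcc
  have hd : ∀ z ≤ z₁, HasDerivAt d (c z * d z) z := fun z hz' =>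
    h.hasDerivAt_deviation hY (hI z hz') (hpos _ (hz z hz'))
  obtain ⟨z₂', hz₂'⟩ := eventually_atBot.1 (hua.eventually (gt_mem_nhds hh.left_lt))
  set z₂ := min z₂' z₁
  have hlim : Tendsto d atBot (𝓝 0) := by
    have h1 : Tendsto u atBot (𝓝[>] a) := tendsto_nhdsWithin_of_tendsto_nhds_of_eventually_within _
      hua ((eventually_le_atBot z₁).mono fun z hz' => (hz z hz').1)
    have h2 := (tendsto_sqrt_energy hY (hh.left_lt.trans hh.lt_right)).comp h1
    have h3 := hwa.sub h2
    rwa [sub_zero] at h3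
  -- While `u < m` the coefficient of the linear equation is nonpositive, so `d²` is nonincreasing;
  -- since it tends to zero at `-∞`, it vanishes up to `z₂`. Uniqueness for the linear equation then
  -- carries `d = 0` on to `z₁`.
  have hanti : AntitoneOn (fun z => d z ^ 2) (Iic z₂) := by
    refine antitoneOn_of_hasDerivWithinAt_nonpos (convex_Iic z₂)
      (f' := fun z => 2 * d z * (c z * d z))
      (fun z hz' => ((hd z (le_trans hz' (min_le_right _ _))).continuousAt.continuousWithinAt).pow 2)
      (fun z hz' => ?_) (fun z hz' => ?_) <;> rw [interior_Iic] at hz'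
    · have := (hd z ((le_of_lt hz').trans (min_le_right _ _))).pow 2
      refine (this.congr_deriv ?_).hasDerivWithinAt
      norm_num
    · have h1 := hI z ((le_of_lt hz').trans (min_le_right _ _))
      have h2 := hh.pos (u z) ⟨h1.1, hz₂' z ((le_of_lt hz').trans (min_le_left _ _))⟩
      have h3 : c z ≤ 0 := by
        simp only [hcc]
        exact neg_nonpos.2 (div_nonneg h2.le (Real.sqrt_nonneg _))
      nlinarith [mul_nonneg (neg_nonneg.2 h3) (sq_nonneg (d z))]
  have hd0 : d z₂ = 0 := by
    have h1 : d z₂ ^ 2 ≤ 0 := by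
      have h2 : Tendsto (fun z => d z ^ 2) atBot (𝓝 0) := by simpa using hlim.pow 2
      refine ge_of_tendsto h2 ?_
      filter_upwards [eventually_le_atBot z₂] with z hz' using hanti hz' self_mem_Iic hz'
    nlinarith [sq_nonneg (d z₂)]
  have hcc' : ContinuousOn c (Icc z₂ z₁) := h.continuousOn_coeff hh.contG hY
    fun z hz' => ⟨hI z hz'.2, hpos _ (hz z hz'.2)⟩
  obtain ⟨K, hK⟩ := isCompact_Icc.exists_bound_of_continuousOn hcc'
  have := eq_zero_of_abs_deriv_le_mul_abs_self_of_eq_zero_right (f := d) (K := K)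
    (fun z hz' => (hd z hz'.2).continuousAt.continuousWithinAt)
    (fun z hz' => (hd z hz'.2.le).hasDerivWithinAt) hd0
    (fun z hz' => (norm_mul _ _).trans_le (mul_le_mul_of_nonneg_right (hK z ⟨hz'.1, hz'.2.le⟩)
      (norm_nonneg _))) z₁ ⟨min_le_right _ _, le_rfl⟩
  simp only [hdd] at this
  linarith

/-- The first return of a solution leaving the saddle to the axis `w = 0`. -/
theorem first_return (h : IsSol I G H u w) (hh : Hump G H a m b) (hY : IsEnergy G H a b Y)
    (hp : ∀ᶠ u in 𝓝[>] a, 0 < Y u)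
    (hua : Tendsto u atBot (𝓝 a)) (hwa : Tendsto w atBot (𝓝 0))
    (hz : ∀ z < z₁, a < u z ∧ 0 < w z) (hw : w z₁ = 0) (hub : u z₁ < b) :
    m ≤ u z₁ ∧ (∀ x ∈ Ioo a (u z₁), 0 < Y x) ∧ Y (u z₁) = 0 ∧
      ∀ z < z₁, w z = √(2 * Y (u z)) := by
  have hmono : StrictMonoOn u (Iic z₁) := h.strictMonoOn (convex_Iic z₁)
    (fun z hz' => by rw [interior_Iic] at hz'; exact (hz z hz').2)
  have hlt : ∀ z < z₁, u z < u z₁ := fun z hz' => hmono (mem_Iic.2 (le_of_lt hz')) self_mem_Iic hz'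
  have hap : a < u z₁ := (hz (z₁ - 1) (by linarith)).1.trans (hlt _ (by linarith))
  have hYc : ContinuousAt (fun z => √(2 * Y (u z))) z₁ :=
    ((((hY.hasDerivAt ⟨hap, hub⟩).continuousAt.comp
      (f := u) h.continuous_fst.continuousAt)).const_mul 2).sqrt
  -- along the way the graph is followed up to its first zero
  have hfol : (∀ x ∈ Ioo a (u z₁), 0 < Y x) → (∀ z < z₁, w z = √(2 * Y (u z))) ∧ Y (u z₁) ≤ 0 := by
    intro hpos
    have h1 : ∀ z < z₁, w z = √(2 * Y (u z)) := fun z hz' =>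
      h.follow hh hY hua hwa hub.le hpos fun y hy =>
        ⟨(hz y (hy.trans_lt hz')).1, hlt y (hy.trans_lt hz')⟩
    refine ⟨h1, ?_⟩
    have h2 : w z₁ = √(2 * Y (u z₁)) := by
      refine tendsto_nhds_unique ((h.continuous_snd.tendsto z₁).mono_left
        (nhdsWithin_le_nhds (s := Iio z₁))) ((hYc.tendsto.mono_left
        (nhdsWithin_le_nhds (s := Iio z₁))).congr' ?_)
      filter_upwards [self_mem_nhdsWithin] with z hz' using (h1 z hz').symm
    rw [hw, eq_comm, Real.sqrt_eq_zero'] at h2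
    linarith
  rcases hh.pos_or_crossing hY hp with h1 | ⟨q, hq, hq1, hq2, -⟩
  · obtain ⟨-, h3⟩ := hfol fun x hx => h1.1 x ⟨hx.1, hx.2.trans hub⟩
    exact absurd (h1.1 _ ⟨hap, hub⟩) (not_lt.2 h3)
  · have hqu : u z₁ ≤ q := by
      -- A solution going beyond `q` follows the graph up to `q`; there the graph has height zero,
      -- although `w` is still positive.
      by_contra hcon
      push Not at hcon
      have haq := hh.left_lt.trans_le hq.1
      obtain ⟨y₀, hy₀, hy₀'⟩ : ∃ y < z₁, u y < q := by
        obtain ⟨y, hy⟩ := ((hua.eventually (gt_mem_nhds haq)).and (eventually_lt_atBot z₁)).exists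
        exact ⟨y, hy.2, hy.1⟩
      obtain ⟨y, hy, hyq⟩ := intermediate_value_Ioo hy₀.le h.continuous_fst.continuousOn
        ⟨hy₀', hcon⟩
      have hfy : ∀ z < y, w z = √(2 * Y (u z)) := fun z hz' =>
        h.follow hh hY hua hwa hq.2.le hq1 fun x hx =>
          ⟨(hz x ((hx.trans_lt hz').trans hy.2)).1, by
            rw [← hyq]; exact hmono (mem_Iic.2 ((hx.trans_lt hz').trans hy.2).le)
              (mem_Iic.2 hy.2.le) (hx.trans_lt hz')⟩
      have hYcy : ContinuousAt (fun z => √(2 * Y (u z))) y := by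
        have : ContinuousAt Y (u y) := by
          rw [hyq]; exact (hY.hasDerivAt ⟨haq, hq.2⟩).continuousAt
        exact ((this.comp (f := u) h.continuous_fst.continuousAt).const_mul 2).sqrt
      have h2 : w y = √(2 * Y (u y)) := by
        refine tendsto_nhds_unique ((h.continuous_snd.tendsto y).mono_left
          (nhdsWithin_le_nhds (s := Iio y))) ((hYcy.tendsto.mono_left
          (nhdsWithin_le_nhds (s := Iio y))).congr' ?_)
        filter_upwards [self_mem_nhdsWithin] with z hz' using (hfy z hz').symm
      rw [hyq, hq2, mul_zero, Real.sqrt_zero] at h2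
      linarith [(hz y hy.2).2]
    obtain ⟨h2, h3⟩ := hfol fun x hx => hq1 x ⟨hx.1, hx.2.trans_le hqu⟩
    have heq : u z₁ = q := by
      refine le_antisymm hqu (not_lt.1 fun hlt' => ?_)
      exact absurd (hq1 _ ⟨hap, hlt'⟩) (not_lt.2 h3)
    rw [heq]
    exact ⟨hq.1, hq1, hq2, h2⟩

/-- After its first return to the axis at `p > m`, a solution staying to the right of the saddle
never reaches `u ≥ p` again. -/
theorem lt_after_return (h : IsSol I G H u w) (hh : Hump G H a m b) (hY : IsEnergy G H a b Y)
    (hp1 : m < u z₁) (hp2 : u z₁ < b) (hpos : ∀ x ∈ Ioo a (u z₁), 0 < Y x) (hp0 : Y (u z₁) = 0)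
    (hw : w z₁ = 0) (hz : z₁ < z₂) (ha : ∀ z ∈ Icc z₁ z₂, a < u z) : u z₂ < u z₁ := by
  by_contra hcon
  push Not at hcon
  set p := u z₁ with hpdef
  have hGp : G p < 0 := hh.neg p ⟨hp1, hp2⟩
  have hap : a < p := hh.left_lt.trans hp1
  have hd1 := (h z₁).2.2
  rw [hw, mul_zero, add_zero] at hd1
  have hd1' := (hd1.neg)
  have hwneg : ∀ᶠ z in 𝓝[>] z₁, w z < 0 := by
    filter_upwards [eventually_gt_right_of_hasDerivAt_pos hd1' (by simpa using hGp)] with z hz'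
    rw [Pi.neg_apply, Pi.neg_apply, hw] at hz'
    linarith
  obtain ⟨e', he', hesub⟩ := (mem_nhdsGT_iff_exists_Ioo_subset' hz).1 hwneg
  obtain ⟨e, he1, he2⟩ := exists_between (lt_min (show z₁ < e' from he') hz)
  have hwe : w e < 0 := hesub ⟨he1, he2.trans_le (min_le_left _ _)⟩
  have hue : u e < p := h.strictAntiOn (convex_Icc z₁ e) (fun x hx => by
    rw [interior_Icc] at hx
    exact hesub ⟨hx.1, hx.2.trans (he2.trans_le (min_le_left _ _))⟩) ⟨le_rfl, he1.le⟩
    ⟨he1.le, le_rfl⟩ he1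
  have hez₂ : e ≤ z₂ := (he2.trans_le (min_le_right _ _)).le
  -- Just after `z₁` the solution has `w < 0` and `u < p`. If `u` reaches `p` again, `z₃` is the
  -- first such time, and the approach from the left gives `w z₃ ≥ 0`.
  obtain ⟨z₃, hz₃, hmin⟩ := (isCompact_Icc.inter_right
    (isClosed_Ici.preimage h.continuous_fst) : IsCompact (Icc e z₂ ∩ u ⁻¹' Ici p)).exists_isLeast
    ⟨z₂, ⟨hez₂, le_rfl⟩, hcon⟩
  have hez₃ : e < z₃ := hz₃.1.1.lt_of_ne fun heq => by
    have : p ≤ u z₃ := hz₃.2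
    rw [← heq] at this; linarith
  have hbelow : ∀ x ∈ Ico e z₃, u x < p := fun x hx => by
    by_contra hn
    exact absurd (hmin ⟨⟨hx.1, hx.2.le.trans hz₃.1.2⟩, not_lt.1 hn⟩) (not_le.2 hx.2)
  have huz₃ : u z₃ = p := by
    refine le_antisymm (le_of_tendsto ((h.continuous_fst.tendsto z₃).mono_left
      (nhdsWithin_le_nhds (s := Iio z₃))) ?_) hz₃.2
    filter_upwards [Ioo_mem_nhdsLT hez₃] with x hx using (hbelow x ⟨hx.1.le, hx.2⟩).le
  have hwz₃ : 0 ≤ w z₃ := by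
    by_contra hn
    obtain ⟨x, hx1, hx2⟩ := ((eventually_lt_left_of_hasDerivAt_pos (h z₃).2.1.neg
      (by linarith : 0 < -w z₃)).and (Ioo_mem_nhdsLT hez₃)).exists
    rw [Pi.neg_apply, Pi.neg_apply, huz₃] at hx1
    linarith [hbelow x ⟨hx2.1.le, hx2.2⟩]
  have hwpos : ∀ᶠ x in 𝓝[<] z₃, 0 < w x := by
    rcases hwz₃.lt_or_eq with h1 | h1
    · exact ((h.continuous_snd.tendsto z₃).eventually (lt_mem_nhds h1)).filter_mono
        nhdsWithin_le_nhds
    · have hd := (h z₃).2.2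
      rw [← h1, mul_zero, add_zero, huz₃] at hd
      filter_upwards [eventually_lt_left_of_hasDerivAt_pos hd.neg (by linarith)] with x hx
      rw [Pi.neg_apply, Pi.neg_apply, ← h1] at hx
      linarith
  obtain ⟨l, hl, hlsub⟩ := (mem_nhdsLT_iff_exists_Ioo_subset' hez₃).1 hwpos
  obtain ⟨e₂, he₂1, he₂2⟩ := exists_between (max_lt (show l < z₃ from hl) hez₃)
  have hle₂ : l < e₂ := (le_max_left _ _).trans_lt he₂1
  have hee₂ : e ≤ e₂ := ((le_max_right _ _).trans_lt he₂1).le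
  obtain ⟨z₄, hz₄, hmax⟩ := (isCompact_Icc.inter_right
    (isClosed_Iic.preimage h.continuous_snd) : IsCompact (Icc e e₂ ∩ w ⁻¹' Iic 0)).exists_isGreatest
    ⟨e, ⟨le_rfl, hee₂⟩, hwe.le⟩
  have hz₄e : z₄ < e₂ := hz₄.1.2.lt_of_ne fun heq => by
    have h1 : w z₄ ≤ 0 := hz₄.2
    have h2 : 0 < w e₂ := hlsub ⟨hle₂, he₂2⟩
    rw [heq] at h1; linarith
  have hwI : ∀ x ∈ Ioo z₄ z₃, 0 < w x := by
    intro x hx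
    rcases le_or_gt x e₂ with h1 | h1
    · by_contra hn
      exact absurd (hmax ⟨⟨hz₄.1.1.trans hx.1.le, h1⟩, not_lt.1 hn⟩) (not_le.2 hx.1)
    · exact hlsub ⟨hle₂.trans h1, hx.2⟩
  have hIco : ∀ x ∈ Ico z₄ z₃, u x ∈ Ioo a p := fun x hx =>
    ⟨ha x ⟨he1.le.trans (hz₄.1.1.trans hx.1), hx.2.le.trans hz₃.1.2⟩,
      hbelow x ⟨hz₄.1.1.trans hx.1, hx.2⟩⟩
  -- From `z₄`, the last time before `z₃` with `w ≤ 0`, the solution moves right strictly below the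
  -- graph, since the linear equation preserves the sign of `d`. Beyond `m`, where `G < 0`, `d` is
  -- nonincreasing, so it stays negative in the limit at `z₃`. But the graph has height zero at `p`,
  -- so `d z₃ = w z₃ ≥ 0`.
  set d : ℝ → ℝ := fun z => w z - √(2 * Y (u z)) with hdd
  have hd : ∀ x ∈ Ico z₄ z₃, HasDerivAt d (-(G (u x) / √(2 * Y (u x))) * d x) x := fun x hx =>
    h.hasDerivAt_deviation hY ⟨(hIco x hx).1, (hIco x hx).2.trans hp2⟩ (hpos _ (hIco x hx))
  have hz₄3 : z₄ < z₃ := hz₄e.trans he₂2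
  have hd4 : d z₄ < 0 := by
    have h1 : 0 < √(2 * Y (u z₄)) := Real.sqrt_pos.2
      (by linarith [hpos _ (hIco z₄ ⟨le_rfl, hz₄3⟩)])
    have h2 : w z₄ ≤ 0 := hz₄.2
    simp only [hdd]; linarith
  have hdneg : ∀ x ∈ Ico z₄ z₃, d x < 0 := fun x hx =>
    neg_of_linear hx.1 (fun y hy => hd y ⟨hy.1, hy.2.trans_lt hx.2⟩)
      (h.continuousOn_coeff hh.contG hY fun y hy =>
        ⟨⟨(hIco y ⟨hy.1, hy.2.trans_lt hx.2⟩).1,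
          (hIco y ⟨hy.1, hy.2.trans_lt hx.2⟩).2.trans hp2⟩,
          hpos _ (hIco y ⟨hy.1, hy.2.trans_lt hx.2⟩)⟩) hd4
  have hum : ∀ᶠ x in 𝓝[<] z₃, m < u x :=
    ((h.continuous_fst.tendsto z₃).eventually (by rw [huz₃]; exact lt_mem_nhds hp1)).filter_mono
      nhdsWithin_le_nhds
  obtain ⟨l₂, hl₂, hl₂sub⟩ := (mem_nhdsLT_iff_exists_Ioo_subset' hz₄3).1 hum
  obtain ⟨y, hy1, hy2⟩ := exists_between (max_lt (show l₂ < z₃ from hl₂) hz₄3)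
  have hl₂y : l₂ < y := (le_max_left _ _).trans_lt hy1
  have hz₄y : z₄ < y := (le_max_right _ _).trans_lt hy1
  have hanti : AntitoneOn d (Ico y z₃) := by
    refine antitoneOn_of_hasDerivWithinAt_nonpos (convex_Ico y z₃)
      (f' := fun x => -(G (u x) / √(2 * Y (u x))) * d x)
      (fun x hx => (hd x ⟨hz₄y.le.trans hx.1, hx.2⟩).continuousAt.continuousWithinAt)
      (fun x hx => ?_) (fun x hx => ?_) <;> rw [interior_Ico] at hx
    · exact (hd x ⟨hz₄y.le.trans hx.1.le, hx.2⟩).hasDerivWithinAt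
    · have h1 := hIco x ⟨hz₄y.le.trans hx.1.le, hx.2⟩
      have h2 := hh.neg (u x) ⟨hl₂sub ⟨hl₂y.trans hx.1, hx.2⟩, h1.2.trans hp2⟩
      have h3 : 0 ≤ -(G (u x) / √(2 * Y (u x))) :=
        neg_nonneg.2 (div_nonpos_of_nonpos_of_nonneg h2.le (Real.sqrt_nonneg _))
      exact mul_nonpos_of_nonneg_of_nonpos h3 (hdneg x ⟨hz₄y.le.trans hx.1.le, hx.2⟩).le
  have hdc : ContinuousAt d z₃ := by
    have : ContinuousAt Y (u z₃) := by
      rw [huz₃]; exact (hY.hasDerivAt ⟨hap, hp2⟩).continuousAt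
    exact h.continuous_snd.continuousAt.sub
      ((this.comp (f := u) h.continuous_fst.continuousAt).const_mul 2).sqrt
  have hd3 : d z₃ ≤ d y := by
    refine le_of_tendsto (hdc.tendsto.mono_left (nhdsWithin_le_nhds (s := Iio z₃))) ?_
    filter_upwards [Ioo_mem_nhdsLT hy2] with x hx
    exact hanti ⟨le_rfl, hy2⟩ ⟨hx.1.le, hx.2⟩ hx.1.le
  have h5 := hdneg y ⟨hz₄y.le, hy2⟩
  have h6 : d z₃ = w z₃ := by simp only [hdd, huz₃, hp0]; simp
  linarith

end IsSol

end TravelingWave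

/-! ### Homoclinic and heteroclinic solutions are made of graphs of energies. -/

namespace TravelingWave

variable {I : Set ℝ} {G H u w Y Z : ℝ → ℝ} {a m b p : ℝ}

/-- The standing assumptions at a saddle `a`, for both directions of time. -/
structure SaddleHump (I : Set ℝ) (G H : ℝ → ℝ) (a m b : ℝ) : Prop where
  hump : Hump G H a m b
  hump_neg : Hump G (fun x => -H x) a m b
  nhds : I ∈ 𝓝 a
  left_neg : ∀ x ∈ I, x < a → G x < 0
  lin_left : ∃ C, ∀ᶠ x in 𝓝 a, |G x| ≤ C * |x - a|
  lin_mid : ∃ C, ∀ᶠ x in 𝓝 m, |G x| ≤ C * |x - m|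
  cont_left : ContinuousAt H a
  cont_mid : ContinuousAt H m

namespace SaddleHump

theorem neg (S : SaddleHump I G H a m b) : SaddleHump I G (fun x => -H x) a m b :=
  ⟨S.hump_neg, by simpa only [neg_neg] using S.hump, S.nhds, S.left_neg, S.lin_left, S.lin_mid,
    S.cont_left.neg, S.cont_mid.neg⟩

theorem sign (S : SaddleHump I G H a m b) : ∀ᶠ x in 𝓝 a, x ≠ a → 0 < (x - a) * G x := by
  filter_upwards [S.nhds, gt_mem_nhds S.hump.left_lt] with x hx hxm hne
  rcases lt_or_gt_of_ne hne with h | h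
  · have := S.left_neg x hx h
    nlinarith
  · exact mul_pos (by linarith) (S.hump.pos x ⟨h, hxm⟩)

/-- Leaving to the left would enter the region `u < a`, `w < 0`, which traps the solution away from
`a`. -/
theorem departure_right (S : SaddleHump I G H a m b) (h : IsSol I G H u w)
    (h0 : Tendsto u atBot (𝓝 a)) (h1 : Tendsto u atTop (𝓝 a))
    (hne : ∀ z, ¬ (u z = a ∧ w z = 0)) : ∃ z₀, ∀ z ≤ z₀, a < u z ∧ 0 < w z := by
  obtain ⟨z₀, h2 | h2⟩ := h.departure S.sign hne h0
  · exact ⟨z₀, h2⟩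
  · obtain ⟨h3, h4⟩ := h2 z₀ le_rfl
    exact absurd (h.trap_left S.left_neg h3.le h4 h1) (lt_irrefl a)

theorem ne_equilibrium (S : SaddleHump I G H a m b) (h : IsSol I G H u w)
    (hne : ¬ ∀ z, u z = a ∧ w z = 0) : ∀ z, ¬ (u z = a ∧ w z = 0) := by
  rintro z ⟨h1, h2⟩
  obtain ⟨C, hC⟩ := S.lin_left
  exact hne (h.eq_equilibrium hC S.cont_left h1 h2)

/-- At a first return to `u = a` there are three cases: `w < 0` leads into the left trap, `w = 0` is
the equilibrium, and `w > 0` contradicts `u > a` just before. -/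
theorem gt_left (S : SaddleHump I G H a m b) (h : IsSol I G H u w)
    (h0 : Tendsto u atBot (𝓝 a)) (h1 : Tendsto u atTop (𝓝 a))
    (hne : ∀ z, ¬ (u z = a ∧ w z = 0)) (z : ℝ) : a < u z := by
  by_contra hcon
  push Not at hcon
  obtain ⟨z₀, hz₀⟩ := S.departure_right h h0 h1 hne
  have hz0z : z₀ < z := by
    by_contra hn
    linarith [(hz₀ z (not_lt.1 hn)).1]
  obtain ⟨y, hy, hmin⟩ := (isCompact_Icc.inter_right
    (isClosed_Iic.preimage h.continuous_fst) : IsCompact (Icc z₀ z ∩ u ⁻¹' Iic a)).exists_isLeast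
    ⟨z, ⟨hz0z.le, le_rfl⟩, hcon⟩
  have hua : u y ≤ a := hy.2
  have hz0y : z₀ < y := hy.1.1.lt_of_ne fun he => by
    linarith [(hz₀ z₀ le_rfl).1, he ▸ hua]
  have hbefore : ∀ x ∈ Ioo z₀ y, a < u x := fun x hx => by
    by_contra hn
    exact absurd (hmin ⟨⟨hx.1.le, hx.2.le.trans hy.1.2⟩, not_lt.1 hn⟩) (not_le.2 hx.2)
  rcases lt_trichotomy (w y) 0 with hw | hw | hw
  · exact absurd (h.trap_left S.left_neg hua hw h1) (lt_irrefl a)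
  · refine hne y ⟨le_antisymm hua (ge_of_tendsto ((h.continuous_fst.tendsto y).mono_left
      (nhdsWithin_le_nhds (s := Iio y))) ?_), hw⟩
    filter_upwards [Ioo_mem_nhdsLT hz0y] with x hx using (hbefore x hx).le
  · obtain ⟨x, hx1, hx2⟩ := ((eventually_lt_left_of_hasDerivAt_pos (h y).2.1 hw).and
      (Ioo_mem_nhdsLT hz0y)).exists
    linarith [hbefore x hx2]

/-- The first time at which a homoclinic solution meets the axis `w = 0`. -/
theorem exists_first_return (S : SaddleHump I G H a m b) (h : IsSol I G H u w)
    (h0 : Tendsto u atBot (𝓝 a)) (h1 : Tendsto u atTop (𝓝 a))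
    (hne : ∀ z, ¬ (u z = a ∧ w z = 0)) :
    ∃ z₁, (∀ z < z₁, a < u z ∧ 0 < w z) ∧ w z₁ = 0 := by
  obtain ⟨z₀, hz₀⟩ := S.departure_right h h0 h1 hne
  -- Seen backwards in time the solution also departs to the right, so `w < 0` near `+∞` and `w` has
  -- a first zero.
  obtain ⟨y₀, hy₀⟩ := S.neg.departure_right h.rev (h1.comp tendsto_neg_atBot_atTop)
    (h0.comp tendsto_neg_atTop_atBot) (fun z hz => hne (-z) (by simpa using hz))
  have hz0y : z₀ < -y₀ := by
    by_contra hn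
    have h2 := (hz₀ _ (not_lt.1 hn)).2
    have h3 := (hy₀ y₀ le_rfl).2
    linarith
  have hwy : w (-y₀) ≤ 0 := by linarith [(hy₀ y₀ le_rfl).2]
  obtain ⟨y, hy, hmin⟩ := (isCompact_Icc.inter_right
    (isClosed_Iic.preimage h.continuous_snd) : IsCompact (Icc z₀ (-y₀) ∩ w ⁻¹' Iic 0)).exists_isLeast
    ⟨-y₀, ⟨hz0y.le, le_rfl⟩, hwy⟩
  have hbefore : ∀ x < y, 0 < w x := fun x hx => by
    rcases le_or_gt x z₀ with hx0 | hx0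
    · exact (hz₀ x hx0).2
    · by_contra hn
      exact absurd (hmin ⟨⟨hx0.le, hx.le.trans hy.1.2⟩, not_lt.1 hn⟩) (not_le.2 hx)
  refine ⟨y, fun x hx => ⟨S.gt_left h h0 h1 hne x, hbefore x hx⟩, le_antisymm hy.2 ?_⟩
  refine ge_of_tendsto ((h.continuous_snd.tendsto y).mono_left
    (nhdsWithin_le_nhds (s := Iio y))) ?_
  filter_upwards [self_mem_nhdsWithin] with x hx using (hbefore x hx).le

/-- A homoclinic solution consists of the two graphs `w = √(2 Y)` and `w = -√(2 Z)`, where the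
energies `Y` and `Z` for `±H` have a common first zero. -/
theorem homoclinic (S : SaddleHump I G H a m b)
    (hY : IsEnergy G H a b Y) (hpY : ∀ᶠ u in 𝓝[>] a, 0 < Y u)
    (hZ : IsEnergy G (fun x => -H x) a b Z) (hpZ : ∀ᶠ u in 𝓝[>] a, 0 < Z u)
    (h : IsSol I G H u w) (h0 : Tendsto u atBot (𝓝 a)) (h1 : Tendsto u atTop (𝓝 a))
    (h2 : Tendsto w atBot (𝓝 0)) (h3 : Tendsto w atTop (𝓝 0))
    (hne' : ¬ ∀ z, u z = a ∧ w z = 0) (hb : ∀ z, u z < b) :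
    ∃ p ∈ Ioo m b, (∀ x ∈ Ioo a p, 0 < Y x) ∧ (∀ x ∈ Ioo a p, 0 < Z x) ∧ Y p = 0 ∧ Z p = 0 ∧
      ∃ z₁, u z₁ = p ∧ w z₁ = 0 ∧ (∀ z < z₁, u z ∈ Ioo a p ∧ w z = √(2 * Y (u z))) ∧
        ∀ z > z₁, u z ∈ Ioo a p ∧ w z = -√(2 * Z (u z)) := by
  have hne := S.ne_equilibrium h hne'
  have h0r := h1.comp tendsto_neg_atBot_atTop
  have h1r := h0.comp tendsto_neg_atTop_atBot
  have hner : ∀ z, ¬ (u (-z) = a ∧ -w (-z) = 0) := fun z hz => hne (-z) (by simpa using hz)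
  obtain ⟨z₁, hz₁, hw₁⟩ := S.exists_first_return h h0 h1 hne
  obtain ⟨y₂, hy₂, hw₂⟩ := S.neg.exists_first_return h.rev h0r h1r hner
  obtain ⟨a1, a2, a3, a4⟩ := h.first_return S.hump hY hpY h0 h2 hz₁ hw₁ (hb z₁)
  obtain ⟨b1, b2, b3, b4⟩ := h.rev.first_return S.hump_neg hZ hpZ h0r
    (by simpa using (h3.comp tendsto_neg_atBot_atTop).neg) hy₂ hw₂ (hb _)
  simp only [neg_eq_zero] at hw₂
  obtain ⟨Cm, hCm⟩ := S.lin_mid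
  have hma : ∀ z, w z = 0 → u z ≠ m := fun z hwz huz => by
    have h4 := h.eq_equilibrium hCm S.cont_mid huz hwz
    have h5 : Tendsto u atBot (𝓝 m) := by
      have : u = fun _ => m := funext fun z => (h4 z).1
      rw [this]; exact tendsto_const_nhds
    exact S.hump.left_lt.ne (tendsto_nhds_unique h0 h5)
  have a1' : m < u z₁ := a1.lt_of_ne (hma z₁ hw₁).symm
  have b1' : m < u (-y₂) := b1.lt_of_ne (hma _ hw₂).symm
  have hle : z₁ ≤ -y₂ := by
    by_contra hn
    have h4 := (hz₁ _ (not_le.1 hn)).2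
    linarith
  -- `z₁` and `-y₂` are the first and the last zero of `w`. If they differed, the no-return property
  -- forwards would give `u (-y₂) < u z₁`, and backwards the opposite inequality.
  have heq : z₁ = -y₂ := by
    refine hle.eq_of_not_lt fun hlt => ?_
    have h4 := h.lt_after_return S.hump hY a1' (hb _) a2 a3 hw₁ hlt
      fun z _ => S.gt_left h h0 h1 hne z
    have h5 := h.rev.lt_after_return (z₁ := y₂) (z₂ := -z₁) S.hump_neg hZ b1' (hb _) b2 b3
      (by simpa using hw₂) (by linarith) fun z _ => S.gt_left h h0 h1 hne (-z)
    rw [neg_neg] at h5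
    linarith
  have hmono : StrictMonoOn u (Iic z₁) := h.strictMonoOn (convex_Iic z₁)
    (fun z hz' => by rw [interior_Iic] at hz'; exact (hz₁ z hz').2)
  have hneg : ∀ z > z₁, w z < 0 := fun z hz => by
    have := (hy₂ (-z) (by linarith)).2
    rw [neg_neg] at this; linarith
  have hanti : StrictAntiOn u (Ici z₁) := h.strictAntiOn (convex_Ici z₁)
    (fun z hz' => by rw [interior_Ici] at hz'; exact hneg z hz')
  refine ⟨u z₁, ⟨a1', hb _⟩, a2, by rw [heq]; exact b2, a3, by rw [heq]; exact b3, z₁, rfl, hw₁,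
    fun z hz => ⟨⟨(hz₁ z hz).1, hmono (mem_Iic.2 (le_of_lt hz)) self_mem_Iic hz⟩, a4 z hz⟩,
    fun z hz => ⟨⟨S.gt_left h h0 h1 hne z, hanti self_mem_Ici (mem_Ici.2 (le_of_lt hz)) hz⟩, ?_⟩⟩
  have := b4 (-z) (by linarith)
  rw [neg_neg] at this
  linarith

/-- A solution connecting the saddle `a` to `b` with `w > 0` is the graph of `√(2 Y)`. -/
theorem heteroclinic (S : SaddleHump I G H a m b)
    (hY : IsEnergy G H a b Y) (hpY : ∀ᶠ u in 𝓝[>] a, 0 < Y u)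
    (h : IsSol I G H u w) (h0 : Tendsto u atBot (𝓝 a)) (h1 : Tendsto u atTop (𝓝 b))
    (h2 : Tendsto w atBot (𝓝 0)) (h3 : Tendsto w atTop (𝓝 0)) (hw : ∀ z, 0 < w z) :
    Y b = 0 ∧ ∀ z, u z ∈ Ioo a b ∧ w z = √(2 * Y (u z)) := by
  have hmono : StrictMono u := strictMonoOn_univ.1
    (h.strictMonoOn convex_univ (fun z _ => hw z))
  have hI : ∀ z, u z ∈ Ioo a b := fun z => by
    constructor
    · refine lt_of_le_of_lt (le_of_tendsto h0 ?_) (hmono (sub_one_lt z))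
      filter_upwards [eventually_le_atBot (z - 1)] with y hy using hmono.monotone hy
    · refine lt_of_lt_of_le (hmono (lt_add_one z)) (ge_of_tendsto h1 ?_)
      filter_upwards [eventually_ge_atTop (z + 1)] with y hy using hmono.monotone hy
  rcases S.hump.pos_or_crossing hY hpY with ⟨hpos, -⟩ | ⟨q, hq, hq1, hq2, -⟩
  · have hf : ∀ z, w z = √(2 * Y (u z)) := fun z =>
      h.follow S.hump hY h0 h2 le_rfl hpos fun y _ => hI y
    refine ⟨?_, fun z => ⟨hI z, hf z⟩⟩
    have hab := S.hump.le_right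
    have hYb : Tendsto (fun z => √(2 * Y (u z))) atTop (𝓝 √(2 * Y b)) := by
      have : ContinuousWithinAt Y (Icc a b) b := hY.continuousOn b ⟨hab, le_rfl⟩
      have h4 := this.tendsto.comp (tendsto_nhdsWithin_of_tendsto_nhds_of_eventually_within _ h1
        (Eventually.of_forall fun z => Ioo_subset_Icc_self (hI z)))
      exact (h4.const_mul 2).sqrt
    have h5 : √(2 * Y b) = 0 := tendsto_nhds_unique hYb (h3.congr hf)
    rw [Real.sqrt_eq_zero'] at h5
    have h6 : 0 ≤ Y b := by
      have := S.hump.pos_or_crossing hY hpY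
      rcases this with h7 | ⟨q, hq, -, hq2, -⟩
      · exact h7.2
      · have := hpos q ⟨S.hump.left_lt.trans_le hq.1, hq.2⟩
        linarith
    linarith
  -- If the energy vanished at `q < b`, the solution would arrive at `u = q` along the graph with `w
  -- = 0`.
  · exfalso
    have haq := S.hump.left_lt.trans_le hq.1
    obtain ⟨y₁, hy₁⟩ := (h0.eventually (gt_mem_nhds haq)).exists
    obtain ⟨y₂, hy₂⟩ := (h1.eventually (lt_mem_nhds hq.2)).exists
    have hlt : y₁ < y₂ := hmono.lt_iff_lt.1 (hy₁.trans hy₂)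
    obtain ⟨y, hy, hyq⟩ := intermediate_value_Ioo hlt.le h.continuous_fst.continuousOn ⟨hy₁, hy₂⟩
    have hfy : ∀ z < y, w z = √(2 * Y (u z)) := fun z hz' =>
      h.follow S.hump hY h0 h2 hq.2.le hq1 fun x hx =>
        ⟨(hI x).1, by rw [← hyq]; exact hmono (hx.trans_lt hz')⟩
    have hYcy : ContinuousAt (fun z => √(2 * Y (u z))) y := by
      have : ContinuousAt Y (u y) := by
        rw [hyq]; exact (hY.hasDerivAt ⟨haq, hq.2⟩).continuousAt
      exact ((this.comp (f := u) h.continuous_fst.continuousAt).const_mul 2).sqrt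
    have h4 : w y = √(2 * Y (u y)) := by
      refine tendsto_nhds_unique ((h.continuous_snd.tendsto y).mono_left
        (nhdsWithin_le_nhds (s := Iio y))) ((hYcy.tendsto.mono_left
        (nhdsWithin_le_nhds (s := Iio y))).congr' ?_)
      filter_upwards [self_mem_nhdsWithin] with z hz' using (hfy z hz').symm
    rw [hyq, hq2, mul_zero, Real.sqrt_zero] at h4
    linarith [hw y]

end SaddleHump

end TravelingWave

/-! ### Time parametrization of a graph, and existence of heteroclinic solutions. -/

namespace TravelingWave

variable {I : Set ℝ} {G H u w Y Z W T : ℝ → ℝ} {a b c m p x₀ : ℝ}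

/-- A linear upper barrier for `√(2 Y)`. -/
theorem IsEnergy.le_barrier {C₀ : ℝ} (hY : IsEnergy G H a b Y) (hab : a ≤ b) (hC₀ : 0 ≤ C₀)
    (hG : ∀ x ∈ Icc a b, G x ≤ C₀ * (x - a)) (hH : ContinuousOn H (Icc a b)) :
    ∃ k > 0, ∀ x ∈ Icc a b, √(2 * Y x) ≤ k * (x - a) := by
  obtain ⟨C, hC⟩ := isCompact_Icc.exists_bound_of_continuousOn hH
  simp only [Real.norm_eq_abs] at hC
  have hC0 : 0 ≤ C := (abs_nonneg _).trans (hC a ⟨le_rfl, hab⟩)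
  set k := C₀ + C + 1
  have hk : 0 < k := by positivity
  refine ⟨k, hk, fun x hx => ?_⟩
  -- The shift by `η` makes the barrier strict also at `x = a`, where the unshifted one has slope
  -- zero.
  have hη : ∀ η > 0, √(2 * Y x) ≤ k * (x - a) + η := by
    intro η hη
    have hB : ∀ y, HasDerivAt (fun y => (k * (y - a) + η) ^ 2 / 2) (k * (k * (y - a) + η)) y := by
      intro y
      refine ((((((hasDerivAt_id' y).sub_const a).const_mul k).add_const η).pow 2).div_const
        2).congr_deriv ?_
      norm_num
      ring
    have := image_le_of_deriv_right_lt_deriv_boundary hY.continuousOn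
      (fun y hy => hY.hasDerivWithinAt_Ici hy) (by rw [hY.init]; positivity) hB (fun y hy he => ?_) hx
    · exact Real.sqrt_le_iff.2 ⟨by have := hx.1; nlinarith, by linarith⟩
    · set q := k * (y - a) + η
      have hy0 : 0 ≤ y - a := by linarith [hy.1]
      have hq : 0 < q := by positivity
      rw [he, show 2 * (q ^ 2 / 2) = q ^ 2 by ring, Real.sqrt_sq hq.le]
      have h1 := hG y ⟨hy.1, hy.2.le⟩
      have h2 := (abs_le.1 (hC y ⟨hy.1, hy.2.le⟩)).2
      have h3 : H y * q ≤ C * q := mul_le_mul_of_nonneg_right h2 hq.le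
      have h4 : y - a ≤ q := by
        have : 1 * (y - a) ≤ k * (y - a) :=
          mul_le_mul_of_nonneg_right (by simp only [k]; linarith) hy0
        simp only [q]; linarith
      have h5 : C₀ * (y - a) ≤ C₀ * q := mul_le_mul_of_nonneg_left h4 hC₀
      have h6 : k * q = C₀ * q + C * q + q := by simp only [k]; ring
      linarith
  exact le_of_forall_pos_le_add hη

/-- This reads an energy that vanishes at `b` from its right end, so that estimates near the left
end apply there. Only the graph is reflected, without changing the sign of `w`, hence the sign of
`H` changes too. -/
theorem IsEnergy.mirror (hY : IsEnergy G H a b Y) (hb : Y b = 0) :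
    IsEnergy (fun v => -G (-v)) (fun v => -H (-v)) (-b) (-a) (fun v => Y (-v)) := by
  refine ⟨by simpa using hb, fun v hv => ?_⟩
  have h1 := (hY.deriv (-v) ⟨by linarith [hv.2], by linarith [hv.1]⟩)
  have h2 := h1.comp v (hasDerivAt_neg v).hasDerivWithinAt
    (fun y hy => ⟨by linarith [hy.2], by linarith [hy.1]⟩ : MapsTo _ (Icc (-b) (-a)) (Icc a b))
  refine h2.congr_deriv ?_
  ring

section Flow

/-- The solution of `u' = W(u)`, as the inverse of a primitive `T` of `1 / W`. -/
theorem exists_inverse_flow (hpos : ∀ x ∈ Ioo a c, 0 < W x)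
    (hT : ∀ x ∈ Ioo a c, HasDerivAt T (W x)⁻¹ x) {J : Set ℝ} (hJ : IsOpen J)
    (hTJ : T '' Ioo a c = J) :
    ∃ u : ℝ → ℝ, ∀ z ∈ J, u z ∈ Ioo a c ∧ T (u z) = z ∧ HasDerivAt u (W (u z)) z := by
  have hmono : StrictMonoOn T (Ioo a c) := strictMonoOn_of_hasDerivWithinAt_pos (convex_Ioo a c)
    (fun x hx => (hT x hx).continuousAt.continuousWithinAt)
    (fun x hx => (hT x (interior_subset hx)).hasDerivWithinAt)
    (fun x hx => inv_pos.2 (hpos x (interior_subset hx)))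
  have hex : ∀ z : ℝ, ∃ x : ℝ, z ∈ J → x ∈ Ioo a c ∧ T x = z := by
    intro z
    by_cases hz : z ∈ J
    · rw [← hTJ] at hz
      obtain ⟨x, hx, hxz⟩ := hz
      exact ⟨x, fun _ => ⟨hx, hxz⟩⟩
    · exact ⟨0, fun h => absurd h hz⟩
  choose u hu using hex
  refine ⟨u, fun z hz => ⟨(hu z hz).1, (hu z hz).2, ?_⟩⟩
  have hcont : ContinuousAt u z := by
    rw [ContinuousAt, tendsto_order]
    obtain ⟨hI, hTz⟩ := hu z hz
    constructor
    · intro y hy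
      obtain ⟨x, hx1, hx2⟩ := exists_between (max_lt hy hI.1)
      have hxI : x ∈ Ioo a c := ⟨(le_max_right _ _).trans_lt hx1, hx2.trans hI.2⟩
      have : T x < z := by rw [← hTz]; exact hmono hxI hI hx2
      filter_upwards [lt_mem_nhds this, hJ.mem_nhds hz] with z' hz' hz'J
      rw [← (hu z' hz'J).2] at hz'
      exact ((le_max_left _ _).trans_lt hx1).trans ((hmono.lt_iff_lt hxI (hu z' hz'J).1).1 hz')
    · intro y hy
      obtain ⟨x, hx1, hx2⟩ := exists_between (lt_min hy hI.2)
      have hxI : x ∈ Ioo a c := ⟨hI.1.trans hx1, hx2.trans_le (min_le_right _ _)⟩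
      have : z < T x := by rw [← hTz]; exact hmono hI hxI hx1
      filter_upwards [gt_mem_nhds this, hJ.mem_nhds hz] with z' hz' hz'J
      rw [← (hu z' hz'J).2] at hz'
      exact ((hmono.lt_iff_lt (hu z' hz'J).1 hxI).1 hz').trans (hx2.trans_le (min_le_left _ _))
  have hd := HasDerivAt.of_local_left_inverse hcont (hT _ (hu z hz).1)
    (inv_ne_zero (hpos _ (hu z hz).1).ne')
    ((hJ.eventually_mem hz).mono fun y hy => (hu y hy).2)
  rwa [inv_inv] at hd

theorem exists_primitive_inv (hac : a < c) (hpos : ∀ x ∈ Ioo a c, 0 < W x)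
    (hW : ContinuousOn W (Ioo a c)) : ∃ T : ℝ → ℝ, ∀ x ∈ Ioo a c, HasDerivAt T (W x)⁻¹ x := by
  obtain ⟨x₀, hx₀⟩ := exists_between hac
  have hc : ContinuousOn (fun x => (W x)⁻¹) (Ioo a c) := hW.inv₀ fun x hx => (hpos x hx).ne'
  refine ⟨fun x => ∫ s in x₀..x, (W s)⁻¹, fun x hx => ?_⟩
  refine intervalIntegral.integral_hasDerivAt_right (ContinuousOn.intervalIntegrable
    (hc.mono ?_)) (hc.stronglyMeasurableAtFilter isOpen_Ioo x hx)
    (hc.continuousAt (Ioo_mem_nhds hx.1 hx.2))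
  exact (ordConnected_Ioo.uIcc_subset hx₀ hx)

/-- Since `1 / W ≥ 1 / (k (x - a))` near `a`, the primitive falls at least as fast as `log (x - a) /
k`: leaving the equilibrium takes infinite time. -/
theorem tendsto_primitive_atBot (hpos : ∀ x ∈ Ioo a c, 0 < W x)
    (hT : ∀ x ∈ Ioo a c, HasDerivAt T (W x)⁻¹ x) {k : ℝ} (hk : 0 < k)
    (hx₀ : x₀ ∈ Ioo a c) (hWk : ∀ x ∈ Ioo a x₀, W x ≤ k * (x - a)) :
    Tendsto T (𝓝[>] a) atBot := by
  have hmono : MonotoneOn (fun x => T x - k⁻¹ * Real.log (x - a)) (Ioc a x₀) := by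
    have hd : ∀ x ∈ Ioc a x₀, HasDerivAt (fun x => T x - k⁻¹ * Real.log (x - a))
        ((W x)⁻¹ - k⁻¹ * (1 / (x - a))) x := fun x hx =>
      (hT x ⟨hx.1, hx.2.trans_lt hx₀.2⟩).sub
        ((((hasDerivAt_id' x).sub_const a).log (by linarith [hx.1] : x - a ≠ 0)).const_mul k⁻¹)
    refine monotoneOn_of_hasDerivWithinAt_nonneg (convex_Ioc a x₀)
      (f' := fun x => (W x)⁻¹ - k⁻¹ * (1 / (x - a)))
      (fun x hx => (hd x hx).continuousAt.continuousWithinAt) (fun x hx => ?_) (fun x hx => ?_)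
    · exact (hd x (interior_subset hx)).hasDerivWithinAt
    · rw [interior_Ioc] at hx
      have h1 := hpos x ⟨hx.1, hx.2.trans hx₀.2⟩
      have h2 := inv_anti₀ h1 (hWk x hx)
      rw [mul_inv] at h2
      rw [one_div]; linarith
  have hlog : Tendsto (fun x => k⁻¹ * Real.log (x - a) + (T x₀ - k⁻¹ * Real.log (x₀ - a)))
      (𝓝[>] a) atBot := by
    refine tendsto_atBot_add_const_right _ _ (Tendsto.const_mul_atBot (inv_pos.2 hk) ?_)
    refine Real.tendsto_log_nhdsGT_zero.comp ?_
    refine tendsto_nhdsWithin_of_tendsto_nhds_of_eventually_within _ ?_ ?_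
    · have : Tendsto (fun x : ℝ => x - a) (𝓝 a) (𝓝 (a - a)) := (continuous_sub_right a).tendsto a
      rw [sub_self] at this
      exact this.mono_left nhdsWithin_le_nhds
    · filter_upwards [self_mem_nhdsWithin] with x hx using sub_pos.2 (mem_Ioi.1 hx)
  refine tendsto_atBot_mono' _ ?_ hlog
  filter_upwards [Ioo_mem_nhdsGT hx₀.1] with x hx
  have := hmono ⟨hx.1, hx.2.le⟩ ⟨hx₀.1, le_rfl⟩ hx.2.le
  simp only at this
  linarith

theorem tendsto_primitive_atTop (hpos : ∀ x ∈ Ioo a c, 0 < W x)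
    (hT : ∀ x ∈ Ioo a c, HasDerivAt T (W x)⁻¹ x) {k : ℝ} (hk : 0 < k)
    (hx₀ : x₀ ∈ Ioo a c) (hWk : ∀ x ∈ Ioo x₀ c, W x ≤ k * (c - x)) :
    Tendsto T (𝓝[<] c) atTop := by
  have h1 := tendsto_primitive_atBot (a := -c) (c := -a) (W := fun x => W (-x))
    (T := fun x => - T (-x)) (x₀ := -x₀) (k := k)
    (fun x hx => hpos (-x) ⟨by linarith [hx.2], by linarith [hx.1]⟩)
    (fun x hx => by
      have := ((hT (-x) ⟨by linarith [hx.2], by linarith [hx.1]⟩).comp x (hasDerivAt_neg x)).neg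
      refine this.congr_deriv ?_
      ring) hk ⟨by linarith [hx₀.2], by linarith [hx₀.1]⟩
    (fun x hx => by
      have := hWk (-x) ⟨by linarith [hx.2], by linarith [hx.1]⟩
      linarith)
  have h2 : Tendsto (fun x : ℝ => -x) (𝓝[<] c) (𝓝[>] (-c)) := by
    refine tendsto_nhdsWithin_of_tendsto_nhds_of_eventually_within _
      ((continuous_neg.tendsto c).mono_left nhdsWithin_le_nhds) ?_
    filter_upwards [self_mem_nhdsWithin] with y hy using neg_lt_neg (mem_Iio.1 hy)
  have h3 := tendsto_neg_atBot_atTop.comp (h1.comp h2)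
  simpa [Function.comp_def] using h3

theorem tendsto_inverse_left (hmono : StrictMonoOn T (Ioo a c)) {J : Set ℝ} (hac : a < c)
    (hu : ∀ z ∈ J, u z ∈ Ioo a c ∧ T (u z) = z) {l : Filter ℝ} (hl : ∀ᶠ z in l, z ∈ J)
    (hlT : ∀ x ∈ Ioo a c, ∀ᶠ z in l, z < T x) : Tendsto u l (𝓝 a) := by
  rw [tendsto_order]
  constructor
  · intro y hy
    filter_upwards [hl] with z hz using hy.trans (hu z hz).1.1
  · intro y hy
    obtain ⟨x, hx1, hx2⟩ := exists_between (lt_min hy hac)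
    have hx : x ∈ Ioo a c := ⟨hx1, hx2.trans_le (min_le_right _ _)⟩
    filter_upwards [hl, hlT x hx] with z hz hzT
    rw [← (hu z hz).2] at hzT
    exact ((hmono.lt_iff_lt (hu z hz).1 hx).1 hzT).trans (hx2.trans_le (min_le_left _ _))

theorem tendsto_inverse_right (hmono : StrictMonoOn T (Ioo a c)) {J : Set ℝ} (hac : a < c)
    (hu : ∀ z ∈ J, u z ∈ Ioo a c ∧ T (u z) = z) {l : Filter ℝ} (hl : ∀ᶠ z in l, z ∈ J)
    (hlT : ∀ x ∈ Ioo a c, ∀ᶠ z in l, T x < z) : Tendsto u l (𝓝 c) := by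
  rw [tendsto_order]
  constructor
  · intro y hy
    obtain ⟨x, hx1, hx2⟩ := exists_between (max_lt hy hac)
    have hx : x ∈ Ioo a c := ⟨(le_max_right _ _).trans_lt hx1, hx2⟩
    filter_upwards [hl, hlT x hx] with z hz hzT
    rw [← (hu z hz).2] at hzT
    exact ((le_max_left _ _).trans_lt hx1).trans ((hmono.lt_iff_lt hx (hu z hz).1).1 hzT)
  · intro y hy
    filter_upwards [hl] with z hz using (hu z hz).1.2.trans hy

end Flow

theorem IsEnergy.hasDerivAt_comp_sqrt (hY : IsEnergy G H a b Y) {z : ℝ} (hu : u z ∈ Ioo a b)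
    (hpos : 0 < Y (u z)) (hd : HasDerivAt u (√(2 * Y (u z))) z) :
    HasDerivAt (fun z => √(2 * Y (u z))) (G (u z) + H (u z) * √(2 * Y (u z))) z := by
  refine ((hY.hasDerivAt_sqrt hu hpos).comp z hd).congr_deriv ?_
  have : 0 < √(2 * Y (u z)) := Real.sqrt_pos.2 (by linarith)
  field_simp

/-- The linear growth of `G` at the equilibrium gives a linear upper barrier for `√(2 Y)`. This is
the bound under which the travel time to `a` is infinite. -/
theorem exists_local_bound (hh : ContinuousOn H (Icc a b)) (hab : a < b)
    (hl : ∃ C, ∀ᶠ x in 𝓝 a, |G x| ≤ C * |x - a|) (hY : IsEnergy G H a b Y) :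
    ∃ x₀ ∈ Ioo a b, ∃ k > 0, ∀ x ∈ Ioo a x₀, √(2 * Y x) ≤ k * (x - a) := by
  obtain ⟨C, hC⟩ := hl
  obtain ⟨l, hl, hlsub⟩ := (mem_nhdsGT_iff_exists_Ioo_subset' hab).1 (nhdsWithin_le_nhds hC)
  obtain ⟨x₀, h1, h2⟩ := exists_between (lt_min (show a < l from hl) hab)
  have hx₀l := h2.trans_le (min_le_left _ _)
  have hx₀b := h2.trans_le (min_le_right _ _)
  have hGa : G a ≤ 0 := by
    have := hC.self_of_nhds
    simp only [sub_self, abs_zero, mul_zero] at this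
    exact (le_abs_self _).trans this
  obtain ⟨k, hk, hb⟩ := (hY.mono_right hx₀b.le).le_barrier h1.le (C₀ := |C|) (abs_nonneg C)
    (fun x hx => by
      rcases hx.1.lt_or_eq with h3 | rfl
      · have h4 : |G x| ≤ C * |x - a| := hlsub ⟨h3, hx.2.trans_lt hx₀l⟩
        rw [abs_of_pos (sub_pos.2 h3)] at h4
        exact (le_abs_self _).trans (h4.trans (mul_le_mul_of_nonneg_right (le_abs_self C)
          (by linarith)))
      · simpa using hGa) (hh.mono (Icc_subset_Icc_right hx₀b.le))
  exact ⟨x₀, ⟨h1, hx₀b⟩, k, hk, fun x hx => hb x (Ioo_subset_Icc_self hx)⟩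

/-- The energy of a heteroclinic orbit gives rise to a heteroclinic solution. -/
theorem exists_heteroclinic (hab : a < b) (hI : Ioo a b ⊆ I)
    (hH : ContinuousOn H (Icc a b)) (hla : ∃ C, ∀ᶠ x in 𝓝 a, |G x| ≤ C * |x - a|)
    (hlb : ∃ C, ∀ᶠ x in 𝓝 b, |G x| ≤ C * |x - b|) (hY : IsEnergy G H a b Y)
    (hpos : ∀ x ∈ Ioo a b, 0 < Y x) (hYb : Y b = 0) :
    ∃ u w : ℝ → ℝ, IsSol I G H u w ∧ Tendsto u atBot (𝓝 a) ∧ Tendsto u atTop (𝓝 b) ∧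
      Tendsto w atBot (𝓝 0) ∧ Tendsto w atTop (𝓝 0) ∧ ∀ z, 0 < w z := by
  have hWpos : ∀ x ∈ Ioo a b, 0 < √(2 * Y x) := fun x hx =>
    Real.sqrt_pos.2 (by linarith [hpos x hx])
  have hWc : ContinuousOn (fun x => √(2 * Y x)) (Icc a b) :=
    (continuousOn_const.mul hY.continuousOn).sqrt
  obtain ⟨T, hT⟩ := exists_primitive_inv hab hWpos (hWc.mono Ioo_subset_Icc_self)
  obtain ⟨x₀, hx₀, k, hk, hka⟩ := exists_local_bound hH hab hla hY
  have hTa := tendsto_primitive_atBot hWpos hT hk hx₀ hka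
  obtain ⟨C, hC⟩ := hlb
  -- The right end is treated through the mirrored energy, which starts from zero at `-b` because `Y
  -- b = 0`.
  obtain ⟨x₁, hx₁, k', hk', hkb⟩ := exists_local_bound (G := fun v => -G (-v))
    (H := fun v => -H (-v)) (a := -b) (b := -a) (Y := fun v => Y (-v))
    ((hH.comp continuous_neg.continuousOn
      (fun v hv => ⟨by linarith [hv.2], by linarith [hv.1]⟩)).neg) (by linarith)
    ⟨C, by
      have := (continuous_neg.tendsto (-b)).eventually (by rw [neg_neg]; exact hC)
      filter_upwards [this] with x hx
      rw [abs_neg, show x - -b = -(-x - b) by ring, abs_neg]; exact hx⟩ (hY.mirror hYb)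
  have hTb := tendsto_primitive_atTop (x₀ := -x₁) hWpos hT hk'
    ⟨by linarith [hx₁.2], by linarith [hx₁.1]⟩ (fun x hx => by
      have := hkb (-x) ⟨by linarith [hx.2], by linarith [hx.1]⟩
      rw [neg_neg] at this
      linarith)
  have hTc : ContinuousOn T (Ioo a b) := fun x hx => (hT x hx).continuousAt.continuousWithinAt
  have himg : T '' Ioo a b = univ := by
    have := NeBot.mono (inferInstance : (𝓝[>] a).NeBot) le_rfl
    refine univ_subset_iff.1 (isPreconnected_Ioo.intermediate_value_Iii
      (l₁ := 𝓝[>] a) (l₂ := 𝓝[<] b) (le_principal_iff.2 (Ioo_mem_nhdsGT hab))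
      (le_principal_iff.2 (Ioo_mem_nhdsLT hab)) hTc hTa hTb)
  obtain ⟨u, hu⟩ := exists_inverse_flow hWpos hT isOpen_univ himg
  have hmono : StrictMonoOn T (Ioo a b) := strictMonoOn_of_hasDerivWithinAt_pos (convex_Ioo a b)
    hTc (fun x hx => (hT x (interior_subset hx)).hasDerivWithinAt)
    (fun x hx => inv_pos.2 (hWpos x (interior_subset hx)))
  have hu' : ∀ z ∈ univ, u z ∈ Ioo a b ∧ T (u z) = z := fun z hz => ⟨(hu z hz).1, (hu z hz).2.1⟩
  have h0 : Tendsto u atBot (𝓝 a) := tendsto_inverse_left hmono hab hu' (by simp)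
    fun x _ => eventually_lt_atBot _
  have h1 : Tendsto u atTop (𝓝 b) := tendsto_inverse_right hmono hab hu' (by simp)
    fun x _ => eventually_gt_atTop _
  have hw : ∀ c ∈ Icc a b, Y c = 0 → ∀ l : Filter ℝ, Tendsto u l (𝓝 c) →
      Tendsto (fun z => √(2 * Y (u z))) l (𝓝 0) := by
    intro c hc hc0 l hl
    have h2 := (hWc c hc).tendsto.comp (tendsto_nhdsWithin_of_tendsto_nhds_of_eventually_within _ hl
      (Eventually.of_forall fun z => Ioo_subset_Icc_self (hu z (mem_univ z)).1))
    simpa [hc0, Function.comp_def] using h2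
  refine ⟨u, fun z => √(2 * Y (u z)), fun z => ⟨hI (hu z (mem_univ z)).1, (hu z (mem_univ z)).2.2,
    hY.hasDerivAt_comp_sqrt (hu z (mem_univ z)).1 (hpos _ (hu z (mem_univ z)).1)
      (hu z (mem_univ z)).2.2⟩, h0, h1, hw a ⟨le_rfl, hab.le⟩ hY.init _ h0,
    hw b ⟨hab.le, le_rfl⟩ hYb _ h1, fun z => hWpos _ (hu z (mem_univ z)).1⟩

end TravelingWave

/-! ### Existence of homoclinic solutions from two energies with a common zero. -/

namespace TravelingWave

variable {I : Set ℝ} {G H u w Y Z W T : ℝ → ℝ} {a b c m p x₀ : ℝ}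

/-- The primitive of `1 / √(2 Y)` is bounded near a transversal zero of `Y`. -/
theorem primitive_bounded (hG : ContinuousAt G p) (hH : ContinuousAt H p) (hGp : G p < 0)
    (hY : IsEnergy G H a b Y) (hap : a < p) (hpb : p < b) (hpos : ∀ x ∈ Ioo a p, 0 < Y x)
    (hp0 : Y p = 0) (hT : ∀ x ∈ Ioo a p, HasDerivAt T (√(2 * Y x))⁻¹ x) :
    ∃ τ, ∀ᶠ x in 𝓝[<] p, T x ≤ τ := by
  set γ := - G p / 2
  have hγ : 0 < γ := by simp only [γ]; linarith
  have e1 : ∀ᶠ x in 𝓝[<] p, G x < -γ := (hG.eventually (gt_mem_nhds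
    (by simp only [γ]; linarith))).filter_mono nhdsWithin_le_nhds
  have e2 : ∀ᶠ x in 𝓝[<] p, |H x| < |H p| + 1 := (hH.abs.eventually (gt_mem_nhds
    (lt_add_one _))).filter_mono nhdsWithin_le_nhds
  -- The slope of `√(2 Y)` is `G / √(2 Y) + H` with `G < -γ` near `p`. With `lam = 2 / γ` the
  -- function `T + lam √(2 Y)` is nonincreasing once `√(2 Y)` is small, so `p` is reached in finite
  -- time.
  set lam := 2 / γ
  have hlam : 0 < lam := by positivity
  have e3 : ∀ᶠ x in 𝓝[<] p, √(2 * Y x) < (lam * (|H p| + 1))⁻¹ := by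
    have h1 : ContinuousAt (fun x => √(2 * Y x)) p :=
      (((hY.hasDerivAt ⟨hap, hpb⟩).continuousAt).const_mul 2).sqrt
    refine (h1.eventually (gt_mem_nhds ?_)).filter_mono nhdsWithin_le_nhds
    show √(2 * Y p) < _
    rw [hp0, mul_zero, Real.sqrt_zero]
    positivity
  obtain ⟨l, hl, hlsub⟩ := (mem_nhdsLT_iff_exists_Ioo_subset' hap).1 ((e1.and e2).and
    (e3.and (Ioo_mem_nhdsLT hap)))
  obtain ⟨y, hy1, hy2⟩ := exists_between (show l < p from hl)
  have hanti : AntitoneOn (fun x => T x + lam * √(2 * Y x)) (Ico y p) := by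
    have hd : ∀ x ∈ Ico y p, HasDerivAt (fun x => T x + lam * √(2 * Y x))
        ((√(2 * Y x))⁻¹ + lam * (G x / √(2 * Y x) + H x)) x := fun x hx => by
      have hxI := (hlsub ⟨hy1.trans_le hx.1, hx.2⟩).2.2
      exact (hT x hxI).add ((hY.hasDerivAt_sqrt ⟨hxI.1, hxI.2.trans hpb⟩ (hpos x hxI)).const_mul lam)
    refine antitoneOn_of_hasDerivWithinAt_nonpos (convex_Ico y p)
      (f' := fun x => (√(2 * Y x))⁻¹ + lam * (G x / √(2 * Y x) + H x))
      (fun x hx => (hd x hx).continuousAt.continuousWithinAt)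
      (fun x hx => (hd x (interior_subset hx)).hasDerivWithinAt) (fun x hx => ?_)
    rw [interior_Ico] at hx
    obtain ⟨⟨h1, h2⟩, h3, h4⟩ := hlsub ⟨hy1.trans hx.1, hx.2⟩
    have hW : 0 < √(2 * Y x) := Real.sqrt_pos.2 (by linarith [hpos x h4])
    set q := √(2 * Y x)
    have h5 : lam * (|H p| + 1) < q⁻¹ := by
      rw [lt_inv_comm₀ (by positivity) hW]; exact h3
    have h6 : lam * H x ≤ lam * (|H p| + 1) :=
      mul_le_mul_of_nonneg_left ((le_abs_self _).trans h2.le) hlam.le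
    have h7 : lam * (G x / q) ≤ -2 * q⁻¹ := by
      have : lam * G x ≤ -2 := by
        have h8 : lam * G x ≤ lam * (-γ) := mul_le_mul_of_nonneg_left h1.le hlam.le
        have h9 : lam * γ = 2 := by simp only [lam]; field_simp
        linarith
      rw [div_eq_mul_inv, ← mul_assoc]
      exact mul_le_mul_of_nonneg_right this (inv_pos.2 hW).le
    linarith
  refine ⟨T y + lam * √(2 * Y y), ?_⟩
  filter_upwards [Ioo_mem_nhdsLT hy2] with x hx
  have := hanti ⟨le_rfl, hy2⟩ ⟨hx.1.le, hx.2⟩ hx.1.le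
  simp only at this
  linarith [mul_nonneg hlam.le (Real.sqrt_nonneg (2 * Y x))]

/-- The half of a homoclinic orbit on which `w > 0`, in the time parametrization. -/
theorem exists_half_orbit (hG : ContinuousAt G p) (hGp : G p < 0)
    (hH : ContinuousOn H (Icc a b)) (hla : ∃ C, ∀ᶠ x in 𝓝 a, |G x| ≤ C * |x - a|)
    (hY : IsEnergy G H a b Y) (hap : a < p) (hpb : p < b) (hpos : ∀ x ∈ Ioo a p, 0 < Y x)
    (hp0 : Y p = 0) :
    ∃ u : ℝ → ℝ, (∀ z < 0, u z ∈ Ioo a p ∧ HasDerivAt u (√(2 * Y (u z))) z) ∧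
      Tendsto u atBot (𝓝 a) ∧ Tendsto u (𝓝[<] 0) (𝓝 p) := by
  have hWpos : ∀ x ∈ Ioo a p, 0 < √(2 * Y x) := fun x hx =>
    Real.sqrt_pos.2 (by linarith [hpos x hx])
  have hWc : ContinuousOn (fun x => √(2 * Y x)) (Ioo a p) :=
    (continuousOn_const.mul (hY.continuousOn.mono fun x hx => ⟨hx.1.le, (hx.2.trans hpb).le⟩)).sqrt
  obtain ⟨T₀, hT₀⟩ := exists_primitive_inv hap hWpos hWc
  have hHp : ContinuousAt H p := hH.continuousAt (Icc_mem_nhds hap hpb)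
  obtain ⟨τ₀, hτ₀⟩ := primitive_bounded hG hHp hGp hY hap hpb hpos hp0 hT₀
  have hmono₀ : StrictMonoOn T₀ (Ioo a p) := strictMonoOn_of_hasDerivWithinAt_pos (convex_Ioo a p)
    (fun x hx => (hT₀ x hx).continuousAt.continuousWithinAt)
    (fun x hx => (hT₀ x (interior_subset hx)).hasDerivWithinAt)
    (fun x hx => inv_pos.2 (hWpos x (interior_subset hx)))
  have hbdd : ∀ x ∈ Ioo a p, T₀ x ≤ τ₀ := by
    intro x hx
    obtain ⟨y, hy, hy1, hy2⟩ := (hτ₀.and (Ioo_mem_nhdsLT hx.2)).exists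
    exact (hmono₀.monotoneOn hx ⟨hx.1.trans hy1, hy2⟩ hy1.le).trans hy
  -- Subtracting the supremum places the arrival at `p` at time zero.
  set τ := sSup (T₀ '' Ioo a p)
  have hba : BddAbove (T₀ '' Ioo a p) := ⟨τ₀, by rintro _ ⟨x, hx, rfl⟩; exact hbdd x hx⟩
  have hlt : ∀ x ∈ Ioo a p, T₀ x < τ := fun x hx => by
    obtain ⟨y, hy1, hy2⟩ := exists_between hx.2
    have hy : y ∈ Ioo a p := ⟨hx.1.trans hy1, hy2⟩
    exact (hmono₀ hx hy hy1).trans_le (le_csSup hba ⟨y, hy, rfl⟩)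
  set T : ℝ → ℝ := fun x => T₀ x - τ
  have hT : ∀ x ∈ Ioo a p, HasDerivAt T (√(2 * Y x))⁻¹ x := fun x hx => (hT₀ x hx).sub_const τ
  have hmono : StrictMonoOn T (Ioo a p) := fun x hx y hy hxy => sub_lt_sub_right (hmono₀ hx hy hxy) τ
  have hTc : ContinuousOn T (Ioo a p) := fun x hx => (hT x hx).continuousAt.continuousWithinAt
  obtain ⟨x₀, hx₀, k, hk, hka⟩ := exists_local_bound (hH.mono (Icc_subset_Icc_right hpb.le)) hap hla
    (hY.mono_right hpb.le)
  have hTa := tendsto_primitive_atBot hWpos hT hk hx₀ hka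
  have himg : T '' Ioo a p = Iio 0 := by
    refine Subset.antisymm ?_ ?_
    · rintro _ ⟨x, hx, rfl⟩
      exact sub_neg.2 (hlt x hx)
    · intro z hz
      have hz' : z < 0 := hz
      obtain ⟨_, ⟨y, hy, rfl⟩, hyz⟩ := exists_lt_of_lt_csSup
        (nonempty_Ioo.2 hap |>.image T₀) (show z + τ < τ by linarith)
      obtain ⟨x, hx1, hx2⟩ := ((hTa.eventually (eventually_lt_atBot z)).and
        (Ioo_mem_nhdsGT hap)).exists
      exact isPreconnected_Ioo.intermediate_value hx2 hy hTc
        ⟨hx1.le, by simp only [T]; linarith⟩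
  obtain ⟨u, hu⟩ := exists_inverse_flow hWpos hT isOpen_Iio himg
  have hu' : ∀ z ∈ Iio (0 : ℝ), u z ∈ Ioo a p ∧ T (u z) = z :=
    fun z hz => ⟨(hu z hz).1, (hu z hz).2.1⟩
  refine ⟨u, fun z hz => ⟨(hu z hz).1, (hu z hz).2.2⟩,
    tendsto_inverse_left hmono hap hu' (eventually_lt_atBot 0) fun x _ => eventually_lt_atBot _,
    tendsto_inverse_right hmono hap hu' self_mem_nhdsWithin fun x hx => ?_⟩
  exact nhdsWithin_le_nhds (lt_mem_nhds (sub_neg.2 (hlt x hx)))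

/-- Two energies with a common transversal zero give rise to a homoclinic solution. -/
theorem exists_homoclinic (hI : Ioc a p ⊆ I) (hG : ContinuousAt G p) (hGp : G p < 0)
    (hH : ContinuousOn H (Icc a b)) (hla : ∃ C, ∀ᶠ x in 𝓝 a, |G x| ≤ C * |x - a|)
    (hY : IsEnergy G H a b Y) (hZ : IsEnergy G (fun x => -H x) a b Z)
    (hap : a < p) (hpb : p < b) (hpos : ∀ x ∈ Ioo a p, 0 < Y x) (hposZ : ∀ x ∈ Ioo a p, 0 < Z x)
    (hp0 : Y p = 0) (hpZ : Z p = 0) :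
    ∃ u w : ℝ → ℝ, IsSol I G H u w ∧ Tendsto u atBot (𝓝 a) ∧ Tendsto u atTop (𝓝 a) ∧
      Tendsto w atBot (𝓝 0) ∧ Tendsto w atTop (𝓝 0) ∧ ¬ ∀ z, u z = a ∧ w z = 0 := by
  obtain ⟨u₁, hu₁, h1a, h1p⟩ := exists_half_orbit hG hGp hH hla hY hap hpb hpos hp0
  obtain ⟨u₂, hu₂, h2a, h2p⟩ := exists_half_orbit hG hGp hH.neg hla hZ hap hpb hposZ hpZ
  -- Both half orbits arrive at `(p, 0)` at time zero. The one built from `Z` is run backwards with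
  -- `w` negated and glued to the other.
  set u : ℝ → ℝ := fun z => if z < 0 then u₁ z else if z = 0 then p else u₂ (-z) with hu
  set w : ℝ → ℝ := fun z => if z < 0 then √(2 * Y (u₁ z)) else
    if z = 0 then 0 else -√(2 * Z (u₂ (-z))) with hw
  have uneg : ∀ z < 0, u z = u₁ z ∧ w z = √(2 * Y (u₁ z)) := fun z hz => by
    simp only [hu, hw, if_pos hz, and_self]
  have upos : ∀ z > 0, u z = u₂ (-z) ∧ w z = -√(2 * Z (u₂ (-z))) := fun z hz => by
    simp only [hu, hw, if_neg (not_lt.2 (le_of_lt hz)), if_neg (ne_of_gt hz), and_self]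
  have u0 : u 0 = p ∧ w 0 = 0 := by simp [hu, hw]
  have hYt : ∀ c ∈ Icc a p, Y c = 0 → ∀ l : Filter ℝ, Tendsto u₁ l (𝓝 c) → (∀ᶠ z in l, z < 0) →
      Tendsto (fun z => √(2 * Y (u₁ z))) l (𝓝 0) := by
    intro c hc hc0 l hl hl0
    have h2 := ((hY.continuousOn c ⟨hc.1, hc.2.trans hpb.le⟩).tendsto.comp
      (tendsto_nhdsWithin_of_tendsto_nhds_of_eventually_within _ hl
      (hl0.mono fun z hz => ⟨(hu₁ z hz).1.1.le, ((hu₁ z hz).1.2.trans hpb).le⟩)))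
    simpa [hc0] using (h2.const_mul 2).sqrt
  have hZt : ∀ c ∈ Icc a p, Z c = 0 → ∀ l : Filter ℝ, Tendsto u₂ l (𝓝 c) → (∀ᶠ z in l, z < 0) →
      Tendsto (fun z => √(2 * Z (u₂ z))) l (𝓝 0) := by
    intro c hc hc0 l hl hl0
    have h2 := ((hZ.continuousOn c ⟨hc.1, hc.2.trans hpb.le⟩).tendsto.comp
      (tendsto_nhdsWithin_of_tendsto_nhds_of_eventually_within _ hl
      (hl0.mono fun z hz => ⟨(hu₂ z hz).1.1.le, ((hu₂ z hz).1.2.trans hpb).le⟩)))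
    simpa [hc0] using (h2.const_mul 2).sqrt
  have hnegt : Tendsto (fun z : ℝ => -z) (𝓝[>] 0) (𝓝[<] 0) := by
    have : Tendsto (fun z : ℝ => -z) (𝓝[>] 0) (𝓝[<] (-0)) := by
      refine tendsto_nhdsWithin_of_tendsto_nhds_of_eventually_within _
        ((continuous_neg.tendsto 0).mono_left nhdsWithin_le_nhds) ?_
      filter_upwards [self_mem_nhdsWithin] with y hy using neg_lt_neg (mem_Ioi.1 hy)
    rwa [neg_zero] at this
  have hHp : ContinuousAt H p := hH.continuousAt (Icc_mem_nhds hap hpb)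
  have hb0 : ∀ᶠ z : ℝ in atBot, z < 0 := eventually_lt_atBot 0
  have ht0 : ∀ᶠ z : ℝ in atTop, z > 0 := eventually_gt_atTop 0
  have huc : ContinuousAt u 0 := by
    rw [continuousAt_iff_continuous_left'_right', ContinuousWithinAt, ContinuousWithinAt, u0.1]
    refine ⟨h1p.congr' ?_, (h2p.comp hnegt).congr' ?_⟩
    · filter_upwards [self_mem_nhdsWithin] with z hz using (uneg z hz).1.symm
    · filter_upwards [self_mem_nhdsWithin] with z hz using (upos z hz).1.symm
  have hwc : ContinuousAt w 0 := by
    rw [continuousAt_iff_continuous_left'_right', ContinuousWithinAt, ContinuousWithinAt, u0.2]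
    constructor
    · refine (hYt p ⟨hap.le, le_rfl⟩ hp0 _ h1p self_mem_nhdsWithin).congr' ?_
      filter_upwards [self_mem_nhdsWithin] with z hz using (uneg z hz).2.symm
    · have := ((hZt p ⟨hap.le, le_rfl⟩ hpZ _ h2p self_mem_nhdsWithin).comp hnegt).neg
      rw [neg_zero] at this
      refine this.congr' ?_
      filter_upwards [self_mem_nhdsWithin] with z hz using (upos z hz).2.symm
  have hdne : ∀ z ≠ 0, HasDerivAt u (w z) z ∧
      HasDerivAt w (G (u z) + H (u z) * w z) z := by
    intro z hz
    rcases lt_or_gt_of_ne hz with hlt | hgt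
    · have hev : ∀ᶠ y in 𝓝 z, y < 0 := gt_mem_nhds hlt
      obtain ⟨h1, h2⟩ := hu₁ z hlt
      rw [(uneg z hlt).1, (uneg z hlt).2]
      refine ⟨h2.congr_of_eventuallyEq (hev.mono fun y hy => (uneg y hy).1), ?_⟩
      exact (hY.hasDerivAt_comp_sqrt ⟨h1.1, h1.2.trans hpb⟩ (hpos _ h1) h2).congr_of_eventuallyEq
        (hev.mono fun y hy => (uneg y hy).2)
    · have hev : ∀ᶠ y in 𝓝 z, y > 0 := lt_mem_nhds hgt
      obtain ⟨h1, h2⟩ := hu₂ (-z) (by linarith)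
      rw [(upos z hgt).1, (upos z hgt).2]
      have h3 := (h2.comp z (hasDerivAt_neg z))
      have h4 := ((hZ.hasDerivAt_comp_sqrt ⟨h1.1, h1.2.trans hpb⟩ (hposZ _ h1) h2).comp z
        (hasDerivAt_neg z)).neg
      refine ⟨(h3.congr_of_eventuallyEq (hev.mono fun y hy => (upos y hy).1)).congr_deriv
        (by ring), (h4.congr_of_eventuallyEq (hev.mono fun y hy => (upos y hy).2)).congr_deriv
        (by ring)⟩
  -- At the junction `z = 0` differentiability follows from the continuity of `u`, `w` and of the
  -- right-hand side.
  have hcont : ContinuousAt (fun z => G (u z) + H (u z) * w z) 0 := by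
    have h1 : ContinuousAt G (u 0) := by rw [u0.1]; exact hG
    have h2 : ContinuousAt H (u 0) := by rw [u0.1]; exact hHp
    exact (h1.comp (f := u) huc).add ((h2.comp (f := u) huc).mul hwc)
  have hsol : IsSol I G H u w := by
    intro z
    rcases lt_trichotomy z 0 with hz | rfl | hz
    · refine ⟨?_, hdne z hz.ne⟩
      rw [(uneg z hz).1]
      exact hI ⟨(hu₁ z hz).1.1, (hu₁ z hz).1.2.le⟩
    · refine ⟨by rw [u0.1]; exact hI ⟨hap, le_rfl⟩, ?_, ?_⟩
      · exact hasDerivAt_of_hasDerivAt_of_ne (fun y hy => (hdne y hy).1) huc hwc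
      · exact hasDerivAt_of_hasDerivAt_of_ne (g := fun z => G (u z) + H (u z) * w z)
          (fun y hy => (hdne y hy).2) hwc hcont
    · refine ⟨?_, hdne z hz.ne'⟩
      rw [(upos z hz).1]
      have := (hu₂ (-z) (by linarith)).1
      exact hI ⟨this.1, this.2.le⟩
  have hnn : Tendsto (fun z : ℝ => -z) atTop atBot := tendsto_neg_atTop_atBot
  refine ⟨u, w, hsol, h1a.congr' (hb0.mono fun z hz => (uneg z hz).1.symm),
    (h2a.comp hnn).congr' (ht0.mono fun z hz => (upos z hz).1.symm),
    (hYt a ⟨le_rfl, hap.le⟩ hY.init _ h1a hb0).congr' (hb0.mono fun z hz => (uneg z hz).2.symm), ?_,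
    fun hcon => hap.ne' (by rw [← u0.1]; exact (hcon 0).1)⟩
  have := ((hZt a ⟨le_rfl, hap.le⟩ hZ.init _ h2a hb0).comp hnn).neg
  rw [neg_zero] at this
  exact this.congr' (ht0.mono fun z hz => (upos z hz).2.symm)

end TravelingWave

/-! ### Orbits as graphs in the plane, and Hausdorff convergence. -/

namespace TravelingWave

variable {u w W W' : ℝ → ℝ} {a b p z₁ : ℝ}

/-- The graph of `W` over `s`, as a subset of the Euclidean plane. -/
def graphOver (s : Set ℝ) (W : ℝ → ℝ) : Set (EuclideanSpace ℝ (Fin 2)) :=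
  {q | q 0 ∈ s ∧ q 1 = W (q 0)}

theorem eq_vec (q : EuclideanSpace ℝ (Fin 2)) : q = !₂[q 0, q 1] := by
  ext i
  fin_cases i <;> simp

theorem vec_mem_graphOver {s : Set ℝ} {x : ℝ} (hx : x ∈ s) :
    (!₂[x, W x] : EuclideanSpace ℝ (Fin 2)) ∈ graphOver s W := by
  simpa [graphOver] using hx

theorem mem_orbit (z : ℝ) : (!₂[u z, w z] : EuclideanSpace ℝ (Fin 2)) ∈ TrafficModel.orbit (u, w) :=
  ⟨z, rfl⟩

theorem exists_eq_of_tendsto (hu : Continuous u) {l l' : Filter ℝ} [l.NeBot] [l'.NeBot]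
    (h0 : Tendsto u l (𝓝 a)) (h1 : Tendsto u l' (𝓝 b)) {x : ℝ} (hx : x ∈ Ioo a b) :
    ∃ z, u z = x := by
  obtain ⟨z, hz⟩ := (h0.eventually (gt_mem_nhds hx.1)).exists
  obtain ⟨z', hz'⟩ := (h1.eventually (lt_mem_nhds hx.2)).exists
  exact mem_range_of_exists_le_of_exists_ge hu ⟨z, hz.le⟩ ⟨z', hz'.le⟩

theorem orbit_eq_graphOver (hu : Continuous u) {l l' : Filter ℝ} [l.NeBot] [l'.NeBot]
    (h0 : Tendsto u l (𝓝 a)) (h1 : Tendsto u l' (𝓝 b))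
    (h : ∀ z, u z ∈ Ioo a b ∧ w z = W (u z)) :
    TrafficModel.orbit (u, w) = graphOver (Ioo a b) W := by
  ext q
  constructor
  · rintro ⟨z, rfl⟩
    simpa [graphOver] using h z
  · rintro ⟨h2, h3⟩
    obtain ⟨z, hz⟩ := exists_eq_of_tendsto hu h0 h1 h2
    rw [eq_vec q, h3, ← hz, ← (h z).2]
    exact mem_orbit z

/-- The times before `z₁` sweep one graph and those after it the other. Both graphs are taken over
`Ioc a p`, so each contains the common tip `(p, 0)`. -/
theorem orbit_eq_union (hu : Continuous u) (h0 : Tendsto u atBot (𝓝 a))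
    (h1 : Tendsto u atTop (𝓝 a)) (hap : a < p) (hup : u z₁ = p) (hwp : w z₁ = 0) (hW : W p = 0)
    (hW' : W' p = 0) (h : ∀ z < z₁, u z ∈ Ioo a p ∧ w z = W (u z))
    (h' : ∀ z > z₁, u z ∈ Ioo a p ∧ w z = W' (u z)) :
    TrafficModel.orbit (u, w) = graphOver (Ioc a p) W ∪ graphOver (Ioc a p) W' := by
  ext q
  constructor
  · rintro ⟨z, rfl⟩
    rcases lt_trichotomy z z₁ with hz | rfl | hz
    · obtain ⟨h2, h3⟩ := h z hz
      exact Or.inl (by simpa [graphOver, h3] using Ioo_subset_Ioc_self h2)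
    · exact Or.inl (by simp [graphOver, hup, hwp, hW, hap])
    · obtain ⟨h2, h3⟩ := h' z hz
      exact Or.inr (by simpa [graphOver, h3] using Ioo_subset_Ioc_self h2)
  · have hp : (!₂[p, 0] : EuclideanSpace ℝ (Fin 2)) ∈ TrafficModel.orbit (u, w) := by
      rw [← hup, ← hwp]; exact mem_orbit z₁
    rintro (⟨h2, h3⟩ | ⟨h2, h3⟩) <;> rw [eq_vec q, h3]
    · rcases h2.2.lt_or_eq with hlt | heq
      · obtain ⟨y, hy, hy'⟩ := ((h0.eventually (gt_mem_nhds h2.1)).and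
          (eventually_le_atBot z₁)).exists
        obtain ⟨z, hz, hzx⟩ := intermediate_value_Icc hy' hu.continuousOn
          (show q 0 ∈ Icc (u y) (u z₁) from ⟨hy.le, by rw [hup]; exact h2.2⟩)
        have : z < z₁ := hz.2.lt_of_ne fun he => by rw [he, hup] at hzx; linarith
        rw [← hzx, ← (h z this).2]
        exact mem_orbit z
      · rwa [heq, hW]
    · rcases h2.2.lt_or_eq with hlt | heq
      · obtain ⟨y, hy, hy'⟩ := ((h1.eventually (gt_mem_nhds h2.1)).and
          (eventually_ge_atTop z₁)).exists
        obtain ⟨z, hz, hzx⟩ := intermediate_value_Icc' hy' hu.continuousOn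
          (show q 0 ∈ Icc (u y) (u z₁) from ⟨hy.le, by rw [hup]; exact h2.2⟩)
        have : z₁ < z := hz.1.lt_of_ne fun he => by rw [← he, hup] at hzx; linarith
        rw [← hzx, ← (h' z this).2]
        exact mem_orbit z
      · rwa [heq, hW']

theorem orbit_neg (u w : ℝ → ℝ) :
    TrafficModel.orbit (fun z => -u z, fun z => -w z) =
      (fun q => -q) '' TrafficModel.orbit (u, w) := by
  rw [TrafficModel.orbit, TrafficModel.orbit, ← range_comp]
  congr 1
  ext z i
  fin_cases i <;> simp

theorem hausdorffEDist_neg (s t : Set (EuclideanSpace ℝ (Fin 2))) :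
    Metric.hausdorffEDist ((fun q => -q) '' s) ((fun q => -q) '' t) =
      Metric.hausdorffEDist s t :=
  Metric.hausdorffEDist_image (IsometryEquiv.neg (EuclideanSpace ℝ (Fin 2))).isometry

theorem dist_vec_le (q q' : EuclideanSpace ℝ (Fin 2)) :
    dist q q' ≤ |q 0 - q' 0| + |q 1 - q' 1| := by
  rw [EuclideanSpace.dist_eq, Fin.sum_univ_two, Real.dist_eq, Real.dist_eq]
  refine Real.sqrt_le_iff.2 ⟨by positivity, ?_⟩
  nlinarith [abs_nonneg (q 0 - q' 0), abs_nonneg (q 1 - q' 1)]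

/-- Hausdorff convergence of graphs from uniform convergence. -/
theorem tendsto_graphOver {ι : Type*} {l : Filter ι} {V : ι → ℝ → ℝ} {S : ι → Set ℝ}
    (hab : a < b) (hW : UniformContinuous W)
    (hV : ∀ ε > 0, ∀ᶠ i in l, ∀ x ∈ S i, |V i x - W x| < ε)
    (hS : ∀ δ > 0, ∀ᶠ i in l, S i ⊆ Ioo (a - δ) (b + δ))
    (hS' : ∀ δ > 0, ∀ᶠ i in l, Icc (a + δ) (b - δ) ⊆ S i) :
    ∀ ε > 0, ∀ᶠ i in l, (∀ q ∈ graphOver (S i) (V i), ∃ q' ∈ graphOver (Ioo a b) W,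
      dist q q' ≤ ε) ∧ ∀ q ∈ graphOver (Ioo a b) W, ∃ q' ∈ graphOver (S i) (V i),
      dist q q' ≤ ε := by
  intro ε hε
  obtain ⟨η, hη, hWη⟩ := Metric.uniformContinuous_iff.1 hW (ε / 4) (by positivity)
  simp only [Real.dist_eq] at hWη
  obtain ⟨δ, hδ, hδ1, hδ2, hδ3⟩ : ∃ δ > 0, 2 * δ < η ∧ 2 * δ ≤ ε / 4 ∧ 2 * δ ≤ b - a := by
    refine ⟨min (η / 3) (min (ε / 8) ((b - a) / 2)), ?_, ?_, ?_, ?_⟩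
    · have : 0 < b - a := by linarith
      positivity
    · linarith [min_le_left (η / 3) (min (ε / 8) ((b - a) / 2))]
    · linarith [min_le_right (η / 3) (min (ε / 8) ((b - a) / 2)),
        min_le_left (ε / 8) ((b - a) / 2)]
    · linarith [min_le_right (η / 3) (min (ε / 8) ((b - a) / 2)),
        min_le_right (ε / 8) ((b - a) / 2)]
  -- The two graphs may have different domains, but only within `δ` of `a` and `b`. Points there are
  -- moved into `[a + δ, b - δ]`, which costs at most `2 δ` horizontally and, by uniform continuity
  -- of `W`, `ε / 4` vertically.
  have hclamp : ∀ x ∈ Ioo (a - δ) (b + δ), ∃ y ∈ Icc (a + δ) (b - δ), |x - y| ≤ 2 * δ := by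
    intro x hx
    rcases lt_or_ge x (a + δ) with h | h
    · exact ⟨a + δ, ⟨le_rfl, by linarith⟩, abs_le.2 ⟨by linarith [hx.1], by linarith⟩⟩
    · rcases lt_or_ge (b - δ) x with h' | h'
      · exact ⟨b - δ, ⟨by linarith, le_rfl⟩, abs_le.2 ⟨by linarith, by linarith [hx.2]⟩⟩
      · exact ⟨x, ⟨h, h'⟩, by simp [hδ.le]⟩
  filter_upwards [hV (ε / 4) (by positivity), hS δ hδ, hS' δ hδ] with i h1 h2 h3
  constructor
  · rintro q ⟨hq0, hq1⟩
    obtain ⟨y, hy, hxy⟩ := hclamp _ (h2 hq0)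
    refine ⟨!₂[y, W y], vec_mem_graphOver ⟨by linarith [hy.1], by linarith [hy.2]⟩,
      (dist_vec_le _ _).trans ?_⟩
    have e1 := h1 _ hq0
    have e2 := hWη (hxy.trans_lt hδ1)
    have e3 : |q 1 - W y| ≤ |V i (q 0) - W (q 0)| + |W (q 0) - W y| := by
      rw [hq1]; exact abs_sub_le _ _ _
    simp only [Matrix.cons_val_zero, Matrix.cons_val_one]
    linarith
  · rintro q ⟨hq0, hq1⟩
    obtain ⟨y, hy, hxy⟩ := hclamp (q 0) ⟨by linarith [hq0.1], by linarith [hq0.2]⟩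
    refine ⟨!₂[y, V i y], vec_mem_graphOver (h3 hy), (dist_vec_le _ _).trans ?_⟩
    have e1 := h1 _ (h3 hy)
    have e2 := hWη (hxy.trans_lt hδ1)
    have e3 : |q 1 - V i y| ≤ |W (q 0) - W y| + |W y - V i y| := by
      rw [hq1]; exact abs_sub_le _ _ _
    rw [abs_sub_comm (W y)] at e3
    simp only [Matrix.cons_val_zero, Matrix.cons_val_one]
    linarith

theorem hausdorffEDist_union_le_of_dist {E : Type*} [PseudoMetricSpace E] {A A' B B' : Set E}
    {ε : ℝ} (hA : (∀ q ∈ A, ∃ q' ∈ B, dist q q' ≤ ε) ∧ ∀ q ∈ B, ∃ q' ∈ A, dist q q' ≤ ε)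
    (hA' : (∀ q ∈ A', ∃ q' ∈ B', dist q q' ≤ ε) ∧ ∀ q ∈ B', ∃ q' ∈ A', dist q q' ≤ ε) :
    Metric.hausdorffEDist (A ∪ A') (B ∪ B') ≤ ENNReal.ofReal ε := by
  refine Metric.hausdorffEDist_le_of_mem_edist ?_ ?_
  · rintro q (h | h)
    · obtain ⟨q', h1, h2⟩ := hA.1 q h
      exact ⟨q', Or.inl h1, by rw [edist_dist]; exact ENNReal.ofReal_le_ofReal h2⟩
    · obtain ⟨q', h1, h2⟩ := hA'.1 q h
      exact ⟨q', Or.inr h1, by rw [edist_dist]; exact ENNReal.ofReal_le_ofReal h2⟩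
  · rintro q (h | h)
    · obtain ⟨q', h1, h2⟩ := hA.2 q h
      exact ⟨q', Or.inl h1, by rw [edist_dist]; exact ENNReal.ofReal_le_ofReal h2⟩
    · obtain ⟨q', h1, h2⟩ := hA'.2 q h
      exact ⟨q', Or.inr h1, by rw [edist_dist]; exact ENNReal.ofReal_le_ofReal h2⟩

theorem tendsto_zero_of_le_ofReal {ι : Type*} {l : Filter ι} {d : ι → ENNReal}
    (h : ∀ ε > 0, ∀ᶠ i in l, d i ≤ ENNReal.ofReal ε) : Tendsto d l (𝓝 0) := by
  refine ENNReal.tendsto_nhds_zero.2 fun ε hε => ?_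
  rcases eq_or_ne ε ⊤ with rfl | hne
  · simp
  · filter_upwards [h ε.toReal (ENNReal.toReal_pos hε.ne' hne)] with i hi
    rwa [ENNReal.ofReal_toReal hne] at hi

end TravelingWave

/-! ### Continuous dependence of energies on coefficients and left end. -/

namespace TravelingWave

variable {G H Y : ℝ → ℝ} {a b m α : ℝ}

/-- Extension of a function by zero to the left of `a`. -/
noncomputable def extendLeft (a : ℝ) (Y : ℝ → ℝ) (u : ℝ) : ℝ := if u ≤ a then 0 else Y u

theorem extendLeft_of_le {u : ℝ} (h : u ≤ a) : extendLeft a Y u = 0 := if_pos h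

theorem extendLeft_of_gt {u : ℝ} (h : a < u) : extendLeft a Y u = Y u := if_neg (not_le.2 h)

theorem IsEnergy.extendLeft_of_ge (hY : IsEnergy G H a b Y) {u : ℝ} (h : a ≤ u) :
    extendLeft a Y u = Y u := by
  rcases h.eq_or_lt with rfl | h
  · rw [extendLeft_of_le le_rfl, hY.init]
  · exact extendLeft_of_gt h

/-- Freezing `G` at `a`, where it vanishes, makes zero a solution to the left of `a`. Energies with
varying left ends thereby live on one interval `[α, b]`. -/
theorem IsEnergy.hasDerivWithinAt_extendLeft (hY : IsEnergy G H a b Y) (hG : G a = 0)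
    (hα : α ≤ a) (hab : a ≤ b) : ∀ u ∈ Icc α b, HasDerivWithinAt (extendLeft a Y)
      (G (max u a) + H u * √(2 * extendLeft a Y u)) (Icc α b) u := by
  intro u hu
  rw [← Icc_union_Icc_eq_Icc hα hab]
  refine HasDerivWithinAt.union ?_ ?_
  · rcases le_or_gt u a with h | h
    · rw [max_eq_right h, extendLeft_of_le h, hG]
      simpa using (hasDerivWithinAt_const u (Icc α a) (0 : ℝ)).congr
        (fun x hx => extendLeft_of_le hx.2) (extendLeft_of_le h)
    · exact HasFDerivWithinAt.of_notMem_closure (by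
        rw [isClosed_Icc.closure_eq]; exact fun hh => (hh.2.trans_lt h).false)
  · rcases lt_or_ge u a with h | h
    · exact HasFDerivWithinAt.of_notMem_closure (by
        rw [isClosed_Icc.closure_eq]; exact fun hh => (hh.1.trans_lt h).false)
    · rw [max_eq_left h, hY.extendLeft_of_ge h]
      exact (hY.deriv u ⟨h, hu.2⟩).congr (fun x hx => hY.extendLeft_of_ge hx.1)
        (hY.extendLeft_of_ge h)

theorem tendstoUniformlyOn_mul {ι : Type*} {l : Filter ι} {P Q : ι → ℝ → ℝ}
    {p q : ℝ → ℝ} {s : Set ℝ} (hs : IsCompact s) (hP : TendstoUniformlyOn P p l s)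
    (hQ : TendstoUniformlyOn Q q l s) (hp : ContinuousOn p s) (hq : ContinuousOn q s) :
    TendstoUniformlyOn (fun i x => P i x * Q i x) (fun x => p x * q x) l s := by
  have := (hP.tendstoLocallyUniformlyOn).mul₀ (hQ.tendstoLocallyUniformlyOn) hp hq
  exact (tendstoLocallyUniformlyOn_iff_tendstoUniformlyOn_of_compact hs).1 this

theorem tendstoUniformlyOn_sqrt {ι : Type*} {l : Filter ι} {P : ι → ℝ → ℝ}
    {p : ℝ → ℝ} {s : Set ℝ} (hP : TendstoUniformlyOn P p l s) :
    TendstoUniformlyOn (fun i x => √(2 * P i x)) (fun x => √(2 * p x)) l s := by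
  rw [Metric.tendstoUniformlyOn_iff] at hP ⊢
  intro ε hε
  filter_upwards [hP (ε ^ 2 / 2) (by positivity)] with i hi x hx
  have := hi x hx
  rw [Real.dist_eq] at this ⊢
  refine (abs_sqrt_sub_sqrt_le _ _).trans_lt ?_
  rw [Real.sqrt_lt' hε, ← mul_sub, abs_mul, abs_two]
  linarith

theorem tendstoUniformlyOn_comp_max {ι : Type*} {l : Filter ι} {P : ι → ℝ → ℝ} {A : ι → ℝ}
    {p : ℝ → ℝ} (hP : TendstoUniformlyOn P p l (Icc α b)) (hp : ContinuousOn p (Icc α b))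
    (hA : Tendsto A l (𝓝 a)) (ha : a ≤ b) (hAb : ∀ᶠ i in l, A i ≤ b) :
    TendstoUniformlyOn (fun i x => P i (max x (A i))) (fun x => p (max x a)) l (Icc α b) := by
  have hu := isCompact_Icc.uniformContinuousOn_of_continuous hp
  rw [Metric.uniformContinuousOn_iff] at hu
  rw [Metric.tendstoUniformlyOn_iff] at hP ⊢
  intro ε hε
  obtain ⟨δ, hδ, hd⟩ := hu (ε / 2) (by positivity)
  filter_upwards [hP (ε / 2) (by positivity), Metric.tendsto_nhds.1 hA δ hδ, hAb]
    with i h1 h2 h3 x hx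
  have e1 : max x (A i) ∈ Icc α b := ⟨hx.1.trans (le_max_left _ _), max_le hx.2 h3⟩
  have e2 : max x a ∈ Icc α b := ⟨hx.1.trans (le_max_left _ _), max_le hx.2 ha⟩
  have e3 : dist (max x a) (max x (A i)) < δ := by
    have h0 : |x - x| < δ := by simpa using hδ
    rw [Real.dist_eq] at h2 ⊢
    rw [abs_sub_comm] at h2
    exact (abs_max_sub_max_le_max x a x (A i)).trans_lt (max_lt h0 h2)
  have := hd _ e2 _ e1 e3
  have e4 := h1 _ e1
  linarith [dist_triangle (p (max x a)) (p (max x (A i))) (P i (max x (A i)))]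

/-- Continuous dependence of energies on the coefficients and the left end. -/
theorem Hump.tendstoUniformlyOn_energy {ι : Type*} {l : Filter ι} {Gi Hi Yi : ι → ℝ → ℝ}
    {A : ι → ℝ} (h : Hump G H a m b) (hY : IsMaxEnergy G H a b Y)
    (hα : α < a) (hA : Tendsto A l (𝓝 a)) (hGc : ContinuousOn G (Icc α b))
    (hHc : ContinuousOn H (Icc α b)) (hGi : TendstoUniformlyOn Gi G l (Icc α b))
    (hHi : TendstoUniformlyOn Hi H l (Icc α b))
    (hGic : ∀ᶠ i in l, ContinuousOn (Gi i) (Icc α b))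
    (hHic : ∀ᶠ i in l, ContinuousOn (Hi i) (Icc α b))
    (hGA : ∀ᶠ i in l, Gi i (A i) = 0)
    (hYi : ∀ᶠ i in l, IsEnergy (Gi i) (Hi i) (A i) b (Yi i))
    (hpos : ∀ u ∈ Ioo a m, ∃ δ > 0, ∀ᶠ i in l, δ ≤ Yi i u) :
    TendstoUniformlyOn (fun i => extendLeft (A i) (Yi i)) (extendLeft a Y) l (Icc α b) := by
  have hab : a < b := h.left_lt.trans h.lt_right
  have hAb : ∀ᶠ i in l, A i < b := hA.eventually (gt_mem_nhds hab)
  have hAα : ∀ᶠ i in l, α < A i := hA.eventually (lt_mem_nhds hα)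
  have hd : ∀ᶠ i in l, ∀ u ∈ Icc α b, HasDerivWithinAt (extendLeft (A i) (Yi i))
      (Gi i (max u (A i)) + Hi i u * √(2 * extendLeft (A i) (Yi i) u)) (Icc α b) u := by
    filter_upwards [hAb, hAα, hGA, hYi] with i h1 h2 h3 h4
    exact h4.hasDerivWithinAt_extendLeft h3 h2.le h1.le
  obtain ⟨C₀, hC₀⟩ := isCompact_Icc.exists_bound_of_continuousOn hGc
  obtain ⟨C₁, hC₁⟩ := isCompact_Icc.exists_bound_of_continuousOn hHc
  simp only [Real.norm_eq_abs] at hC₀ hC₁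
  have hmem : b ∈ Icc α b := ⟨(hα.trans hab).le, le_rfl⟩
  have hC₀0 : 0 ≤ C₀ := (abs_nonneg _).trans (hC₀ b hmem)
  have hC₁0 : 0 ≤ C₁ := (abs_nonneg _).trans (hC₁ b hmem)
  have hbd : ∀ᶠ i in l, ∀ u ∈ Icc α b,
      |Gi i (max u (A i)) + Hi i u * √(2 * extendLeft (A i) (Yi i) u)| ≤
        (C₀ + 1) + (C₁ + 1) * √(2 * extendLeft (A i) (Yi i) u) := by
    rw [Metric.tendstoUniformlyOn_iff] at hGi hHi
    filter_upwards [hGi 1 one_pos, hHi 1 one_pos, hAb] with i h1 h2 h3 u hu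
    have e1 : max u (A i) ∈ Icc α b := ⟨hu.1.trans (le_max_left _ _), max_le hu.2 h3.le⟩
    have e2 := h1 _ e1
    have e3 := h2 u hu
    rw [Real.dist_eq] at e2 e3
    have e4 : |Gi i (max u (A i))| ≤ C₀ + 1 := by
      have := abs_sub_abs_le_abs_sub (Gi i (max u (A i))) (G (max u (A i)))
      rw [abs_sub_comm] at this
      linarith [hC₀ _ e1]
    have e5 : |Hi i u| ≤ C₁ + 1 := by
      have := abs_sub_abs_le_abs_sub (Hi i u) (H u)
      rw [abs_sub_comm] at this
      linarith [hC₁ _ hu]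
    refine (abs_add_le _ _).trans (add_le_add e4 ?_)
    rw [abs_mul, abs_of_nonneg (Real.sqrt_nonneg _)]
    exact mul_le_mul_of_nonneg_right e5 (Real.sqrt_nonneg _)
  have hinit : ∀ᶠ i in l, |extendLeft (A i) (Yi i) α| ≤ 1 / 2 := by
    filter_upwards [hAα] with i hi
    rw [extendLeft_of_le hi.le]
    norm_num
  have hlip : ∀ᶠ i in l, ∀ u ∈ Icc α b, ∀ v ∈ Icc α b,
      |extendLeft (A i) (Yi i) u - extendLeft (A i) (Yi i) v| ≤
        energyLip (C₀ + 1) (C₁ + 1) (b - α) * |u - v| := by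
    filter_upwards [hd, hbd, hinit] with i h1 h2 h3
    exact lipschitz_of_energy (by positivity) (by positivity) le_rfl h1 h3 h2
  have hB : ∀ᶠ i in l, ∀ u ∈ Icc α b, |extendLeft (A i) (Yi i) u| ≤
      ((C₀ + 1 + (C₁ + 1) + 1) * (b - α) + 1) ^ 2 / 2 := by
    filter_upwards [hd, hbd, hinit] with i h1 h2 h3 u hu
    refine (abs_le_of_energy (by positivity) (by positivity) h1 h3 h2 u hu).trans ?_
    have h0 : 0 ≤ u - α := by linarith [hu.1]
    have := hu.2
    gcongr
  rw [Metric.tendstoUniformlyOn_iff]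
  intro ε hε
  -- Along any ultrafilter the energies have a uniform limit that solves the limit equation. The
  -- lower bound `hpos` makes that limit positive near `a`, so uniqueness identifies it with `Y`.
  refine mem_iff_ultrafilter.2 fun U hU => ?_
  obtain ⟨Z, hZ⟩ := exists_tendstoUniformlyOn_of_lipschitz U (hU hB) (hU hlip)
  have hZt : ∀ u ∈ Icc α b, Tendsto (fun i => extendLeft (A i) (Yi i) u) U (𝓝 (Z u)) :=
    fun u hu => hZ.tendsto_at hu
  have hcont : ∀ᶠ i in (U : Filter ι), ContinuousOn (extendLeft (A i) (Yi i)) (Icc α b) :=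
    (hd.filter_mono hU).mono fun i hi u hu => (hi u hu).continuousWithinAt
  have hZc : ContinuousOn Z (Icc α b) := hZ.continuousOn hcont.frequently
  have hyu := (tendstoUniformlyOn_comp_max (fun u hu => hU (hGi u hu)) hGc
    (hA.mono_left hU) hab.le (hU (hAb.mono fun _ h => h.le))).add
    (tendstoUniformlyOn_mul isCompact_Icc
      (fun u hu => hU (hHi u hu)) (tendstoUniformlyOn_sqrt hZ) hHc
      (hZc.const_smul (2 : ℝ)).sqrt)
  have hyc : ∀ᶠ i in (U : Filter ι), ContinuousOn (fun u => Gi i (max u (A i)) +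
      Hi i u * √(2 * extendLeft (A i) (Yi i) u)) (Icc α b) := by
    filter_upwards [hcont, hU hGic, hU hHic, hU hAb] with i h1 h2 h3 h4
    refine (h2.comp (by fun_prop) fun u hu =>
      ⟨hu.1.trans (le_max_left _ _), max_le hu.2 h4.le⟩).add
      (h3.mul (h1.const_smul (2 : ℝ)).sqrt)
  have hZd := hasDerivWithinAt_of_tendstoUniformlyOn (hU hd) hyc hyu hZt
  have hZ0 : ∀ u ∈ Icc α a, Z u = 0 := by
    have h1 : ∀ u ∈ Ico α a, Z u = 0 := fun u hu => by
      refine tendsto_nhds_unique (hZt u ⟨hu.1, (hu.2.trans hab).le⟩)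
        (tendsto_const_nhds.congr' ?_)
      filter_upwards [hU (hA.eventually (lt_mem_nhds hu.2))] with i hi
      exact (extendLeft_of_le hi.le).symm
    have h2 : closure (Ico α a) = Icc α a := closure_Ico hα.ne
    intro u hu
    rw [← h2] at hu
    exact EqOn.of_subset_closure (g := fun _ => (0 : ℝ)) h1
      (hZc.mono (Icc_subset_Icc_right hab.le)) continuousOn_const Ico_subset_Icc_self h2.ge
      (h2 ▸ hu)
  have hE : IsEnergy G H a b Z := by
    refine ⟨hZ0 a ⟨hα.le, le_rfl⟩, fun u hu => ?_⟩
    have := (hZd u ⟨hα.le.trans hu.1, hu.2⟩).mono (Icc_subset_Icc_left hα.le)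
    simpa only [Pi.add_apply, max_eq_left hu.1] using this
  have hEq : EqOn Z Y (Icc a b) := by
    refine h.eqOn_of_pos hY hE ?_
    filter_upwards [Ioo_mem_nhdsGT h.left_lt] with u hu
    obtain ⟨δ, hδ, hev⟩ := hpos u hu
    refine hδ.trans_le (ge_of_tendsto (hZt u ⟨(hα.trans hu.1).le, (hu.2.trans h.lt_right).le⟩) ?_)
    filter_upwards [hU hev, hU (hA.eventually (gt_mem_nhds hu.1))] with i h1 h2
    rwa [extendLeft_of_gt h2]
  have hZe : ∀ u ∈ Icc α b, Z u = extendLeft a Y u := fun u hu => by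
    rcases le_or_gt u a with h1 | h1
    · rw [extendLeft_of_le h1, hZ0 u ⟨hu.1, h1⟩]
    · rw [extendLeft_of_gt h1, hEq ⟨h1.le, hu.2⟩]
  rw [Metric.tendstoUniformlyOn_iff] at hZ
  filter_upwards [hZ ε hε] with i hi u hu
  rw [← hZe u hu]
  exact hi u hu

end TravelingWave

/-! ### Families of equations with a cubic-like nonlinearity and their roots. -/

namespace TravelingWave

/-- The family of equations `u' = w`, `w' = g(u) (F(u) - t) + k(u) (D(u) + ν) w` with a cubic-like
nonlinearity `F`: increasing up to `M`, decreasing on `[M, N]`, and increasing from `N` on. -/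
structure WaveFamily where
  I : Set ℝ
  g : ℝ → ℝ
  k : ℝ → ℝ
  F : ℝ → ℝ
  F' : ℝ → ℝ
  D : ℝ → ℝ
  M : ℝ
  N : ℝ
  B : ℝ
  isOpen : IsOpen I
  ordConnected : I.OrdConnected
  g_pos : ∀ x ∈ I, 0 < g x
  k_pos : ∀ x ∈ I, 0 < k x
  g_cont : ContinuousOn g I
  k_cont : ContinuousOn k I
  hasDerivAt : ∀ x ∈ I, HasDerivAt F (F' x) x
  F'_cont : ContinuousOn F' I
  D_diff : ∀ x ∈ I, DifferentiableAt ℝ D x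
  D_le : ∀ x ∈ I, |D x| ≤ B
  M_mem : M ∈ I
  N_mem : N ∈ I
  M_lt_N : M < N
  inc_left : ∀ x ∈ I, x < M → 0 < F' x
  dec_mid : ∀ x ∈ Ioo M N, F' x < 0
  inc_right : ∀ x ∈ I, N < x → 0 < F' x
  F'_M : F' M = 0
  F'_N : F' N = 0
  D_M : D M = 0
  D_N : D N = 0

namespace WaveFamily

variable (P : WaveFamily)

noncomputable section

/-- The zeroth order coefficient. -/
def G (t u : ℝ) : ℝ := P.g u * (P.F u - t)

/-- The first order coefficient. -/
def H (ν u : ℝ) : ℝ := P.k u * (P.D u + ν)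

/-- Reversal of time. -/
def rev : WaveFamily where
  I := P.I
  g := P.g
  k := P.k
  F := P.F
  F' := P.F'
  D := fun x => -P.D x
  M := P.M
  N := P.N
  B := P.B
  isOpen := P.isOpen
  ordConnected := P.ordConnected
  g_pos := P.g_pos
  k_pos := P.k_pos
  g_cont := P.g_cont
  k_cont := P.k_cont
  hasDerivAt := P.hasDerivAt
  F'_cont := P.F'_cont
  D_diff := fun x hx => (P.D_diff x hx).neg
  D_le := fun x hx => by rw [abs_neg]; exact P.D_le x hx
  M_mem := P.M_mem
  N_mem := P.N_mem
  M_lt_N := P.M_lt_N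
  inc_left := P.inc_left
  dec_mid := P.dec_mid
  inc_right := P.inc_right
  F'_M := P.F'_M
  F'_N := P.F'_N
  D_M := by rw [P.D_M, neg_zero]
  D_N := by rw [P.D_N, neg_zero]

end

theorem rev_H (ν : ℝ) : P.rev.H (-ν) = fun x => -P.H ν x := by
  ext x; simp only [H, rev]; ring

theorem rev_rev : P.rev.rev = P := by
  simp only [rev, neg_neg]

theorem convex_I : Convex ℝ P.I := P.ordConnected.convex

theorem F_cont : ContinuousOn P.F P.I := fun x hx => (P.hasDerivAt x hx).continuousAt.continuousWithinAt

theorem D_cont : ContinuousOn P.D P.I := fun x hx => (P.D_diff x hx).continuousAt.continuousWithinAt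

theorem G_cont (t : ℝ) : ContinuousOn (P.G t) P.I := P.g_cont.mul (P.F_cont.sub continuousOn_const)

theorem H_cont (ν : ℝ) : ContinuousOn (P.H ν) P.I := P.k_cont.mul (P.D_cont.add continuousOn_const)

theorem Icc_subset {x y : ℝ} (hx : x ∈ P.I) (hy : y ∈ P.I) : Icc x y ⊆ P.I :=
  P.ordConnected.out hx hy

theorem strictMonoOn_left : StrictMonoOn P.F (P.I ∩ Iic P.M) := by
  refine strictMonoOn_of_hasDerivWithinAt_pos (P.convex_I.inter (convex_Iic _))
    (P.F_cont.mono inter_subset_left) (f' := P.F') (fun x hx => ?_) (fun x hx => ?_) <;>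
  rw [interior_inter, interior_Iic] at hx
  · exact (P.hasDerivAt x (interior_subset hx.1)).hasDerivWithinAt
  · exact P.inc_left x (interior_subset hx.1) hx.2

theorem strictAntiOn_mid : StrictAntiOn P.F (Icc P.M P.N) := by
  have hs := P.Icc_subset P.M_mem P.N_mem
  refine strictAntiOn_of_hasDerivWithinAt_neg (convex_Icc _ _)
    (P.F_cont.mono hs) (f' := P.F') (fun x hx => ?_) (fun x hx => ?_) <;>
  rw [interior_Icc] at hx
  · exact (P.hasDerivAt x (hs (Ioo_subset_Icc_self hx))).hasDerivWithinAt
  · exact P.dec_mid x hx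

theorem strictMonoOn_right : StrictMonoOn P.F (P.I ∩ Ici P.N) := by
  refine strictMonoOn_of_hasDerivWithinAt_pos (P.convex_I.inter (convex_Ici _))
    (P.F_cont.mono inter_subset_left) (f' := P.F') (fun x hx => ?_) (fun x hx => ?_) <;>
  rw [interior_inter, interior_Ici] at hx
  · exact (P.hasDerivAt x (interior_subset hx.1)).hasDerivWithinAt
  · exact P.inc_right x (interior_subset hx.1) hx.2

/-- `a < m` are the left and the middle root of `F = t`. -/
structure Root (t a m : ℝ) : Prop where
  left_mem : a ∈ P.I
  left_lt : a < P.M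
  left_eq : P.F a = t
  M_lt : P.M < m
  lt_N : m < P.N
  mid_eq : P.F m = t

/-- Moreover, `F < t` on `(m, β)`. -/
structure Adm (t a m β : ℝ) : Prop extends P.Root t a m where
  lt_right : m < β
  right_mem : β ∈ P.I
  neg : ∀ u ∈ Ioo m β, P.F u < t

variable {P} {t t' a a' m m' β β' ν ν' b b' : ℝ}

theorem Root.mid_mem (R : P.Root t a m) : m ∈ P.I :=
  P.Icc_subset P.M_mem P.N_mem ⟨R.M_lt.le, R.lt_N.le⟩

theorem Root.lt_mid (R : P.Root t a m) : a < m := R.left_lt.trans R.M_lt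

theorem Root.pos (R : P.Root t a m) {u : ℝ} (hu : u ∈ Ioo a m) : t < P.F u := by
  rcases le_or_gt u P.M with h | h
  · rw [← R.left_eq]
    exact P.strictMonoOn_left ⟨R.left_mem, R.left_lt.le⟩
      ⟨P.Icc_subset R.left_mem R.mid_mem ⟨hu.1.le, hu.2.le⟩, h⟩ hu.1
  · rw [← R.mid_eq]
    exact P.strictAntiOn_mid ⟨h.le, (hu.2.trans R.lt_N).le⟩ ⟨R.M_lt.le, R.lt_N.le⟩ hu.2

theorem Root.neg_left (R : P.Root t a m) {u : ℝ} (hu : u ∈ P.I) (h : u < a) : P.F u < t := by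
  rw [← R.left_eq]
  exact P.strictMonoOn_left ⟨hu, (h.trans R.left_lt).le⟩ ⟨R.left_mem, R.left_lt.le⟩ h

theorem Root.G_left (R : P.Root t a m) : P.G t a = 0 := by
  rw [G, R.left_eq, sub_self, mul_zero]

theorem Root.unique (R : P.Root t a m) (R' : P.Root t a' m') : a = a' ∧ m = m' :=
  ⟨P.strictMonoOn_left.injOn ⟨R.left_mem, R.left_lt.le⟩ ⟨R'.left_mem, R'.left_lt.le⟩
    (R.left_eq.trans R'.left_eq.symm),
  P.strictAntiOn_mid.injOn ⟨R.M_lt.le, R.lt_N.le⟩ ⟨R'.M_lt.le, R'.lt_N.le⟩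
    (R.mid_eq.trans R'.mid_eq.symm)⟩

theorem Root.lt_of_lt (R : P.Root t a m) (R' : P.Root t' a' m') (h : t < t') :
    a < a' ∧ m' < m := by
  refine ⟨?_, ?_⟩
  · rw [← R.left_eq, ← R'.left_eq] at h
    exact (P.strictMonoOn_left.lt_iff_lt ⟨R.left_mem, R.left_lt.le⟩
      ⟨R'.left_mem, R'.left_lt.le⟩).1 h
  · rw [← R.mid_eq, ← R'.mid_eq] at h
    exact (P.strictAntiOn_mid.lt_iff_gt ⟨R.M_lt.le, R.lt_N.le⟩
      ⟨R'.M_lt.le, R'.lt_N.le⟩).1 h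

theorem Adm.subset (A : P.Adm t a m β) : Icc a β ⊆ P.I := P.Icc_subset A.left_mem A.right_mem

theorem Adm.le (A : P.Adm t a m β) : a < β := A.lt_mid.trans A.lt_right

theorem Adm.mono_right (A : P.Adm t a m β) (h : m < b) (hb : b ≤ β) : P.Adm t a m b :=
  ⟨A.toRoot, h, A.subset ⟨(A.lt_mid.trans h).le, hb⟩, fun u hu => A.neg u ⟨hu.1, hu.2.trans_le hb⟩⟩

/-- Raising the level keeps the right end. -/
theorem Adm.of_le (A : P.Adm t a m β) (R : P.Root t' a' m') (h : t ≤ t') :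
    P.Adm t' a' m' β := by
  have hm : m' ≤ m := by
    rcases h.eq_or_lt with rfl | h
    · exact (R.unique A.toRoot).2.le
    · exact (A.toRoot.lt_of_lt R h).2.le
  refine ⟨R, hm.trans_lt A.lt_right, A.right_mem, fun u hu => ?_⟩
  rcases lt_or_ge m u with h1 | h1
  · exact (A.neg u ⟨h1, hu.2⟩).trans_le h
  · rw [← R.mid_eq]
    exact P.strictAntiOn_mid ⟨R.M_lt.le, R.lt_N.le⟩
      ⟨(R.M_lt.trans hu.1).le, (h1.trans_lt A.lt_N).le⟩ hu.1

theorem Root.rev (R : P.Root t a m) : P.rev.Root t a m :=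
  ⟨R.left_mem, R.left_lt, R.left_eq, R.M_lt, R.lt_N, R.mid_eq⟩

theorem Adm.rev (A : P.Adm t a m β) : P.rev.Adm t a m β :=
  ⟨A.toRoot.rev, A.lt_right, A.right_mem, A.neg⟩

theorem G_lin {x : ℝ} (hx : x ∈ P.I) (ht : P.F x = t) :
    ∃ C, ∀ᶠ y in 𝓝 x, |P.G t y| ≤ C * |y - x| := by
  obtain ⟨C, hC⟩ := (P.hasDerivAt x hx).differentiableAt.isBigO_sub.bound
  have hg := (P.g_cont.continuousAt (P.isOpen.mem_nhds hx)).eventually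
    (gt_mem_nhds (lt_add_one _))
  refine ⟨(P.g x + 1) * C, ?_⟩
  filter_upwards [hC, hg, P.isOpen.mem_nhds hx] with y h1 h2 h3
  have h4 := P.g_pos y h3
  rw [Real.norm_eq_abs, Real.norm_eq_abs, ht] at h1
  rw [G, abs_mul, abs_of_pos h4, mul_assoc]
  exact mul_le_mul h2.le h1 (abs_nonneg _) (h4.trans h2).le

/-- The linear bounds on `G` come from `F' a > 0` and `F' m < 0`. If `H m ≥ 0` then `D m + ν ≥ 0`,
and the differentiability of `D` at `m` leaves `H` at worst `-C (m - u)` just before `m`. -/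
theorem Adm.hump (A : P.Adm t a m β) (ν : ℝ) : Hump (P.G t) (P.H ν) a m β where
  left_lt := A.lt_mid
  lt_right := A.lt_right
  contG := (P.G_cont t).mono A.subset
  contH := (P.H_cont ν).mono A.subset
  pos := fun u hu => mul_pos (P.g_pos u (A.subset ⟨hu.1.le, (hu.2.trans A.lt_right).le⟩))
    (sub_pos.2 (A.pos hu))
  neg := fun u hu => mul_neg_of_pos_of_neg
    (P.g_pos u (A.subset ⟨(A.lt_mid.trans hu.1).le, hu.2.le⟩)) (sub_neg.2 (A.neg u hu))
  lin := by
    have hd := P.inc_left a A.left_mem A.left_lt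
    set c := P.F' a / 2 with hc
    have h1 := eventually_gt_right_of_hasDerivAt_pos (f := fun y => P.F y - c * y)
      ((P.hasDerivAt a A.left_mem).sub ((hasDerivAt_id' a).const_mul c))
      (by rw [mul_one, hc]; linarith)
    have hg := (P.g_cont.continuousAt (P.isOpen.mem_nhds A.left_mem)).eventually
      (lt_mem_nhds (half_lt_self (P.g_pos a A.left_mem)))
    obtain ⟨r, hr, hsub⟩ := mem_nhdsGT_iff_exists_Ioo_subset.1
      (h1.and (nhdsWithin_le_nhds hg))
    have hr' : a < r := hr
    have hga := P.g_pos a A.left_mem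
    refine ⟨P.g a / 2 * c, by positivity, r - a, by linarith, fun u hu => ?_⟩
    rcases hu.1.eq_or_lt with rfl | hlt
    · rw [A.G_left]; simp
    · obtain ⟨h2, h3⟩ := hsub ⟨hlt, by linarith [hu.2]⟩
      have h2' : P.F a - c * a < P.F u - c * u := h2
      have h3' : P.g a / 2 < P.g u := h3
      rw [G, mul_assoc]
      have h4 : 0 ≤ c * (u - a) := mul_nonneg (by positivity) (by linarith)
      refine mul_le_mul h3'.le ?_ h4 (by linarith)
      rw [← A.left_eq]; linarith
  node := by
    intro hH
    have hmI := A.toRoot.mid_mem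
    have hkm := P.k_pos m hmI
    have hD : 0 ≤ P.D m + ν := by
      by_contra hn
      exact absurd hH (not_le.2 (mul_neg_of_pos_of_neg hkm (not_le.1 hn)))
    have hd := P.dec_mid m ⟨A.M_lt, A.lt_N⟩
    set c := P.F' m / 2 with hc
    have h1 := eventually_lt_left_of_hasDerivAt_pos (f := fun y => c * y - P.F y)
      (((hasDerivAt_id' m).const_mul c).sub (P.hasDerivAt m hmI))
      (by rw [mul_one, hc]; linarith)
    have hg := (P.g_cont.continuousAt (P.isOpen.mem_nhds hmI)).eventually
      (lt_mem_nhds (half_lt_self (P.g_pos m hmI)))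
    have hk := (P.k_cont.continuousAt (P.isOpen.mem_nhds hmI)).eventually
      (gt_mem_nhds (lt_add_one _))
    obtain ⟨C, hC⟩ := (P.D_diff m hmI).isBigO_sub.bound
    have hgm := P.g_pos m hmI
    refine ⟨(P.k m + 1) * C, P.g m / 2 * (-c), mul_pos (by positivity) (by linarith), ?_⟩
    filter_upwards [h1, nhdsWithin_le_nhds hg, nhdsWithin_le_nhds hk, nhdsWithin_le_nhds hC,
      nhdsWithin_le_nhds (P.isOpen.mem_nhds hmI), self_mem_nhdsWithin] with u h2 h3 h4 h5 h6 h7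
    have h7' : u < m := h7
    have h3' : P.g m / 2 < P.g u := h3
    rw [Real.norm_eq_abs, Real.norm_eq_abs, abs_of_neg (sub_neg.2 h7')] at h5
    constructor
    · rw [G, mul_assoc]
      have h8 : 0 ≤ -c * (m - u) := mul_nonneg (by linarith) (by linarith)
      refine mul_le_mul h3'.le ?_ h8 (by linarith)
      rw [← A.mid_eq]; linarith
    · have h8 := P.k_pos u h6
      have h9 : -(C * (m - u)) ≤ P.D u - P.D m := by
        have := neg_abs_le (P.D u - P.D m)
        linarith
      have h10 : P.k u * -(C * (m - u)) ≤ P.k u * (P.D u + ν) :=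
        mul_le_mul_of_nonneg_left (by linarith) h8.le
      have h11 : P.k u * (C * (m - u)) ≤ (P.k m + 1) * (C * (m - u)) :=
        mul_le_mul_of_nonneg_right (le_of_lt h4)
          ((abs_nonneg _).trans (by linarith : |P.D u - P.D m| ≤ C * (m - u)))
      rw [H]
      linarith

theorem Adm.saddleHump (A : P.Adm t a m β) (ν : ℝ) :
    SaddleHump P.I (P.G t) (P.H ν) a m β where
  hump := A.hump ν
  hump_neg := by
    have := A.rev.hump (-ν)
    rw [rev_H] at this
    exact this
  nhds := P.isOpen.mem_nhds A.left_mem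
  left_neg := fun x hx hxa => mul_neg_of_pos_of_neg (P.g_pos x hx)
    (sub_neg.2 (A.neg_left hx hxa))
  lin_left := G_lin A.left_mem A.left_eq
  lin_mid := G_lin A.toRoot.mid_mem A.mid_eq
  cont_left := (P.H_cont ν).continuousAt (P.isOpen.mem_nhds A.left_mem)
  cont_mid := (P.H_cont ν).continuousAt (P.isOpen.mem_nhds A.toRoot.mid_mem)

end WaveFamily

end TravelingWave

/-! ### Energies of a family: monotonicity, continuity and the unique connecting parameter. -/

namespace TravelingWave

variable {G H H₀ Y : ℝ → ℝ} {a b m : ℝ}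

/-- If `H` is large, then the energy is positive at the right end. -/
theorem Hump.exists_pos_of_large (h : Hump G H₀ a m b) : ∃ C, ∀ H Y, IsMaxEnergy G H a b Y →
    (∀ u ∈ Icc a b, C ≤ H u) → 0 < Y b := by
  obtain ⟨γ, hγ, δ, hδ, hl⟩ := h.lin
  obtain ⟨C₀, hC₀⟩ := isCompact_Icc.exists_bound_of_continuousOn h.contG
  simp only [Real.norm_eq_abs] at hC₀
  have hab := h.left_lt.trans h.lt_right
  have hC₀0 : 0 ≤ C₀ := (abs_nonneg _).trans (hC₀ a ⟨le_rfl, hab.le⟩)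
  -- For such `H` the line of slope one is a subsolution for `√(2 Y)`: within `δ` of `a` one has `G
  -- ≥ 0`, and farther away `(C₀ / δ) (u - a) ≥ C₀` absorbs `G`.
  refine ⟨1 + C₀ / δ, fun H Y hY hH => ?_⟩
  have := hY.barrier_le hab.le le_rfl zero_le_one (fun u hu => ?_) b ⟨hab.le, le_rfl⟩
  · refine lt_of_lt_of_le ?_ this
    have : 0 < b - a := by linarith
    positivity
  · have hua : 0 ≤ u - a := by linarith [hu.1]
    have h1 := mul_le_mul_of_nonneg_right (hH u ⟨hu.1, hu.2.le⟩) hua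
    rcases lt_or_ge u (a + δ) with h2 | h2
    · have h3 := hl u ⟨hu.1, h2⟩
      have h4 : 0 ≤ C₀ / δ * (u - a) := by positivity
      have h5 : 0 ≤ γ * (u - a) := by positivity
      linarith
    · have h3 := (abs_le.1 (hC₀ u ⟨hu.1, hu.2.le⟩)).1
      have h4 : C₀ ≤ C₀ / δ * (u - a) := by
        rw [div_mul_eq_mul_div, le_div_iff₀ hδ]
        exact mul_le_mul_of_nonneg_left (by linarith) hC₀0
      linarith

/-- If `H` is very negative, then the energy is negative at the right end. -/
theorem Hump.exists_neg_of_small (h : Hump G H₀ a m b) : ∃ C, ∀ H Y, Hump G H a m b →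
    IsEnergy G H a b Y → (∀ᶠ u in 𝓝[>] a, 0 < Y u) →
    (∀ u ∈ Icc a b, H u ≤ -C) → Y b < 0 := by
  obtain ⟨C₀, hC₀⟩ := isCompact_Icc.exists_bound_of_continuousOn h.contG
  simp only [Real.norm_eq_abs] at hC₀
  have hab := h.left_lt.trans h.lt_right
  have hC₀0 : 0 ≤ C₀ := (abs_nonneg _).trans (hC₀ a ⟨le_rfl, hab.le⟩)
  have hmb := h.lt_right
  have ham := h.left_lt
  obtain ⟨m₁, hm₁, hm₁b⟩ := exists_between hmb
  obtain ⟨m₂, hm₂, hm₂b⟩ := exists_between hm₁b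
  obtain ⟨x, hx, hmax⟩ := isCompact_Icc.exists_isMaxOn (nonempty_Icc.2 hm₂.le)
    (h.contG.mono (Icc_subset_Icc (ham.trans hm₁).le hm₂b.le))
  have hGx := h.neg x ⟨hm₁.trans_le hx.1, hx.2.trans_lt hm₂b⟩
  set γ := -G x
  have hγ : 0 < γ := neg_pos.2 hGx
  have hGγ : ∀ u ∈ Icc m₁ m₂, G u ≤ -γ := fun u hu => by
    simpa [γ] using hmax hu
  -- `y₀` is half of the drop that `G ≤ -γ` forces across `[m₁, m₂]`. A bound `H ≤ -C` with `C √(2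
  -- y₀) = C₀ + 1` keeps `Y ≤ y₀` throughout, so `Y m₂ ≤ y₀ - 2 y₀ < 0`.
  set y₀ := γ * (m₂ - m₁) / 2
  have hy₀ : 0 < y₀ := half_pos (mul_pos hγ (by linarith))
  have hs : 0 < √(2 * y₀) := Real.sqrt_pos.2 (by linarith)
  refine ⟨(C₀ + 1) / √(2 * y₀), fun H Y hh hY hp hH => ?_⟩
  have hH0 : ∀ u ∈ Icc a b, H u ≤ 0 := fun u hu => (hH u hu).trans
    (neg_nonpos.2 (by positivity))
  have hle : ∀ u ∈ Icc a b, Y u ≤ y₀ := by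
    refine fun u hu => image_le_of_deriv_right_lt_deriv_boundary (B := fun _ => y₀)
      (B' := fun _ => 0) hY.continuousOn
      (fun x hx => hY.hasDerivWithinAt_Ici hx) (by rw [hY.init]; exact hy₀.le)
      (fun x => hasDerivAt_const x _) (fun x hx hxy => ?_) hu
    rw [hxy]
    have h1 := mul_le_mul_of_nonneg_right (hH x ⟨hx.1, hx.2.le⟩) hs.le
    rw [neg_mul, div_mul_cancel₀ _ hs.ne'] at h1
    linarith [(abs_le.1 (hC₀ x ⟨hx.1, hx.2.le⟩)).2]
  have hdec : Y m₂ ≤ Y m₁ + -γ * (m₂ - m₁) := by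
    refine image_le_of_deriv_right_le_deriv_boundary (f := Y) (a := m₁) (b := m₂)
      (B := fun u => Y m₁ + -γ * (u - m₁)) (B' := fun _ => -γ)
      (hY.continuousOn.mono (Icc_subset_Icc (ham.trans hm₁).le hm₂b.le))
      (fun x hx => hY.hasDerivWithinAt_Ici ⟨(ham.trans hm₁).le.trans hx.1, hx.2.trans hm₂b⟩)
      (by simp) (by fun_prop) (fun x _ => ?_) (fun x hx => ?_) ⟨hm₂.le, le_rfl⟩
    · simpa using ((((hasDerivAt_id' x).sub_const m₁).const_mul (-γ)).const_add
        (Y m₁)).hasDerivWithinAt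
    · have h1 := hGγ x ⟨hx.1, hx.2.le⟩
      have h2 := mul_nonpos_of_nonpos_of_nonneg
        (hH0 x ⟨(ham.trans hm₁).le.trans hx.1, (hx.2.trans hm₂b).le⟩)
        (Real.sqrt_nonneg (2 * Y x))
      linarith
  have hY₂ : Y m₂ < 0 := by
    have := hle m₁ ⟨(ham.trans hm₁).le, hm₁b.le⟩
    have e : γ * (m₂ - m₁) = 2 * y₀ := by simp only [y₀]; ring
    linarith
  exact (hh.strictAntiOn_after hY hp ⟨(hm₁.trans hm₂).le, hm₂b.le⟩ hY₂.le
    ⟨le_rfl, hm₂b.le⟩ ⟨hm₂b.le, le_rfl⟩ hm₂b).trans hY₂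

namespace WaveFamily

variable {P : WaveFamily} {t t' a a' m m' β β' ν ν' b b' α : ℝ}

/-- The energy of the unstable manifold of `a`. -/
noncomputable def E (P : WaveFamily) (t ν a β : ℝ) : ℝ → ℝ :=
  Classical.epsilon (IsMaxEnergy (P.G t) (P.H ν) a β)

theorem isMaxEnergy_E (h : a ≤ β) (hs : Icc a β ⊆ P.I) (ν : ℝ) :
    IsMaxEnergy (P.G t) (P.H ν) a β (P.E t ν a β) :=
  Classical.epsilon_spec (exists_isMaxEnergy h ((P.G_cont t).mono hs) ((P.H_cont ν).mono hs))

theorem Adm.max (A : P.Adm t a m β) (ν : ℝ) :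
    IsMaxEnergy (P.G t) (P.H ν) a β (P.E t ν a β) :=
  isMaxEnergy_E A.le.le A.subset ν

theorem Adm.max_rev (A : P.Adm t a m β) (ν : ℝ) :
    IsMaxEnergy (P.G t) (fun x => -P.H ν x) a β (P.rev.E t (-ν) a β) := by
  have := A.rev.max (-ν)
  rwa [rev_H] at this

theorem Adm.near (A : P.Adm t a m β) (ν : ℝ) : ∀ᶠ u in 𝓝[>] a, 0 < P.E t ν a β u :=
  (A.hump ν).eventually_pos (A.max ν)

/-- Restricting the energy to a shorter interval leaves it positive near `a`, and such an energy is
unique. Energies with different right ends are therefore interchangeable. -/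
theorem Adm.E_eqOn (A : P.Adm t a m β) (ν : ℝ) (hm : m < b) (hb : b ≤ β) :
    EqOn (P.E t ν a b) (P.E t ν a β) (Icc a b) :=
  ((A.mono_right hm hb).hump ν).eqOn_of_pos ((A.max ν).mono_right hb)
    ((A.mono_right hm hb).max ν).toIsEnergy ((A.mono_right hm hb).near ν)

/-- Monotonicity of the energy in both parameters. -/
theorem Adm.E_le (A : P.Adm t a m β) (R : P.Root t' a' m') (ht : t ≤ t') (hν : ν' ≤ ν) :
    ∀ u ∈ Icc a' β, P.E t' ν' a' β u ≤ P.E t ν a β u := by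
  have A' := A.of_le R ht
  have ha : a ≤ a' := by
    rcases ht.eq_or_lt with rfl | ht
    · exact (A.toRoot.unique R).1.le
    · exact (A.toRoot.lt_of_lt R ht).1.le
  refine (A.max ν).le_of_le (A'.max ν').toIsEnergy ha A'.le.le ?_ (fun u hu => ?_) fun u hu => ?_
  · rcases ha.eq_or_lt with rfl | ha
    · rw [(A.max ν).init]
    · exact ((A.hump ν).pos_left (A.max ν).toIsEnergy (A.near ν) a'
        ⟨ha, R.left_lt.trans A.M_lt⟩).le
  · exact mul_le_mul_of_nonneg_left (by linarith) (P.g_pos u (A'.subset ⟨hu.1, hu.2.le⟩)).le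
  · exact mul_le_mul_of_nonneg_left (by linarith) (P.k_pos u (A'.subset ⟨hu.1, hu.2.le⟩)).le

/-- At the value zero, strictness is the comparison at a first zero, here `β` itself; from a
positive value ordinary monotonicity is enough. -/
theorem Adm.E_pos_of_lt (A : P.Adm t a m β) (hν : ν < ν') (h : 0 ≤ P.E t ν a β β) :
    0 < P.E t ν' a β β := by
  rcases h.eq_or_lt with h0 | h0
  · refine (A.hump ν).pos_of_lt (A.max ν).toIsEnergy (A.max ν') (fun u hu => ?_)
      ⟨A.lt_right, le_rfl⟩ ((A.hump ν).pos_of_nonneg (A.max ν).toIsEnergy (A.near ν) h) h0.symm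
    exact mul_lt_mul_of_pos_left (by linarith) (P.k_pos u (A.subset ⟨hu.1, hu.2.le⟩))
  · exact h0.trans_le (A.E_le A.toRoot le_rfl hν.le β ⟨A.le.le, le_rfl⟩)

/-- The left and middle roots persist when the level is raised. -/
theorem Root.exists_of_lt (R : P.Root t a m) (h : t < t') (h' : t' < P.F P.M) :
    ∃ a' m', P.Root t' a' m' := by
  obtain ⟨a', ha, ha'⟩ := intermediate_value_Ioo R.left_lt.le
    (P.F_cont.mono (P.Icc_subset R.left_mem P.M_mem)) ⟨by rwa [R.left_eq], h'⟩
  obtain ⟨m', hm, hm'⟩ := intermediate_value_Ioo' R.M_lt.le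
    (P.F_cont.mono (P.Icc_subset P.M_mem R.mid_mem)) ⟨by rwa [R.mid_eq], h'⟩
  exact ⟨a', m', P.Icc_subset R.left_mem P.M_mem (Ioo_subset_Icc_self ha), ha.2, ha', hm.1,
    hm.2.trans R.lt_N, hm'⟩

/-- The case `a = M` is allowed: it is the fold where the left and the middle root merge, and there
`A i < M` gives the upper half. -/
theorem tendsto_left_root {ι : Type*} {l : Filter ι} {T A C : ι → ℝ} (ha : a ∈ P.I)
    (haM : a ≤ P.M) (hFa : P.F a = t) (hT : Tendsto T l (𝓝 t))
    (hR : ∀ᶠ i in l, P.Root (T i) (A i) (C i)) : Tendsto A l (𝓝 a) := by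
  refine tendsto_order.2 ⟨fun x hx => ?_, fun x hx => ?_⟩
  · obtain ⟨r, hr, hsub⟩ := mem_nhdsLT_iff_exists_Ioo_subset.1
      (mem_nhdsWithin_of_mem_nhds (P.isOpen.mem_nhds ha) : P.I ∈ 𝓝[<] a)
    obtain ⟨y, hy, hya⟩ := exists_between (max_lt hx hr)
    have hyI : y ∈ P.I := hsub ⟨(le_max_right _ _).trans_lt hy, hya⟩
    have hlt := P.strictMonoOn_left ⟨hyI, hya.le.trans haM⟩ ⟨ha, haM⟩ hya
    rw [hFa] at hlt
    filter_upwards [hT.eventually (lt_mem_nhds hlt), hR] with i h1 h2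
    rw [← h2.left_eq] at h1
    exact ((le_max_left _ _).trans_lt hy).trans ((P.strictMonoOn_left.lt_iff_lt
      ⟨hyI, hya.le.trans haM⟩ ⟨h2.left_mem, h2.left_lt.le⟩).1 h1)
  · rcases haM.eq_or_lt with rfl | haM
    · filter_upwards [hR] with i h2 using h2.left_lt.trans hx
    · obtain ⟨y, hy, hyx⟩ := exists_between (lt_min hx haM)
      have hyM := (hyx.trans_le (min_le_right _ _)).le
      have hyI : y ∈ P.I := P.Icc_subset ha P.M_mem ⟨hy.le, hyM⟩
      have hlt := P.strictMonoOn_left ⟨ha, haM.le⟩ ⟨hyI, hyM⟩ hy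
      rw [hFa] at hlt
      filter_upwards [hT.eventually (gt_mem_nhds hlt), hR] with i h1 h2
      rw [← h2.left_eq] at h1
      exact ((P.strictMonoOn_left.lt_iff_lt ⟨h2.left_mem, h2.left_lt.le⟩ ⟨hyI, hyM⟩).1 h1).trans
        (hyx.trans_le (min_le_left _ _))

theorem tendstoUniformlyOn_G {ι : Type*} {l : Filter ι} {T : ι → ℝ} {s : Set ℝ}
    (hs : IsCompact s) (hsI : s ⊆ P.I) (hT : Tendsto T l (𝓝 t)) :
    TendstoUniformlyOn (fun i => P.G (T i)) (P.G t) l s := by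
  have h : TendstoUniformlyOn (fun i (x : ℝ) => P.F x - T i) (fun x => P.F x - t) l s := by
    rw [Metric.tendstoUniformlyOn_iff]
    intro ε hε
    filter_upwards [Metric.tendsto_nhds.1 hT ε hε] with i hi x _
    rwa [dist_sub_left, dist_comm]
  exact tendstoUniformlyOn_mul hs (P := fun _ => P.g)
    (by rw [Metric.tendstoUniformlyOn_iff]; intro ε hε; simp [hε]) h (P.g_cont.mono hsI)
    ((P.F_cont.mono hsI).sub continuousOn_const)

theorem tendstoUniformlyOn_H {ι : Type*} {l : Filter ι} {V : ι → ℝ} {s : Set ℝ}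
    (hs : IsCompact s) (hsI : s ⊆ P.I) (hV : Tendsto V l (𝓝 ν)) :
    TendstoUniformlyOn (fun i => P.H (V i)) (P.H ν) l s := by
  have h : TendstoUniformlyOn (fun i (x : ℝ) => P.D x + V i) (fun x => P.D x + ν) l s := by
    rw [Metric.tendstoUniformlyOn_iff]
    intro ε hε
    filter_upwards [Metric.tendsto_nhds.1 hV ε hε] with i hi x _
    rwa [dist_add_left, dist_comm]
  exact tendstoUniformlyOn_mul hs (P := fun _ => P.k)
    (by rw [Metric.tendstoUniformlyOn_iff]; intro ε hε; simp [hε]) h (P.k_cont.mono hsI)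
    ((P.D_cont.mono hsI).add continuousOn_const)

/-- Joint continuity of the energy in the parameters. -/
theorem Adm.tendsto_E {ι : Type*} {l : Filter ι} {T V A C : ι → ℝ} (A₀ : P.Adm t a m β)
    (hT : Tendsto T l (𝓝 t)) (hV : Tendsto V l (𝓝 ν))
    (hR : ∀ᶠ i in l, P.Adm (T i) (A i) (C i) β) (hα : α < a) (hαI : α ∈ P.I) :
    TendstoUniformlyOn (fun i => extendLeft (A i) (P.E (T i) (V i) (A i) β))
      (extendLeft a (P.E t ν a β)) l (Icc α β) := by
  have hs := P.Icc_subset hαI A₀.right_mem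
  refine (A₀.hump ν).tendstoUniformlyOn_energy (A₀.max ν) hα
    (tendsto_left_root A₀.left_mem A₀.left_lt.le A₀.left_eq hT (hR.mono fun i h => h.toRoot))
    ((P.G_cont t).mono hs) ((P.H_cont ν).mono hs) (tendstoUniformlyOn_G isCompact_Icc hs hT)
    (tendstoUniformlyOn_H isCompact_Icc hs hV) (Eventually.of_forall fun i => (P.G_cont _).mono hs)
    (Eventually.of_forall fun i => (P.H_cont _).mono hs) (hR.mono fun i h => h.G_left)
    (hR.mono fun i h => (h.max _).toIsEnergy) fun u hu => ?_
  have huI := A₀.subset ⟨hu.1.le, (hu.2.trans A₀.lt_right).le⟩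
  have hFu : P.F u ≤ P.F P.M := by
    rcases le_total u P.M with h | h
    · exact P.strictMonoOn_left.monotoneOn ⟨huI, h⟩ ⟨P.M_mem, self_mem_Iic⟩ h
    · exact P.strictAntiOn_mid.antitoneOn ⟨le_rfl, P.M_lt_N.le⟩ ⟨h, (hu.2.trans A₀.lt_N).le⟩ h
  -- A lower bound at `u`, uniform in nearby parameters, comes from a single comparison energy, at a
  -- level `s` between `t` and `F u` and with parameter `ν - 1`. By monotonicity it lies below the
  -- energies of the family and it is positive at `u`.
  obtain ⟨s, hts, hsu⟩ := exists_between (A₀.toRoot.pos hu)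
  obtain ⟨a', m', R⟩ := A₀.toRoot.exists_of_lt hts (hsu.trans_le hFu)
  have A' := A₀.of_le R hts.le
  have hau : a' < u := by
    rcases le_or_gt u P.M with h | h
    · rw [← R.left_eq] at hsu
      exact (P.strictMonoOn_left.lt_iff_lt ⟨R.left_mem, R.left_lt.le⟩ ⟨huI, h⟩).1 hsu
    · exact R.left_lt.trans h
  have hum : u < m' := by
    rcases le_or_gt u P.M with h | h
    · exact h.trans_lt R.M_lt
    · rw [← R.mid_eq] at hsu
      exact (P.strictAntiOn_mid.lt_iff_gt ⟨R.M_lt.le, R.lt_N.le⟩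
        ⟨h.le, (hu.2.trans A₀.lt_N).le⟩).1 hsu
  refine ⟨P.E s (ν - 1) a' β u, (A'.hump _).pos_left (A'.max _).toIsEnergy (A'.near _) u
    ⟨hau, hum⟩, ?_⟩
  filter_upwards [hT.eventually (gt_mem_nhds hts), hV.eventually (lt_mem_nhds (sub_one_lt ν)), hR]
    with i h1 h2 h3
  exact h3.E_le R h1.le h2.le u ⟨hau.le, (hum.trans A'.lt_right).le⟩

theorem Adm.tendsto_E_at {ι : Type*} {l : Filter ι} {T V A C : ι → ℝ} (A₀ : P.Adm t a m β)
    (hT : Tendsto T l (𝓝 t)) (hV : Tendsto V l (𝓝 ν))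
    (hR : ∀ᶠ i in l, P.Adm (T i) (A i) (C i) β) {x : ℝ} (hx : x ∈ Ioc a β) :
    Tendsto (fun i => P.E (T i) (V i) (A i) β x) l (𝓝 (P.E t ν a β x)) := by
  obtain ⟨r, hr, hsub⟩ := mem_nhdsLT_iff_exists_Ioo_subset.1
    (mem_nhdsWithin_of_mem_nhds (P.isOpen.mem_nhds A₀.left_mem) : P.I ∈ 𝓝[<] a)
  obtain ⟨α, hα, hαa⟩ := exists_between (show r < a from hr)
  have h := (A₀.tendsto_E hT hV hR hαa (hsub ⟨hα, hαa⟩)).tendsto_at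
    (show x ∈ Icc α β from ⟨(hαa.trans hx.1).le, hx.2⟩)
  rw [extendLeft_of_gt hx.1] at h
  refine h.congr' ?_
  filter_upwards [(tendsto_left_root A₀.left_mem A₀.left_lt.le A₀.left_eq hT
    (hR.mono fun i h => h.toRoot)).eventually (gt_mem_nhds hx.1)] with i hi
  exact extendLeft_of_gt hi

theorem Adm.continuous_E (A : P.Adm t a m β) {x : ℝ} (hx : x ∈ Ioc a β) :
    Continuous fun ν => P.E t ν a β x :=
  continuous_iff_continuousAt.2 fun ν => A.tendsto_E_at (l := 𝓝 ν) (T := fun _ => t)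
    (V := fun ν => ν) (A := fun _ => a) (C := fun _ => m) tendsto_const_nhds tendsto_id
    (Eventually.of_forall fun _ => A) hx

/-- There is exactly one speed parameter for which the unstable manifold of `a` ends at `β`. -/
theorem Adm.existsUnique_zero (A : P.Adm t a m β) : ∃! ν, P.E t ν a β β = 0 := by
  have hβ : β ∈ Ioc a β := ⟨A.le, le_rfl⟩
  obtain ⟨C, hC⟩ := (A.hump 0).exists_pos_of_large
  obtain ⟨C', hC'⟩ := (A.hump 0).exists_neg_of_small
  obtain ⟨x, hx, hmin⟩ := isCompact_Icc.exists_isMinOn (nonempty_Icc.2 A.le.le)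
    (P.k_cont.mono A.subset)
  have hkx := P.k_pos x (A.subset hx)
  have hB0 : 0 ≤ P.B := (abs_nonneg _).trans (P.D_le a A.left_mem)
  -- Here `D ≥ -B` and `k ≥ k x` on `[a, β]`, so this `ν` makes `H ≥ |C|`. The opposite value below
  -- makes `H ≤ -|C'|`.
  have hpos : 0 < P.E t (P.B + |C| / P.k x) a β β := by
    refine hC _ _ (A.max _) fun u hu => ?_
    have h1 := hmin hu
    have h2 := (abs_le.1 (P.D_le u (A.subset hu))).1
    have h3 : |C| ≤ P.k u * (|C| / P.k x) := by
      rw [mul_div_assoc', le_div_iff₀ hkx, mul_comm]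
      exact mul_le_mul_of_nonneg_right h1 (abs_nonneg C)
    have h4 : P.k u * (|C| / P.k x) ≤ P.k u * (P.D u + (P.B + |C| / P.k x)) :=
      mul_le_mul_of_nonneg_left (by linarith) (P.k_pos u (A.subset hu)).le
    exact (le_abs_self C).trans (h3.trans h4)
  have hneg : P.E t (-(P.B + |C'| / P.k x)) a β β < 0 := by
    refine hC' _ _ (A.hump _) (A.max _).toIsEnergy (A.near _) fun u hu => ?_
    have h1 := hmin hu
    have h2 := (abs_le.1 (P.D_le u (A.subset hu))).2
    have h3 : |C'| ≤ P.k u * (|C'| / P.k x) := by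
      rw [mul_div_assoc', le_div_iff₀ hkx, mul_comm]
      exact mul_le_mul_of_nonneg_right h1 (abs_nonneg C')
    have h4 : P.k u * (P.D u + -(P.B + |C'| / P.k x)) ≤ P.k u * -(|C'| / P.k x) :=
      mul_le_mul_of_nonneg_left (by linarith) (P.k_pos u (A.subset hu)).le
    have h5 := le_abs_self C'
    rw [H]
    linarith
  obtain ⟨ν, hν⟩ := mem_range_of_exists_le_of_exists_ge (A.continuous_E hβ)
    ⟨_, hneg.le⟩ ⟨_, hpos.le⟩
  refine ⟨ν, hν, fun ν' hν' => ?_⟩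
  by_contra hne
  rcases lt_or_gt_of_ne hne with h | h
  · exact (A.E_pos_of_lt h (le_of_eq (Eq.symm hν'))).ne' hν
  · exact (A.E_pos_of_lt h (le_of_eq (Eq.symm hν))).ne' hν'

end WaveFamily

end TravelingWave

/-! ### Mirror symmetry, connecting orbits and the matching condition for pulses. -/

namespace TravelingWave

namespace WaveFamily

/-- Reflection `u ↦ -u`. -/
noncomputable def mirror (P : WaveFamily) : WaveFamily where
  I := -P.I
  g := fun x => P.g (-x)
  k := fun x => P.k (-x)
  F := fun x => -P.F (-x)
  F' := fun x => P.F' (-x)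
  D := fun x => P.D (-x)
  M := -P.N
  N := -P.M
  B := P.B
  isOpen := P.isOpen.neg
  ordConnected := ⟨fun x hx y hy z hz => P.ordConnected.out (x := -y) (y := -x) hy hx
    ⟨neg_le_neg hz.2, neg_le_neg hz.1⟩⟩
  g_pos := fun x hx => P.g_pos _ hx
  k_pos := fun x hx => P.k_pos _ hx
  g_cont := P.g_cont.comp continuous_neg.continuousOn fun _ hx => hx
  k_cont := P.k_cont.comp continuous_neg.continuousOn fun _ hx => hx
  hasDerivAt := fun x hx => by
    have h := ((P.hasDerivAt (-x) hx).comp x (hasDerivAt_neg x)).neg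
    exact h.congr_deriv (by ring)
  F'_cont := P.F'_cont.comp continuous_neg.continuousOn fun _ hx => hx
  D_diff := fun x hx => (P.D_diff (-x) hx).comp x differentiableAt_id.neg
  D_le := fun x hx => P.D_le _ hx
  M_mem := by simpa using P.N_mem
  N_mem := by simpa using P.M_mem
  M_lt_N := neg_lt_neg P.M_lt_N
  inc_left := fun x hx h => P.inc_right _ hx (by linarith)
  dec_mid := fun x hx => P.dec_mid _ ⟨by linarith [hx.2], by linarith [hx.1]⟩
  inc_right := fun x hx h => P.inc_left _ hx (by linarith)
  F'_M := by rw [neg_neg]; exact P.F'_N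
  F'_N := by rw [neg_neg]; exact P.F'_M
  D_M := by rw [neg_neg]; exact P.D_N
  D_N := by rw [neg_neg]; exact P.D_M

variable {P : WaveFamily} {t t' a a' m m' β β' ν ν' b b' α p : ℝ} {u w u' w' : ℝ → ℝ}

theorem mirror_G : P.mirror.G (-t) = fun x => -P.G t (-x) := by
  ext x; simp only [G, mirror]; ring

/-- Three roots `a < m < b` of `F = t`. -/
structure Root₃ (P : WaveFamily) (t a m b : ℝ) : Prop extends P.Root t a m where
  N_lt : P.N < b
  right_mem : b ∈ P.I
  right_eq : P.F b = t

theorem Root₃.adm (R : P.Root₃ t a m b) : P.Adm t a m b := by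
  refine ⟨R.toRoot, R.lt_N.trans R.N_lt, R.right_mem, fun u hu => ?_⟩
  rcases le_or_gt u P.N with h | h
  · rw [← R.mid_eq]
    exact P.strictAntiOn_mid ⟨R.M_lt.le, R.lt_N.le⟩ ⟨(R.M_lt.trans hu.1).le, h⟩ hu.1
  · rw [← R.right_eq]
    exact P.strictMonoOn_right ⟨P.Icc_subset R.toRoot.mid_mem R.right_mem ⟨hu.1.le, hu.2.le⟩, h.le⟩
      ⟨R.right_mem, R.N_lt.le⟩ hu.2

theorem Root₃.pos_right (R : P.Root₃ t a m b) {x : ℝ} (hx : x ∈ P.I) (h : b < x) :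
    0 < P.G t x := by
  refine mul_pos (P.g_pos x hx) (sub_pos.2 ?_)
  rw [← R.right_eq]
  exact P.strictMonoOn_right ⟨R.right_mem, R.N_lt.le⟩ ⟨hx, (R.N_lt.trans h).le⟩ h

theorem Root₃.rev (R : P.Root₃ t a m b) : P.rev.Root₃ t a m b :=
  ⟨R.toRoot.rev, R.N_lt, R.right_mem, R.right_eq⟩

theorem Root₃.mirror (R : P.Root₃ t a m b) : P.mirror.Root₃ (-t) (-b) (-m) (-a) where
  left_mem := by simpa [WaveFamily.mirror] using R.right_mem
  left_lt := neg_lt_neg R.N_lt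
  left_eq := by simp only [WaveFamily.mirror, neg_neg, R.right_eq]
  M_lt := neg_lt_neg R.lt_N
  lt_N := neg_lt_neg R.M_lt
  mid_eq := by simp only [WaveFamily.mirror, neg_neg, R.mid_eq]
  N_lt := neg_lt_neg R.left_lt
  right_mem := by simpa [WaveFamily.mirror] using R.left_mem
  right_eq := by simp only [WaveFamily.mirror, neg_neg, R.left_eq]

theorem Root₃.lt_of_lt (R : P.Root₃ t a m b) (R' : P.Root₃ t' a' m' b') (h : t < t') :
    b < b' := by
  rw [← R.right_eq, ← R'.right_eq] at h
  exact (P.strictMonoOn_right.lt_iff_lt ⟨R.right_mem, R.N_lt.le⟩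
      ⟨R'.right_mem, R'.N_lt.le⟩).1 h

/-- Solutions of the system on the whole line. -/
def Sol (P : WaveFamily) (t ν : ℝ) (u w : ℝ → ℝ) : Prop := IsSol P.I (P.G t) (P.H ν) u w

/-- An increasing heteroclinic solution from `a` to `b`. -/
structure IsUp (P : WaveFamily) (t ν a b : ℝ) (u w : ℝ → ℝ) : Prop where
  sol : P.Sol t ν u w
  u_bot : Tendsto u atBot (𝓝 a)
  u_top : Tendsto u atTop (𝓝 b)
  w_bot : Tendsto w atBot (𝓝 0)
  w_top : Tendsto w atTop (𝓝 0)
  pos : ∀ z, 0 < w z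

/-- A decreasing heteroclinic solution from `b` to `a`. -/
structure IsDown (P : WaveFamily) (t ν a b : ℝ) (u w : ℝ → ℝ) : Prop where
  sol : P.Sol t ν u w
  u_bot : Tendsto u atBot (𝓝 b)
  u_top : Tendsto u atTop (𝓝 a)
  w_bot : Tendsto w atBot (𝓝 0)
  w_top : Tendsto w atTop (𝓝 0)
  neg : ∀ z, w z < 0

/-- A nonconstant homoclinic solution. -/
structure IsHom (P : WaveFamily) (t ν a : ℝ) (u w : ℝ → ℝ) : Prop where
  sol : P.Sol t ν u w
  u_bot : Tendsto u atBot (𝓝 a)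
  u_top : Tendsto u atTop (𝓝 a)
  w_bot : Tendsto w atBot (𝓝 0)
  w_top : Tendsto w atTop (𝓝 0)
  ne : ¬ ∀ z, u z = a ∧ w z = 0

theorem Sol.rev (h : P.Sol t ν u w) :
    P.rev.Sol t (-ν) (fun z => u (-z)) (fun z => -w (-z)) := by
  have := IsSol.rev h
  rw [Sol, rev_H]
  exact this

theorem Sol.mirror (h : P.Sol t ν u w) :
    P.mirror.Sol (-t) ν (fun z => -u z) (fun z => -w z) := by
  have := IsSol.mirror h
  rw [Sol, mirror_G]
  exact this

theorem neg_zero_tendsto {l : Filter ℝ} (h : Tendsto w l (𝓝 0)) :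
    Tendsto (fun z => -w z) l (𝓝 0) := by simpa using h.neg

theorem IsDown.rev (h : P.IsDown t ν a b u w) :
    P.rev.IsUp t (-ν) a b (fun z => u (-z)) (fun z => -w (-z)) :=
  ⟨h.sol.rev, h.u_top.comp tendsto_neg_atBot_atTop, h.u_bot.comp tendsto_neg_atTop_atBot,
    neg_zero_tendsto (h.w_top.comp tendsto_neg_atBot_atTop),
    neg_zero_tendsto (h.w_bot.comp tendsto_neg_atTop_atBot), fun _ => neg_pos.2 (h.neg _)⟩

theorem IsUp.rev (h : P.IsUp t ν a b u w) :
    P.rev.IsDown t (-ν) a b (fun z => u (-z)) (fun z => -w (-z)) :=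
  ⟨h.sol.rev, h.u_top.comp tendsto_neg_atBot_atTop, h.u_bot.comp tendsto_neg_atTop_atBot,
    neg_zero_tendsto (h.w_top.comp tendsto_neg_atBot_atTop),
    neg_zero_tendsto (h.w_bot.comp tendsto_neg_atTop_atBot), fun _ => neg_neg_iff_pos.2 (h.pos _)⟩

theorem IsDown.mirror (h : P.IsDown t ν a b u w) :
    P.mirror.IsUp (-t) ν (-b) (-a) (fun z => -u z) (fun z => -w z) :=
  ⟨h.sol.mirror, h.u_bot.neg, h.u_top.neg, neg_zero_tendsto h.w_bot, neg_zero_tendsto h.w_top,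
    fun z => neg_pos.2 (h.neg z)⟩

theorem IsUp.mirror (h : P.IsUp t ν a b u w) :
    P.mirror.IsDown (-t) ν (-b) (-a) (fun z => -u z) (fun z => -w z) :=
  ⟨h.sol.mirror, h.u_bot.neg, h.u_top.neg, neg_zero_tendsto h.w_bot, neg_zero_tendsto h.w_top,
    fun z => neg_neg_iff_pos.2 (h.pos z)⟩

theorem IsHom.mirror (h : P.IsHom t ν a u w) :
    P.mirror.IsHom (-t) ν (-a) (fun z => -u z) (fun z => -w z) :=
  ⟨h.sol.mirror, h.u_bot.neg, h.u_top.neg, neg_zero_tendsto h.w_bot, neg_zero_tendsto h.w_top,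
    fun hc => h.ne fun z => ⟨neg_injective (hc z).1, neg_eq_zero.1 (hc z).2⟩⟩

/-- The value of `ν` for which the unstable manifold of `a` ends at `β`. -/
noncomputable def speed (P : WaveFamily) (t a β : ℝ) : ℝ :=
  Classical.epsilon fun ν => P.E t ν a β β = 0

theorem Adm.E_speed (A : P.Adm t a m β) : P.E t (P.speed t a β) a β β = 0 :=
  Classical.epsilon_spec A.existsUnique_zero.exists

theorem Adm.E_neg_iff (A : P.Adm t a m β) : P.E t ν a β β < 0 ↔ ν < P.speed t a β := by
  constructor
  · intro h
    by_contra hn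
    have := A.E_le A.toRoot le_rfl (not_lt.1 hn) β ⟨A.le.le, le_rfl⟩
    linarith [A.E_speed]
  · intro h
    by_contra hn
    exact (A.E_pos_of_lt h (not_lt.1 hn)).ne' A.E_speed

theorem Adm.E_eq_zero_iff (A : P.Adm t a m β) : P.E t ν a β β = 0 ↔ ν = P.speed t a β :=
  ⟨fun h => A.existsUnique_zero.unique h A.E_speed, fun h => h ▸ A.E_speed⟩

theorem Root₃.up_spec (R : P.Root₃ t a m b) (h : P.IsUp t ν a b u w) :
    ν = P.speed t a b ∧ ∀ z, u z ∈ Ioo a b ∧ w z = √(2 * P.E t ν a b (u z)) := by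
  obtain ⟨h1, h2⟩ := (R.adm.saddleHump ν).heteroclinic (R.adm.max ν).toIsEnergy (R.adm.near ν)
    h.sol h.u_bot h.u_top h.w_bot h.w_top h.pos
  exact ⟨R.adm.E_eq_zero_iff.1 h1, h2⟩

theorem Root₃.exists_up (R : P.Root₃ t a m b) :
    ∃ u w, P.IsUp t (P.speed t a b) a b u w := by
  have A := R.adm
  obtain ⟨u, w, h1, h2, h3, h4, h5, h6⟩ := exists_heteroclinic A.le
    (Ioo_subset_Icc_self.trans A.subset) ((P.H_cont (P.speed t a b)).mono A.subset)
    (G_lin R.left_mem R.left_eq) (G_lin R.right_mem R.right_eq) (A.max _).toIsEnergy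
    ((A.hump _).pos_of_nonneg (A.max _).toIsEnergy (A.near _) A.E_speed.ge) A.E_speed
  exact ⟨u, w, h1, h2, h3, h4, h5, h6⟩

theorem Root₃.orbit_up (R : P.Root₃ t a m b) (h : P.IsUp t ν a b u w) :
    TrafficModel.orbit (u, w) = graphOver (Ioo a b) fun x => √(2 * P.E t ν a b x) :=
  orbit_eq_graphOver h.sol.continuous_fst h.u_bot h.u_top (R.up_spec h).2

theorem Root₃.down_spec (R : P.Root₃ t a m b) (h : P.IsDown t ν a b u w) :
    ν = -P.rev.speed t a b ∧ ∀ z, u z ∈ Ioo a b ∧ w z = -√(2 * P.rev.E t (-ν) a b (u z)) := by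
  obtain ⟨h1, h2⟩ := R.rev.up_spec h.rev
  refine ⟨by rw [← h1, neg_neg], fun z => ?_⟩
  obtain ⟨h3, h4⟩ := h2 (-z)
  rw [neg_neg] at h3 h4
  exact ⟨h3, by rw [← h4, neg_neg]⟩

theorem Root₃.exists_down (R : P.Root₃ t a m b) :
    ∃ u w, P.IsDown t (-P.rev.speed t a b) a b u w := by
  obtain ⟨u, w, h⟩ := R.rev.exists_up
  have := h.rev
  rw [rev_rev] at this
  exact ⟨_, _, this⟩

theorem Root₃.orbit_down (R : P.Root₃ t a m b) (h : P.IsDown t ν a b u w) :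
    TrafficModel.orbit (u, w) =
      graphOver (Ioo a b) fun x => -√(2 * P.rev.E t (-ν) a b x) :=
  orbit_eq_graphOver h.sol.continuous_fst h.u_top h.u_bot (R.down_spec h).2

/-- Reflecting a decreasing connection gives an increasing one of the mirrored family with the same
parameter, and the parameter of a connection is unique. -/
theorem Root₃.speed_mirror (R : P.Root₃ t a m b) :
    P.mirror.speed (-t) (-b) (-a) = -P.rev.speed t a b := by
  obtain ⟨u, w, h⟩ := R.exists_down
  exact (R.mirror.up_spec h.mirror).1.symm

theorem Root₃.speed_mirror_rev (R : P.Root₃ t a m b) :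
    P.mirror.rev.speed (-t) (-b) (-a) = -P.speed t a b := by
  obtain ⟨u, w, h⟩ := R.exists_up
  exact neg_eq_iff_eq_neg.1 (R.mirror.down_spec h.mirror).1.symm

/-- Description of homoclinic solutions staying to the left of `β`. -/
theorem Adm.hom_spec (A : P.Adm t a m β) (h : P.IsHom t ν a u w) (hb : ∀ z, u z < β) :
    ∃ p ∈ Ioo m β, (∀ x ∈ Ioo a p, 0 < P.E t ν a β x) ∧
      (∀ x ∈ Ioo a p, 0 < P.rev.E t (-ν) a β x) ∧ P.E t ν a β p = 0 ∧
      P.rev.E t (-ν) a β p = 0 ∧ TrafficModel.orbit (u, w) =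
        graphOver (Ioc a p) (fun x => √(2 * P.E t ν a β x)) ∪
        graphOver (Ioc a p) (fun x => -√(2 * P.rev.E t (-ν) a β x)) := by
  have near_rev := A.rev.near (-ν)
  obtain ⟨p, hp, h1, h2, h3, h4, z₁, h5, h6, h7, h8⟩ := (A.saddleHump ν).homoclinic
    (A.max ν).toIsEnergy (A.near ν) (A.max_rev ν).toIsEnergy near_rev
    h.sol h.u_bot h.u_top h.w_bot h.w_top h.ne hb
  refine ⟨p, hp, h1, h2, h3, h4, orbit_eq_union h.sol.continuous_fst h.u_bot h.u_top
    (A.lt_mid.trans hp.1) h5 h6 ?_ ?_ h7 h8⟩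
  · simp [h3]
  · simp [h4]

theorem Adm.neg_after (A : P.Adm t a m β) (hp : p ∈ Ico m β) (h : P.E t ν a β p ≤ 0) :
    P.E t ν a β β < 0 :=
  ((A.hump ν).strictAntiOn_after (A.max ν).toIsEnergy (A.near ν) ⟨hp.1, hp.2.le⟩ h
    ⟨le_rfl, hp.2.le⟩ ⟨hp.2.le, le_rfl⟩ hp.2).trans_le h

/-- Raising `ν` makes the energy strictly positive at the old first zero `p`. If it had a zero at or
before `p`, it would be nonpositive at `p`. -/
theorem Adm.crossing_lt (A : P.Adm t a m β) (hν : ν < ν') {p p' : ℝ} (hp : p ∈ Ioo m β)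
    (hp' : p' ∈ Ioo m β) (h0 : ∀ x ∈ Ioo a p, 0 < P.E t ν a β x) (h1 : P.E t ν a β p = 0)
    (h2 : P.E t ν' a β p' = 0) : p < p' := by
  by_contra hle
  have h3 := (A.hump ν).pos_of_lt (A.max ν).toIsEnergy (A.max ν') (fun u hu =>
    mul_lt_mul_of_pos_left (by linarith) (P.k_pos u (A.subset ⟨hu.1, hu.2.le⟩)))
    ⟨hp.1, hp.2.le⟩ h0 h1
  have h4 := (A.hump ν').nonpos_after (A.max ν').toIsEnergy (A.near ν') ⟨hp'.1.le, hp'.2.le⟩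
    h2.le p ⟨not_lt.1 hle, hp.2.le⟩
  linarith

theorem Adm.hom_orbit_unique (A : P.Adm t a m β) (h : P.IsHom t ν a u w) (hb : ∀ z, u z < β)
    (h' : P.IsHom t ν a u' w') (hb' : ∀ z, u' z < β) :
    TrafficModel.orbit (u, w) = TrafficModel.orbit (u', w') := by
  obtain ⟨p, hp, h1, -, h3, -, h5⟩ := A.hom_spec h hb
  obtain ⟨p', hp', h1', -, h3', -, h5'⟩ := A.hom_spec h' hb'
  have : p = p' := by
    have ha := A.lt_mid.trans hp.1
    have ha' := A.lt_mid.trans hp'.1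
    rcases lt_trichotomy p p' with hl | hl | hl
    · exact absurd h3 (h1' p ⟨ha, hl⟩).ne'
    · exact hl
    · exact absurd h3' (h1 p' ⟨ha', hl⟩).ne'
  rw [h5, h5', this]

/-- At a homoclinic solution, both invariant manifolds pass below `β`. -/
theorem Adm.hom_neg (A : P.Adm t a m β) (h : P.IsHom t ν a u w) (hb : ∀ z, u z < β) :
    P.E t ν a β β < 0 ∧ P.rev.E t (-ν) a β β < 0 ∧ P.E t ν a β β = P.rev.E t (-ν) a β β := by
  obtain ⟨p, hp, h1, h2, h3, h4, -⟩ := A.hom_spec h hb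
  have hh : Hump (P.G t) (fun x => -P.H ν x) a m β := (A.saddleHump ν).hump_neg
  obtain ⟨e1, e2⟩ := (A.hump ν).eq_of_common_zero (A.max ν).toIsEnergy hh
    (A.max_rev ν).toIsEnergy (A.near ν) (A.rev.near (-ν)) ⟨hp.1.le, hp.2⟩ h3 h4
  exact ⟨e2, e1 ▸ e2, e1⟩

/-- After their first zeros both energies descend with slope `G`, so equal negative values at `β`
mean a common first zero. The two half orbits meet there. -/
theorem Adm.exists_hom (A : P.Adm t a m β) (he : P.E t ν a β β = P.rev.E t (-ν) a β β)
    (hn : P.E t ν a β β < 0) : ∃ u w, P.IsHom t ν a u w := by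
  have hh : Hump (P.G t) (fun x => -P.H ν x) a m β := (A.saddleHump ν).hump_neg
  obtain ⟨p, hp, h1, h2, h3, h4⟩ := (A.hump ν).exists_common_crossing (A.max ν).toIsEnergy hh
    (A.max_rev ν).toIsEnergy (fun _ _ => rfl) (A.near ν) (A.rev.near (-ν)) he hn
  have hap := A.lt_mid.trans hp.1
  have hpI := A.subset ⟨hap.le, hp.2.le⟩
  obtain ⟨u, w, e1, e2, e3, e4, e5, e6⟩ := exists_homoclinic (I := P.I)
    (fun x hx => A.subset ⟨hx.1.le, hx.2.trans hp.2.le⟩)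
    ((P.G_cont t).continuousAt (P.isOpen.mem_nhds hpI)) ((A.hump ν).neg p hp)
    (A.hump ν).contH (G_lin A.left_mem A.left_eq) (A.max ν).toIsEnergy (A.max_rev ν).toIsEnergy
    hap hp.2 h1 h2 h3 h4
  exact ⟨u, w, e1, e2, e3, e4, e5, e6⟩

/-- The two invariant manifolds can be matched at `β` with a bounded parameter. -/
theorem Adm.exists_common (A : P.Adm t a m β) :
    ∃ ν, |ν| ≤ P.B ∧ P.E t ν a β β = P.rev.E t (-ν) a β β := by
  have hβ : β ∈ Ioc a β := ⟨A.le, le_rfl⟩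
  have hc : Continuous fun ν => P.E t ν a β β - P.rev.E t (-ν) a β β :=
    (A.continuous_E hβ).sub ((A.rev.continuous_E hβ).comp continuous_neg)
  have hB0 : 0 ≤ P.B := (abs_nonneg _).trans (P.D_le a A.left_mem)
  -- At `ν = B` one has `H ≥ 0 ≥ -H`, so the energy for `H` is the larger; at `ν = -B` the order is
  -- reversed.
  have h1 : P.rev.E t (-P.B) a β β ≤ P.E t P.B a β β := by
    refine (A.max P.B).le_of_le (A.max_rev P.B).toIsEnergy le_rfl A.le.le
      (A.max P.B).init.ge (fun u _ => le_rfl) (fun u hu => ?_) β ⟨A.le.le, le_rfl⟩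
    have huI := A.subset ⟨hu.1, hu.2.le⟩
    have : 0 ≤ P.H P.B u := mul_nonneg (P.k_pos u huI).le
      (by linarith [(abs_le.1 (P.D_le u huI)).1])
    linarith
  have h2 : P.E t (-P.B) a β β ≤ P.rev.E t (- -P.B) a β β := by
    refine (A.max_rev (-P.B)).le_of_le (A.max (-P.B)).toIsEnergy le_rfl A.le.le
      (A.max_rev (-P.B)).init.ge (fun u _ => le_rfl) (fun u hu => ?_) β ⟨A.le.le, le_rfl⟩
    have huI := A.subset ⟨hu.1, hu.2.le⟩
    have : P.H (-P.B) u ≤ 0 := mul_nonpos_of_nonneg_of_nonpos (P.k_pos u huI).le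
      (by linarith [(abs_le.1 (P.D_le u huI)).2])
    linarith
  obtain ⟨ν, hν, hν0⟩ := intermediate_value_Icc (by linarith : -P.B ≤ P.B) hc.continuousOn
    (show (0 : ℝ) ∈ Icc _ _ from ⟨sub_nonpos.2 h2, sub_nonneg.2 h1⟩)
  exact ⟨ν, abs_le.2 hν, sub_eq_zero.1 hν0⟩

/-- Near both ends of time `u` is below a value it takes, so the maximum is attained on a compact
set, and there `w = u' = 0`. -/
theorem IsHom.exists_max (h : P.IsHom t ν a u w) (hx : ∃ z, a < u z) :
    ∃ z, w z = 0 ∧ ∀ y, u y ≤ u z := by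
  obtain ⟨x, hx⟩ := hx
  have hc := h.sol.continuous_fst
  have hco : ∀ᶠ z in cocompact ℝ, u z ≤ u x := by
    rw [cocompact_eq_atBot_atTop]
    exact eventually_sup.2 ⟨(h.u_bot.eventually (gt_mem_nhds hx)).mono fun _ h => h.le,
      (h.u_top.eventually (gt_mem_nhds hx)).mono fun _ h => h.le⟩
  obtain ⟨z, hz⟩ := hc.exists_forall_ge' x hco
  refine ⟨z, ?_, hz⟩
  have hmax : IsLocalMax u z := Eventually.of_forall hz
  exact hmax.hasDerivAt_eq_zero (h.sol z).2.1

/-- A homoclinic solution at `a` cannot pass the right saddle. -/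
theorem Root₃.hom_lt (R : P.Root₃ t a m b) (h : P.IsHom t ν a u w) (z : ℝ) : u z < b := by
  by_contra hz
  have hab := R.adm.le
  obtain ⟨y, hy, hmax⟩ := h.exists_max ⟨z, hab.trans_le (not_lt.1 hz)⟩
  have hby : b ≤ u y := (not_lt.1 hz).trans (hmax z)
  -- A maximum equal to `b` would be the equilibrium `(b, 0)`. A larger one has `w' = G > 0`, so the
  -- solution enters the trap `u ≥ b`, `w > 0` and cannot come back to `a`.
  rcases hby.eq_or_lt with he | hlt
  · obtain ⟨C, hC⟩ := G_lin R.right_mem R.right_eq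
    have := h.sol.eq_equilibrium hC
      ((P.H_cont ν).continuousAt (P.isOpen.mem_nhds R.right_mem)) he.symm hy
    have h2 : Tendsto u atTop (𝓝 b) := by
      simp only [show u = fun _ => b from funext fun z => (this z).1]
      exact tendsto_const_nhds
    exact hab.ne (tendsto_nhds_unique h.u_top h2)
  · obtain ⟨h1, h2, h3⟩ := h.sol y
    have hG : 0 < P.G t (u y) + P.H ν (u y) * w y := by
      rw [hy, mul_zero, add_zero]; exact R.pos_right h1 hlt
    have hw := eventually_gt_right_of_hasDerivAt_pos h3 hG
    have hu := (h2.continuousAt.eventually (lt_mem_nhds hlt)).filter_mono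
      (nhdsWithin_le_nhds (s := Ioi y))
    obtain ⟨x, hx1, hx2⟩ := (hw.and hu).exists
    rw [hy] at hx1
    have := h.sol.trap_right (fun x hx hbx => R.pos_right hx hbx) (le_of_lt hx2) hx1 h.u_top
    linarith

/-- If `F < t` to the right of `m`, then every homoclinic solution has an admissible bound. -/
theorem IsHom.exists_bound (h : P.IsHom t ν a u w) (R : P.Root t a m)
    (hF : ∀ x ∈ P.I, m < x → P.F x < t) (β₀ : ℝ) (hβ₀ : β₀ ∈ P.I) :
    ∃ β ≥ β₀, P.Adm t a m β ∧ ∀ z, u z < β := by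
  obtain ⟨c, hc, hcu⟩ : ∃ c ∈ P.I, ∀ z, u z ≤ c := by
    by_cases hx : ∃ z, a < u z
    · obtain ⟨z, -, hz⟩ := h.exists_max hx
      exact ⟨u z, (h.sol z).1, hz⟩
    · push Not at hx
      exact ⟨a, R.left_mem, hx⟩
  have hmax : max c (max m β₀) ∈ P.I := by
    rcases max_choice c (max m β₀) with h1 | h1
    · rwa [h1]
    · rw [h1]
      rcases max_choice m β₀ with h2 | h2
      · rw [h2]; exact R.mid_mem
      · rwa [h2]
  obtain ⟨r, hr, hsub⟩ := mem_nhdsGT_iff_exists_Ioo_subset.1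
    (mem_nhdsWithin_of_mem_nhds (P.isOpen.mem_nhds hmax) : P.I ∈ 𝓝[>] _)
  obtain ⟨β, hβ, hβr⟩ := exists_between (show _ < r from hr)
  have h1 : m < β := ((le_max_left _ _).trans (le_max_right _ _)).trans_lt hβ
  have hβI : β ∈ P.I := hsub ⟨hβ, hβr⟩
  exact ⟨β, ((le_max_right _ _).trans (le_max_right _ _)).trans hβ.le, ⟨R, h1, hβI,
    fun x hx => hF x (P.Icc_subset R.mid_mem hβI ⟨hx.1.le, hx.2.le⟩) hx.1⟩,
    fun z => (hcu z).trans_lt ((le_max_left _ _).trans_lt hβ)⟩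

end WaveFamily

end TravelingWave

/-! ### Dependence of the connecting parameter on the level; uniqueness of pulses. -/

namespace TravelingWave

namespace WaveFamily

variable {P : WaveFamily} {t t' a a' m m' β β' ν ν' b b' α p x y s s' : ℝ} {u w : ℝ → ℝ}

/-- With the parameter of level `t`, the energy at level `t'` is at most zero at `b` by
monotonicity. The right root `b'` lies beyond `b`, and a nonpositive energy decreases strictly, so
it is negative at `b'`. -/
theorem Root₃.speed_lt (R : P.Root₃ t a m b) (R' : P.Root₃ t' a' m' b') (h : t < t') :
    P.speed t a b < P.speed t' a' b' := by
  have hm : m' < b := R'.lt_N.trans R.N_lt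
  have hb := R.lt_of_lt R' h
  have h1 := R.adm.E_le R'.toRoot h.le (le_refl (P.speed t a b)) b
    ⟨(R'.lt_mid.trans hm).le, le_rfl⟩
  rw [R.adm.E_speed, R'.adm.E_eqOn _ hm hb.le ⟨(R'.lt_mid.trans hm).le, le_rfl⟩] at h1
  exact R'.adm.E_neg_iff.1 (R'.adm.neg_after ⟨hm.le, hb⟩ h1)

theorem eventually_mid_lt {ι : Type*} {l : Filter ι} {T A C : ι → ℝ} (hm : m ∈ Ico P.M P.N)
    (hFm : P.F m = t) (hT : Tendsto T l (𝓝 t)) (hR : ∀ᶠ i in l, P.Root (T i) (A i) (C i))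
    (hx : m < x) : ∀ᶠ i in l, C i < x := by
  obtain ⟨y, hy, hyx⟩ := exists_between (lt_min hx hm.2)
  have hyN := (hyx.trans_le (min_le_right _ _)).le
  have hlt := P.strictAntiOn_mid ⟨hm.1, hm.2.le⟩ ⟨hm.1.trans hy.le, hyN⟩ hy
  rw [hFm] at hlt
  filter_upwards [hT.eventually (lt_mem_nhds hlt), hR] with i h1 h2
  rw [← h2.mid_eq] at h1
  exact ((P.strictAntiOn_mid.lt_iff_gt ⟨hm.1.trans hy.le, hyN⟩
    ⟨h2.M_lt.le, h2.lt_N.le⟩).1 h1).trans (hyx.trans_le (min_le_left _ _))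

theorem Root₃.tendsto_right {ι : Type*} {l : Filter ι} {T A C S : ι → ℝ}
    (R : P.Root₃ t a m b) (hT : Tendsto T l (𝓝 t))
    (hR : ∀ᶠ i in l, P.Root₃ (T i) (A i) (C i) (S i)) : Tendsto S l (𝓝 b) := by
  have := (tendsto_left_root R.mirror.left_mem R.mirror.left_lt.le R.mirror.left_eq hT.neg
    (hR.mono fun i h => h.mirror.toRoot)).neg
  simpa using this

theorem Root₃.tendsto_left {ι : Type*} {l : Filter ι} {T A C S : ι → ℝ}
    (R : P.Root₃ t a m b) (hT : Tendsto T l (𝓝 t))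
    (hR : ∀ᶠ i in l, P.Root₃ (T i) (A i) (C i) (S i)) : Tendsto A l (𝓝 a) :=
  tendsto_left_root R.left_mem R.left_lt.le R.left_eq hT (hR.mono fun _ h => h.toRoot)

/-- The right roots `S i` may lie on either side of `b`, so negativity is first pulled back to some
`β < b`, which remains admissible for nearby levels. It persists at `β` by continuity, and beyond
`β` the energy only decreases. -/
theorem Root₃.eventually_lt_speed {ι : Type*} {l : Filter ι} {T A C S : ι → ℝ}
    (R : P.Root₃ t a m b) (hT : Tendsto T l (𝓝 t))
    (hR : ∀ᶠ i in l, P.Root₃ (T i) (A i) (C i) (S i)) (hν : ν < P.speed t a b) :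
    ∀ᶠ i in l, ν < P.speed (T i) (A i) (S i) := by
  have A₀ := R.adm
  have hneg := A₀.E_neg_iff.2 hν
  have hc := (A₀.max ν).continuousOn b ⟨A₀.le.le, le_rfl⟩
  have hev : ∀ᶠ x in 𝓝[<] b, P.E t ν a b x < 0 := by
    have h1 : ∀ᶠ x in 𝓝[Icc a b] b, P.E t ν a b x < 0 := hc.eventually (gt_mem_nhds hneg)
    exact (nhdsWithin_le_of_mem (mem_of_superset (Ioo_mem_nhdsLT A₀.le) Ioo_subset_Icc_self)) h1
  obtain ⟨β, hβ, hβ'⟩ := (hev.and (Ioo_mem_nhdsLT A₀.lt_right)).exists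
  have A₁ := A₀.mono_right hβ'.1 hβ'.2.le
  have hbS : ∀ᶠ i in l, P.Adm (T i) (A i) (C i) β := by
    filter_upwards [(R.tendsto_right hT hR).eventually (lt_mem_nhds hβ'.2), hR,
      eventually_mid_lt ⟨R.M_lt.le, R.lt_N⟩ R.mid_eq hT (hR.mono fun i h => h.toRoot) hβ'.1]
      with i h1 h2 h3
    exact h2.adm.mono_right h3 h1.le
  have h0 : P.E t ν a β β < 0 := by
    rw [A₀.E_eqOn ν hβ'.1 hβ'.2.le ⟨A₁.le.le, le_rfl⟩]; exact hβ
  filter_upwards [(A₁.tendsto_E_at (V := fun _ => ν) hT tendsto_const_nhds hbS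
    ⟨A₁.le, le_rfl⟩).eventually (gt_mem_nhds h0), hbS, hR,
    (R.tendsto_right hT hR).eventually (lt_mem_nhds hβ'.2)] with i h1 h2 h3 h4
  refine h3.adm.E_neg_iff.1 (h3.adm.neg_after ⟨h2.lt_right.le, h4⟩ ?_)
  rw [← h3.adm.E_eqOn ν h2.lt_right h4.le ⟨h2.le.le, le_rfl⟩]
  exact le_of_lt h1

/-- The lower bound is `eventually_lt_speed`. The upper bound is the same fact for the mirrored and
reversed family, whose connecting parameter is the negative. -/
theorem Root₃.tendsto_speed {ι : Type*} {l : Filter ι} {T A C S : ι → ℝ}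
    (R : P.Root₃ t a m b) (hT : Tendsto T l (𝓝 t))
    (hR : ∀ᶠ i in l, P.Root₃ (T i) (A i) (C i) (S i)) :
    Tendsto (fun i => P.speed (T i) (A i) (S i)) l (𝓝 (P.speed t a b)) := by
  refine tendsto_order.2 ⟨fun ν hν => R.eventually_lt_speed hT hR hν, fun ν hν => ?_⟩
  have h1 : -ν < P.mirror.rev.speed (-t) (-b) (-a) := by
    rw [R.speed_mirror_rev]; linarith
  filter_upwards [R.mirror.rev.eventually_lt_speed hT.neg (hR.mono fun i h => h.mirror.rev) h1,
    hR] with i h2 h3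
  rw [h3.speed_mirror_rev] at h2
  linarith

/-- Matching parameters with a negative common value are unique. -/
theorem Adm.common_unique (A : P.Adm t a m β) (he : P.E t ν a β β = P.rev.E t (-ν) a β β)
    (hn : P.E t ν a β β < 0) (he' : P.E t ν' a β β = P.rev.E t (-ν') a β β)
    (hn' : P.E t ν' a β β < 0) : ν = ν' := by
  obtain ⟨p, hp, h1, h2, h3, h4⟩ := (A.hump ν).exists_common_crossing (A.max ν).toIsEnergy
    (A.saddleHump ν).hump_neg (A.max_rev ν).toIsEnergy (fun _ _ => rfl) (A.near ν)
    (A.rev.near (-ν)) he hn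
  obtain ⟨p', hp', h1', h2', h3', h4'⟩ := (A.hump ν').exists_common_crossing
    (A.max ν').toIsEnergy (A.saddleHump ν').hump_neg (A.max_rev ν').toIsEnergy (fun _ _ => rfl)
    (A.near ν') (A.rev.near (-ν')) he' hn'
  -- Increasing `ν` moves the first zero for `H` to the right and that for `-H` to the left, so the
  -- common zeros for two different parameters would be ordered both ways.
  rcases lt_trichotomy ν ν' with hν | hν | hν
  · have e1 := A.crossing_lt hν hp hp' h1 h3 h3'
    have e2 := A.rev.crossing_lt (neg_lt_neg hν) hp' hp h2' h4' h4
    exact absurd e1 e2.not_gt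
  · exact hν
  · have e1 := A.crossing_lt hν hp' hp h1' h3' h3
    have e2 := A.rev.crossing_lt (neg_lt_neg hν) hp hp' h2 h4 h4'
    exact absurd e1 e2.not_gt

theorem Adm.hom_unique (A : P.Adm t a m β) {u' w' : ℝ → ℝ} (h : P.IsHom t ν a u w)
    (hb : ∀ z, u z < β) (h' : P.IsHom t ν' a u' w') (hb' : ∀ z, u' z < β) : ν = ν' := by
  obtain ⟨h1, h2, h3⟩ := A.hom_neg h hb
  obtain ⟨h1', h2', h3'⟩ := A.hom_neg h' hb'
  exact A.common_unique h3 h1 h3' h1'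

/-- The bounded matching parameter of `exists_common` has a negative common value: on whichever side
of `ν` it lies, one of its two energies is below a negative energy of the homoclinic solution.
Uniqueness then makes it equal to `ν`. -/
theorem Adm.hom_abs_le (A : P.Adm t a m β) (h : P.IsHom t ν a u w) (hb : ∀ z, u z < β) :
    |ν| ≤ P.B := by
  obtain ⟨ν', hB, he⟩ := A.exists_common
  obtain ⟨h1, h2, h3⟩ := A.hom_neg h hb
  have hn : P.E t ν' a β β < 0 := by
    rcases le_total ν' ν with hν | hν
    · exact (A.E_le A.toRoot le_rfl hν β ⟨A.le.le, le_rfl⟩).trans_lt h1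
    · rw [he]
      exact (A.rev.E_le A.rev.toRoot le_rfl (neg_le_neg hν) β ⟨A.le.le, le_rfl⟩).trans_lt h2
  rwa [A.common_unique h3 h1 he hn]

theorem Adm.exists_hom_of_not_nonneg (A : P.Adm t a m β)
    (hn : ∀ ν, |ν| ≤ P.B → ¬ (0 ≤ P.E t ν a β β ∧ 0 ≤ P.rev.E t (-ν) a β β)) :
    ∃ ν u w, P.IsHom t ν a u w := by
  obtain ⟨ν, hB, he⟩ := A.exists_common
  have h1 : P.E t ν a β β < 0 := by
    by_contra h0
    exact hn ν hB ⟨not_lt.1 h0, he ▸ not_lt.1 h0⟩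
  exact ⟨ν, A.exists_hom he h1⟩

/-- At a matching parameter with negative common value, `ν` is below the connecting parameter of the
family and `-ν` below that of the reversed family; adding the two inequalities gives the claim. -/
theorem Root₃.speed_lt_of_not_nonneg (R : P.Root₃ t a m b)
    (hn : ∀ ν, |ν| ≤ P.B → ¬ (0 ≤ P.E t ν a b b ∧ 0 ≤ P.rev.E t (-ν) a b b)) :
    -P.rev.speed t a b < P.speed t a b := by
  obtain ⟨ν, hB, he⟩ := R.adm.exists_common
  have h1 : P.E t ν a b b < 0 := by
    by_contra h0
    exact hn ν hB ⟨not_lt.1 h0, he ▸ not_lt.1 h0⟩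
  have h2 := R.adm.E_neg_iff.1 h1
  rw [he] at h1
  have h3 := R.rev.adm.E_neg_iff.1 h1
  linarith

/-- Nonnegative values of both energies at `b` would require `ν` to be at least `speed` and at most
`-rev.speed`, which the hypothesis forbids. -/
theorem Root₃.exists_hom (R : P.Root₃ t a m b) (h : -P.rev.speed t a b < P.speed t a b) :
    ∃ ν u w, P.IsHom t ν a u w := by
  refine R.adm.exists_hom_of_not_nonneg fun ν _ h0 => ?_
  have h1 : ¬ ν < P.speed t a b := fun hh => (R.adm.E_neg_iff.2 hh).not_ge h0.1
  have h2 : ¬ -ν < P.rev.speed t a b := fun hh => (R.rev.adm.E_neg_iff.2 hh).not_ge h0.2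
  linarith

/-- Both energies of a homoclinic solution are negative at `b`. The resulting squeeze determines the
limit of the pulse parameter when the two ends meet. -/
theorem Root₃.hom_between (R : P.Root₃ t a m b) (h : P.IsHom t ν a u w) :
    -P.rev.speed t a b < ν ∧ ν < P.speed t a b := by
  obtain ⟨h1, h2, -⟩ := R.adm.hom_neg h (R.hom_lt h)
  have h3 := R.rev.adm.E_neg_iff.1 h2
  exact ⟨by linarith, R.adm.E_neg_iff.1 h1⟩

/-! ### Collapse -/

/-- Uniform Lipschitz bound for energies. -/
theorem exists_lipschitz (hx : x ∈ P.I) (hy : y ∈ P.I) (hxy : x ≤ y) (τ : ℝ) :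
    ∃ L ≥ 0, ∀ {t ν a b : ℝ} {Y : ℝ → ℝ}, |t| ≤ τ → |ν| ≤ P.B → x ≤ a → b ≤ y →
      IsEnergy (P.G t) (P.H ν) a b Y → ∀ u ∈ Icc a b, ∀ v ∈ Icc a b, |Y u - Y v| ≤ L * |u - v| := by
  have hs := P.Icc_subset hx hy
  obtain ⟨C₁, hC₁⟩ := isCompact_Icc.exists_bound_of_continuousOn (P.g_cont.mono hs)
  obtain ⟨C₂, hC₂⟩ := isCompact_Icc.exists_bound_of_continuousOn (P.F_cont.mono hs)
  obtain ⟨C₃, hC₃⟩ := isCompact_Icc.exists_bound_of_continuousOn (P.k_cont.mono hs)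
  simp only [Real.norm_eq_abs] at hC₁ hC₂ hC₃
  have hC₁0 : 0 ≤ C₁ := (abs_nonneg _).trans (hC₁ x ⟨le_rfl, hxy⟩)
  have hC₂0 : 0 ≤ C₂ := (abs_nonneg _).trans (hC₂ x ⟨le_rfl, hxy⟩)
  have hC₃0 : 0 ≤ C₃ := (abs_nonneg _).trans (hC₃ x ⟨le_rfl, hxy⟩)
  have hB0 : 0 ≤ P.B := (abs_nonneg _).trans (P.D_le x hx)
  refine ⟨energyLip (C₁ * (C₂ + |τ|)) (C₃ * (P.B + P.B)) (y - x), ?_, ?_⟩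
  · have : 0 ≤ y - x := by linarith
    simp only [energyLip]
    positivity
  · intro t ν a b Y ht hν hxa hby hY
    refine lipschitz_of_energy (by positivity) (by positivity) (by linarith) hY.deriv
      (by rw [hY.init]; norm_num) fun u hu => ?_
    have hu' : u ∈ Icc x y := ⟨hxa.trans hu.1, hu.2.trans hby⟩
    refine (abs_add_le _ _).trans (add_le_add ?_ ?_)
    · rw [G, abs_mul]
      refine mul_le_mul (hC₁ u hu') ((abs_sub _ _).trans (add_le_add (hC₂ u hu')
        (ht.trans (le_abs_self τ)))) (abs_nonneg _) hC₁0
    · rw [abs_mul, abs_of_nonneg (Real.sqrt_nonneg _), H, abs_mul]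
      exact mul_le_mul_of_nonneg_right (mul_le_mul (hC₃ u hu') ((abs_add_le _ _).trans
        (add_le_add (P.D_le u (hs hu')) hν)) (abs_nonneg _) hC₃0) (Real.sqrt_nonneg _)

theorem intervalIntegrable_G (hx : x ∈ P.I) (hy : y ∈ P.I) :
    IntervalIntegrable (P.G t) volume x y := by
  refine ((P.G_cont t).mono ?_).intervalIntegrable
  exact P.ordConnected.uIcc_subset hx hy

/-- If both invariant manifolds are nonnegative at `β`, then the area of `G` to the right of the
middle root is controlled by the distance of the roots. -/
theorem exists_collapse (hx : x ∈ P.I) (hy : y ∈ P.I) (hxy : x ≤ y) (τ : ℝ) :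
    ∃ L ≥ 0, ∀ {t ν a m β s' s : ℝ}, |t| ≤ τ → |ν| ≤ P.B → P.Adm t a m β → x ≤ a → m ≤ s' →
      s' ≤ y → s' ≤ s → s < β → 0 ≤ P.E t ν a β β → 0 ≤ P.rev.E t (-ν) a β β →
      -(∫ v in s'..s, P.G t v) ≤ L * (m - a) := by
  obtain ⟨L₁, hL₁0, hL₁⟩ := P.exists_lipschitz hx hy hxy τ
  obtain ⟨L₂, hL₂0, hL₂⟩ := P.rev.exists_lipschitz hx hy hxy τ
  refine ⟨max L₁ L₂, le_max_of_le_left hL₁0, ?_⟩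
  intro t ν a m β s' s ht hν A hxa hms hsy hss hsβ h1 h2
  have ham := A.lt_mid.le
  have hma : 0 ≤ m - a := by linarith
  have hsub : ∀ {z}, m ≤ z → z ≤ s → z ∈ P.I := fun h h' =>
    A.subset ⟨ham.trans h, h'.trans hsβ.le⟩
  rcases (hms.trans hss).eq_or_lt with he | hlt
  · have : s' = s := le_antisymm hss (he ▸ hms)
    rw [this, intervalIntegral.integral_same, neg_zero]
    exact mul_nonneg (le_max_of_le_left hL₁0) hma
  have e1 := (A.hump ν).sq_sum_le (A.max ν).toIsEnergy
    (A.max_rev ν).toIsEnergy (fun _ _ => rfl)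
    ((A.hump ν).pos_of_nonneg (A.max ν).toIsEnergy (A.near ν) h1)
    ((A.rev.hump (-ν)).pos_of_nonneg (A.rev.max (-ν)).toIsEnergy (A.rev.near (-ν)) h2)
    (show s ∈ Ioo m β from ⟨hlt, hsβ⟩)
  have e2 := hL₁ ht hν hxa (hms.trans hsy)
    ((A.max ν).toIsEnergy.mono_right A.lt_right.le) m ⟨ham, le_rfl⟩ a ⟨le_rfl, ham⟩
  have e3 := hL₂ (ν := -ν) ht (by rwa [abs_neg]) hxa (hms.trans hsy)
    ((A.rev.max (-ν)).toIsEnergy.mono_right A.lt_right.le) m ⟨ham, le_rfl⟩ a ⟨le_rfl, ham⟩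
  rw [(A.max ν).init, sub_zero, abs_of_nonneg hma] at e2
  rw [(A.rev.max (-ν)).init, sub_zero, abs_of_nonneg hma] at e3
  set Y := P.E t ν a β m
  set Z := P.rev.E t (-ν) a β m
  -- With `Y a = Z a = 0` and the Lipschitz bounds, the right-hand side is at most `4 (L₁ + L₂) (m -
  -- a) ≤ 8 L (m - a)` for `L = max L₁ L₂`, which cancels the factor 8 on the area.
  have e4 : (√(2 * Y) + √(2 * Z)) ^ 2 ≤ 4 * (|Y| + |Z|) := by
    have h3 : √(2 * Y) ^ 2 ≤ 2 * |Y| := by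
      refine (pow_le_pow_left₀ (Real.sqrt_nonneg _) (Real.sqrt_le_sqrt
        (by linarith [le_abs_self Y] : 2 * Y ≤ 2 * |Y|)) 2).trans ?_
      rw [Real.sq_sqrt (by positivity)]
    have h4 : √(2 * Z) ^ 2 ≤ 2 * |Z| := by
      refine (pow_le_pow_left₀ (Real.sqrt_nonneg _) (Real.sqrt_le_sqrt
        (by linarith [le_abs_self Z] : 2 * Z ≤ 2 * |Z|)) 2).trans ?_
      rw [Real.sq_sqrt (by positivity)]
    nlinarith [sq_nonneg (√(2 * Y) - √(2 * Z))]
  have e5 : L₁ * (m - a) ≤ max L₁ L₂ * (m - a) :=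
    mul_le_mul_of_nonneg_right (le_max_left _ _) hma
  have e6 : L₂ * (m - a) ≤ max L₁ L₂ * (m - a) :=
    mul_le_mul_of_nonneg_right (le_max_right _ _) hma
  -- `G ≤ 0` on `[m, s']`, so measuring the area from the fixed point `s'` instead of `m` only makes
  -- it smaller.
  have e7 : ∫ v in m..s', P.G t v ≤ 0 := by
    refine neg_nonneg.1 ?_
    rw [← intervalIntegral.integral_neg]
    refine intervalIntegral.integral_nonneg hms fun v hv => neg_nonneg.2 ?_
    rcases hv.1.eq_or_lt with h | h
    · rw [← h, G, A.mid_eq, sub_self, mul_zero]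
    · exact ((A.hump ν).neg v ⟨h, (hv.2.trans hss).trans_lt hsβ⟩).le
  have e8 := intervalIntegral.integral_add_adjacent_intervals
    (intervalIntegrable_G (t := t) (hsub le_rfl hlt.le) (hsub hms hss))
    (intervalIntegrable_G (t := t) (hsub hms hss) (hsub hlt.le le_rfl))
  linarith

theorem tendsto_integral_G {ι : Type*} {l : Filter ι} {T : ι → ℝ} (hx : x ∈ P.I) (hy : y ∈ P.I)
    (hT : Tendsto T l (𝓝 t)) :
    Tendsto (fun i => ∫ v in x..y, P.G (T i) v) l (𝓝 (∫ v in x..y, P.G t v)) := by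
  have hs := P.ordConnected.uIcc_subset hx hy
  have hg := (P.g_cont.mono hs).intervalIntegrable (μ := volume)
  have hgF : IntervalIntegrable (fun v => P.g v * P.F v) volume x y :=
    ((P.g_cont.mul P.F_cont).mono hs).intervalIntegrable
  have e : ∀ r, ∫ v in x..y, P.G r v =
      (∫ v in x..y, P.g v * P.F v) - r * ∫ v in x..y, P.g v := fun r => by
    rw [← intervalIntegral.integral_const_mul, ← intervalIntegral.integral_sub hgF
      (hg.const_mul r)]
    refine intervalIntegral.integral_congr fun v _ => ?_
    simp only [G]; ring
  simp only [e]
  exact tendsto_const_nhds.sub (hT.mul_const _)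

/-- Collapse near a level where the left and the middle root merge. -/
theorem eventually_collapse_M {ι : Type*} {l : Filter ι} {T A C : ι → ℝ}
    (hT : Tendsto T l (𝓝 (P.F P.M))) (hR : ∀ᶠ i in l, P.Root (T i) (A i) (C i))
    (hs : s ∈ Ioo P.M P.N) : ∀ᶠ i in l, ∀ β ν, |ν| ≤ P.B → P.Adm (T i) (A i) (C i) β → s < β →
      ¬ (0 ≤ P.E (T i) ν (A i) β β ∧ 0 ≤ P.rev.E (T i) (-ν) (A i) β β) := by
  obtain ⟨s', hs', hss⟩ := exists_between hs.1
  have hsN := (hss.trans hs.2).le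
  have hs'I := P.Icc_subset P.M_mem P.N_mem ⟨hs'.le, hsN⟩
  have hsI := P.Icc_subset P.M_mem P.N_mem ⟨hs.1.le, hs.2.le⟩
  obtain ⟨r, hr, hsub⟩ := mem_nhdsLT_iff_exists_Ioo_subset.1
    (mem_nhdsWithin_of_mem_nhds (P.isOpen.mem_nhds P.M_mem) : P.I ∈ 𝓝[<] P.M)
  obtain ⟨x, hx, hxM⟩ := exists_between (show r < P.M from hr)
  have hxI := hsub ⟨hx, hxM⟩
  have hA := tendsto_left_root P.M_mem le_rfl rfl hT hR
  obtain ⟨L, hL0, hL⟩ := P.exists_collapse hxI hs'I (hxM.trans hs').le (|P.F P.M| + 1)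
  have hκ : 0 < -∫ v in s'..s, P.G (P.F P.M) v := by
    rw [← intervalIntegral.integral_neg]
    refine intervalIntegral.intervalIntegral_pos_of_pos_on
      (intervalIntegrable_G hs'I hsI).neg (fun v hv => ?_) hss
    have hvI := P.Icc_subset hs'I hsI ⟨hv.1.le, hv.2.le⟩
    refine neg_pos.2 (mul_neg_of_pos_of_neg (P.g_pos v hvI) (sub_neg.2 ?_))
    exact P.strictAntiOn_mid ⟨le_rfl, P.M_lt_N.le⟩
      ⟨(hs'.trans hv.1).le, (hv.2.trans hs.2).le⟩ (hs'.trans hv.1)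
  set κ := -∫ v in s'..s, P.G (P.F P.M) v
  -- Both roots tend to `M`, so eventually `C i - A i < κ / (2 (L + 1))`. The collapse bound is then
  -- at most `κ / 2`, whereas the area over `[s', s]` exceeds `κ / 2` at nearby levels.
  have hη : 0 < κ / (4 * (L + 1)) := by positivity
  filter_upwards [hR, hA.eventually (lt_mem_nhds hxM),
    hA.eventually (lt_mem_nhds (sub_lt_self P.M hη)),
    eventually_mid_lt ⟨le_rfl, P.M_lt_N⟩ rfl hT hR hs',
    eventually_mid_lt ⟨le_rfl, P.M_lt_N⟩ rfl hT hR (lt_add_of_pos_right P.M hη),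
    (tendsto_integral_G hs'I hsI hT).eventually (gt_mem_nhds
      (show (∫ v in s'..s, P.G (P.F P.M) v) < -(κ / 2) by simp only [κ] at hκ ⊢; linarith)),
    (hT.abs).eventually (gt_mem_nhds (lt_add_one _))]
    with i h1 h2 h3 h4 h5 h6 h7 β ν hν hA hsβ h0
  have h8 := hL h7.le hν hA h2.le h4.le le_rfl hss.le hsβ h0.1 h0.2
  have h9 : L * (C i - A i) ≤ L * (κ / (2 * (L + 1))) := by
    refine mul_le_mul_of_nonneg_left ?_ hL0
    have : κ / (2 * (L + 1)) = κ / (4 * (L + 1)) + κ / (4 * (L + 1)) := by field_simp; norm_num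
    linarith
  have h10 : L * (κ / (2 * (L + 1))) ≤ κ / 2 := by
    rw [mul_div_assoc', div_le_div_iff₀ (by positivity) two_pos]
    nlinarith
  linarith

/-- Collapse when the area of `-G` diverges at the right end of the domain. -/
theorem eventually_collapse_of_integral {ι : Type*} {l : Filter ι} {T A C : ι → ℝ}
    (hT : Tendsto T l (𝓝 t)) (hx : x ∈ P.I) (hs' : s' ∈ P.I) (hxs : x ≤ s')
    (hA : ∀ᶠ i in l, x ≤ A i) (hC : ∀ᶠ i in l, C i ≤ s')
    (hdiv : ∀ κ, ∃ s ∈ P.I, s' < s ∧ κ < -∫ v in s'..s, P.G t v) :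
    ∃ s ∈ P.I, s' < s ∧ ∀ᶠ i in l, ∀ β ν, |ν| ≤ P.B → P.Adm (T i) (A i) (C i) β → s < β →
      ¬ (0 ≤ P.E (T i) ν (A i) β β ∧ 0 ≤ P.rev.E (T i) (-ν) (A i) β β) := by
  obtain ⟨L, hL0, hL⟩ := P.exists_collapse hx hs' hxs (|t| + 1)
  -- The distance of the roots does not shrink here; it is at most `s' - x`, and `s` is taken so
  -- that the area exceeds `L (s' - x)`.
  obtain ⟨s, hs, hss, hκ⟩ := hdiv (L * (s' - x))
  refine ⟨s, hs, hss, ?_⟩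
  filter_upwards [hA, hC, (tendsto_integral_G hs' hs hT).neg.eventually (lt_mem_nhds hκ),
    (hT.abs).eventually (gt_mem_nhds (lt_add_one _))] with i h1 h2 h3 h4 β ν hν hAd hsβ h0
  have h5 := hL h4.le hν hAd h1 h2 le_rfl hss.le hsβ h0.1 h0.2
  have h6 : L * (C i - A i) ≤ L * (s' - x) := mul_le_mul_of_nonneg_left (by linarith) hL0
  linarith

end WaveFamily

end TravelingWave

/-! ### Limits of homoclinic orbits: shrinking to a point, and convergence to a cycle. -/

namespace TravelingWave

namespace WaveFamily

variable {P : WaveFamily} {t t' a a' m m' β β' ν ν' b b' α p x y s s' : ℝ}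

/-- Near the level of `M`, a positive parameter keeps the energy positive slightly beyond `M`. -/
theorem eventually_pos_M {ι : Type*} {l : Filter ι} {T A C : ι → ℝ}
    (hT : Tendsto T l (𝓝 (P.F P.M))) (hR : ∀ᶠ i in l, P.Root (T i) (A i) (C i)) {δ : ℝ}
    (hδ : 0 < δ) : ∃ s ∈ Ioo P.M P.N, ∀ᶠ i in l, ∀ β ν, δ ≤ ν → P.Adm (T i) (A i) (C i) β → s ≤ β →
      0 < P.E (T i) ν (A i) β s := by
  have hMI := P.isOpen.mem_nhds P.M_mem
  have hkM := P.k_pos _ P.M_mem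
  have hgM := P.g_pos _ P.M_mem
  set k₀ := P.k P.M / 2
  have hk₀ : 0 < k₀ := half_pos hkM
  -- The choice gives `(g M + 1) ε = κ²` for `κ = k₀ δ / 4`. Near `M`, where `F'` and `D` are close
  -- to zero, `G ≥ -κ² (v - A i)` while `H κ (v - A i) ≥ 2 κ² (v - A i)`, so the line of slope `κ`
  -- is a subsolution for `√(2 Y)`.
  set ε := (k₀ * δ) ^ 2 / (16 * (P.g P.M + 1))
  have hε : 0 < ε := by positivity
  have hk := (P.k_cont.continuousAt hMI).eventually (lt_mem_nhds (half_lt_self hkM))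
  have hg := (P.g_cont.continuousAt hMI).eventually (gt_mem_nhds (lt_add_one _))
  have hD := (P.D_cont.continuousAt hMI).eventually (lt_mem_nhds
    (show -(δ / 2) < P.D P.M by rw [P.D_M]; linarith))
  have hF := (P.F'_cont.continuousAt hMI).eventually (lt_mem_nhds
    (show -ε < P.F' P.M by rw [P.F'_M]; linarith))
  obtain ⟨r, hr, hball⟩ := Metric.mem_nhds_iff.1
    ((hk.and (hg.and (hD.and hF))).and hMI)
  have hmem : ∀ v, P.M - r < v → v < P.M + r → v ∈ Metric.ball P.M r := fun v h1 h2 => by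
    rw [Metric.mem_ball, Real.dist_eq, abs_lt]; constructor <;> linarith
  obtain ⟨s, hs, hsr⟩ := exists_between (lt_min (lt_add_of_pos_right P.M hr) P.M_lt_N)
  have hsr1 := hsr.trans_le (min_le_left _ _)
  refine ⟨s, ⟨hs, hsr.trans_le (min_le_right _ _)⟩, ?_⟩
  filter_upwards [(tendsto_left_root P.M_mem le_rfl rfl hT hR).eventually
    (lt_mem_nhds (sub_lt_self P.M hr)), hR] with i h1 h2 β ν hν hA hsβ
  have hAs : A i < s := h2.left_lt.trans hs
  have hin : ∀ v ∈ Icc (A i) s, v ∈ Metric.ball P.M r := fun v hv =>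
    hmem v (by linarith [hv.1]) (hv.2.trans_lt hsr1)
  have hmono : ∀ v ∈ Icc (A i) s, P.F (A i) + ε * A i ≤ P.F v + ε * v := by
    have : MonotoneOn (fun v => P.F v + ε * v) (Icc (A i) s) := by
      refine monotoneOn_of_hasDerivWithinAt_nonneg (f' := fun v => P.F' v + ε) (convex_Icc _ _)
        (((P.F_cont.mono fun v hv => (hball (hin v hv)).2)).add (by fun_prop)) (fun v hv => ?_)
        (fun v hv => ?_) <;> have hv' := hin v (interior_subset hv)
      · exact ((P.hasDerivAt v (hball hv').2).add
          (by simpa using (hasDerivAt_id' v).const_mul ε)).hasDerivWithinAt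
      · have : -ε < P.F' v := (hball hv').1.2.2.2
        linarith
    exact fun v hv => this ⟨le_rfl, hAs.le⟩ hv hv.1
  set κ := k₀ * δ / 4 with hκdef
  have hκ : 0 < κ := by positivity
  have := (hA.max ν).barrier_le hA.le.le hsβ hκ.le (fun v hv => ?_) s ⟨hAs.le, le_rfl⟩
  · refine lt_of_lt_of_le ?_ this
    have : 0 < s - A i := by linarith
    positivity
  · obtain ⟨⟨b1, b2, b3, b4⟩, b5⟩ := hball (hin v ⟨hv.1, hv.2.le⟩)
    have b1' : k₀ < P.k v := b1
    have b2' : P.g v < P.g P.M + 1 := b2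
    have b3' : -(δ / 2) < P.D v := b3
    have hgv := P.g_pos v b5
    have hva : 0 ≤ v - A i := by linarith [hv.1]
    have c1 := hmono v ⟨hv.1, hv.2.le⟩
    rw [h2.left_eq] at c1
    have c2 : -(ε * (v - A i)) ≤ P.F v - T i := by linarith
    have c3 : -((P.g P.M + 1) * (ε * (v - A i))) ≤ P.G (T i) v := by
      have := mul_le_mul_of_nonneg_left c2 hgv.le
      have h4 : P.g v * (ε * (v - A i)) ≤ (P.g P.M + 1) * (ε * (v - A i)) :=
        mul_le_mul_of_nonneg_right b2'.le (by positivity)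
      rw [G]; linarith
    have c4 : (P.g P.M + 1) * (ε * (v - A i)) = κ ^ 2 * (v - A i) := by
      simp only [ε, hκdef]
      field_simp
      ring
    have c5 : k₀ * (δ / 2) ≤ P.H ν v :=
      mul_le_mul b1'.le (by linarith) (by positivity) (P.k_pos v b5).le
    have c6 : k₀ * (δ / 2) * (κ * (v - A i)) ≤ P.H ν v * (κ * (v - A i)) :=
      mul_le_mul_of_nonneg_right c5 (by positivity)
    have c7 : k₀ * (δ / 2) * (κ * (v - A i)) = 2 * (κ ^ 2 * (v - A i)) := by
      simp only [hκdef]; ring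
    linarith

/-- A common zero `p > s` would itself be an admissible right end at which both energies are
nonnegative, which the collapse estimate forbids. -/
theorem eventually_crossing_le {ι : Type*} {l : Filter ι} {T A C : ι → ℝ}
    (hT : Tendsto T l (𝓝 (P.F P.M))) (hR : ∀ᶠ i in l, P.Root (T i) (A i) (C i))
    (hs : s ∈ Ioo P.M P.N) : ∀ᶠ i in l, ∀ β ν p, |ν| ≤ P.B → P.Adm (T i) (A i) (C i) β →
      p ∈ Ioo (C i) β → P.E (T i) ν (A i) β p = 0 → P.rev.E (T i) (-ν) (A i) β p = 0 → p ≤ s := by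
  filter_upwards [eventually_collapse_M hT hR hs] with i h1 β ν p hν hA hp h2 h3
  by_contra hsp
  have hpp : p ∈ Icc (A i) p := ⟨(hA.lt_mid.trans hp.1).le, le_rfl⟩
  refine h1 p ν hν (hA.mono_right hp.1 hp.2.le) (not_le.1 hsp) ⟨?_, ?_⟩
  · rw [hA.E_eqOn ν hp.1 hp.2.le hpp, h2]
  · rw [hA.rev.E_eqOn (-ν) hp.1 hp.2.le hpp, h3]

/-- Homoclinic orbits shrink to `(M, 0)` as the level approaches `F M`. -/
theorem tendsto_hom_M {ι : Type*} {l : Filter ι} {T A C V : ι → ℝ} {u w : ι → ℝ → ℝ}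
    (hT : Tendsto T l (𝓝 (P.F P.M))) (hR : ∀ᶠ i in l, P.Root (T i) (A i) (C i))
    (h : ∀ᶠ i in l, ∃ β ≥ P.N, P.Adm (T i) (A i) (C i) β ∧
      P.IsHom (T i) (V i) (A i) (u i) (w i) ∧ ∀ z, u i z < β) :
    Tendsto V l (𝓝 0) ∧ Tendsto (fun i => Metric.hausdorffEDist
      (TrafficModel.orbit (u i, w i)) {!₂[P.M, 0]}) l (𝓝 0) := by
  constructor
  · refine Metric.tendsto_nhds.2 fun δ hδ => ?_
    obtain ⟨s, hs, h1⟩ := eventually_pos_M hT hR hδ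
    obtain ⟨s', hs', h2⟩ := P.rev.eventually_pos_M hT (hR.mono fun i h => h.rev) hδ
    filter_upwards [h, h1, h2, eventually_crossing_le hT hR hs, eventually_crossing_le hT hR hs']
      with i ⟨β, hβ, hA, hh, hu⟩ h3 h4 h5 h6
    obtain ⟨p, hp, -, -, e1, e2, -⟩ := hA.hom_spec hh hu
    have hB := hA.hom_abs_le hh hu
    rw [Real.dist_eq, sub_zero, abs_lt]
    -- If `|V i| ≥ δ`, the energy for `H` or the one for `-H` is positive at a point at or beyond
    -- the common zero, where it should be nonpositive.
    constructor
    · by_contra hn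
      have h7 := h4 β (-V i) (by linarith) hA.rev (hs'.2.le.trans hβ)
      have h8 := (hA.rev.hump (-V i)).nonpos_after (hA.rev.max _).toIsEnergy (hA.rev.near _)
        ⟨hp.1.le, hp.2.le⟩ e2.le s' ⟨h6 β _ p hB hA hp e1 e2, hs'.2.le.trans hβ⟩
      linarith
    · by_contra hn
      have h7 := h3 β (V i) (by linarith) hA (hs.2.le.trans hβ)
      have h8 := (hA.hump (V i)).nonpos_after (hA.max _).toIsEnergy (hA.near _)
        ⟨hp.1.le, hp.2.le⟩ e1.le s ⟨h5 β _ p hB hA hp e1 e2, hs.2.le.trans hβ⟩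
      linarith
  · have hMI := P.isOpen.mem_nhds P.M_mem
    obtain ⟨r, hr, hsub⟩ := mem_nhdsLT_iff_exists_Ioo_subset.1
      (mem_nhdsWithin_of_mem_nhds hMI : P.I ∈ 𝓝[<] P.M)
    obtain ⟨x, hx, hxM⟩ := exists_between (show r < P.M from hr)
    have hxI := hsub ⟨hx, hxM⟩
    obtain ⟨L₁, hL₁0, hL₁⟩ := P.exists_lipschitz hxI P.N_mem (hxM.trans P.M_lt_N).le
      (|P.F P.M| + 1)
    obtain ⟨L₂, hL₂0, hL₂⟩ := P.rev.exists_lipschitz hxI P.N_mem (hxM.trans P.M_lt_N).le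
      (|P.F P.M| + 1)
    refine tendsto_zero_of_le_ofReal fun ε hε => ?_
    set L := max L₁ L₂
    have hL : 0 ≤ L := le_max_of_le_left hL₁0
    -- On `(A i, p]` this gives `|v - M| ≤ ε / 4` and `v - A i ≤ 2 η`, hence `2 Y ≤ ε² / 8` and `√(2
    -- Y) ≤ ε / 2`.
    set η := min (ε / 4) (ε ^ 2 / (32 * (L + 1)))
    have hη : 0 < η := by positivity
    obtain ⟨s, hs, hsη⟩ := exists_between (lt_min (lt_add_of_pos_right P.M hη) P.M_lt_N)
    have hsN := hsη.trans_le (min_le_right _ _)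
    have hsη' := hsη.trans_le (min_le_left _ _)
    have hA := tendsto_left_root P.M_mem le_rfl rfl hT hR
    filter_upwards [h, eventually_crossing_le hT hR ⟨hs, hsN⟩, hA.eventually (lt_mem_nhds hxM),
      hA.eventually (lt_mem_nhds (sub_lt_self P.M hη)),
      (hT.abs).eventually (gt_mem_nhds (lt_add_one _)), hR]
      with i ⟨β, hβ, hA, hh, hu⟩ h1 h2 h3 h4 h5
    obtain ⟨p, hp, -, -, e1, e2, e3⟩ := hA.hom_spec hh hu
    have hB := hA.hom_abs_le hh hu
    have hps := h1 β _ p hB hA hp e1 e2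
    have hAp := hA.lt_mid.trans hp.1
    have hbound : ∀ v ∈ Ioc (A i) p, |v - P.M| ≤ ε / 4 ∧ v - A i ≤ ε ^ 2 / (16 * (L + 1)) := by
      intro v hv
      have hη1 : η ≤ ε / 4 := min_le_left _ _
      have hη2 : η ≤ ε ^ 2 / (32 * (L + 1)) := min_le_right _ _
      have hη3 : ε ^ 2 / (16 * (L + 1)) = ε ^ 2 / (32 * (L + 1)) + ε ^ 2 / (32 * (L + 1)) := by
        field_simp; norm_num
      have := hv.1
      have := hv.2
      exact ⟨abs_le.2 ⟨by linarith, by linarith⟩, by linarith⟩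
    have hsmall : ∀ (Y : ℝ → ℝ), Y (A i) = 0 → (∀ v ∈ Icc (A i) p, |Y v - Y (A i)| ≤
        L * |v - A i|) → ∀ v ∈ Ioc (A i) p, √(2 * Y v) ≤ ε / 2 := by
      intro Y h0 hY v hv
      have h6 := hY v ⟨hv.1.le, hv.2⟩
      rw [h0, sub_zero, abs_of_pos (show 0 < v - A i by linarith [hv.1])] at h6
      have h7 : L * (v - A i) ≤ L * (ε ^ 2 / (16 * (L + 1))) :=
        mul_le_mul_of_nonneg_left (hbound v hv).2 hL
      have h8 : L * (ε ^ 2 / (16 * (L + 1))) ≤ ε ^ 2 / 16 := by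
        rw [mul_div_assoc', div_le_div_iff₀ (by positivity) (by norm_num)]
        nlinarith [sq_nonneg ε]
      refine Real.sqrt_le_iff.2 ⟨by positivity, ?_⟩
      have := le_abs_self (Y v)
      nlinarith [sq_nonneg ε]
    have hpN : p ≤ P.N := hps.trans hsN.le
    have hY₁ := hsmall _ (hA.max (V i)).init fun v hv => (hL₁ h4.le hB h2.le hpN
      ((hA.max (V i)).toIsEnergy.mono_right hp.2.le) v hv (A i) ⟨le_rfl, hAp.le⟩).trans
      (mul_le_mul_of_nonneg_right (le_max_left _ _) (abs_nonneg _))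
    have hY₂ := hsmall _ (hA.rev.max (-V i)).init fun v hv => (hL₂ (ν := -V i) h4.le
      (by rwa [abs_neg]) h2.le hpN
      ((hA.rev.max (-V i)).toIsEnergy.mono_right hp.2.le) v hv (A i) ⟨le_rfl, hAp.le⟩).trans
      (mul_le_mul_of_nonneg_right (le_max_right _ _) (abs_nonneg _))
    have hdist : ∀ q ∈ TrafficModel.orbit (u i, w i),
        edist q (!₂[P.M, 0] : EuclideanSpace ℝ (Fin 2)) ≤ ENNReal.ofReal ε := by
      rw [e3]
      intro q hq
      rw [edist_dist]
      refine ENNReal.ofReal_le_ofReal ((dist_vec_le _ _).trans ?_)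
      simp only [Matrix.cons_val_zero, Matrix.cons_val_one, sub_zero]
      rcases hq with ⟨hq0, hq1⟩ | ⟨hq0, hq1⟩
      · rw [hq1, abs_of_nonneg (Real.sqrt_nonneg _)]
        linarith [(hbound _ hq0).1, hY₁ _ hq0]
      · rw [hq1, abs_neg, abs_of_nonneg (Real.sqrt_nonneg _)]
        linarith [(hbound _ hq0).1, hY₂ _ hq0]
    refine Metric.hausdorffEDist_le_of_mem_edist (fun q hq => ⟨_, rfl, hdist q hq⟩) ?_
    rintro _ rfl
    exact ⟨_, mem_orbit 0, by rw [edist_comm]; exact hdist _ (mem_orbit 0)⟩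

/-- The branch of homoclinic orbits leaving `a` converges to the heteroclinic orbit. -/
theorem Root₃.tendsto_branch {ι : Type*} {l : Filter ι} {T A C S V p : ι → ℝ}
    (R : P.Root₃ t a m b) (h0 : P.E t ν a b b = 0) (hT : Tendsto T l (𝓝 t))
    (htT : ∀ᶠ i in l, t < T i) (hR : ∀ᶠ i in l, P.Root₃ (T i) (A i) (C i) (S i))
    (hV : Tendsto V l (𝓝 ν)) (hB : ∀ᶠ i in l, |V i| ≤ P.B)
    (hp : ∀ᶠ i in l, p i ∈ Ioo (C i) (S i) ∧ P.E (T i) (V i) (A i) (S i) (p i) = 0) :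
    ∃ W : ℝ → ℝ, UniformContinuous W ∧ (∀ x ∈ Ioo a b, W x = √(2 * P.E t ν a b x)) ∧
      (∀ ε > 0, ∀ᶠ i in l, ∀ x ∈ Ioc (A i) (p i),
        |√(2 * P.E (T i) (V i) (A i) (S i) x) - W x| < ε) ∧
      (∀ δ > 0, ∀ᶠ i in l, Ioc (A i) (p i) ⊆ Ioo (a - δ) (b + δ)) ∧
      (∀ δ > 0, ∀ᶠ i in l, Icc (a + δ) (b - δ) ⊆ Ioc (A i) (p i)) := by
  have A₀ := R.adm
  have hab := A₀.le
  have hEc := (A₀.max ν).continuousOn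
  have hAt := R.tendsto_left hT hR
  have hSt := R.tendsto_right hT hR
  -- Levels above `t` have their right root beyond `b`, so `b` can serve as a common right end.
  have hAdm : ∀ᶠ i in l, P.Adm (T i) (A i) (C i) b ∧ b < S i := by
    filter_upwards [htT, hR] with i h1 h2
    exact ⟨A₀.of_le h2.toRoot h1.le, R.lt_of_lt h2 h1⟩
  have hcont : Continuous fun x : Icc a b => √(2 * P.E t ν a b x) :=
    ((continuousOn_iff_continuous_domRestrict.1 hEc).const_smul (2 : ℝ)).sqrt
  -- The energy vanishes at `a` and at `b`, so this extension is zero outside `[a, b]`; it is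
  -- uniformly continuous on the line.
  set W : ℝ → ℝ := IccExtend hab.le (fun x : Icc a b => √(2 * P.E t ν a b x)) with hWdef
  have hWx : ∀ x ∈ Icc a b, W x = √(2 * P.E t ν a b x) := fun x hx => by
    rw [hWdef, IccExtend_of_mem _ _ hx]
  have hWa : ∀ x ≤ a, W x = 0 := fun x hx => by
    rw [hWdef, IccExtend_of_le_left _ _ hx]
    simp [(A₀.max ν).init]
  have hWb : ∀ x ≥ b, W x = 0 := fun x hx => by
    rw [hWdef, IccExtend_of_right_le _ _ hx]
    simp [h0]
  refine ⟨W, ?_, fun x hx => hWx x (Ioo_subset_Icc_self hx), ?_, ?_, ?_⟩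
  · exact (CompactSpace.uniformContinuous_of_continuous hcont).comp
      (LipschitzWith.projIcc hab.le).uniformContinuous
  · intro ε hε
    obtain ⟨r, hr, hsub⟩ := mem_nhdsLT_iff_exists_Ioo_subset.1
      (mem_nhdsWithin_of_mem_nhds (P.isOpen.mem_nhds A₀.left_mem) : P.I ∈ 𝓝[<] a)
    obtain ⟨α, hα, hαa⟩ := exists_between (show r < a from hr)
    have hαI := hsub ⟨hα, hαa⟩
    obtain ⟨r', hr', hsub'⟩ := mem_nhdsGT_iff_exists_Ioo_subset.1
      (mem_nhdsWithin_of_mem_nhds (P.isOpen.mem_nhds A₀.right_mem) : P.I ∈ 𝓝[>] b)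
    obtain ⟨γ, hγ, hγr⟩ := exists_between (show b < r' from hr')
    have hγI := hsub' ⟨hγ, hγr⟩
    obtain ⟨L, hL0, hL⟩ := P.exists_lipschitz hαI hγI (hαa.trans (hab.trans hγ)).le (|t| + 1)
    have hun := tendstoUniformlyOn_sqrt
      (A₀.tendsto_E hT hV (hAdm.mono fun i h => h.1) hαa hαI)
    rw [Metric.tendstoUniformlyOn_iff] at hun
    have hε' : 0 < ε ^ 2 / (4 * (L + 1)) := by positivity
    filter_upwards [hun ε hε, hAdm, hR, hp, hB, hAt.eventually (lt_mem_nhds hαa),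
      hSt.eventually (gt_mem_nhds hγ), hSt.eventually (gt_mem_nhds (lt_add_of_pos_right b hε')),
      (hT.abs).eventually (gt_mem_nhds (lt_add_one _))]
      with i h1 ⟨h2, h3⟩ h4 ⟨h5, h6⟩ h7 h8 h9 h10 h11 x hx
    rcases le_or_gt x b with hxb | hxb
    · have h12 := h1 x ⟨(h8.trans hx.1).le, hxb⟩
      rw [extendLeft_of_gt hx.1, h4.adm.E_eqOn (V i) h2.lt_right h3.le ⟨hx.1.le, hxb⟩,
        Real.dist_eq, abs_sub_comm] at h12
      convert h12 using 3
      rcases le_or_gt x a with hxa | hxa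
      · rw [hWa x hxa, extendLeft_of_le hxa, mul_zero, Real.sqrt_zero]
      · rw [hWx x ⟨hxa.le, hxb⟩, extendLeft_of_gt hxa]
    -- Beyond `b` the energy is small by the Lipschitz bound, since it vanishes at `p i < S i` and
    -- `S i → b`.
    · rw [hWb x hxb.le, sub_zero, abs_of_nonneg (Real.sqrt_nonneg _), Real.sqrt_lt' hε]
      have h12 := hL h11.le h7 h8.le h9.le (h4.adm.max (V i)).toIsEnergy x
        ⟨hx.1.le, (hx.2.trans_lt h5.2).le⟩ (p i) ⟨(hx.1.trans_le hx.2).le, h5.2.le⟩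
      rw [h6, sub_zero, abs_sub_comm, abs_of_nonneg (sub_nonneg.2 hx.2)] at h12
      have h13 : L * (p i - x) ≤ L * (ε ^ 2 / (4 * (L + 1))) :=
        mul_le_mul_of_nonneg_left (by linarith [h5.2]) hL0
      have h14 : L * (ε ^ 2 / (4 * (L + 1))) ≤ ε ^ 2 / 4 := by
        rw [mul_div_assoc', div_le_div_iff₀ (by positivity) (by norm_num)]
        nlinarith [sq_nonneg ε]
      have := le_abs_self (P.E (T i) (V i) (A i) (S i) x)
      have : 0 < ε ^ 2 := by positivity
      linarith
  · intro δ hδ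
    filter_upwards [hp, hAt.eventually (lt_mem_nhds (sub_lt_self a hδ)),
      hSt.eventually (gt_mem_nhds (lt_add_of_pos_right b hδ))] with i h1 h2 h3 x hx
    exact ⟨h2.trans hx.1, (hx.2.trans_lt h1.1.2).trans h3⟩
  · intro δ hδ
    rcases lt_or_ge (b - δ) (a + δ) with hlt | hge
    · exact Eventually.of_forall fun i => by rw [Icc_eq_empty (not_le.2 hlt)]; exact empty_subset _
    -- The limit energy is positive at `b - δ`, hence so are the nearby ones, and their zero `p i`
    -- lies beyond `b - δ`.
    · have hyI : b - δ ∈ Ioc a b := ⟨by linarith, by linarith⟩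
      have hpos := (A₀.hump ν).pos_of_nonneg (A₀.max ν).toIsEnergy (A₀.near ν) h0.ge (b - δ)
        ⟨hyI.1, by linarith⟩
      filter_upwards [(A₀.tendsto_E_at hT hV (hAdm.mono fun i h => h.1) hyI).eventually
        (lt_mem_nhds hpos), hAdm, hR, hp, hAt.eventually (gt_mem_nhds (lt_add_of_pos_right a hδ))]
        with i h1 ⟨h2, h3⟩ h4 ⟨h5, h6⟩ h7 x hx
      rw [h4.adm.E_eqOn (V i) h2.lt_right h3.le ⟨by linarith [h7], by linarith⟩] at h1
      refine ⟨h7.trans_le hx.1, hx.2.trans ?_⟩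
      by_contra hn
      have := (h4.adm.hump (V i)).nonpos_after (h4.adm.max (V i)).toIsEnergy (h4.adm.near (V i))
        ⟨h5.1.le, h5.2.le⟩ h6.le (b - δ) ⟨(not_le.1 hn).le, by linarith⟩
      linarith

theorem graphOver_congr {s : Set ℝ} {W W' : ℝ → ℝ} (h : ∀ x ∈ s, W x = W' x) :
    graphOver s W = graphOver s W' := by
  ext q
  exact ⟨fun hq => ⟨hq.1, hq.2.trans (h _ hq.1)⟩, fun hq => ⟨hq.1, hq.2.trans (h _ hq.1).symm⟩⟩

/-- Homoclinic orbits converge to a heteroclinic cycle. -/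
theorem Root₃.tendsto_hom_cycle {ι : Type*} {l : Filter ι} {T A C S V : ι → ℝ}
    {u w : ι → ℝ → ℝ} {u₁ w₁ u₂ w₂ : ℝ → ℝ} (R : P.Root₃ t a m b)
    (hup : P.IsUp t ν a b u₁ w₁) (hdown : P.IsDown t ν a b u₂ w₂)
    (hT : Tendsto T l (𝓝 t)) (htT : ∀ᶠ i in l, t < T i)
    (hR : ∀ᶠ i in l, P.Root₃ (T i) (A i) (C i) (S i))
    (h : ∀ᶠ i in l, P.IsHom (T i) (V i) (A i) (u i) (w i)) :
    Tendsto V l (𝓝 ν) ∧ Tendsto (fun i => Metric.hausdorffEDist (TrafficModel.orbit (u i, w i))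
      (TrafficModel.orbit (u₁, w₁) ∪ TrafficModel.orbit (u₂, w₂))) l (𝓝 0) := by
  have e1 : ν = P.speed t a b := (R.up_spec hup).1
  have e2 : ν = -P.rev.speed t a b := (R.down_spec hdown).1
  have hV : Tendsto V l (𝓝 ν) := by
    refine tendsto_of_tendsto_of_tendsto_of_le_of_le' (g := fun i => -P.rev.speed (T i) (A i) (S i))
      (h := fun i => P.speed (T i) (A i) (S i)) ?_ ?_ ?_ ?_
    · rw [e2]; exact (R.rev.tendsto_speed hT (hR.mono fun i h => h.rev)).neg
    · rw [e1]; exact R.tendsto_speed hT hR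
    · filter_upwards [hR, h] with i h1 h2 using (h1.hom_between h2).1.le
    · filter_upwards [hR, h] with i h1 h2 using (h1.hom_between h2).2.le
  refine ⟨hV, ?_⟩
  have hspec : ∀ i, ∃ p, P.Root₃ (T i) (A i) (C i) (S i) →
      P.IsHom (T i) (V i) (A i) (u i) (w i) → p ∈ Ioo (C i) (S i) ∧
      P.E (T i) (V i) (A i) (S i) p = 0 ∧ P.rev.E (T i) (-V i) (A i) (S i) p = 0 ∧
      TrafficModel.orbit (u i, w i) =
        graphOver (Ioc (A i) p) (fun x => √(2 * P.E (T i) (V i) (A i) (S i) x)) ∪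
        graphOver (Ioc (A i) p) (fun x => -√(2 * P.rev.E (T i) (-V i) (A i) (S i) x)) := by
    intro i
    by_cases hi : P.Root₃ (T i) (A i) (C i) (S i) ∧ P.IsHom (T i) (V i) (A i) (u i) (w i)
    · obtain ⟨p, hp, -, -, h1, h2, h3⟩ := hi.1.adm.hom_spec hi.2 (hi.1.hom_lt hi.2)
      exact ⟨p, fun _ _ => ⟨hp, h1, h2, h3⟩⟩
    · exact ⟨0, fun h1 h2 => absurd ⟨h1, h2⟩ hi⟩
  choose p hp using hspec
  have hB : ∀ᶠ i in l, |V i| ≤ P.B := by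
    filter_upwards [hR, h] with i h1 h2 using h1.adm.hom_abs_le h2 (h1.hom_lt h2)
  obtain ⟨W, hW1, hW2, hW3, hW4, hW5⟩ := R.tendsto_branch (R.adm.E_eq_zero_iff.2 e1) hT htT hR hV hB
    (p := p) (by filter_upwards [hR, h] with i h1 h2 using ⟨(hp i h1 h2).1, (hp i h1 h2).2.1⟩)
  -- Both branches end at the same `p i`, so the two statements on domains from the first branch
  -- serve for this one as well.
  obtain ⟨W', hW1', hW2', hW3', -, -⟩ := R.rev.tendsto_branch (V := fun i => -V i)
    (R.rev.adm.E_eq_zero_iff.2 (by rw [e2, neg_neg])) hT htT (hR.mono fun i h => h.rev) hV.neg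
    (hB.mono fun i h => by rw [abs_neg]; exact h)
    (p := p) (by filter_upwards [hR, h] with i h1 h2 using ⟨(hp i h1 h2).1, (hp i h1 h2).2.2.1⟩)
  have hab := R.adm.le
  refine tendsto_zero_of_le_ofReal fun ε hε => ?_
  have c1 := tendsto_graphOver hab hW1 hW3 hW4 hW5 ε hε
  have c2 := tendsto_graphOver (W := fun x => -W' x)
    (V := fun i x => -√(2 * P.rev.E (T i) (-V i) (A i) (S i) x)) hab hW1'.neg (fun ε hε =>
    (hW3' ε hε).mono fun i hi x hx => by
      rw [neg_sub_neg, abs_sub_comm]; exact hi x hx) hW4 hW5 ε hε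
  filter_upwards [c1, c2, hR, h] with i h1 h2 h3 h4
  rw [(hp i h3 h4).2.2.2, R.orbit_up hup, R.orbit_down hdown, graphOver_congr fun x hx =>
    (hW2 x hx).symm, graphOver_congr (s := Ioo a b) (W := fun x => -√(2 * P.rev.E t (-ν) a b x))
    (W' := fun x => -W' x) fun x hx => by rw [hW2' x hx]]
  exact hausdorffEDist_union_le_of_dist h1 h2

end WaveFamily

end TravelingWave

/-! ### The traffic model as such a family, and condition (H) as a divergent area. -/

namespace TrafficModel

open TravelingWave

variable {m : TrafficModel} {K c μ : ℝ} {u w : ℝ → ℝ}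

theorem deriv_V_uM (hK : K ∈ Ioo m.K₀ m.KM) : deriv m.V (m.uM K) = K := by
  have h := m.isMaxPoint_uM hK
  have := h.2.hasDerivAt_eq_zero (m.hasDerivAt_aux K h.1.1)
  linarith

theorem pos_of_mem (hK : K ∈ Ioo m.K₀ m.KM) : 0 < K := m.K₀_nonneg.trans_lt hK.1

theorem mem_Ioo_zero (hK : K ∈ Ioo m.K₀ m.KM) : K ∈ Ioo 0 m.KM := ⟨pos_of_mem hK, hK.2⟩

theorem continuousOn_κ_inv (m : TrafficModel) : ContinuousOn (fun u => m.κ u⁻¹) (Ioi 0) :=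
  m.κ_contDiffOn.continuousOn.comp (continuousOn_inv₀.mono fun _ hu => ne_of_gt hu)
    fun _ hu => mem_Ioi.2 (inv_pos.2 hu)

theorem κ_inv_pos (m : TrafficModel) {u : ℝ} (hu : 0 < u) : 0 < m.κ u⁻¹ := m.κ_pos _ (inv_pos.2 hu)

/-- The traveling wave equation as a member of the general family. -/
noncomputable def family (m : TrafficModel) {K : ℝ} (hK : K ∈ Ioo m.K₀ m.KM) : WaveFamily where
  I := Ioi 0
  g := m.g₁
  k := m.g₂
  F := fun u => u - m.V u / K
  F' := fun u => 1 - deriv m.V u / K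
  D := fun u => 1 - deriv m.V u / K
  M := m.uM K
  N := m.um K
  B := 1 + m.KM / K
  isOpen := isOpen_Ioi
  ordConnected := ordConnected_Ioi
  g_pos := fun x hx => one_div_pos.2 (mul_pos m.τ_pos (m.κ_inv_pos hx))
  k_pos := fun x hx => div_pos hx (mul_pos (mul_pos two_pos m.τ_pos) (m.κ_inv_pos hx))
  g_cont := continuousOn_const.div (continuousOn_const.mul m.continuousOn_κ_inv)
    fun x hx => (mul_pos m.τ_pos (m.κ_inv_pos hx)).ne'
  k_cont := continuousOn_id.div (continuousOn_const.mul m.continuousOn_κ_inv)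
    fun x hx => (mul_pos (mul_pos two_pos m.τ_pos) (m.κ_inv_pos hx)).ne'
  hasDerivAt := fun x hx => (hasDerivAt_id' x).sub ((m.hasDerivAt_V hx).div_const K)
  F'_cont := fun x hx => (continuousAt_const.sub
    ((m.hasDerivAt_deriv_V hx).continuousAt.div_const K)).continuousWithinAt
  D_diff := fun x hx => (differentiableAt_const _).sub
    ((m.hasDerivAt_deriv_V hx).differentiableAt.div_const K)
  D_le := fun x hx => by
    have h0 := pos_of_mem hK
    have h1 := div_pos (m.deriv_V_pos x hx) h0
    have h2 : deriv m.V x / K ≤ m.KM / K := div_le_div_of_nonneg_right (m.deriv_V_le x hx) h0.le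
    exact abs_le.2 ⟨by linarith, by linarith⟩
  M_mem := (m.isMaxPoint_uM hK).1.1
  N_mem := m.UM_pos.trans (m.isMinPoint_um (mem_Ioo_zero hK)).1
  M_lt_N := (m.isMaxPoint_uM hK).1.2.trans (m.isMinPoint_um (mem_Ioo_zero hK)).1
  inc_left := fun x hx h => by
    have h0 := pos_of_mem hK
    have hM := (m.isMaxPoint_uM hK).1
    have := m.strictMonoOn_deriv_V ⟨hx, (h.trans hM.2).le⟩ ⟨hM.1, hM.2.le⟩ h
    rw [deriv_V_uM hK] at this
    rw [sub_pos, div_lt_one h0]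
    exact this
  dec_mid := fun x hx => by
    have h0 := pos_of_mem hK
    have hM := (m.isMaxPoint_uM hK).1
    have hN := (m.isMinPoint_um (mem_Ioo_zero hK)).1
    rw [sub_neg, one_lt_div h0]
    rcases le_total x m.UM with h | h
    · have := m.strictMonoOn_deriv_V ⟨hM.1, hM.2.le⟩ ⟨hM.1.trans hx.1, h⟩ hx.1
      rwa [deriv_V_uM hK] at this
    · have := m.strictAntiOn_deriv_V (mem_Ici.2 h) (mem_Ici.2 (le_of_lt hN)) hx.2
      rwa [m.deriv_V_um (mem_Ioo_zero hK)] at this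
  inc_right := fun x hx h => by
    have h0 := pos_of_mem hK
    have hN := (m.isMinPoint_um (mem_Ioo_zero hK)).1
    have := m.strictAntiOn_deriv_V (mem_Ici.2 (le_of_lt hN)) (mem_Ici.2 (le_of_lt (lt_trans hN h))) h
    rw [m.deriv_V_um (mem_Ioo_zero hK)] at this
    rw [sub_pos, div_lt_one h0]
    exact this
  F'_M := by rw [deriv_V_uM hK, div_self (pos_of_mem hK).ne', sub_self]
  F'_N := by rw [m.deriv_V_um (mem_Ioo_zero hK), div_self (pos_of_mem hK).ne', sub_self]
  D_M := by rw [deriv_V_uM hK, div_self (pos_of_mem hK).ne', sub_self]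
  D_N := by rw [m.deriv_V_um (mem_Ioo_zero hK), div_self (pos_of_mem hK).ne', sub_self]

theorem f_eq (hK : K ∈ Ioo m.K₀ m.KM) (u : ℝ) : m.f K c u = (m.family hK).F u - c / K := by
  have h0 := (pos_of_mem hK).ne'
  simp only [f, family]
  field_simp

theorem isSolution_iff (hK : K ∈ Ioo m.K₀ m.KM) : m.IsSolution K c μ u w ↔ (m.family hK).Sol (c / K) μ u w := by
  have h0 := (pos_of_mem hK).ne'
  refine forall_congr' fun z => and_congr_right fun hz => and_congr_right fun _ => ?_
  have hd : deriv (m.f K c) (u z) = (m.family hK).D (u z) := by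
    have h1 : HasDerivAt (m.f K c) ((K - deriv m.V (u z)) / K) (u z) :=
      (((m.hasDerivAt_aux K hz).sub_const c).div_const K)
    rw [h1.deriv, sub_div, div_self h0]
    rfl
  have : m.g₁ (u z) * m.f K c (u z) + m.g₂ (u z) * m.h K c (u z) μ * w z =
      (m.family hK).G (c / K) (u z) + (m.family hK).H μ (u z) * w z := by
    rw [h, hd, f_eq hK]
    rfl
  rw [this]

theorem F_M (hK : K ∈ Ioo m.K₀ m.KM) : (m.family hK).F (m.family hK).M = m.cM K / K := by
  have h0 := (pos_of_mem hK).ne'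
  simp only [family, cM]
  field_simp

theorem F_N (hK : K ∈ Ioo m.K₀ m.KM) : (m.family hK).F (m.family hK).N = m.cm K / K := by
  have h0 := (pos_of_mem hK).ne'
  simp only [family, cm]
  field_simp

theorem F_zero (hK : K ∈ Ioo m.K₀ m.KM) : (m.family hK).F 0 = m.c₀ / K := by
  simp only [family, c₀]
  ring

theorem continuousOn_F (hK : K ∈ Ioo m.K₀ m.KM) : ContinuousOn (m.family hK).F (Ici 0) :=
  continuousOn_id.sub (m.continuousOn_V.div_const K)

theorem strictMonoOn_F (hK : K ∈ Ioo m.K₀ m.KM) : StrictMonoOn (m.family hK).F (Icc 0 (m.uM K)) := by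
  refine strictMonoOn_of_hasDerivWithinAt_pos (f' := (m.family hK).F') (convex_Icc _ _)
    ((continuousOn_F hK).mono Icc_subset_Ici_self) (fun x hx => ?_) fun x hx => ?_ <;>
  rw [interior_Icc] at hx
  · exact ((m.family hK).hasDerivAt x hx.1).hasDerivWithinAt
  · exact (m.family hK).inc_left x hx.1 hx.2

theorem cm_lt_cM (hK : K ∈ Ioo m.K₀ m.KM) : m.cm K < m.cM K := by
  have := (m.family hK).strictAntiOn_mid ⟨le_rfl, (m.family hK).M_lt_N.le⟩
    ⟨(m.family hK).M_lt_N.le, le_rfl⟩ (m.family hK).M_lt_N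
  rw [F_M, F_N] at this
  exact (div_lt_div_iff_of_pos_right (pos_of_mem hK)).1 this

theorem c₀_lt_cM (hK : K ∈ Ioo m.K₀ m.KM) : m.c₀ < m.cM K := by
  have hM := (m.isMaxPoint_uM hK).1.1
  have := strictMonoOn_F hK ⟨le_rfl, hM.le⟩ ⟨hM.le, le_rfl⟩ hM
  rw [F_zero hK, show (m.family hK).F (m.uM K) = m.cM K / K from F_M hK] at this
  exact (div_lt_div_iff_of_pos_right (pos_of_mem hK)).1 this

/-- Since `V' → 0`, eventually `F' ≥ 1 / 2`, so `F` is unbounded above. -/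
theorem exists_F_gt (hK : K ∈ Ioo m.K₀ m.KM) (t : ℝ) : ∃ u, m.um K < u ∧ t < (m.family hK).F u := by
  have h0 := pos_of_mem hK
  have hN : 0 < m.um K := (m.family hK).N_mem
  obtain ⟨r, hr⟩ := ((m.deriv_V_tendsto.eventually (gt_mem_nhds (half_pos h0))).and
    (eventually_gt_atTop (m.um K))).exists_forall_of_atTop
  have hrN := (hr r le_rfl).2
  have hmono : MonotoneOn (fun u => (m.family hK).F u - u / 2) (Ici r) := by
    have hpos : ∀ x ∈ Ici r, 0 < x := fun x hx => (hN.trans hrN).trans_le hx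
    have hd : ∀ x ∈ Ici r, HasDerivAt (fun u => (m.family hK).F u - u / 2)
        ((m.family hK).F' x - 1 / 2) x := fun x hx =>
      ((m.family hK).hasDerivAt x (hpos x hx)).sub ((hasDerivAt_id' x).div_const 2)
    refine monotoneOn_of_hasDerivWithinAt_nonneg (f' := fun x => (m.family hK).F' x - 1 / 2)
      (convex_Ici r) (fun x hx => (hd x hx).continuousAt.continuousWithinAt)
      (fun x hx => (hd x (interior_subset hx)).hasDerivWithinAt) fun x hx => ?_
    have h1 := (hr x (interior_subset hx)).1
    have h2 : deriv m.V x / K < 1 / 2 := by rw [div_lt_iff₀ h0]; linarith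
    show 0 ≤ 1 - deriv m.V x / K - 1 / 2
    linarith
  set v := r + 2 * (|t - (m.family hK).F r| + 1)
  have hrv : r ≤ v := by simp only [v]; linarith [abs_nonneg (t - (m.family hK).F r)]
  refine ⟨v, hrN.trans_le hrv, ?_⟩
  have h1 : (m.family hK).F r - r / 2 ≤ (m.family hK).F v - v / 2 :=
    hmono self_mem_Ici (mem_Ici.2 hrv) hrv
  have h2 := le_abs_self (t - (m.family hK).F r)
  simp only [v] at h1 ⊢
  linarith

/-- The middle and the right root. -/
theorem exists_right (hK : K ∈ Ioo m.K₀ m.KM) (h1 : m.cm K < c) (h2 : c < m.cM K) : ∃ x b : ℝ,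
    (m.family hK).M < x ∧ x < (m.family hK).N ∧ (m.family hK).F x = c / K ∧
    (m.family hK).N < b ∧ (m.family hK).F b = c / K := by
  have h0 := pos_of_mem hK
  set P := m.family hK
  have hc1 : P.F P.N < c / K := by rw [F_N]; exact div_lt_div_of_pos_right h1 h0
  have hc2 : c / K < P.F P.M := by rw [F_M]; exact div_lt_div_of_pos_right h2 h0
  obtain ⟨x, hx, hxc⟩ := intermediate_value_Ioo' P.M_lt_N.le
    (P.F_cont.mono (P.Icc_subset P.M_mem P.N_mem)) ⟨hc1, hc2⟩
  obtain ⟨y, hy, hyc⟩ := exists_F_gt hK (c / K)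
  obtain ⟨b, hb, hbc⟩ := intermediate_value_Ioo (show P.N ≤ y from hy.le)
    (P.F_cont.mono (P.Icc_subset P.N_mem (lt_trans P.N_mem hy))) ⟨hc1, hyc⟩
  exact ⟨x, b, hx.1, hx.2, hxc, hb.1, hbc⟩

theorem u₂_eq (hK : K ∈ Ioo m.K₀ m.KM) {b : ℝ} (hb : (m.family hK).N < b) (hbc : (m.family hK).F b = c / K) :
    m.u₂ K c = b := by
  have hN : 0 < (m.family hK).N := (m.family hK).N_mem
  refine IsGreatest.csSup_eq ⟨⟨hN.trans hb, by rw [f_eq hK, hbc, sub_self]⟩, fun x hx => ?_⟩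
  by_contra hn
  have := (m.family hK).strictMonoOn_right ⟨hN.trans hb, hb.le⟩ ⟨hx.1, (hb.trans (not_le.1 hn)).le⟩
    (not_le.1 hn)
  have h2 := hx.2
  rw [f_eq hK] at h2
  linarith

/-- The right saddle, seen in the mirror. -/
theorem exists_root_mirror (hK : K ∈ Ioo m.K₀ m.KM) (h1 : m.cm K < c) (h2 : c < m.cM K) :
    ∃ x, (m.family hK).mirror.Root (-(c / K)) (-m.u₂ K c) x := by
  obtain ⟨x, b, e1, e2, e3, e4, e5⟩ := exists_right hK h1 h2
  have hN : 0 < (m.family hK).N := (m.family hK).N_mem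
  rw [u₂_eq hK e4 e5]
  refine ⟨-x, ?_, neg_lt_neg e4, ?_, neg_lt_neg e2, neg_lt_neg e1, ?_⟩
  · simpa [WaveFamily.mirror, family] using (hN.trans e4 : 0 < b)
  · simp only [WaveFamily.mirror, neg_neg, e5]
  · simp only [WaveFamily.mirror, neg_neg, e3]

theorem mem_D₁_iff (hK : K ∈ Ioo m.K₀ m.KM) : (K, c) ∈ m.D₁ ↔ m.c₁ K < c ∧ c < m.cM K :=
  ⟨fun h => h.2.2, fun h => ⟨hK.1, hK.2, h⟩⟩

/-- `F 0 = c₀ / K`, so `c > c₀` is what makes the left root positive, and `c > c_m` provides the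
middle and the right one. -/
theorem exists_root₃ (hK : K ∈ Ioo m.K₀ m.KM) (h1 : m.c₁ K < c) (h2 : c < m.cM K) :
    ∃ x, (m.family hK).Root₃ (c / K) (m.u₁ K c) x (m.u₂ K c) := by
  have h0 := pos_of_mem hK
  obtain ⟨x, b, e1, e2, e3, e4, e5⟩ := exists_right hK ((le_max_right _ _).trans_lt h1) h2
  have hM : 0 < (m.family hK).M := (m.family hK).M_mem
  have hN : 0 < (m.family hK).N := (m.family hK).N_mem
  obtain ⟨a, ha, hac⟩ := intermediate_value_Ioo hM.le
    ((continuousOn_F hK).mono Icc_subset_Ici_self)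
    (show c / K ∈ Ioo _ _ by
      rw [F_zero hK, F_M hK]
      exact ⟨div_lt_div_of_pos_right ((le_max_left _ _).trans_lt h1) h0,
        div_lt_div_of_pos_right h2 h0⟩)
  have R : (m.family hK).Root (c / K) a x := ⟨ha.1, ha.2, hac, e1, e2, e3⟩
  have hu₁ : m.u₁ K c = a := by
    refine IsLeast.csInf_eq ⟨⟨ha.1, by rw [f_eq hK, hac, sub_self]⟩, fun y hy => ?_⟩
    by_contra hn
    have := R.neg_left hy.1 (not_le.1 hn)
    have h3 := hy.2
    rw [f_eq hK] at h3
    linarith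
  rw [hu₁, u₂_eq hK e4 e5]
  exact ⟨x, R, e4, hN.trans e4, e5⟩

theorem isBack_iff (hK : K ∈ Ioo m.K₀ m.KM) : m.IsBack K c μ u w ↔
    (m.family hK).IsUp (c / K) μ (m.u₁ K c) (m.u₂ K c) u w := by
  rw [IsBack, isSolution_iff hK]
  exact ⟨fun ⟨h1, h2, h3, h4, h5, h6⟩ => ⟨h1, h2, h3, h4, h5, h6⟩,
    fun ⟨h1, h2, h3, h4, h5, h6⟩ => ⟨h1, h2, h3, h4, h5, h6⟩⟩

theorem isFront_iff (hK : K ∈ Ioo m.K₀ m.KM) : m.IsFront K c μ u w ↔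
    (m.family hK).IsDown (c / K) μ (m.u₁ K c) (m.u₂ K c) u w := by
  rw [IsFront, isSolution_iff hK]
  exact ⟨fun ⟨h1, h2, h3, h4, h5, h6⟩ => ⟨h1, h2, h3, h4, h5, h6⟩,
    fun ⟨h1, h2, h3, h4, h5, h6⟩ => ⟨h1, h2, h3, h4, h5, h6⟩⟩

theorem isPulse_iff (hK : K ∈ Ioo m.K₀ m.KM) {a : ℝ} : m.IsPulse K c μ a u w ↔
    (m.family hK).IsHom (c / K) μ a u w := by
  rw [IsPulse, isSolution_iff hK]
  exact ⟨fun ⟨h1, h2, h3, h4, h5, h6⟩ => ⟨h1, h2, h3, h4, h5, h6⟩,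
    fun ⟨h1, h2, h3, h4, h5, h6⟩ => ⟨h1, h2, h3, h4, h5, h6⟩⟩

/-- Condition (H) as divergence of interval integrals. -/
theorem exists_integral_gt (hH : m.ConditionH) {A : ℝ} (hA : 0 < A) (C : ℝ) :
    ∃ R > A, C < ∫ ρ in A..R, 1 / (ρ ^ 3 * m.κ ρ) := by
  have hpos : ∀ ρ > 0, 0 < 1 / (ρ ^ 3 * m.κ ρ) := fun ρ hρ => by
    have := m.κ_pos ρ hρ
    positivity
  have hc : ContinuousOn (fun ρ => 1 / (ρ ^ 3 * m.κ ρ)) (Ioi 0) :=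
    continuousOn_const.div (by exact (continuousOn_pow 3).mul m.κ_contDiffOn.continuousOn)
      fun ρ hρ => by
        have := m.κ_pos ρ hρ
        have : (0 : ℝ) < ρ := hρ
        positivity
  by_contra hcon
  push Not at hcon
  have hint : IntegrableOn (fun ρ => 1 / (ρ ^ 3 * m.κ ρ)) (Ioi A) := by
    refine integrableOn_Ioi_of_intervalIntegral_norm_bounded (l := atTop) (b := id) C A
      (fun R => ?_) tendsto_id ?_
    · exact ((hc.mono fun x hx => hA.trans_le hx.1).integrableOn_Icc
        (μ := volume) (a := A) (b := R)).mono_set Ioc_subset_Icc_self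
    · filter_upwards [eventually_gt_atTop A] with R hR
      refine le_trans (le_of_eq ?_) (hcon R hR)
      refine intervalIntegral.integral_congr fun ρ hρ => ?_
      rw [id, uIcc_of_le (le_of_lt hR)] at hρ
      exact Real.norm_of_nonneg (hpos ρ (hA.trans_le hρ.1)).le
  have hint1 : IntegrableOn (fun ρ => 1 / (ρ ^ 3 * m.κ ρ)) (Ioi 1) := by
    have h1 : IntegrableOn (fun ρ => 1 / (ρ ^ 3 * m.κ ρ)) (Icc 1 A) :=
      (hc.mono fun x hx => one_pos.trans_le hx.1).integrableOn_Icc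
    refine (h1.union hint).mono_set fun x hx => ?_
    rcases le_or_gt x A with h | h
    · exact Or.inl ⟨le_of_lt hx, h⟩
    · exact Or.inr h
  have hfin := hint1.2
  rw [hasFiniteIntegral_iff_ofReal ((ae_restrict_iff' measurableSet_Ioi).2
    (Eventually.of_forall fun ρ hρ => (hpos ρ (one_pos.trans hρ)).le))] at hfin
  exact hfin.ne hH

/-- The substitution `u = 1 / ρ` turns condition (H) at infinite density into a divergence at `u =
0`. -/
theorem integral_inv {A R : ℝ} (hA : 0 < A) (hR : A ≤ R) :
    ∫ u in R⁻¹..A⁻¹, u / m.κ u⁻¹ = ∫ ρ in A..R, 1 / (ρ ^ 3 * m.κ ρ) := by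
  have hu : uIcc A R ⊆ Ioi 0 := by
    rw [uIcc_of_le hR]; exact fun x hx => hA.trans_le hx.1
  have h := intervalIntegral.integral_comp_mul_deriv'' (a := A) (b := R) (f := fun ρ : ℝ => ρ⁻¹)
    (f' := fun ρ => -(ρ ^ 2)⁻¹) (g := fun u => u / m.κ u⁻¹)
    (continuousOn_inv₀.mono fun x hx => ne_of_gt (hu hx))
    (fun x hx => (hasDerivAt_inv (ne_of_gt (hu (by
      rw [uIcc_of_le hR]; rw [min_eq_left hR, max_eq_right hR] at hx
      exact Ioo_subset_Icc_self hx)))).hasDerivWithinAt)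
    (ContinuousOn.neg (ContinuousOn.inv₀ (by fun_prop) fun x hx => pow_ne_zero 2 (ne_of_gt (hu hx))))
    (ContinuousOn.mono (s := Ioi 0) (continuousOn_id.div m.continuousOn_κ_inv
      fun x hx => (m.κ_inv_pos hx).ne') (by rintro _ ⟨x, hx, rfl⟩; exact mem_Ioi.2 (inv_pos.2 (mem_Ioi.1 (hu hx)))))
  rw [intervalIntegral.integral_symm, ← h, ← intervalIntegral.integral_neg]
  refine intervalIntegral.integral_congr fun ρ hρ => ?_
  have h1 : (0 : ℝ) < ρ := hu hρ
  have h2 := m.κ_pos ρ h1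
  simp only [Function.comp, inv_inv]
  field_simp

/-- Under (H), the area of `G` diverges at `0` for levels up to `F 0`. -/
theorem exists_area_gt (hK : K ∈ Ioo m.K₀ m.KM) (hH : m.ConditionH) (hc : c ≤ m.c₀) :
    ∃ r ∈ Ioo 0 (m.uM K), ∀ C, ∃ ε ∈ Ioo 0 r, C < ∫ u in ε..r, (m.family hK).G (c / K) u := by
  have h0 := pos_of_mem hK
  set P := m.family hK
  have hM : 0 < m.uM K := P.M_mem
  -- near `0`, `F u - F 0` is bounded below by a multiple of `u`
  obtain ⟨k₀, hk₀, r, hr, hF⟩ : ∃ k₀ > 0, ∃ r ∈ Ioo 0 (m.uM K), ∀ u ∈ Ioc 0 r,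
      k₀ * u ≤ P.F u - c / K := by
    have hM' := (m.isMaxPoint_uM hK).1
    set r := m.uM K / 2
    have hr : r ∈ Ioo 0 (m.uM K) := ⟨half_pos hM, half_lt_self hM⟩
    have hrU : r < m.UM := hr.2.trans hM'.2
    have hlt := m.strictMonoOn_deriv_V ⟨hr.1, hrU.le⟩ ⟨hM'.1, hM'.2.le⟩ hr.2
    rw [deriv_V_uM hK] at hlt
    refine ⟨1 - deriv m.V r / K, ?_, r, hr, fun u hu => ?_⟩
    · rw [gt_iff_lt, sub_pos, div_lt_one h0]; exact hlt
    · obtain ⟨s, hs, hsV⟩ := m.exists_deriv_V_eq hu.1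
      have h1 : deriv m.V s ≤ deriv m.V r := m.strictMonoOn_deriv_V.monotoneOn
        ⟨hs.1, ((hs.2.trans_le hu.2).trans hrU).le⟩ ⟨hr.1, hrU.le⟩ (hs.2.trans_le hu.2).le
      have h2 : c / K ≤ m.c₀ / K := div_le_div_of_nonneg_right hc h0.le
      have h3 : P.F u - m.c₀ / K = (1 - deriv m.V s / K) * u := by
        simp only [P, family, c₀]
        field_simp
        linarith
      have h4 : deriv m.V s / K ≤ deriv m.V r / K := div_le_div_of_nonneg_right h1 h0.le
      nlinarith [hu.1]
  refine ⟨r, hr, fun C => ?_⟩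
  have hτ := m.τ_pos
  -- `G` is at least `(k₀ / τ) u / κ(1 / u)` on `(0, r]`, so an integral above `C τ / k₀` gives an
  -- area above `C`.
  obtain ⟨R, hR, hRC⟩ := exists_integral_gt hH (inv_pos.2 hr.1) (C * m.τ / k₀)
  rw [← integral_inv (inv_pos.2 hr.1) (le_of_lt hR), inv_inv] at hRC
  have hR0 : 0 < R := (inv_pos.2 hr.1).trans hR
  have hε : R⁻¹ < r := inv_lt_of_inv_lt₀ hr.1 hR
  refine ⟨R⁻¹, ⟨inv_pos.2 hR0, hε⟩, ?_⟩
  rw [div_lt_iff₀ hk₀] at hRC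
  have hsub : uIcc R⁻¹ r ⊆ Ioi 0 := by
    rw [uIcc_of_le hε.le]; exact fun x hx => (inv_pos.2 hR0).trans_le hx.1
  have hmono : ∫ u in R⁻¹..r, (k₀ / m.τ) * (u / m.κ u⁻¹) ≤ ∫ u in R⁻¹..r, P.G (c / K) u := by
    refine intervalIntegral.integral_mono_on hε.le ?_ ?_ fun u hu => ?_
    · exact ((continuousOn_id.div m.continuousOn_κ_inv
        fun x hx => (m.κ_inv_pos hx).ne').mono hsub).intervalIntegrable.const_mul _
    · exact P.intervalIntegrable_G (inv_pos.2 hR0 : (0 : ℝ) < R⁻¹) hr.1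
    · have hu0 : 0 < u := (inv_pos.2 hR0).trans_le hu.1
      have hg := P.g_pos u hu0
      have hκ := m.κ_inv_pos hu0
      refine le_trans (le_of_eq ?_) (mul_le_mul_of_nonneg_left (hF u ⟨hu0, hu.2⟩) hg.le)
      show _ = 1 / (m.τ * m.κ u⁻¹) * (k₀ * u)
      field_simp
  rw [intervalIntegral.integral_const_mul] at hmono
  refine lt_of_lt_of_le ?_ hmono
  rw [div_mul_eq_mul_div, lt_div_iff₀ hτ]
  linarith

/-- In the mirrored family `u = 0` becomes the right end of the domain, and the divergence takes the
form required by `eventually_collapse_of_integral`. -/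
theorem mirror_area (hK : K ∈ Ioo m.K₀ m.KM) (hH : m.ConditionH) (hc : c ≤ m.c₀) :
    ∃ s' ∈ (m.family hK).mirror.I, (m.family hK).mirror.N < s' ∧ ∀ C,
      ∃ s ∈ (m.family hK).mirror.I, s' < s ∧
        C < -∫ v in s'..s, (m.family hK).mirror.G (-(c / K)) v := by
  obtain ⟨r, hr, h⟩ := exists_area_gt hK hH hc
  refine ⟨-r, by simpa [WaveFamily.mirror, family] using hr.1, neg_lt_neg hr.2, fun C => ?_⟩
  obtain ⟨ε, hε, hC⟩ := h C
  refine ⟨-ε, by simpa [WaveFamily.mirror, family] using hε.1, neg_lt_neg hε.2, ?_⟩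
  rw [WaveFamily.mirror_G, intervalIntegral.integral_neg, neg_neg,
    intervalIntegral.integral_comp_neg (fun u => (m.family hK).G (c / K) u), neg_neg, neg_neg]
  exact hC

end TrafficModel

/-! ### Well-definedness and limits of backs, fronts and pulses in the traffic model. -/

namespace TrafficModel

open TravelingWave

variable {m : TrafficModel} {K c μ μ' : ℝ} {u w u' w' : ℝ → ℝ}

theorem ConditionC.mem (hC : m.ConditionC K) : K ∈ Ioo m.K₀ m.KM := by
  have h1 := m.isK₁_K₁.1
  rcases hC with h | ⟨-, h⟩
  · exact ⟨h1.1.trans h.1, h.2⟩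
  · exact ⟨h.1, h.2.trans_lt h1.2⟩

theorem lt_K₁_iff (hK : K ∈ Ioo m.K₀ m.KM) : K < m.K₁ ↔ m.cm K < m.c₀ := by
  obtain ⟨h1, h2, h3, h4⟩ := m.isK₁_K₁
  refine ⟨fun h => h2 K ⟨pos_of_mem hK, h⟩, fun h => ?_⟩
  by_contra hn
  rcases (not_lt.1 hn).eq_or_lt with he | hlt
  · rw [← he, h3] at h; exact lt_irrefl _ h
  · exact h.not_gt (h4 K ⟨hlt, hK.2⟩)

theorem ConditionC.conditionH (hC : m.ConditionC K) (h : m.cm K < m.c₀) : m.ConditionH := by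
  have := (lt_K₁_iff hC.mem).2 h
  rcases hC with h' | h'
  · exact absurd this h'.1.not_gt
  · exact h'.1

/-- For fixed `K > K₀` the segment `c = c₀` closes the open piece from above, and `K < K₁` is
equivalent to `c_m < c₀`. -/
theorem mem_D₂_iff (hK : K ∈ Ioo m.K₀ m.KM) : (K, c) ∈ m.D₂ ↔ m.cm K < c ∧ c ≤ m.c₀ := by
  have h0 := lt_K₁_iff hK
  constructor
  · rintro (⟨-, h1, h2⟩ | ⟨-, h1, h2, h3⟩)
    · have h1' : K < m.K₁ := h1
      have h2' : c = m.c₀ := h2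
      exact ⟨h2' ▸ h0.1 h1', h2'.le⟩
    · exact ⟨h2, le_of_lt h3⟩
  · rintro ⟨h1, h2⟩
    rcases h2.eq_or_lt with he | hlt
    · exact Or.inl ⟨hK.1, h0.2 (he ▸ h1), he⟩
    · exact Or.inr ⟨pos_of_mem hK, h0.2 (h1.trans hlt), h1, hlt⟩

theorem c₁_lt_cM (hK : K ∈ Ioo m.K₀ m.KM) : m.c₁ K < m.cM K := max_lt (c₀_lt_cM hK) (cm_lt_cM hK)

theorem exists_mid (hK : K ∈ Ioo m.K₀ m.KM) : ∃ x : ℝ → ℝ, ∀ c ∈ Ioo (m.c₁ K) (m.cM K),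
    (m.family hK).Root₃ (c / K) (m.u₁ K c) (x c) (m.u₂ K c) := by
  choose! x hx using fun c (h : c ∈ Ioo (m.c₁ K) (m.cM K)) => exists_root₃ hK h.1 h.2
  exact ⟨x, hx⟩

theorem exists_mid_mirror (hK : K ∈ Ioo m.K₀ m.KM) : ∃ x : ℝ → ℝ, ∀ c ∈ Ioo (m.cm K) (m.cM K),
    (m.family hK).mirror.Root (-(c / K)) (-m.u₂ K c) (x c) := by
  choose! x hx using fun c (h : c ∈ Ioo (m.cm K) (m.cM K)) => exists_root_mirror hK h.1 h.2
  exact ⟨x, hx⟩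

theorem tendsto_div (K : ℝ) {c : ℝ} {s : Set ℝ} : Tendsto (fun c => c / K) (𝓝[s] c) (𝓝 (c / K)) :=
  ((continuous_id.div_const K).tendsto c).mono_left nhdsWithin_le_nhds

theorem hasBack_iff (hK : K ∈ Ioo m.K₀ m.KM) (hc : c ∈ Ioo (m.c₁ K) (m.cM K)) :
    m.HasBack K c μ ↔ μ = (m.family hK).speed (c / K) (m.u₁ K c) (m.u₂ K c) := by
  obtain ⟨x, R⟩ := exists_root₃ hK hc.1 hc.2
  constructor
  · rintro ⟨u, w, h⟩
    exact (R.up_spec ((isBack_iff hK).1 h)).1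
  · rintro rfl
    obtain ⟨u, w, h⟩ := R.exists_up
    exact ⟨u, w, (isBack_iff hK).2 h⟩

theorem hasFront_iff (hK : K ∈ Ioo m.K₀ m.KM) (hc : c ∈ Ioo (m.c₁ K) (m.cM K)) :
    m.HasFront K c μ ↔ μ = -(m.family hK).rev.speed (c / K) (m.u₁ K c) (m.u₂ K c) := by
  obtain ⟨x, R⟩ := exists_root₃ hK hc.1 hc.2
  constructor
  · rintro ⟨u, w, h⟩
    exact (R.down_spec ((isFront_iff hK).1 h)).1
  · rintro rfl
    obtain ⟨u, w, h⟩ := R.exists_down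
    exact ⟨u, w, (isFront_iff hK).2 h⟩

theorem existsUnique_back (hK : K ∈ Ioo m.K₀ m.KM) (hc : c ∈ Ioo (m.c₁ K) (m.cM K)) :
    ∃! μ, m.HasBack K c μ :=
  ⟨_, (hasBack_iff hK hc).2 rfl, fun _ h => (hasBack_iff hK hc).1 h⟩

theorem existsUnique_front (hK : K ∈ Ioo m.K₀ m.KM) (hc : c ∈ Ioo (m.c₁ K) (m.cM K)) :
    ∃! μ, m.HasFront K c μ :=
  ⟨_, (hasFront_iff hK hc).2 rfl, fun _ h => (hasFront_iff hK hc).1 h⟩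

theorem hasBack_μb (hK : K ∈ Ioo m.K₀ m.KM) (hc : c ∈ Ioo (m.c₁ K) (m.cM K)) :
    m.HasBack K c (m.μb K c) := Classical.epsilon_spec (existsUnique_back hK hc).exists

theorem hasFront_μf (hK : K ∈ Ioo m.K₀ m.KM) (hc : c ∈ Ioo (m.c₁ K) (m.cM K)) :
    m.HasFront K c (m.μf K c) := Classical.epsilon_spec (existsUnique_front hK hc).exists

theorem μb_eq (hK : K ∈ Ioo m.K₀ m.KM) (hc : c ∈ Ioo (m.c₁ K) (m.cM K)) :
    m.μb K c = (m.family hK).speed (c / K) (m.u₁ K c) (m.u₂ K c) :=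
  (hasBack_iff hK hc).1 (hasBack_μb hK hc)

theorem μf_eq (hK : K ∈ Ioo m.K₀ m.KM) (hc : c ∈ Ioo (m.c₁ K) (m.cM K)) :
    m.μf K c = -(m.family hK).rev.speed (c / K) (m.u₁ K c) (m.u₂ K c) :=
  (hasFront_iff hK hc).1 (hasFront_μf hK hc)

theorem orbitUnique_back (hK : K ∈ Ioo m.K₀ m.KM) (hc : c ∈ Ioo (m.c₁ K) (m.cM K)) :
    OrbitUnique (m.IsBack K c μ) := by
  intro u w u' w' h h'
  obtain ⟨x, R⟩ := exists_root₃ hK hc.1 hc.2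
  rw [R.orbit_up ((isBack_iff hK).1 h), R.orbit_up ((isBack_iff hK).1 h')]

theorem orbitUnique_front (hK : K ∈ Ioo m.K₀ m.KM) (hc : c ∈ Ioo (m.c₁ K) (m.cM K)) :
    OrbitUnique (m.IsFront K c μ) := by
  intro u w u' w' h h'
  obtain ⟨x, R⟩ := exists_root₃ hK hc.1 hc.2
  rw [R.orbit_down ((isFront_iff hK).1 h), R.orbit_down ((isFront_iff hK).1 h')]

/-! ### The heteroclinic cycle -/

theorem strictMonoOn_μb (hK : K ∈ Ioo m.K₀ m.KM) :
    StrictMonoOn (m.μb K) (Ioo (m.c₁ K) (m.cM K)) := by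
  intro c hc c' hc' h
  obtain ⟨x, R⟩ := exists_root₃ hK hc.1 hc.2
  obtain ⟨x', R'⟩ := exists_root₃ hK hc'.1 hc'.2
  rw [μb_eq hK hc, μb_eq hK hc']
  exact R.speed_lt R' (div_lt_div_of_pos_right h (pos_of_mem hK))

theorem strictAntiOn_μf (hK : K ∈ Ioo m.K₀ m.KM) :
    StrictAntiOn (m.μf K) (Ioo (m.c₁ K) (m.cM K)) := by
  intro c hc c' hc' h
  obtain ⟨x, R⟩ := exists_root₃ hK hc.1 hc.2
  obtain ⟨x', R'⟩ := exists_root₃ hK hc'.1 hc'.2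
  rw [μf_eq hK hc, μf_eq hK hc']
  exact neg_lt_neg (R.rev.speed_lt R'.rev (div_lt_div_of_pos_right h (pos_of_mem hK)))

theorem continuousOn_μb (hK : K ∈ Ioo m.K₀ m.KM) :
    ContinuousOn (m.μb K) (Ioo (m.c₁ K) (m.cM K)) := by
  obtain ⟨x, hx⟩ := exists_mid hK
  intro c hc
  rw [ContinuousWithinAt, μb_eq hK hc]
  refine ((hx c hc).tendsto_speed (tendsto_div K) (A := m.u₁ K) (C := x) (S := m.u₂ K)
    (eventually_mem_nhdsWithin.mono hx)).congr' ?_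
  filter_upwards [self_mem_nhdsWithin] with y hy using (μb_eq hK hy).symm

theorem continuousOn_μf (hK : K ∈ Ioo m.K₀ m.KM) :
    ContinuousOn (m.μf K) (Ioo (m.c₁ K) (m.cM K)) := by
  obtain ⟨x, hx⟩ := exists_mid hK
  intro c hc
  rw [ContinuousWithinAt, μf_eq hK hc]
  refine ((hx c hc).rev.tendsto_speed (tendsto_div K) (A := m.u₁ K) (C := x) (S := m.u₂ K)
    (eventually_mem_nhdsWithin.mono fun c hc => (hx c hc).rev)).neg.congr' ?_
  filter_upwards [self_mem_nhdsWithin] with y hy using (μf_eq hK hy).symm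

/-- As `c → c_M` the left and the middle root merge, and the collapse estimate excludes nonnegative
values of both energies at `u₂`. -/
theorem eventually_μf_lt_μb (hK : K ∈ Ioo m.K₀ m.KM) :
    ∀ᶠ c in 𝓝[<] m.cM K, m.μf K c < m.μb K c := by
  obtain ⟨x, hx⟩ := exists_mid hK
  have hmem := Ioo_mem_nhdsLT (c₁_lt_cM hK)
  obtain ⟨s, hs⟩ := exists_between (m.family hK).M_lt_N
  filter_upwards [hmem, WaveFamily.eventually_collapse_M (T := fun c => c / K) (A := m.u₁ K) (C := x)
    (by rw [F_M]; exact tendsto_div K) (mem_of_superset hmem fun c hc => (hx c hc).toRoot) hs]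
    with c hc h
  rw [μb_eq hK hc, μf_eq hK hc]
  exact (hx c hc).speed_lt_of_not_nonneg fun ν hν =>
    h _ ν hν (hx c hc).adm (hs.2.trans (hx c hc).N_lt)

/-- In the mirror `u₂` is the left saddle and `μ_b`, `μ_f` exchange roles. If `c₀ ≤ c_m`, the right
and the middle root merge as `c → c_m`. Otherwise `c → c₀`, the root `u₁` tends to zero, and (H)
supplies the area needed for the collapse. -/
theorem eventually_μb_lt_μf (hC : m.ConditionC K) :
    ∀ᶠ c in 𝓝[>] m.c₁ K, m.μb K c < m.μf K c := by
  have hK := hC.mem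
  have h0 := pos_of_mem hK
  obtain ⟨x, hx⟩ := exists_mid hK
  have hmem := Ioo_mem_nhdsGT (c₁_lt_cM hK)
  have key : (∀ᶠ c in 𝓝[>] m.c₁ K, ∀ ν, |ν| ≤ (m.family hK).mirror.B →
      ¬ (0 ≤ (m.family hK).mirror.E (-(c / K)) ν (-m.u₂ K c) (-m.u₁ K c) (-m.u₁ K c) ∧
      0 ≤ (m.family hK).mirror.rev.E (-(c / K)) (-ν) (-m.u₂ K c) (-m.u₁ K c) (-m.u₁ K c))) →
      ∀ᶠ c in 𝓝[>] m.c₁ K, m.μb K c < m.μf K c := by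
    intro h
    filter_upwards [hmem, h] with c hc h
    have := (hx c hc).mirror.speed_lt_of_not_nonneg h
    rw [(hx c hc).speed_mirror, (hx c hc).speed_mirror_rev, neg_neg] at this
    rwa [μb_eq hK hc, μf_eq hK hc]
  refine key ?_
  have hR : ∀ᶠ c in 𝓝[>] m.c₁ K, (m.family hK).mirror.Root (-(c / K)) (-m.u₂ K c) (-x c) :=
    mem_of_superset hmem fun c hc => (hx c hc).mirror.toRoot
  rcases le_or_gt m.c₀ (m.cm K) with hle | hlt
  · have hc₁ : m.c₁ K = m.cm K := max_eq_right hle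
    obtain ⟨s, hs⟩ := exists_between (m.family hK).mirror.M_lt_N
    have hT : Tendsto (fun c => -(c / K)) (𝓝[>] m.c₁ K)
        (𝓝 ((m.family hK).mirror.F (m.family hK).mirror.M)) := by
      have : (m.family hK).mirror.F (m.family hK).mirror.M = -(m.c₁ K / K) := by
        rw [hc₁, ← F_N hK]; simp only [WaveFamily.mirror, neg_neg]
      rw [this]
      exact (tendsto_div K).neg
    filter_upwards [hmem, WaveFamily.eventually_collapse_M hT hR hs] with c hc h ν hν
    exact h _ ν hν (hx c hc).mirror.adm (hs.2.trans (hx c hc).mirror.N_lt)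
  · have hc₁ : m.c₁ K = m.c₀ := max_eq_left hlt.le
    have hH := hC.conditionH hlt
    obtain ⟨s', hs', hNs', hdiv⟩ := mirror_area hK hH (le_refl m.c₀)
    obtain ⟨y, hy⟩ := exists_root_mirror hK hlt (c₀_lt_cM hK)
    have hT : Tendsto (fun c => -(c / K)) (𝓝[>] m.c₁ K) (𝓝 (-(m.c₀ / K))) := by
      rw [hc₁]; exact (tendsto_div K).neg
    have hA := WaveFamily.tendsto_left_root hy.left_mem hy.left_lt.le hy.left_eq hT hR
    have hu0 : -m.u₂ K m.c₀ < 0 := by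
      have : 0 < - -m.u₂ K m.c₀ := hy.left_mem
      linarith
    have hxI : -m.u₂ K m.c₀ - 1 ∈ (m.family hK).mirror.I := by
      show 0 < -(-m.u₂ K m.c₀ - 1)
      linarith
    obtain ⟨s, hs, hss, hev⟩ := WaveFamily.eventually_collapse_of_integral hT hxI hs'
      (by linarith [hy.left_lt, (m.family hK).mirror.M_lt_N])
      (hA.eventually (le_mem_nhds (sub_one_lt _))) (hR.mono fun c hc => (hc.lt_N.trans hNs').le)
      hdiv
    have hs0 : 0 < -s := hs
    have hsM : -s < m.uM K := by
      have : -m.uM K < s' := hNs'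
      linarith
    have hFs : m.c₀ / K < (m.family hK).F (-s) := by
      rw [← F_zero hK]
      exact strictMonoOn_F hK ⟨le_rfl, (hs0.trans hsM).le⟩ ⟨hs0.le, hsM.le⟩ hs0
    -- This forces `u₁ < -s`, so the mirrored right end `-u₁` lies beyond `s`.
    have hTs : ∀ᶠ c in 𝓝[>] m.c₁ K, c / K < (m.family hK).F (-s) := by
      rw [hc₁]; exact (tendsto_div K).eventually (gt_mem_nhds hFs)
    filter_upwards [hmem, hev, hTs] with c hc h hcs ν hν
    refine h _ ν hν (hx c hc).mirror.adm ?_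
    rw [← (hx c hc).left_eq] at hcs
    have := ((m.family hK).strictMonoOn_left.lt_iff_lt ⟨(hx c hc).left_mem, (hx c hc).left_lt.le⟩
      ⟨hs0, hsM.le⟩).1 hcs
    linarith

/-- The difference `μ_b - μ_f` is continuous and strictly increasing in `c`, negative near `c₁` and
positive near `c_M`. -/
theorem existsUnique_isCStar (hC : m.ConditionC K) : ∃! c, m.IsCStar K c := by
  have hK := hC.mem
  obtain ⟨c, hc, hcI⟩ := ((eventually_μb_lt_μf hC).and (Ioo_mem_nhdsGT (c₁_lt_cM hK))).exists
  obtain ⟨c', hc', hcI'⟩ := ((eventually_μf_lt_μb hK).and (Ioo_mem_nhdsLT (c₁_lt_cM hK))).exists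
  obtain ⟨y, hy, hy0⟩ := isPreconnected_Ioo.intermediate_value hcI hcI'
    ((continuousOn_μb hK).sub (continuousOn_μf hK))
    (show (0 : ℝ) ∈ Icc _ _ from ⟨sub_nonpos.2 hc.le, sub_nonneg.2 hc'.le⟩)
  refine ⟨y, ⟨hy, sub_eq_zero.1 hy0⟩, fun z hz => ?_⟩
  have hmono : StrictMonoOn (fun c => m.μb K c - m.μf K c) (Ioo (m.c₁ K) (m.cM K)) :=
    fun a ha b hb hab => by
      have h1 := strictMonoOn_μb hK ha hb hab
      have h2 := strictAntiOn_μf hK ha hb hab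
      show m.μb K a - m.μf K a < m.μb K b - m.μf K b
      linarith
  exact hmono.injOn hz.1 hy ((sub_eq_zero.2 hz.2).trans hy0.symm)

theorem isCStar_cStar (hC : m.ConditionC K) : m.IsCStar K (m.cStar K) :=
  Classical.epsilon_spec (existsUnique_isCStar hC).exists

theorem μf_lt_μb (hC : m.ConditionC K) (h1 : m.cStar K < c) (h2 : c < m.cM K) :
    m.μf K c < m.μb K c := by
  obtain ⟨h3, h4⟩ := isCStar_cStar hC
  have hc : c ∈ Ioo (m.c₁ K) (m.cM K) := ⟨h3.1.trans h1, h2⟩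
  have h5 := strictMonoOn_μb hC.mem h3 hc h1
  have h6 := strictAntiOn_μf hC.mem h3 hc h1
  linarith

theorem μb_lt_μf (hC : m.ConditionC K) (h1 : m.c₁ K < c) (h2 : c < m.cStar K) :
    m.μb K c < m.μf K c := by
  obtain ⟨h3, h4⟩ := isCStar_cStar hC
  have hc : c ∈ Ioo (m.c₁ K) (m.cM K) := ⟨h1, h2.trans h3.2⟩
  have h5 := strictMonoOn_μb hC.mem hc h3 h2
  have h6 := strictAntiOn_μf hC.mem hc h3 h2
  linarith

/-! ### Pulses at the left saddle -/

theorem existsUnique_pulse₁ (hC : m.ConditionC K) (h1 : m.cStar K < c) (h2 : c < m.cM K) :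
    ∃! μ, m.HasPulse K c μ (m.u₁ K c) := by
  have hK := hC.mem
  have hc : c ∈ Ioo (m.c₁ K) (m.cM K) := ⟨(isCStar_cStar hC).1.1.trans h1, h2⟩
  obtain ⟨x, R⟩ := exists_root₃ hK hc.1 hc.2
  have h := μf_lt_μb hC h1 h2
  rw [μb_eq hK hc, μf_eq hK hc] at h
  obtain ⟨μ, u, w, hh⟩ := R.exists_hom h
  refine ⟨μ, ⟨u, w, (isPulse_iff hK).2 hh⟩, ?_⟩
  rintro μ' ⟨u', w', h'⟩
  have h' := (isPulse_iff hK).1 h'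
  exact R.adm.hom_unique h' (R.hom_lt h') hh (R.hom_lt hh)

theorem orbitUnique_pulse₁ (hK : K ∈ Ioo m.K₀ m.KM) (hc : c ∈ Ioo (m.c₁ K) (m.cM K)) :
    OrbitUnique (m.IsPulse K c μ (m.u₁ K c)) := by
  intro u w u' w' h h'
  obtain ⟨x, R⟩ := exists_root₃ hK hc.1 hc.2
  have h := (isPulse_iff hK).1 h
  have h' := (isPulse_iff hK).1 h'
  exact R.adm.hom_orbit_unique h (R.hom_lt h) h' (R.hom_lt h')

/-! ### Pulses at the right saddle -/

/-- Two pulses at the right saddle have a common admissible bound in the mirror. -/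
theorem exists_bound_mirror (hK : K ∈ Ioo m.K₀ m.KM) (h1 : m.cm K < c) (h2 : c < m.cM K)
    (h : (m.family hK).mirror.IsHom (-(c / K)) μ (-m.u₂ K c) u w)
    (h' : (m.family hK).mirror.IsHom (-(c / K)) μ' (-m.u₂ K c) u' w') {x : ℝ}
    (R : (m.family hK).mirror.Root (-(c / K)) (-m.u₂ K c) x) :
    ∃ β ≥ (m.family hK).mirror.N, (m.family hK).mirror.Adm (-(c / K)) (-m.u₂ K c) x β ∧
      (∀ z, u z < β) ∧ ∀ z, u' z < β := by
  rcases lt_or_ge m.c₀ c with hc | hc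
  · obtain ⟨y, R₃⟩ := exists_root₃ hK (max_lt hc h1) h2
    have R₃ := R₃.mirror
    rw [(R.unique R₃.toRoot).2]
    exact ⟨_, R₃.N_lt.le, R₃.adm, R₃.hom_lt h, R₃.hom_lt h'⟩
  -- For `c ≤ c₀` there is no left root: `F > c / K` on the whole of `(0, u₀)`. In the mirror every
  -- point of the domain beyond the middle root is an admissible right end, and one beyond both
  -- solutions can be chosen.
  · have hF : ∀ y ∈ (m.family hK).mirror.I, x < y → (m.family hK).mirror.F y < -(c / K) := by
      intro y hy hxy
      have hy0 : 0 < -y := hy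
      refine neg_lt_neg ?_
      show c / K < (m.family hK).F (-y)
      rcases le_or_gt (-y) (m.uM K) with hle | hlt
      · refine lt_of_le_of_lt ?_ (strictMonoOn_F hK ⟨le_rfl, hy0.le.trans hle⟩ ⟨hy0.le, hle⟩ hy0)
        rw [F_zero]
        exact div_le_div_of_nonneg_right hc (pos_of_mem hK).le
      · have hx1 : -m.um K < x := R.M_lt
        have hx2 : x < -m.uM K := R.lt_N
        have hxc : (m.family hK).F (-x) = c / K := neg_injective R.mid_eq
        rw [← hxc]
        exact (m.family hK).strictAntiOn_mid ⟨hlt.le, show -y ≤ m.um K by linarith⟩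
          ⟨show m.uM K ≤ -x by linarith, show -x ≤ m.um K by linarith⟩ (neg_lt_neg hxy)
    obtain ⟨β₁, hβ₁, A₁, hu₁⟩ := h.exists_bound R hF _ (m.family hK).mirror.N_mem
    obtain ⟨β, hβ, A, hu⟩ := h'.exists_bound R hF β₁ A₁.right_mem
    exact ⟨β, hβ₁.trans hβ, A, fun z => (hu₁ z).trans_le hβ, hu⟩

theorem isHom_mirror (hK : K ∈ Ioo m.K₀ m.KM) {a : ℝ} (h : m.IsPulse K c μ a u w) :
    (m.family hK).mirror.IsHom (-(c / K)) μ (-a) (fun z => -u z) (fun z => -w z) :=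
  ((isPulse_iff hK).1 h).mirror

theorem mirror_mirror (P : WaveFamily) : P.mirror.mirror = P := by
  simp only [WaveFamily.mirror, neg_neg]

/-- For `c > c₀` this is the mirrored three-root case with `μ_b < μ_f`. For `c ≤ c₀` no third root
bounds the orbit, and the infinite area near `u = 0` excludes a nonnegative common value instead. -/
theorem exists_pulse₂ (hC : m.ConditionC K) (h1 : m.cm K < c) (h2 : c < m.cStar K) :
    ∃ μ, m.HasPulse K c μ (m.u₂ K c) := by
  have hK := hC.mem
  have h3 : c < m.cM K := h2.trans (isCStar_cStar hC).1.2
  have key : (∃ μ u w, (m.family hK).mirror.IsHom (-(c / K)) μ (-m.u₂ K c) u w) →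
      ∃ μ, m.HasPulse K c μ (m.u₂ K c) := by
    rintro ⟨μ, u, w, h⟩
    have := h.mirror
    rw [mirror_mirror, neg_neg, neg_neg] at this
    exact ⟨μ, _, _, (isPulse_iff hK).2 this⟩
  refine key ?_
  rcases lt_or_ge m.c₀ c with hc | hc
  · have hc' : c ∈ Ioo (m.c₁ K) (m.cM K) := ⟨max_lt hc h1, h3⟩
    obtain ⟨x, R⟩ := exists_root₃ hK hc'.1 hc'.2
    have h := μb_lt_μf hC hc'.1 h2
    rw [μb_eq hK hc', μf_eq hK hc'] at h
    refine R.mirror.exists_hom ?_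
    rwa [R.speed_mirror, R.speed_mirror_rev, neg_neg]
  · have hH := hC.conditionH (h1.trans_le hc)
    obtain ⟨x, R⟩ := exists_root_mirror hK h1 h3
    obtain ⟨s', hs', hNs', hdiv⟩ := mirror_area hK hH hc
    -- The collapse is needed at a single level only, hence the one-point filter. The right end used
    -- below is `s / 2`, between `s < 0` and the boundary `0` of the mirrored domain.
    obtain ⟨s, hs, hss, hev⟩ := WaveFamily.eventually_collapse_of_integral (l := pure ())
      (T := fun _ => -(c / K)) (A := fun _ => -m.u₂ K c) (C := fun _ => x) tendsto_const_nhds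
      R.left_mem hs' (by linarith [R.left_lt, (m.family hK).mirror.M_lt_N])
      (Eventually.of_forall fun _ => le_rfl) (Eventually.of_forall fun _ => (R.lt_N.trans hNs').le)
      hdiv
    have hev := (eventually_pure.1 hev)
    have hs0 : 0 < -s := hs
    have hβI : s / 2 ∈ (m.family hK).mirror.I := by
      show 0 < -(s / 2)
      linarith
    have hxs : x < s := R.lt_N.trans (hNs'.trans hss)
    have hA : (m.family hK).mirror.Adm (-(c / K)) (-m.u₂ K c) x (s / 2) := by
      refine ⟨R, by linarith, hβI, fun y hy => ?_⟩
      have hy0 : 0 < -y := by linarith [hy.2]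
      refine neg_lt_neg ?_
      show c / K < (m.family hK).F (-y)
      rcases le_or_gt (-y) (m.uM K) with hle | hlt
      · refine lt_of_le_of_lt ?_ (strictMonoOn_F hK ⟨le_rfl, hy0.le.trans hle⟩ ⟨hy0.le, hle⟩ hy0)
        rw [F_zero]
        exact div_le_div_of_nonneg_right hc (pos_of_mem hK).le
      · have hx1 : -m.um K < x := R.M_lt
        have hx2 : x < -m.uM K := R.lt_N
        have hxy := hy.1
        have hxc : (m.family hK).F (-x) = c / K := neg_injective R.mid_eq
        rw [← hxc]
        exact (m.family hK).strictAntiOn_mid ⟨hlt.le, show -y ≤ m.um K by linarith⟩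
          ⟨show m.uM K ≤ -x by linarith, show -x ≤ m.um K by linarith⟩ (neg_lt_neg hxy)
    exact hA.exists_hom_of_not_nonneg fun ν hν => hev _ ν hν hA (by linarith)

theorem existsUnique_pulse₂ (hC : m.ConditionC K) (h1 : m.cm K < c) (h2 : c < m.cStar K) :
    ∃! μ, m.HasPulse K c μ (m.u₂ K c) := by
  have hK := hC.mem
  have h3 : c < m.cM K := h2.trans (isCStar_cStar hC).1.2
  refine existsUnique_of_exists_of_unique (exists_pulse₂ hC h1 h2) ?_
  rintro μ μ' ⟨u, w, h⟩ ⟨u', w', h'⟩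
  obtain ⟨x, R⟩ := exists_root_mirror hK h1 h3
  obtain ⟨β, -, A, hu, hu'⟩ := exists_bound_mirror hK h1 h3 (isHom_mirror hK h) (isHom_mirror hK h') R
  exact A.hom_unique (isHom_mirror hK h) hu (isHom_mirror hK h') hu'

theorem orbitUnique_pulse₂ (hK : K ∈ Ioo m.K₀ m.KM) (h1 : m.cm K < c) (h2 : c < m.cM K) :
    OrbitUnique (m.IsPulse K c μ (m.u₂ K c)) := by
  intro u w u' w' h h'
  obtain ⟨x, R⟩ := exists_root_mirror hK h1 h2
  obtain ⟨β, -, A, hu, hu'⟩ := exists_bound_mirror hK h1 h2 (isHom_mirror hK h) (isHom_mirror hK h') R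
  have := A.hom_orbit_unique (isHom_mirror hK h) hu (isHom_mirror hK h') hu'
  rw [orbit_neg, orbit_neg] at this
  exact (neg_injective.image_injective) this

/-! ### Limits -/

theorem isPulse₁_epsilon (hC : m.ConditionC K) (h1 : m.cStar K < c) (h2 : c < m.cM K) :
    m.IsPulse K c (m.μPul₁ K c) (m.u₁ K c)
      (Classical.epsilon fun s : (ℝ → ℝ) × (ℝ → ℝ) =>
        m.IsPulse K c (m.μPul₁ K c) (m.u₁ K c) s.1 s.2).1
      (Classical.epsilon fun s : (ℝ → ℝ) × (ℝ → ℝ) =>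
        m.IsPulse K c (m.μPul₁ K c) (m.u₁ K c) s.1 s.2).2 := by
  obtain ⟨u, w, h⟩ : m.HasPulse K c (m.μPul₁ K c) (m.u₁ K c) :=
    Classical.epsilon_spec (existsUnique_pulse₁ hC h1 h2).exists
  exact Classical.epsilon_spec (p := fun s : (ℝ → ℝ) × (ℝ → ℝ) =>
    m.IsPulse K c (m.μPul₁ K c) (m.u₁ K c) s.1 s.2) ⟨(u, w), h⟩

theorem isPulse₂_epsilon (hC : m.ConditionC K) (h1 : m.cm K < c) (h2 : c < m.cStar K) :
    m.IsPulse K c (m.μPul₂ K c) (m.u₂ K c)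
      (Classical.epsilon fun s : (ℝ → ℝ) × (ℝ → ℝ) =>
        m.IsPulse K c (m.μPul₂ K c) (m.u₂ K c) s.1 s.2).1
      (Classical.epsilon fun s : (ℝ → ℝ) × (ℝ → ℝ) =>
        m.IsPulse K c (m.μPul₂ K c) (m.u₂ K c) s.1 s.2).2 := by
  obtain ⟨u, w, h⟩ : m.HasPulse K c (m.μPul₂ K c) (m.u₂ K c) :=
    Classical.epsilon_spec (existsUnique_pulse₂ hC h1 h2).exists
  exact Classical.epsilon_spec (p := fun s : (ℝ → ℝ) × (ℝ → ℝ) =>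
    m.IsPulse K c (m.μPul₂ K c) (m.u₂ K c) s.1 s.2) ⟨(u, w), h⟩

/-- The two heteroclinic orbits at `(c_*, μ_*)`. -/
theorem exists_orbitStar (hC : m.ConditionC K) : ∃ u w u' w' : ℝ → ℝ,
    m.IsBack K (m.cStar K) (m.μStar K) u w ∧ m.IsFront K (m.cStar K) (m.μStar K) u' w' ∧
      m.orbitStar K = orbit (u, w) ∪ orbit (u', w') := by
  obtain ⟨h1, h2⟩ := isCStar_cStar hC
  obtain ⟨u, w, h⟩ : m.HasBack K (m.cStar K) (m.μStar K) := hasBack_μb hC.mem h1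
  obtain ⟨u', w', h'⟩ : m.HasFront K (m.cStar K) (m.μStar K) := by
    rw [μStar, h2]; exact hasFront_μf hC.mem h1
  have e1 := Classical.epsilon_spec (p := fun s : (ℝ → ℝ) × (ℝ → ℝ) =>
    m.IsBack K (m.cStar K) (m.μStar K) s.1 s.2) ⟨(u, w), h⟩
  have e2 := Classical.epsilon_spec (p := fun s : (ℝ → ℝ) × (ℝ → ℝ) =>
    m.IsFront K (m.cStar K) (m.μStar K) s.1 s.2) ⟨(u', w'), h'⟩
  exact ⟨_, _, _, _, e1, e2, rfl⟩

theorem tendsto_pulse₁_cStar (hC : m.ConditionC K) :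
    Tendsto (m.μPul₁ K) (𝓝[>] m.cStar K) (𝓝 (m.μStar K)) ∧
      SetTendsto (m.orbitPul₁ K) (𝓝[>] m.cStar K) (m.orbitStar K) := by
  have hK := hC.mem
  have hs := (isCStar_cStar hC).1
  obtain ⟨x, hx⟩ := exists_mid hK
  obtain ⟨u, w, u', w', h1, h2, h3⟩ := exists_orbitStar hC
  have hmem := Ioo_mem_nhdsGT hs.2
  have := (hx _ hs).tendsto_hom_cycle ((isBack_iff hK).1 h1) ((isFront_iff hK).1 h2)
    (tendsto_div K) (l := 𝓝[>] m.cStar K)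
    (mem_of_superset hmem fun c hc => div_lt_div_of_pos_right hc.1 (pos_of_mem hK))
    (mem_of_superset hmem fun c hc => hx c ⟨hs.1.trans hc.1, hc.2⟩)
    (mem_of_superset hmem fun c hc => (isPulse_iff hK).1 (isPulse₁_epsilon hC hc.1 hc.2))
  rw [← h3] at this
  exact this

/-- In the mirror the level `-c / K` approaches its limit from above as `c` increases to `c_*`, and
the front becomes the increasing connection. The reflection of the plane is an isometry, so
Hausdorff distances carry over. -/
theorem tendsto_pulse₂_cStar (hC : m.ConditionC K) :
    Tendsto (m.μPul₂ K) (𝓝[<] m.cStar K) (𝓝 (m.μStar K)) ∧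
      SetTendsto (m.orbitPul₂ K) (𝓝[<] m.cStar K) (m.orbitStar K) := by
  have hK := hC.mem
  have hs := (isCStar_cStar hC).1
  obtain ⟨x, hx⟩ := exists_mid hK
  obtain ⟨u, w, u', w', h1, h2, h3⟩ := exists_orbitStar hC
  have hmem := Ioo_mem_nhdsLT hs.1
  have := (hx _ hs).mirror.tendsto_hom_cycle ((isFront_iff hK).1 h2).mirror
    ((isBack_iff hK).1 h1).mirror (tendsto_div K).neg (l := 𝓝[<] m.cStar K)
    (mem_of_superset hmem fun c hc => neg_lt_neg (div_lt_div_of_pos_right hc.2 (pos_of_mem hK)))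
    (mem_of_superset hmem fun c hc => (hx c ⟨hc.1, hc.2.trans hs.2⟩).mirror)
    (mem_of_superset hmem fun c hc =>
      isHom_mirror hK (isPulse₂_epsilon hC ((le_max_right _ _).trans_lt hc.1) hc.2))
  refine ⟨this.1, ?_⟩
  have h4 := this.2
  simp only [orbit_neg] at h4
  rw [← image_union, union_comm, ← h3] at h4
  simp only [hausdorffEDist_neg] at h4
  exact h4

theorem tendsto_pulse₁_cM (hC : m.ConditionC K) :
    Tendsto (m.μPul₁ K) (𝓝[<] m.cM K) (𝓝 0) ∧
      SetTendsto (m.orbitPul₁ K) (𝓝[<] m.cM K) {!₂[m.uM K, 0]} := by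
  have hK := hC.mem
  have hs := (isCStar_cStar hC).1
  obtain ⟨x, hx⟩ := exists_mid hK
  have hmem := Ioo_mem_nhdsLT hs.2
  refine WaveFamily.tendsto_hom_M (P := m.family hK) (l := 𝓝[<] m.cM K) (T := fun c => c / K)
    (A := m.u₁ K) (C := x) (by rw [F_M]; exact tendsto_div K)
    (mem_of_superset hmem fun c hc => (hx c ⟨hs.1.trans hc.1, hc.2⟩).toRoot)
    (mem_of_superset hmem fun c hc => ?_)
  have R := hx c ⟨hs.1.trans hc.1, hc.2⟩
  have h := (isPulse_iff hK).1 (isPulse₁_epsilon hC hc.1 hc.2)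
  exact ⟨_, R.N_lt.le, R.adm, h, R.hom_lt h⟩

/-- This is the shrinking of pulses at a fold for the mirrored family, whose left fold is `-u_m`. -/
theorem tendsto_pulse₂_cm (hC : m.ConditionC K) :
    Tendsto (m.μPul₂ K) (𝓝[>] m.cm K) (𝓝 0) ∧
      SetTendsto (m.orbitPul₂ K) (𝓝[>] m.cm K) {!₂[m.um K, 0]} := by
  have hK := hC.mem
  have hs := (isCStar_cStar hC).1
  obtain ⟨x, hx⟩ := exists_mid_mirror hK
  have hmem := Ioo_mem_nhdsGT ((le_max_right m.c₀ (m.cm K)).trans_lt hs.1)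
  have hT : Tendsto (fun c => -(c / K)) (𝓝[>] m.cm K)
      (𝓝 ((m.family hK).mirror.F (m.family hK).mirror.M)) := by
    have : (m.family hK).mirror.F (m.family hK).mirror.M = -(m.cm K / K) := by
      rw [← F_N hK]; simp only [WaveFamily.mirror, neg_neg]
    rw [this]
    exact (tendsto_div K).neg
  have := WaveFamily.tendsto_hom_M hT
    (mem_of_superset hmem fun c hc => hx c ⟨hc.1, hc.2.trans hs.2⟩)
    (mem_of_superset hmem fun c hc => by
      have h := isHom_mirror hK (isPulse₂_epsilon hC hc.1 hc.2)
      obtain ⟨β, h1, h2, h3, -⟩ := exists_bound_mirror hK hc.1 (hc.2.trans hs.2) h h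
        (hx c ⟨hc.1, hc.2.trans hs.2⟩)
      exact ⟨β, h1, h2, h, h3⟩)
  refine ⟨this.1, ?_⟩
  have h4 := this.2
  have e : ({!₂[(m.family hK).mirror.M, 0]} : Set (EuclideanSpace ℝ (Fin 2))) =
      (fun q => -q) '' {!₂[m.um K, 0]} := by
    rw [image_singleton]
    congr 1
    ext i
    fin_cases i <;> simp [WaveFamily.mirror, family]
  rw [e] at h4
  simp only [orbit_neg, hausdorffEDist_neg] at h4
  exact h4

end TrafficModel

theorem proposition6p1 (m : TrafficModel) (K : ℝ) (hC : m.ConditionC K) :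
    -- the parameters `μ_b`, `μ_f`, `c_*`, `μ¹_pul`, `μ²_pul` and the orbits are well defined
    ((∀ c : ℝ, (K, c) ∈ m.D₁ → (∃! μ, m.HasBack K c μ) ∧ (∃! μ, m.HasFront K c μ) ∧
        TrafficModel.OrbitUnique (m.IsBack K c (m.μb K c)) ∧
        TrafficModel.OrbitUnique (m.IsFront K c (m.μf K c))) ∧
      (∃! c, m.IsCStar K c) ∧
      (∀ c : ℝ, (K, c) ∈ m.D₁₁ → (∃! μ, m.HasPulse K c μ (m.u₁ K c)) ∧
        TrafficModel.OrbitUnique (m.IsPulse K c (m.μPul₁ K c) (m.u₁ K c))) ∧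
      (∀ c : ℝ, (K, c) ∈ m.D₁₂ ∪ m.D₂ → (∃! μ, m.HasPulse K c μ (m.u₂ K c)) ∧
        TrafficModel.OrbitUnique (m.IsPulse K c (m.μPul₂ K c) (m.u₂ K c)))) ∧
    -- `c → c_*`
    ((Tendsto (m.μPul₁ K) (𝓝[>] m.cStar K) (𝓝 (m.μStar K)) ∧
        TrafficModel.SetTendsto (m.orbitPul₁ K) (𝓝[>] m.cStar K) (m.orbitStar K)) ∧
      (Tendsto (m.μPul₂ K) (𝓝[<] m.cStar K) (𝓝 (m.μStar K)) ∧
        TrafficModel.SetTendsto (m.orbitPul₂ K) (𝓝[<] m.cStar K) (m.orbitStar K))) ∧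
    -- `c → c_M`
    (Tendsto (m.μPul₁ K) (𝓝[<] m.cM K) (𝓝 0) ∧
      TrafficModel.SetTendsto (m.orbitPul₁ K) (𝓝[<] m.cM K) {!₂[m.uM K, 0]}) ∧
    -- `c → c_m`
    (Tendsto (m.μPul₂ K) (𝓝[>] m.cm K) (𝓝 0) ∧
      TrafficModel.SetTendsto (m.orbitPul₂ K) (𝓝[>] m.cm K) {!₂[m.um K, 0]}) := by
  have hK := hC.mem
  have hs := (TrafficModel.isCStar_cStar hC).1
  refine ⟨⟨fun c hc => ?_, TrafficModel.existsUnique_isCStar hC, fun c hc => ?_, fun c hc => ?_⟩,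
    ⟨TrafficModel.tendsto_pulse₁_cStar hC, TrafficModel.tendsto_pulse₂_cStar hC⟩,
    TrafficModel.tendsto_pulse₁_cM hC, TrafficModel.tendsto_pulse₂_cm hC⟩
  · have hc := (TrafficModel.mem_D₁_iff hK).1 hc
    exact ⟨TrafficModel.existsUnique_back hK hc, TrafficModel.existsUnique_front hK hc,
      TrafficModel.orbitUnique_back hK hc, TrafficModel.orbitUnique_front hK hc⟩
  · obtain ⟨h1, h2, h3⟩ := hc
    exact ⟨TrafficModel.existsUnique_pulse₁ hC h2 h3,
      TrafficModel.orbitUnique_pulse₁ hK ((TrafficModel.mem_D₁_iff hK).1 h1)⟩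
  -- Both regions lie in the range `c_m < c < c_*`, which the pulse lemmas at `u₂` treat uniformly.
  · have h : m.cm K < c ∧ c < m.cStar K := by
      rcases hc with ⟨-, h2, h3⟩ | h
      · exact ⟨(le_max_right _ _).trans_lt h2, h3⟩
      · obtain ⟨h1, h2⟩ := (TrafficModel.mem_D₂_iff hK).1 h
        exact ⟨h1, h2.trans_lt ((le_max_left _ _).trans_lt hs.1)⟩
    exact ⟨TrafficModel.existsUnique_pulse₂ hC h.1 h.2,
      TrafficModel.orbitUnique_pulse₂ hK h.1 (h.2.trans hs.2)⟩
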